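/- Let $n\ge 2$. Let $h$ be the Hermitian form $|v_1|^2+\dots+|v_n|^2-|v_{n+1}|^2$ on $\mathbb C^{n+1}$, let $\mathbb H^n_{\mathbb C}$ be complex hyperbolic space, i.e. the set of $h$-negative lines (the unit ball of $\mathbb C^n$), with its $\mathrm{SU}(n,1)$-invariant Kähler form $\omega$ of holomorphic sectional curvature $-1$, and let $\mathcal G$ be the space of complex geodesics of $\mathbb H^n_{\mathbb C}$, i.e. the open set of the Grassmannian of complex $2$-planes of $\mathbb C^{n+1}$ formed by the planes that contain an $h$-negative vector. For a discrete torsion-free subgroup $\Gamma\subset\mathrm{SU}(n,1)$ let $X=\Gamma\backslash\mathbb H^n_{\mathbb C}$, let $\pi:\mathbb PT_X\to X$ be its projectivized (holomorphic) tangent bundle, and let $\mathcal T$ be the tautological foliation of $\mathbb PT_X=\Gamma\backslash\mathbb PT_{\mathbb H^n_{\mathbb C}}$ by complex curves, whose leaves are the images of the fibers of the map $\mathbb PT_{\mathbb H^n_{\mathbb C}}\to\mathcal G$ sending a tangent line to the complex geodesic tangent to it. (1) $\mathcal G$ admits an $\mathrm{SU}(n,1)$-invariant Kähler form $\omega_{\mathcal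 G}$ that is non-degenerate but indefinite (a smooth closed real $(1,1)$-form, non-degenerate at every point, such that $\omega_{\mathcal G}(A,iA)$ takes both signs on every tangent space). Every $\mathrm{SU}(n,1)$-invariant non-degenerate, possibly indefinite, Kähler form on $\mathcal G$ is a non-zero real multiple of $\omega_{\mathcal G}$. (2) There is a constant $a>0$ depending only on $n$ and on the choice of $\omega_{\mathcal G}$ such that the measure $\mu_{\mathcal G}$ on $\mathcal G$ with density $a\,|\omega_{\mathcal G}^{2n-2}|$ has the following properties. It is $\mathrm{SU}(n,1)$-invariant, and for every $\Gamma$ as above it defines a locally finite invariant transverse measure without atoms for the foliation $\mathcal T$ on $\mathbb PT_X$: on the space of plaques of an open set of $\mathbb PT_X$ that is regular for $\mathcal T$, lifted to $\mathbb PT_{\mathbb H^n_{\mathbb C}}$ and so seen as a subset of $\mathcal G$, it is the restriction of $\mu_{\mathcal G}$. The associated current of integration $$\int_{\mathcal T,\mu_{\mathcal G}}\alpha=\sum_i\int_{T_i}\Big(\int_t\chi_i\alpha\Big)\,d\mu_{\mathcal G}(t),$$ where $(\chi_i)$ is a partition of unity subordinate to a covering of $\mathbb PT_X$ by regular open sets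 $U_i$ and $T_i$ is the space of plaques of $U_i$, satisfies $$\int_{\mathcal T,\mu_{\mathcal G}}\pi^\star\beta=\frac1{n!}\int_X\beta\wedge\omega^{n-1}$$ for every smooth compactly supported real $2$-form $\beta$ on $X$, whatever the covering and the partition of unity. -/

import Mathlib

open scoped LinearAlgebra.Projectivization

noncomputable section

namespace CHyp

/-- The space `ℂ^{n+1} = ℂ^n ⊕ ℂ`. -/
abbrev V (n : ℕ) : Type := Fin n ⊕ Unit → ℂ

/-- The matrix `I_{n,1} = diag(1, …, 1, -1)` of the Hermitian form `h`. -/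
def formMatrix (n : ℕ) : Matrix (Fin n ⊕ Unit) (Fin n ⊕ Unit) ℂ :=
  Matrix.diagonal (Sum.elim (fun _ => 1) (fun _ => -1))

/-- The quadratic form `h(v, v) = |v_1|² + … + |v_n|² - |v_{n+1}|²`. -/
def q {n : ℕ} (v : V n) : ℝ := ∑ i, ‖v (Sum.inl i)‖ ^ 2 - ‖v (Sum.inr ())‖ ^ 2

/-- `SU(n,1) = {M ∈ SL(n+1, ℂ) | M^* I_{n,1} M = I_{n,1}}`. -/
def SU (n : ℕ) : Subgroup (Matrix.SpecialLinearGroup (Fin n ⊕ Unit) ℂ) where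
  carrier := {M | (M : Matrix _ _ ℂ).conjTranspose * formMatrix n * (M : Matrix _ _ ℂ)
    = formMatrix n}
  one_mem' := by simp
  mul_mem' := by
    intro a b ha hb
    simp only [Set.mem_ofPred_eq, Matrix.SpecialLinearGroup.coe_mul,
      Matrix.conjTranspose_mul] at *
    calc _ = (b : Matrix _ _ ℂ).conjTranspose *
          ((a : Matrix _ _ ℂ).conjTranspose * formMatrix n * (a : Matrix _ _ ℂ)) *
          (b : Matrix _ _ ℂ) := by simp only [Matrix.mul_assoc]
      _ = _ := by rw [ha, hb]
  inv_mem' := by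
    intro a ha
    simp only [Set.mem_ofPred_eq] at *
    set A : Matrix (Fin n ⊕ Unit) (Fin n ⊕ Unit) ℂ := a.1 with hA
    set B : Matrix (Fin n ⊕ Unit) (Fin n ⊕ Unit) ℂ := (a⁻¹).1 with hB
    have h1 : A * B = 1 := by
      rw [hA, hB, ← Matrix.SpecialLinearGroup.coe_mul]; simp
    have h2 : B.conjTranspose * A.conjTranspose = 1 := by
      rw [← Matrix.conjTranspose_mul, h1, Matrix.conjTranspose_one]
    calc B.conjTranspose * formMatrix n * B
        = B.conjTranspose * (A.conjTranspose * formMatrix n * A) * B := by rw [ha]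
      _ = (B.conjTranspose * A.conjTranspose) * formMatrix n * (A * B) := by
            simp only [Matrix.mul_assoc]
      _ = formMatrix n := by rw [h1, h2]; simp

/-- The linear action of `SU(n,1)` on `ℂ^{n+1}`. -/
def lin {n : ℕ} (g : SU n) : V n ≃ₗ[ℂ] V n :=
  Matrix.SpecialLinearGroup.toLin' (g : Matrix.SpecialLinearGroup (Fin n ⊕ Unit) ℂ)

lemma lin_apply {n : ℕ} (g : SU n) (v : V n) :
    lin g v = ((g : Matrix.SpecialLinearGroup (Fin n ⊕ Unit) ℂ) : Matrix _ _ ℂ).mulVec v := rfl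

lemma lin_one {n : ℕ} (v : V n) : lin (1 : SU n) v = v := by
  simp [lin_apply]

lemma lin_mul {n : ℕ} (g g' : SU n) (v : V n) : lin (g * g') v = lin g (lin g' v) := by
  simp [lin_apply, Matrix.mulVec_mulVec]

lemma q_eq {n : ℕ} (v : V n) :
    ((q v : ℝ) : ℂ) = dotProduct (star v) ((formMatrix n).mulVec v) := by
  simp [q, formMatrix, dotProduct, Matrix.mulVec_diagonal, Fintype.sum_sum_type,
    ← Complex.conj_mul', sub_eq_add_neg]

lemma q_lin {n : ℕ} (g : SU n) (v : V n) : q (lin g v) = q v := by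
  have h : ((q (lin g v) : ℝ) : ℂ) = ((q v : ℝ) : ℂ) := by
    rw [q_eq, q_eq, lin_apply, Matrix.star_mulVec, Matrix.mulVec_mulVec,
      ← Matrix.dotProduct_mulVec, Matrix.mulVec_mulVec, ← Matrix.mul_assoc]
    congr 2
    exact g.2
  exact_mod_cast h

/-! ### Complex hyperbolic space -/

/-- The unit ball of `ℂ^n`. -/
def ball (n : ℕ) : Set (Fin n → ℂ) := {z | ∑ i, ‖z i‖ ^ 2 < 1}

/-- Complex hyperbolic space: the point `z` of the unit ball stands for the negative line
`ℂ (z, 1)` of `ℂ^{n+1}`; every negative line is of this form for exactly one `z`. -/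
abbrev Hn (n : ℕ) : Type := {z : Fin n → ℂ // z ∈ ball n}

/-- `(z, 1)`. -/
def lift {n : ℕ} (z : Fin n → ℂ) : V n := Sum.elim z (fun _ => 1)

/-- `(v, 0)`. -/
def vec {n : ℕ} (v : Fin n → ℂ) : V n := Sum.elim v (fun _ => 0)

/-- The action of `SU(n,1)` on the affine chart: the line of `(mob g z, 1)` is the image of the line
of `(z, 1)` under `g`. -/
def mob {n : ℕ} (g : SU n) (z : Fin n → ℂ) : Fin n → ℂ :=
  fun i => lin g (lift z) (Sum.inl i) / lin g (lift z) (Sum.inr ())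

lemma q_lift {n : ℕ} (z : Fin n → ℂ) : q (lift z) = ∑ i, ‖z i‖ ^ 2 - 1 := by
  simp [q, lift]

lemma q_lift_neg {n : ℕ} {z : Fin n → ℂ} (hz : z ∈ ball n) : q (lift z) < 0 := by
  rw [q_lift]; have : ∑ i, ‖z i‖ ^ 2 < 1 := hz
  linarith

lemma last_ne_zero {n : ℕ} {v : V n} (hv : q v < 0) : v (Sum.inr ()) ≠ 0 := by
  intro h
  simp only [q, h, norm_zero] at hv
  have : 0 ≤ ∑ i, ‖v (Sum.inl i)‖ ^ 2 := Finset.sum_nonneg fun i _ => by positivity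
  norm_num at hv
  linarith

lemma den_ne_zero {n : ℕ} (g : SU n) {z : Fin n → ℂ} (hz : z ∈ ball n) :
    lin g (lift z) (Sum.inr ()) ≠ 0 :=
  last_ne_zero (by rw [q_lin]; exact q_lift_neg hz)

lemma q_smul {n : ℕ} (c : ℂ) (v : V n) : q (c • v) = ‖c‖ ^ 2 * q v := by
  simp [q, mul_pow, Finset.mul_sum, mul_sub]

lemma lift_mob {n : ℕ} (g : SU n) {z : Fin n → ℂ} (hz : z ∈ ball n) :
    lift (mob g z) = (lin g (lift z) (Sum.inr ()))⁻¹ • lin g (lift z) := by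
  have := den_ne_zero g hz
  funext i
  rcases i with i | i
  · simp [lift, mob, div_eq_inv_mul]
  · simpa [lift] using (inv_mul_cancel₀ this).symm

lemma mob_mem {n : ℕ} (g : SU n) {z : Fin n → ℂ} (hz : z ∈ ball n) : mob g z ∈ ball n := by
  have h : q (lift (mob g z)) < 0 := by
    rw [lift_mob g hz, q_smul, q_lin]
    have h1 := q_lift_neg hz
    have h2 : 0 < ‖(lin g (lift z) (Sum.inr ()))⁻¹‖ := by
      simpa using den_ne_zero g hz
    have : 0 < ‖(lin g (lift z) (Sum.inr ()))⁻¹‖ ^ 2 := by positivity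
    nlinarith
  rw [q_lift] at h
  show ∑ i, ‖mob g z i‖ ^ 2 < 1
  linarith

lemma mob_one {n : ℕ} (z : Fin n → ℂ) : mob (1 : SU n) z = z := by
  funext i; simp [mob, lin_one, lift]

lemma mob_mul {n : ℕ} (g g' : SU n) {z : Fin n → ℂ} (hz : z ∈ ball n) :
    mob (g * g') z = mob g (mob g' z) := by
  have h := den_ne_zero g' hz
  funext i
  have : lin g (lift (mob g' z))
      = (lin g' (lift z) (Sum.inr ()))⁻¹ • lin g (lin g' (lift z)) := by
    rw [← map_smul, ← lift_mob g' hz]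
  show lin (g * g') (lift z) (Sum.inl i) / lin (g * g') (lift z) (Sum.inr ()) =
    lin g (lift (mob g' z)) (Sum.inl i) / lin g (lift (mob g' z)) (Sum.inr ())
  rw [this, lin_mul]
  simp only [Pi.smul_apply, smul_eq_mul]
  rw [mul_div_mul_left _ _ (inv_ne_zero h)]

lemma isOpen_ball (n : ℕ) : IsOpen (ball n) :=
  isOpen_lt (by fun_prop) continuous_const

lemma differentiableAt_mob {n : ℕ} (g : SU n) {z : Fin n → ℂ} (hz : z ∈ ball n) :
    DifferentiableAt ℂ (mob g) z := by
  have key : ∀ k, DifferentiableAt ℂ (fun z : Fin n → ℂ => lin g (lift z) k) z := by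
    intro k
    simp only [lin_apply, Matrix.mulVec, dotProduct, Fintype.sum_sum_type, lift, Sum.elim_inl,
      Sum.elim_inr]
    fun_prop
  rw [differentiableAt_pi]
  intro i
  simp only [mob, div_eq_mul_inv]
  exact (key (Sum.inl i)).fun_mul ((key (Sum.inr ())).fun_inv (den_ne_zero g hz))

lemma fderiv_mob_mul {n : ℕ} (g g' : SU n) {z : Fin n → ℂ} (hz : z ∈ ball n) :
    fderiv ℂ (mob (g * g')) z = (fderiv ℂ (mob g) (mob g' z)).comp (fderiv ℂ (mob g') z) := by
  rw [← fderiv_comp z (differentiableAt_mob g (mob_mem g' hz)) (differentiableAt_mob g' hz)]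
  apply Filter.EventuallyEq.fderiv_eq
  filter_upwards [(isOpen_ball n).mem_nhds hz] with w hw using mob_mul g g' hw

lemma fderiv_mob_one {n : ℕ} (z : Fin n → ℂ) :
    fderiv ℂ (mob (1 : SU n)) z = ContinuousLinearMap.id ℂ _ := by
  have : mob (1 : SU n) = id := funext mob_one
  rw [this, fderiv_id]

lemma fderiv_mob_injective {n : ℕ} (g : SU n) {z : Fin n → ℂ} (hz : z ∈ ball n) :
    Function.Injective (fderiv ℂ (mob g) z : (Fin n → ℂ) →ₗ[ℂ] (Fin n → ℂ)) := by
  have h := fderiv_mob_mul g⁻¹ g hz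
  rw [inv_mul_cancel, fderiv_mob_one] at h
  apply Function.LeftInverse.injective (g := fderiv ℂ (mob g⁻¹) (mob g z))
  intro v
  exact (congrArg (fun L => L v) h).symm

instance (n : ℕ) : MulAction (SU n) (Hn n) where
  smul g z := ⟨mob g z.1, mob_mem g z.2⟩
  one_smul z := Subtype.ext (mob_one z.1)
  mul_smul g g' z := Subtype.ext (mob_mul g g' z.2)

/-- The quotient topology on the projective space of `ℂ^n`. -/
instance (n : ℕ) : TopologicalSpace (ℙ ℂ (Fin n → ℂ)) :=
  TopologicalSpace.coinduced
    (fun v : {v : Fin n → ℂ // v ≠ 0} => Projectivization.mk ℂ v.1 v.2) inferInstance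

/-- The projectivized tangent bundle of complex hyperbolic space: pairs of a point `z` of the ball
and a complex line in the holomorphic tangent space `ℂ^n` at `z`. -/
structure PTH (n : ℕ) where
  /-- the point -/
  pt : Hn n
  /-- the line -/
  dir : ℙ ℂ (Fin n → ℂ)

instance (n : ℕ) : TopologicalSpace (PTH n) :=
  TopologicalSpace.induced (fun p => (p.pt, p.dir)) inferInstance

/-- The action of `g` on the projectivized tangent bundle, through its derivative. -/
def ptAct {n : ℕ} (g : SU n) (p : PTH n) : PTH n :=
  ⟨g • p.pt, p.dir.map (fderiv ℂ (mob g) p.pt.1 : (Fin n → ℂ) →ₗ[ℂ] (Fin n → ℂ))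
      (fderiv_mob_injective g p.pt.2)⟩

instance (n : ℕ) : MulAction (SU n) (PTH n) where
  smul := ptAct
  one_smul p := by
    obtain ⟨z, l⟩ := p
    refine congrArg₂ PTH.mk (one_smul _ z) ?_
    induction l using Projectivization.ind with
    | h v hv =>
      show Projectivization.mk ℂ (fderiv ℂ (mob 1) z.1 v) _ = Projectivization.mk ℂ v hv
      congr 1
      simp [fderiv_mob_one]
  mul_smul g g' p := by
    obtain ⟨z, l⟩ := p
    refine congrArg₂ PTH.mk (mul_smul g g' z) ?_
    induction l using Projectivization.ind with
    | h v hv =>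
      show Projectivization.mk ℂ (fderiv ℂ (mob (g * g')) z.1 v) _ =
        Projectivization.mk ℂ (fderiv ℂ (mob g) (mob g' z.1) (fderiv ℂ (mob g') z.1 v)) _
      congr 1
      simp [fderiv_mob_mul g g' z.2]

/-- A subgroup without nontrivial elements of finite order. -/
def TorsionFree {n : ℕ} (Γ : Subgroup (SU n)) : Prop := ∀ γ ∈ Γ, IsOfFinOrder γ → γ = 1

/-- The complex hyperbolic manifold `X = Γ \ H^n`. -/
abbrev X {n : ℕ} (Γ : Subgroup (SU n)) : Type := MulAction.orbitRel.Quotient Γ (Hn n)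

/-- The projectivized tangent bundle `PT_X = Γ \ PT_{H^n}`. -/
abbrev PTX {n : ℕ} (Γ : Subgroup (SU n)) : Type := MulAction.orbitRel.Quotient Γ (PTH n)

/-- The covering map `H^n → X`. -/
def projX {n : ℕ} (Γ : Subgroup (SU n)) (z : Hn n) : X Γ := Quotient.mk _ z

/-- The covering map `PT_{H^n} → PT_X`. -/
def projPT {n : ℕ} (Γ : Subgroup (SU n)) (p : PTH n) : PTX Γ := Quotient.mk _ p

/-! ### The space of complex geodesics -/

/-- The space `𝒢` of complex geodesics of `H^n`: a complex projective line meeting `H^n` is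
a complex 2-plane of `ℂ^{n+1}` containing a negative vector. -/
@[ext]
structure Geodesic (n : ℕ) where
  /-- the 2-plane -/
  plane : Submodule ℂ (V n)
  finrank_eq : Module.finrank ℂ plane = 2
  exists_neg : ∃ v ∈ plane, q v < 0

/-- The action of `g` on complex geodesics. -/
def geoAct {n : ℕ} (g : SU n) (W : Geodesic n) : Geodesic n :=
  ⟨W.plane.map (lin g : V n →ₗ[ℂ] V n), by
    rw [LinearEquiv.finrank_map_eq]; exact W.finrank_eq, by
    obtain ⟨v, hv, h⟩ := W.exists_neg
    exact ⟨lin g v, Submodule.mem_map_of_mem hv, by rwa [q_lin]⟩⟩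

instance (n : ℕ) : MulAction (SU n) (Geodesic n) where
  smul := geoAct
  one_smul W := by
    apply Geodesic.ext
    have h : (lin (1 : SU n) : V n →ₗ[ℂ] V n) = LinearMap.id := LinearMap.ext lin_one
    show W.plane.map (lin (1 : SU n) : V n →ₗ[ℂ] V n) = W.plane
    rw [h, Submodule.map_id]
  mul_smul g g' W := by
    apply Geodesic.ext
    have h : (lin (g * g') : V n →ₗ[ℂ] V n) = (lin g : V n →ₗ[ℂ] V n) ∘ₗ (lin g' : V n →ₗ[ℂ] V n) :=
      LinearMap.ext (lin_mul g g')
    show W.plane.map (lin (g * g') : V n →ₗ[ℂ] V n) = (W.plane.map _).map _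
    rw [h, Submodule.map_comp]

/-- The (open) set of frames `(f_0, f_1)` of the 2-planes that belong to `𝒢`. -/
def frames (n : ℕ) : Set (Fin 2 → V n) :=
  {f | LinearIndependent ℂ f ∧ ∃ v ∈ Submodule.span ℂ (Set.range f), q v < 0}

/-- The complex geodesic spanned by a frame. -/
def spanGeo {n : ℕ} (f : Fin 2 → V n) (hf : f ∈ frames n) : Geodesic n :=
  ⟨Submodule.span ℂ (Set.range f), by simpa using finrank_span_eq_card hf.1, hf.2⟩

/-- `𝒢` has the topology of the Grassmannian: the quotient topology of the space of frames. -/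
instance (n : ℕ) : TopologicalSpace (Geodesic n) :=
  TopologicalSpace.coinduced (fun f : frames n => spanGeo f.1 f.2) inferInstance

instance (n : ℕ) : MeasurableSpace (Geodesic n) := borel _

instance (n : ℕ) : BorelSpace (Geodesic n) := ⟨rfl⟩

/-- The tangent space of `𝒢` at `W`: that of the Grassmannian, `Hom(W, ℂ^{n+1}/W)`. -/
abbrev TanGeo {n : ℕ} (W : Geodesic n) : Type := W.plane →ₗ[ℂ] (V n ⧸ W.plane)

/-- The differential at the frame `f` of the map that sends a frame to the 2-plane it spans: the
vector `u = (u_0, u_1)` goes to the homomorphism `f_i ↦ u_i mod W`. -/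
def dspan {n : ℕ} (f : Fin 2 → V n) (hf : f ∈ frames n) :
    (Fin 2 → V n) →ₗ[ℂ] TanGeo (spanGeo f hf) :=
  ((Module.Basis.span hf.1).constr ℂ).toLinearMap ∘ₗ
    LinearMap.pi (fun i => (spanGeo f hf).plane.mkQ ∘ₗ LinearMap.proj i)

/-- The differential of the action of `g` on `𝒢`. -/
def dgeo {n : ℕ} (g : SU n) (W : Geodesic n) : TanGeo W ≃ₗ[ℂ] TanGeo (g • W) :=
  LinearEquiv.arrowCongr ((lin g).submoduleMap W.plane)
    (Submodule.Quotient.equiv W.plane (W.plane.map (lin g : V n →ₗ[ℂ] V n)) (lin g) rfl)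

/-- Real 2-forms on `𝒢` (no regularity). -/
abbrev GeoForm (n : ℕ) : Type := ∀ W : Geodesic n, (TanGeo W) [⋀^Fin 2]→ₗ[ℝ] ℝ

/-- An alternating form on a finite-dimensional space, as a continuous one. -/
def toCont {E : Type*} [NormedAddCommGroup E] [NormedSpace ℝ E] [FiniteDimensional ℝ E]
    (a : E [⋀^Fin 2]→ₗ[ℝ] ℝ) : E [⋀^Fin 2]→L[ℝ] ℝ :=
  { a with
    cont := by
      have h : ∀ m : Fin 2 → E, a m = ∑ r : Fin 2 → Fin (Module.finrank ℝ E),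
          (∏ i, (Module.finBasis ℝ E).repr (m i) (r i)) •
            a (fun i => Module.finBasis ℝ E (r i)) := by
        intro m
        conv_lhs =>
          rw [show m = fun i => ∑ j, (Module.finBasis ℝ E).repr (m i) j • Module.finBasis ℝ E j from
            funext fun i => ((Module.finBasis ℝ E).sum_repr (m i)).symm]
        rw [← AlternatingMap.coe_multilinearMap, MultilinearMap.map_sum]
        simp_rw [MultilinearMap.map_smul_univ]
      have hc : ∀ j, Continuous fun x : E => (Module.finBasis ℝ E).repr x j := fun j =>
        LinearMap.continuous_of_finiteDimensional ((Module.finBasis ℝ E).coord j)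
      show Continuous fun m : Fin 2 → E => a m
      rw [funext h]
      have hr : ∀ r : Fin 2 → Fin (Module.finrank ℝ E), Continuous fun m : Fin 2 → E =>
          (∏ i, (Module.finBasis ℝ E).repr (m i) (r i)) •
            a (fun i => Module.finBasis ℝ E (r i)) := by
        intro r
        have hp : Continuous fun m : Fin 2 → E =>
            ∏ i, (Module.finBasis ℝ E).repr (m i) (r i) :=
          continuous_finsetProd _ fun i _ => (hc (r i)).comp (continuous_apply i)
        exact hp.smul continuous_const
      exact continuous_finsetSum _ fun r _ => hr r }

open Classical in
/-- The pullback of a 2-form on `𝒢` to the open set of frames, extended by zero. -/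
def GeoForm.pull {n : ℕ} (ω : GeoForm n) (f : Fin 2 → V n) :
    (Fin 2 → V n) [⋀^Fin 2]→L[ℝ] ℝ :=
  if hf : f ∈ frames n then
    toCont ((ω (spanGeo f hf)).compLinearMap ((dspan f hf).restrictScalars ℝ))
  else 0

/-- Smooth 2-forms: the frame map is a surjective submersion, so that smoothness can be read off
on the open set of frames. -/
def GeoForm.Smooth {n : ℕ} (ω : GeoForm n) : Prop :=
  ContDiffOn ℝ ((⊤ : ℕ∞) : WithTop ℕ∞) ω.pull (frames n)

/-- Closed 2-forms: the pullback to the open set of frames is closed. -/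
def GeoForm.Closed {n : ℕ} (ω : GeoForm n) : Prop :=
  ∀ f ∈ frames n, extDeriv ω.pull f = 0

/-- `SU(n,1)`-invariant 2-forms. -/
def GeoForm.Invariant {n : ℕ} (ω : GeoForm n) : Prop :=
  ∀ (g : SU n) (W : Geodesic n) (A B : TanGeo W),
    ω (g • W) ![dgeo g W A, dgeo g W B] = ω W ![A, B]

/-- Non-degenerate, possibly indefinite, Kähler forms: smooth closed real forms of type (1,1) that
are non-degenerate at every point. -/
structure GeoForm.PseudoKahler {n : ℕ} (ω : GeoForm n) : Prop where
  smooth : ω.Smooth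
  closed : ω.Closed
  type_one_one : ∀ (W : Geodesic n) (A B : TanGeo W),
    ω W ![Complex.I • A, Complex.I • B] = ω W ![A, B]
  nondegenerate : ∀ (W : Geodesic n) (A : TanGeo W), (∀ B, ω W ![A, B] = 0) → A = 0

/-- The symmetric form `ω(A, iA)` takes both signs on every tangent space. -/
def GeoForm.Indefinite {n : ℕ} (ω : GeoForm n) : Prop :=
  ∀ W : Geodesic n, (∃ A : TanGeo W, 0 < ω W ![A, Complex.I • A]) ∧
    ∃ A : TanGeo W, ω W ![A, Complex.I • A] < 0

/-! ### Wedge products of 2-forms, volume forms -/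

/-- The value at `v` of the wedge product `α_0 ∧ … ∧ α_{k-1}` of 2-forms. -/
def wedge {E : Type*} [AddCommGroup E] [Module ℝ E] {k : ℕ}
    (α : Fin k → E [⋀^Fin 2]→ₗ[ℝ] ℝ) (v : Fin k × Fin 2 → E) : ℝ :=
  (1 / 2 ^ k) * ∑ σ : Equiv.Perm (Fin k × Fin 2),
    ((Equiv.Perm.sign σ : ℤ) : ℝ) * ∏ i, α i ![v (σ (i, 0)), v (σ (i, 1))]

/-- The real basis `e_1, i e_1, e_2, i e_2, …` of `ℂ^k`, which is positively oriented. -/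
def realBasis (k : ℕ) (j : Fin k × Fin 2) : Fin k → ℂ :=
  Pi.single j.1 (if j.2 = 0 then 1 else Complex.I)

/-- A local holomorphic parametrization `u ↦ span (f_0(u), f_1(u))` of `𝒢`, given with
a holomorphic frame, by an open subset of `ℂ^{2n-2}`. -/
structure GeoChart (n : ℕ) where
  /-- the domain -/
  dom : Set (Fin (2 * n - 2) → ℂ)
  isOpen_dom : IsOpen dom
  /-- the frame -/
  frame : (Fin (2 * n - 2) → ℂ) → Fin 2 → V n
  holomorphic : DifferentiableOn ℂ frame dom
  mem_frames : ∀ u ∈ dom, frame u ∈ frames n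
  injective : ∀ (u) (hu : u ∈ dom) (u') (hu' : u' ∈ dom),
    spanGeo (frame u) (mem_frames u hu) = spanGeo (frame u') (mem_frames u' hu') → u = u'
  immersive : ∀ (u) (hu : u ∈ dom),
    Function.Injective fun x => dspan (frame u) (mem_frames u hu) (fderiv ℂ frame u x)

/-- The coefficient of `ω^{2n-2}` (a form of top degree) in a chart, with respect to
the Lebesgue volume form of `ℂ^{2n-2}`. -/
def GeoChart.density {n : ℕ} (c : GeoChart n) (ω : GeoForm n) (u : Fin (2 * n - 2) → ℂ) : ℝ :=
  wedge (fun _ : Fin (2 * n - 2) => ((ω.pull (c.frame u)).toAlternatingMap.compLinearMap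
    ((fderiv ℂ c.frame u).restrictScalars ℝ).toLinearMap)) (realBasis (2 * n - 2))

/-- `μ` is the measure on `𝒢` defined by the volume form `a • ω^{2n-2}`. -/
def IsVolumeMeasure {n : ℕ} (ω : GeoForm n) (a : ℝ) (μ : MeasureTheory.Measure (Geodesic n)) :
    Prop :=
  ∀ (c : GeoChart n) (A : Set (Fin (2 * n - 2) → ℂ)), MeasurableSet A → A ⊆ c.dom →
    μ {W | ∃ u ∈ A, W.plane = Submodule.span ℂ (Set.range (c.frame u))} =
      ∫⁻ u in A, ENNReal.ofReal (|a * c.density ω u|)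

/-! ### 2-forms on `X` and integration on `X` -/

/-- The Hermitian inner product of `ℂ^n`, linear in the first variable. -/
def herm {n : ℕ} (u v : Fin n → ℂ) : ℂ := ∑ i, u i * starRingEnd ℂ (v i)

lemma herm_add_left {n : ℕ} (u u' v : Fin n → ℂ) : herm (u + u') v = herm u v + herm u' v := by
  simp [herm, add_mul, Finset.sum_add_distrib]

lemma herm_add_right {n : ℕ} (u v v' : Fin n → ℂ) : herm u (v + v') = herm u v + herm u v' := by
  simp [herm, mul_add, Finset.sum_add_distrib]

/-- The `SU(n,1)`-invariant Kähler form `ω` of constant holomorphic sectional curvature `-1`, in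
the ball model. Its metric `ω(u, iu)` is
`4 ((1 - |z|²) |u|² + |⟨u, z⟩|²) / (1 - |z|²)²`. -/
def kahler {n : ℕ} (z : Fin n → ℂ) : (Fin n → ℂ) [⋀^Fin 2]→ₗ[ℝ] ℝ where
  toFun m := -4 * (((1 - herm z z) * herm (m 0) (m 1) + herm (m 0) z * herm z (m 1)) /
    (1 - herm z z) ^ 2).im
  map_update_add' := by
    intro _ m i x y
    have hd := Subsingleton.elim (‹DecidableEq (Fin 2)›) (instDecidableEqFin 2)
    subst hd
    fin_cases i <;>
    · simp [herm_add_left, herm_add_right]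
      simp only [mul_add, add_mul, add_div, Complex.add_im]
      ring
  map_update_smul' := by
    intro _ m i r x
    have hd := Subsingleton.elim (‹DecidableEq (Fin 2)›) (instDecidableEqFin 2)
    subst hd
    fin_cases i
    · have h : ∀ u : Fin n → ℂ, herm (r • x) u = r * herm x u := by
        intro u; simp [herm, Finset.mul_sum, mul_assoc]
      simp only [Fin.zero_eta, Function.update_self, ne_eq, one_ne_zero, not_false_eq_true,
        Function.update_of_ne, h, smul_eq_mul]
      rw [show ((1 - herm z z) * (r * herm x (m 1)) + r * herm x z * herm z (m 1)) /
          (1 - herm z z) ^ 2 = r * (((1 - herm z z) * herm x (m 1) + herm x z * herm z (m 1)) /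
          (1 - herm z z) ^ 2) by ring, Complex.im_ofReal_mul]
      ring
    · have h : ∀ u : Fin n → ℂ, herm u (r • x) = r * herm u x := by
        intro u; simp [herm, Finset.mul_sum, mul_left_comm]
      simp only [Fin.mk_one, Function.update_self, ne_eq, zero_ne_one, not_false_eq_true,
        Function.update_of_ne, h, smul_eq_mul]
      rw [show ((1 - herm z z) * (r * herm (m 0) x) + herm (m 0) z * (r * herm z x)) /
          (1 - herm z z) ^ 2 = r * (((1 - herm z z) * herm (m 0) x + herm (m 0) z * herm z x) /
          (1 - herm z z) ^ 2) by ring, Complex.im_ofReal_mul]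
      ring
  map_eq_zero_of_eq' := by
    intro m i j hij hne
    have h01 : m 0 = m 1 := by
      fin_cases i <;> fin_cases j <;> simp_all
    rw [h01]
    have hs : ∀ u v : Fin n → ℂ, starRingEnd ℂ (herm u v) = herm v u := by
      intro u v; simp [herm, mul_comm]
    have : (((1 - herm z z) * herm (m 1) (m 1) + herm (m 1) z * herm z (m 1)) /
        (1 - herm z z) ^ 2).im = 0 := by
      rw [← Complex.conj_eq_iff_im]
      simp only [map_div₀, map_add, map_mul, map_sub, map_one, map_pow, hs]
      ring
    rw [this, mul_zero]

/-- A smooth real 2-form on `X = Γ \ H^n`, given as a `Γ`-invariant smooth 2-form on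
the ball (the values outside the ball are irrelevant). -/
structure XForm {n : ℕ} (Γ : Subgroup (SU n)) where
  /-- the form on the ball -/
  toFun : (Fin n → ℂ) → (Fin n → ℂ) [⋀^Fin 2]→L[ℝ] ℝ
  smooth : ContDiffOn ℝ ((⊤ : ℕ∞) : WithTop ℕ∞) toFun (ball n)
  invariant : ∀ γ ∈ Γ, ∀ z ∈ ball n,
    (toFun (mob γ z)).compContinuousLinearMap (fderiv ℝ (mob γ) z) = toFun z

/-- The support of the form in `X` is compact. -/
def XForm.CompactlySupported {n : ℕ} {Γ : Subgroup (SU n)} (β : XForm Γ) : Prop :=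
  IsCompact (closure (projX Γ '' {z | β.toFun z.1 ≠ 0}))

/-- The coefficient of `β ∧ ω^{n-1}` with respect to the Lebesgue volume form of the ball. -/
def XForm.wedgeKahler {n : ℕ} {Γ : Subgroup (SU n)} (β : XForm Γ) (z : Hn n) : ℝ :=
  wedge (fun i : Fin n => if (i : ℕ) = 0 then (β.toFun z.1).toAlternatingMap else kahler z.1)
    (realBasis n)

/-- A covering of `X` by open sets `Γ \ Γ U_i`, each with a chart onto the open set `U_i` of the ball
(inverse to the covering map), and a partition of unity subordinate to it. -/
structure XPartition {n : ℕ} (Γ : Subgroup (SU n)) where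
  /-- the index set -/
  ι : Type
  /-- the images of the charts -/
  U : ι → Set (Hn n)
  isOpen_U : ∀ i, IsOpen (U i)
  injOn : ∀ i, Set.InjOn (projX Γ) (U i)
  /-- the partition of unity -/
  χ : PartitionOfUnity ι (X Γ) Set.univ
  subordinate : ∀ i, tsupport (χ i) ⊆ projX Γ '' U i

/-- The integral over `X`, computed with a partition of unity, of the form of top degree whose
lift to the ball has coefficient `τ`. -/
def XPartition.integral {n : ℕ} {Γ : Subgroup (SU n)} (P : XPartition Γ) (τ : Hn n → ℝ) : ℝ :=
  ∑ᶠ i, ∫ z in P.U i, P.χ i (projX Γ z) * τ z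
    ∂(MeasureTheory.Measure.comap Subtype.val MeasureTheory.volume)

/-- `∫_X τ = I`: partitions of unity as above exist and all of them give the value `I`. -/
def HasXIntegral {n : ℕ} (Γ : Subgroup (SU n)) (τ : Hn n → ℝ) (I : ℝ) : Prop :=
  Nonempty (XPartition Γ) ∧ ∀ P : XPartition Γ, P.integral τ = I

/-! ### The tautological foliation -/

lemma mem_frames_of_tangent {n : ℕ} {z v : Fin n → ℂ} (hz : z ∈ ball n) (hv : v ≠ 0) :
    ![lift z, vec v] ∈ frames n := by
  refine ⟨?_, lift z, Submodule.subset_span ⟨0, rfl⟩, q_lift_neg hz⟩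
  rw [LinearIndependent.pair_iff]
  intro s t h
  have hs : s = 0 := by simpa [lift, vec] using congrFun h (Sum.inr ())
  refine ⟨hs, ?_⟩
  by_contra ht
  apply hv
  funext i
  have := congrFun h (Sum.inl i)
  simpa [lift, vec, hs, ht] using this

/-- The complex geodesic through `z` tangent to the line `ℓ`, spanned by `(z, 1)` and by `(v, 0)` for
`v ∈ ℓ`. -/
def toGeodesic {n : ℕ} (p : PTH n) : Geodesic n :=
  spanGeo ![lift p.pt.1, vec p.dir.rep] (mem_frames_of_tangent p.pt.2 p.dir.rep_nonzero)

/-- The real tangent space of `PT_{H^n}` at `(z, ℓ)`: `ℂ^n × Hom(ℓ, ℂ^n / ℓ)`. -/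
abbrev TanPT {n : ℕ} (p : PTH n) : Type :=
  (Fin n → ℂ) × (p.dir.submodule →ₗ[ℂ] ((Fin n → ℂ) ⧸ p.dir.submodule))

/-- Real 2-forms on `PT_{H^n}` (no regularity). -/
abbrev PTForm (n : ℕ) : Type := ∀ p : PTH n, (TanPT p) [⋀^Fin 2]→ₗ[ℝ] ℝ

/-- The pullback of a 2-form under `π : (z, ℓ) ↦ z`. -/
def XForm.pullPT {n : ℕ} {Γ : Subgroup (SU n)} (β : XForm Γ) : PTForm n := fun p =>
  (β.toFun p.pt.1).toAlternatingMap.compLinearMap (LinearMap.fst ℝ _ _)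

/-- An open set of `PT_X` regular for the tautological foliation, given by a lift `carrier` to
`PT_{H^n}`: the foliation, whose leaves in `PT_{H^n}` are the fibers of `toGeodesic`, is a product
foliation there. The plaques are the intersections of `carrier` with the fibers, so that
the space of plaques is the image of `carrier` in `𝒢`. -/
structure RegularOpen {n : ℕ} (Γ : Subgroup (SU n)) where
  /-- the lift to `PT_{H^n}` -/
  carrier : Set (PTH n)
  isOpen_carrier : IsOpen carrier
  injOn : Set.InjOn (projPT Γ) carrier
  product : ∃ e : carrier ≃ₜ (Metric.ball (0 : ℂ) 1) × (toGeodesic '' carrier),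
    ∀ p : carrier, ((e p).2 : Geodesic n) = toGeodesic p.1

/-- The space of plaques. -/
def RegularOpen.plaques {n : ℕ} {Γ : Subgroup (SU n)} (U : RegularOpen Γ) : Set (Geodesic n) :=
  toGeodesic '' U.carrier

/-- An invariant transverse measure for the tautological foliation of `PT_X`: a family of locally
finite measures on the spaces of plaques of the regular open sets that is invariant under
the holonomy. If the lifts `U` and `γ⁻¹ U'` meet, the holonomy between the two regular open
sets sends the plaque of `U` in the fiber over `W` to the plaque of `U'` in the fiber over `γ W`. -/
structure IsInvariantTransverseMeasure {n : ℕ} (Γ : Subgroup (SU n))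
    (ν : RegularOpen Γ → MeasureTheory.Measure (Geodesic n)) : Prop where
  supported : ∀ U, ν U (U.plaques)ᶜ = 0
  locally_finite : ∀ U, ∀ K ⊆ U.plaques, IsCompact K → ν U K < ⊤
  holonomy : ∀ (U U' : RegularOpen Γ), ∀ γ ∈ Γ, ∀ A : Set (Geodesic n), MeasurableSet A →
    A ⊆ toGeodesic '' {p | p ∈ U.carrier ∧ γ • p ∈ U'.carrier} →
    ν U' ((fun W => γ • W) '' A) = ν U A

open Classical in
/-- The integral of the 2-form `φ α` over the part in `S` of the leaf through `p = (z, ℓ)`. This leaf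
is parametrized by `t ↦ (z + t v, ℓ)`, where `v` spans `ℓ`; the images of the tangent vectors `1`
and `i` are `(v, 0)` and `(i v, 0)`. -/
def leafIntegral {n : ℕ} (S : Set (PTH n)) (φ : PTH n → ℝ) (α : PTForm n) (p : PTH n) : ℝ :=
  ∫ t : ℂ, if h : p.pt.1 + t • p.dir.rep ∈ ball n then
      if (⟨⟨p.pt.1 + t • p.dir.rep, h⟩, p.dir⟩ : PTH n) ∈ S then
        φ ⟨⟨p.pt.1 + t • p.dir.rep, h⟩, p.dir⟩ *
          α ⟨⟨p.pt.1 + t • p.dir.rep, h⟩, p.dir⟩ ![(p.dir.rep, 0), (Complex.I • p.dir.rep, 0)]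
      else 0
    else 0

open Classical in
/-- The integral of the 2-form `φ α` over the plaque of `U` that corresponds to `W`. -/
def RegularOpen.plaqueIntegral {n : ℕ} {Γ : Subgroup (SU n)} (U : RegularOpen Γ)
    (φ : PTH n → ℝ) (α : PTForm n) (W : Geodesic n) : ℝ :=
  if h : ∃ p ∈ U.carrier, toGeodesic p = W then leafIntegral U.carrier φ α h.choose else 0

/-- A covering of `PT_X` by regular open sets, with a subordinate partition of unity. -/
structure PTPartition {n : ℕ} (Γ : Subgroup (SU n)) where
  /-- the index set -/
  ι : Type
  /-- the regular open sets -/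
  U : ι → RegularOpen Γ
  /-- the partition of unity -/
  χ : PartitionOfUnity ι (PTX Γ) Set.univ
  subordinate : ∀ i, tsupport (χ i) ⊆ projPT Γ '' (U i).carrier

/-- The current `∑_i ∫_{T_i} (∫_t χ_i α) dν(t)`, where `T_i` is the space of plaques of `U_i`. -/
def PTPartition.current {n : ℕ} {Γ : Subgroup (SU n)} (P : PTPartition Γ)
    (ν : RegularOpen Γ → MeasureTheory.Measure (Geodesic n)) (α : PTForm n) : ℝ :=
  ∑ᶠ i, ∫ W in (P.U i).plaques,
    (P.U i).plaqueIntegral (fun p => P.χ i (projPT Γ p)) α W ∂(ν (P.U i))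

/-- `∫_{𝒯,ν} α = I`: coverings by regular open sets with subordinate partitions of unity exist, and
all of them give the value `I`. -/
def HasCurrent {n : ℕ} (Γ : Subgroup (SU n))
    (ν : RegularOpen Γ → MeasureTheory.Measure (Geodesic n)) (α : PTForm n) (I : ℝ) : Prop :=
  Nonempty (PTPartition Γ) ∧ ∀ P : PTPartition Γ, P.current ν α = I

/-- The transverse measure defined by a measure on `𝒢`, seen as the space of leaves
of `PT_{H^n}`. -/
def transverse {n : ℕ} (Γ : Subgroup (SU n)) (μ : MeasureTheory.Measure (Geodesic n))
    (U : RegularOpen Γ) : MeasureTheory.Measure (Geodesic n) :=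
  μ.restrict U.plaques

end CHyp

end

namespace CHyp

/-! ### The Hermitian form on `ℂ^{n+1}` and on bivectors -/

/-- The signs of the Hermitian form `h`. -/
def sgn {n : ℕ} : Fin n ⊕ Unit → ℂ := Sum.elim (fun _ => 1) (fun _ => -1)

@[simp] lemma sgn_inl {n : ℕ} (i : Fin n) : sgn (Sum.inl i) = 1 := rfl

@[simp] lemma sgn_inr {n : ℕ} (i : Unit) : sgn (n := n) (Sum.inr i) = -1 := rfl

lemma conj_sgn {n : ℕ} (i : Fin n ⊕ Unit) : starRingEnd ℂ (sgn i) = sgn i := by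
  rcases i with i | i <;> simp

/-- The Hermitian form `h`, linear in the first variable. -/
noncomputable def hf {n : ℕ} (v w : V n) : ℂ := ∑ i, sgn i * (v i * starRingEnd ℂ (w i))

section hf

variable {n : ℕ} (v w : V n)

lemma conj_hf : starRingEnd ℂ (hf v w) = hf w v := by
  simp only [hf, map_sum, map_mul, conj_sgn, Complex.conj_conj]
  exact Finset.sum_congr rfl fun i _ => by ring

lemma hf_self : hf v v = (q v : ℂ) := by
  rw [q_eq]
  simp only [hf, formMatrix, dotProduct, Matrix.mulVec_diagonal]
  exact Finset.sum_congr rfl fun i _ => by rcases i with i | i <;> simp <;> ring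

lemma hf_eq_dotProduct : hf v w = dotProduct (star w) ((formMatrix n).mulVec v) := by
  simp only [hf, formMatrix, dotProduct, Matrix.mulVec_diagonal]
  exact Finset.sum_congr rfl fun i _ => by rcases i with i | i <;> simp <;> ring

lemma hf_lin (g : SU n) : hf (lin g v) (lin g w) = hf v w := by
  rw [hf_eq_dotProduct, hf_eq_dotProduct, lin_apply, lin_apply, Matrix.star_mulVec,
    Matrix.mulVec_mulVec, ← Matrix.dotProduct_mulVec, Matrix.mulVec_mulVec, ← Matrix.mul_assoc]
  congr 2
  exact g.2

end hf

/-- Bivectors, as functions of two indices. -/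
abbrev Biv (n : ℕ) : Type := (Fin n ⊕ Unit) × (Fin n ⊕ Unit) → ℂ

/-- The bivector `a ∧ b`. -/
def wdg {n : ℕ} (a b : V n) : Biv n := fun x => a x.1 * b x.2 - a x.2 * b x.1

/-- The Hermitian form induced by `h` on bivectors. -/
noncomputable def hh {n : ℕ} (x y : Biv n) : ℂ :=
  ∑ i, sgn i.1 * sgn i.2 * (x i * starRingEnd ℂ (y i))

section hh

variable {n : ℕ} (x y z : Biv n) (c : ℂ)

lemma hh_add_left : hh (x + y) z = hh x z + hh y z := by
  simp [hh, add_mul, mul_add, Finset.sum_add_distrib]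

lemma hh_add_right : hh x (y + z) = hh x y + hh x z := by
  simp [hh, mul_add, Finset.sum_add_distrib]

lemma hh_smul_left : hh (c • x) y = c * hh x y := by
  simp only [hh, Finset.mul_sum, Pi.smul_apply, smul_eq_mul]
  exact Finset.sum_congr rfl fun i _ => by ring

lemma hh_smul_right : hh x (c • y) = starRingEnd ℂ c * hh x y := by
  simp only [hh, Finset.mul_sum, Pi.smul_apply, smul_eq_mul, map_mul]
  exact Finset.sum_congr rfl fun i _ => by ring

lemma conj_hh : starRingEnd ℂ (hh x y) = hh y x := by
  simp only [hh, map_sum, map_mul, conj_sgn, Complex.conj_conj]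
  exact Finset.sum_congr rfl fun i _ => by ring

lemma hh_wdg (a b c d : V n) :
    hh (wdg a b) (wdg c d) = 2 * (hf a c * hf b d - hf a d * hf b c) := by
  have key : ∀ a b c d : V n, ∑ i : (Fin n ⊕ Unit) × (Fin n ⊕ Unit),
      sgn i.1 * sgn i.2 * (a i.1 * b i.2 * (starRingEnd ℂ (c i.1) * starRingEnd ℂ (d i.2)))
      = hf a c * hf b d := by
    intro a b c d
    rw [hf, hf, Finset.sum_mul_sum, Fintype.sum_prod_type]
    exact Finset.sum_congr rfl fun i _ => Finset.sum_congr rfl fun j _ => by ring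
  have e : hh (wdg a b) (wdg c d) = (hf a c * hf b d - hf a d * hf b c)
      + (hf b d * hf a c - hf b c * hf a d) := by
    rw [← key a b c d, ← key a b d c, ← key b a d c, ← key b a c d,
      ← Finset.sum_sub_distrib, ← Finset.sum_sub_distrib, ← Finset.sum_add_distrib, hh]
    refine Finset.sum_congr rfl fun i _ => ?_
    simp only [wdg, map_sub, map_mul]
    ring
  rw [e]; ring

end hh

section wdg

variable {n : ℕ} (a b c : V n) (s : ℂ)

lemma wdg_add_left : wdg (a + b) c = wdg a c + wdg b c := by
  funext x; simp [wdg]; ring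

lemma wdg_add_right : wdg a (b + c) = wdg a b + wdg a c := by
  funext x; simp [wdg]; ring

lemma wdg_smul_left : wdg (s • a) b = s • wdg a b := by
  funext x; simp [wdg]; ring

lemma wdg_smul_right : wdg a (s • b) = s • wdg a b := by
  funext x; simp [wdg]; ring

lemma wdg_self : wdg a a = 0 := by
  funext x; simp [wdg]; ring

end wdg

/-- The Plücker map, from frames to bivectors. -/
def plucker {n : ℕ} (f : Fin 2 → V n) : Biv n := wdg (f 0) (f 1)

/-- The differential of the Plücker map. -/
def dplucker {n : ℕ} (f : Fin 2 → V n) : (Fin 2 → V n) →ₗ[ℂ] Biv n where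
  toFun u := wdg (u 0) (f 1) + wdg (f 0) (u 1)
  map_add' u w := by simp only [Pi.add_apply, wdg_add_left, wdg_add_right]; abel
  map_smul' c u := by
    simp only [Pi.smul_apply, wdg_smul_left, wdg_smul_right, smul_add, RingHom.id_apply]

lemma dplucker_apply {n : ℕ} (f u : Fin 2 → V n) :
    dplucker f u = wdg (u 0) (f 1) + wdg (f 0) (u 1) := rfl

/-- An alternating 2-form from a bilinear form. -/
def altOfBilin {E : Type*} [AddCommGroup E] [Module ℝ E] (B : E →ₗ[ℝ] E →ₗ[ℝ] ℝ)
    (h : ∀ x, B x x = 0) : E [⋀^Fin 2]→ₗ[ℝ] ℝ where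
  toFun m := B (m 0) (m 1)
  map_update_add' := by
    intro _ m i x y
    have hd := Subsingleton.elim (‹DecidableEq (Fin 2)›) (instDecidableEqFin 2)
    subst hd
    fin_cases i <;> simp
  map_update_smul' := by
    intro _ m i r x
    have hd := Subsingleton.elim (‹DecidableEq (Fin 2)›) (instDecidableEqFin 2)
    subst hd
    fin_cases i <;> simp
  map_eq_zero_of_eq' := by
    intro m i j hij hne
    have h01 : m 0 = m 1 := by
      fin_cases i <;> fin_cases j <;> simp_all
    rw [h01, h]

/-- The sesquilinear Fubini–Study form at a bivector. -/
noncomputable def fsK {n : ℕ} (p x y : Biv n) : ℂ :=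
  (hh x y * hh p p - hh x p * hh p y) / hh p p ^ 2

section fs

variable {n : ℕ} (p x y z : Biv n) (c : ℂ)

lemma fsK_add_left : fsK p (x + y) z = fsK p x z + fsK p y z := by
  simp only [fsK, hh_add_left]; ring

lemma fsK_add_right : fsK p x (y + z) = fsK p x y + fsK p x z := by
  simp only [fsK, hh_add_right]; ring

lemma fsK_smul_left : fsK p (c • x) y = c * fsK p x y := by
  simp only [fsK, hh_smul_left]; ring

lemma fsK_smul_right : fsK p x (c • y) = starRingEnd ℂ c * fsK p x y := by
  simp only [fsK, hh_smul_right]; ring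

lemma conj_fsK : starRingEnd ℂ (fsK p x y) = fsK p y x := by
  simp only [fsK, map_div₀, map_sub, map_mul, map_pow, conj_hh]; ring

lemma fsK_self_left : fsK p p y = 0 := by
  simp only [fsK]
  rw [div_eq_zero_iff]; left; ring

lemma fsK_self_right : fsK p x p = 0 := by
  simp only [fsK]
  rw [div_eq_zero_iff]; left; ring

lemma fsK_rescale {c : ℂ} (hc : c ≠ 0) (s t : ℂ) :
    fsK (c • p) (c • x + s • p) (c • y + t • p) = fsK p x y := by
  have h1 : ∀ x y, fsK (c • p) x y = fsK p x y / (c * starRingEnd ℂ c) := by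
    intro x y
    have hc' : starRingEnd ℂ c ≠ 0 := by simpa using hc
    by_cases hp : hh p p = 0
    · simp only [fsK, hh_smul_left, hh_smul_right, hp]; simp
    · simp only [fsK, hh_smul_left, hh_smul_right]
      field_simp
  have hc' : starRingEnd ℂ c ≠ 0 := by simpa using hc
  simp only [h1, fsK_add_left, fsK_add_right, fsK_smul_left, fsK_smul_right, fsK_self_left,
    fsK_self_right]
  field_simp
  ring

/-- The Fubini–Study form at a bivector. -/
noncomputable def fs {n : ℕ} (p : Biv n) : (Biv n) [⋀^Fin 2]→ₗ[ℝ] ℝ :=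
  altOfBilin
    (LinearMap.mk₂ ℝ (fun x y => (fsK p x y).im)
      (fun x y z => by rw [fsK_add_left, Complex.add_im])
      (fun c x y => by
        rw [show c • x = (c : ℂ) • x from (Complex.coe_smul c x).symm, fsK_smul_left,
          Complex.im_ofReal_mul, smul_eq_mul])
      (fun x y z => by rw [fsK_add_right, Complex.add_im])
      (fun c x y => by
        rw [show c • y = (c : ℂ) • y from (Complex.coe_smul c y).symm, fsK_smul_right,
          Complex.conj_ofReal, Complex.im_ofReal_mul, smul_eq_mul]))
    (fun x => by
      show (fsK p x x).im = 0
      rw [← Complex.conj_eq_iff_im, conj_fsK])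

lemma fs_apply (m : Fin 2 → Biv n) : fs p m = (fsK p (m 0) (m 1)).im := rfl

lemma fs_I : fs p ![Complex.I • x, Complex.I • y] = fs p ![x, y] := by
  simp only [fs_apply, Matrix.cons_val_zero, Matrix.cons_val_one, fsK_smul_left, fsK_smul_right]
  rw [← mul_assoc]
  simp

end fs

/-- The `2 × 2` combinations of a frame. -/
def comb {n : ℕ} (g : Fin 2 → Fin 2 → ℂ) (f : Fin 2 → V n) : Fin 2 → V n :=
  fun i => ∑ j, g i j • f j

lemma plucker_comb {n : ℕ} (g : Fin 2 → Fin 2 → ℂ) (f : Fin 2 → V n) :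
    plucker (comb g f) = (g 0 0 * g 1 1 - g 0 1 * g 1 0) • plucker f := by
  funext x; simp [plucker, comb, wdg]; ring

lemma dplucker_comb {n : ℕ} (g c : Fin 2 → Fin 2 → ℂ) (f u : Fin 2 → V n) :
    dplucker (comb g f) (comb g u + comb c f) = (g 0 0 * g 1 1 - g 0 1 * g 1 0) • dplucker f u +
      (c 0 0 * g 1 1 - c 0 1 * g 1 0 + g 0 0 * c 1 1 - g 0 1 * c 1 0) • plucker f := by
  funext x; simp [plucker, dplucker_apply, comb, wdg]; ring

lemma hh_plucker_lin {n : ℕ} (g : SU n) (a b c d : V n) :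
    hh (wdg (lin g a) (lin g b)) (wdg (lin g c) (lin g d)) = hh (wdg a b) (wdg c d) := by
  simp only [hh_wdg, hf_lin]

lemma fsK_lin {n : ℕ} (g : SU n) (f u w : Fin 2 → V n) :
    fsK (plucker fun i => lin g (f i)) (dplucker (fun i => lin g (f i)) fun i => lin g (u i))
      (dplucker (fun i => lin g (f i)) fun i => lin g (w i)) =
    fsK (plucker f) (dplucker f u) (dplucker f w) := by
  simp only [fsK, dplucker_apply, plucker, hh_add_left, hh_add_right, hh_plucker_lin]

end CHyp

namespace CHyp

/-! ### Elements of `SU(n,1)` and transitivity on complex geodesics -/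

/-- Up to a phase, every isometry of `h` belongs to `SU(n,1)`. -/
lemma exists_SU_of_isometry {n : ℕ} (T : V n →ₗ[ℂ] V n) (hT : ∀ v w, hf (T v) (T w) = hf v w) :
    ∃ (g : SU n) (ζ : ℂ), ζ ≠ 0 ∧ ∀ v, lin g v = ζ • T v := by
  set M := LinearMap.toMatrix' T with hM
  have hMv : ∀ v, M.mulVec v = T v := fun v => by rw [hM, LinearMap.toMatrix'_mulVec]
  have h1 : M.conjTranspose * formMatrix n * M = formMatrix n := by
    apply Matrix.ext_of_mulVec_single
    intro j
    funext i
    have := hT (Pi.single j 1) (Pi.single i 1)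
    rw [hf_eq_dotProduct, hf_eq_dotProduct, ← hMv, ← hMv, Matrix.star_mulVec,
      Matrix.mulVec_mulVec, ← Matrix.dotProduct_mulVec, Matrix.mulVec_mulVec,
      ← Matrix.mul_assoc] at this
    simpa using this
  have hdJ : (formMatrix n).det ≠ 0 := by
    simp [formMatrix, Matrix.det_diagonal, Fintype.prod_sum_type]
  have hdet : starRingEnd ℂ M.det * M.det = 1 := by
    have h2 := congrArg Matrix.det h1
    rw [Matrix.det_mul, Matrix.det_mul, Matrix.det_conjTranspose] at h2
    have h3 : (formMatrix n).det * (star M.det * M.det) = (formMatrix n).det * 1 := by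
      rw [mul_one]; nth_rewrite 2 [← h2]; ring
    exact mul_left_cancel₀ hdJ h3
  obtain ⟨ζ, hζ⟩ : ∃ ζ : ℂ, ζ ^ (n + 1) = M.det⁻¹ :=
    IsAlgClosed.exists_pow_nat_eq _ (Nat.succ_pos n)
  have hM0 : M.det ≠ 0 := fun h => by simp [h] at hdet
  have hζ0 : ζ ≠ 0 := by
    rintro rfl
    rw [zero_pow (Nat.succ_ne_zero n)] at hζ
    exact inv_ne_zero hM0 hζ.symm
  have hζ1 : ‖ζ‖ = 1 := by
    have h3 : ‖M.det‖ = 1 := by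
      have := congrArg norm hdet
      rw [norm_mul, RCLike.norm_conj, norm_one] at this
      nlinarith [norm_nonneg M.det]
    have := congrArg norm hζ
    rw [norm_pow, norm_inv, h3, inv_one] at this
    exact (pow_eq_one_iff_of_nonneg (norm_nonneg _) (Nat.succ_ne_zero n)).1 this
  have hζc : starRingEnd ℂ ζ * ζ = 1 := by
    rw [Complex.conj_mul', hζ1]; simp
  refine ⟨⟨⟨ζ • M, ?_⟩, ?_⟩, ζ, hζ0, fun v => ?_⟩
  · rw [Matrix.det_smul]
    simp only [Fintype.card_sum, Fintype.card_fin, Fintype.card_unit]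
    rw [hζ, inv_mul_cancel₀ hM0]
  · show (ζ • M).conjTranspose * formMatrix n * (ζ • M) = formMatrix n
    rw [Matrix.conjTranspose_smul, Matrix.smul_mul, Matrix.smul_mul, Matrix.mul_smul, smul_smul,
      h1]
    show (starRingEnd ℂ ζ * ζ) • _ = _
    rw [hζc, one_smul]
  · rw [lin_apply, ← hMv]
    exact Matrix.smul_mulVec ζ M v

lemma smul_plane {n : ℕ} (g : SU n) (W : Geodesic n) :
    (g • W).plane = W.plane.map (lin g : V n →ₗ[ℂ] V n) := rfl

/-- The standard basis vectors of `ℂ^{n+1}`. -/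
def eV {n : ℕ} (i : Fin n ⊕ Unit) : V n := Pi.single i 1

/-- The frame of the base point of the space of complex geodesics. -/
def baseFrame (m : ℕ) : Fin 2 → V (m + 1) := ![eV (Sum.inr ()), eV (Sum.inl 0)]

lemma q_eV_inr {n : ℕ} : q (eV (n := n) (Sum.inr ())) = -1 := by
  simp [q, eV]

lemma baseFrame_mem (m : ℕ) : baseFrame m ∈ frames (m + 1) := by
  refine ⟨?_, eV (Sum.inr ()), Submodule.subset_span ⟨0, rfl⟩, by rw [q_eV_inr]; norm_num⟩
  rw [baseFrame, LinearIndependent.pair_iff]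
  intro s t h
  exact ⟨by simpa [eV] using congrFun h (Sum.inr ()), by simpa [eV] using congrFun h (Sum.inl 0)⟩

/-- The base point of the space of complex geodesics. -/
def baseGeo (m : ℕ) : Geodesic (m + 1) := spanGeo (baseFrame m) (baseFrame_mem m)

/-- The boost in the coordinates `0` and `n + 1`. -/
def boost {m : ℕ} (c s : ℝ) : V (m + 1) →ₗ[ℂ] V (m + 1) where
  toFun v := Sum.elim (Fin.cons (c * v (Sum.inl 0) + s * v (Sum.inr ())) fun i => v (Sum.inl i.succ))
    (fun _ => s * v (Sum.inl 0) + c * v (Sum.inr ()))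
  map_add' v w := by
    funext i
    rcases i with i | i
    · refine Fin.cases ?_ (fun i => ?_) i <;> simp; ring
    · simp; ring
  map_smul' r v := by
    funext i
    rcases i with i | i
    · refine Fin.cases ?_ (fun i => ?_) i <;> simp; ring
    · simp; ring

lemma boost_isometry {m : ℕ} {c s : ℝ} (h : c ^ 2 - s ^ 2 = 1) (v w : V (m + 1)) :
    hf (boost c s v) (boost c s w) = hf v w := by
  have hcs : (c : ℂ) ^ 2 - (s : ℂ) ^ 2 = 1 := by exact_mod_cast h
  simp only [hf, boost, LinearMap.coe_mk, AddHom.coe_mk, Fintype.sum_sum_type, Fin.sum_univ_succ,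
    Sum.elim_inl, Sum.elim_inr, sgn_inl, sgn_inr, Fin.cons_zero, Fin.cons_succ, map_add, map_mul,
    Complex.conj_ofReal, Finset.univ_unique, Finset.sum_singleton, PUnit.default_eq_unit]
  linear_combination (v (Sum.inl 0) * (starRingEnd ℂ) (w (Sum.inl 0)) -
    v (Sum.inr ()) * (starRingEnd ℂ) (w (Sum.inr ()))) * hcs

/-- A linear map of `ℂ^n`, extended to `ℂ^{n+1}`. -/
def extend {n : ℕ} (K : (Fin n → ℂ) →ₗ[ℂ] (Fin n → ℂ)) : V n →ₗ[ℂ] V n where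
  toFun v := Sum.elim (K fun i => v (Sum.inl i)) (fun i => v (Sum.inr i))
  map_add' v w := by
    funext i
    rcases i with i | i
    · exact congrFun (map_add K (fun i => v (Sum.inl i)) fun i => w (Sum.inl i)) i
    · simp
  map_smul' c v := by
    funext i
    rcases i with i | i
    · exact congrFun (map_smul K c fun i => v (Sum.inl i)) i
    · simp

lemma extend_isometry {n : ℕ} {K : (Fin n → ℂ) →ₗ[ℂ] (Fin n → ℂ)}
    (hK : ∀ v w, herm (K v) (K w) = herm v w) (v w : V n) :
    hf (extend K v) (extend K w) = hf v w := by
  have := hK (fun i => v (Sum.inl i)) (fun i => w (Sum.inl i))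
  simp only [herm] at this
  simp [hf, extend, Fintype.sum_sum_type, this]

/-- The unitary group of `ℂ^n` acts transitively on complex lines. -/
lemma exists_unitary {m : ℕ} (v : Fin (m + 1) → ℂ) :
    ∃ (K : (Fin (m + 1) → ℂ) →ₗ[ℂ] (Fin (m + 1) → ℂ)) (r : ℝ), 
      (∀ v w, herm (K v) (K w) = herm v w) ∧ Function.Injective K ∧ K v = Pi.single 0 (r : ℂ) := by
  set x : EuclideanSpace ℂ (Fin (m + 1)) := WithLp.toLp 2 v with hx
  obtain ⟨y, r, hy, hxy⟩ : ∃ (y : EuclideanSpace ℂ (Fin (m + 1))) (r : ℝ), ‖y‖ = 1 ∧ 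
      x = (r : ℂ) • y := by
    by_cases h : x = 0
    · exact ⟨EuclideanSpace.single 0 1, 0, by simp, by simp [h]⟩
    · have h0 : ‖x‖ ≠ 0 := by simpa using h
      refine ⟨((‖x‖ : ℂ)⁻¹) • x, ‖x‖, by simp [norm_smul, h0], ?_⟩
      rw [smul_smul, mul_inv_cancel₀ (by exact_mod_cast h0), one_smul]
  have ho : Orthonormal ℂ (Set.domRestrict {(0 : Fin (m + 1))} (fun _ : Fin (m + 1) => y)) := by
    rw [orthonormal_iff_ite]
    rintro ⟨i, hi⟩ ⟨j, hj⟩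
    have : i = j := by rw [Set.mem_singleton_iff.1 hi, Set.mem_singleton_iff.1 hj]
    subst this
    simp [Set.domRestrict, inner_self_eq_norm_sq_to_K, hy]
  obtain ⟨b, hb⟩ := ho.exists_orthonormalBasis_extension_of_card_eq (by simp)
  have hb0 : b 0 = y := hb 0 rfl
  let e := WithLp.linearEquiv 2 ℂ (Fin (m + 1) → ℂ)
  refine ⟨(e.symm.trans (b.repr.toLinearEquiv.trans e)).toLinearMap, r, fun v w => ?_,
    LinearEquiv.injective _, ?_⟩
  · have h1 : ∀ v w : EuclideanSpace ℂ (Fin (m + 1)), 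
        herm (fun i => v i) (fun i => w i) = inner ℂ w v := by
      intro v w; simp [herm, PiLp.inner_apply]
    have := b.repr.inner_map_map (e.symm w) (e.symm v)
    rw [← h1, ← h1] at this
    exact this
  · have : b.repr x = (r : ℂ) • EuclideanSpace.single 0 1 := by
      rw [hxy, map_smul, ← hb0, b.repr_self]
    show e (b.repr x) = _
    rw [this]
    funext i
    simp [e, Pi.single_apply]

lemma exists_SU_map_plane {n : ℕ} (T : V n →ₗ[ℂ] V n) (hT : ∀ v w, hf (T v) (T w) = hf v w)
    (W : Geodesic n) : ∃ g : SU n, (g • W).plane = W.plane.map T := by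
  obtain ⟨g, ζ, hζ, hg⟩ := exists_SU_of_isometry T hT
  refine ⟨g, ?_⟩
  rw [smul_plane, show (lin g : V n →ₗ[ℂ] V n) = ζ • T from LinearMap.ext hg,
    Submodule.map_smul _ _ _ hζ]

lemma lift_mem_plane {n : ℕ} (W : Geodesic n) : ∃ z ∈ ball n, lift z ∈ W.plane := by
  obtain ⟨v, hv, hq⟩ := W.exists_neg
  have h0 := last_ne_zero hq
  have e : lift (fun i => v (Sum.inl i) / v (Sum.inr ())) = (v (Sum.inr ()))⁻¹ • v := by
    funext i
    rcases i with i | i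
    · simp [lift, div_eq_inv_mul]
    · simp [lift, h0]
  refine ⟨fun i => v (Sum.inl i) / v (Sum.inr ()), ?_, ?_⟩
  · have : q ((v (Sum.inr ()))⁻¹ • v) < 0 := by
      rw [q_smul]
      have : 0 < ‖(v (Sum.inr ()))⁻¹‖ ^ 2 := by
        have := norm_pos_iff.2 (inv_ne_zero h0)
        positivity
      nlinarith
    rw [← e, q_lift] at this
    show ∑ i, ‖_‖ ^ 2 < 1
    linarith
  · rw [e]; exact W.plane.smul_mem _ hv

lemma exists_smul_eV_mem {m : ℕ} (W : Geodesic (m + 1)) :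
    ∃ g : SU (m + 1), eV (Sum.inr ()) ∈ (g • W).plane := by
  obtain ⟨z, hz, hzW⟩ := lift_mem_plane W
  obtain ⟨K, r, hK, -, hKz⟩ := exists_unitary z
  obtain ⟨g, hg⟩ := exists_SU_map_plane _ (extend_isometry hK) W
  have hr : r ^ 2 < 1 := by
    have h1 : herm z z = ((r ^ 2 : ℝ) : ℂ) := by
      rw [← hK, hKz]
      simp [herm, Pi.single_apply, sq]
    have h2 : herm z z = ((∑ i, ‖z i‖ ^ 2 : ℝ) : ℂ) := by
      simp [herm, Complex.mul_conj']
    have h3 : ∑ i, ‖z i‖ ^ 2 < 1 := hz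
    have h4 : (∑ i, ‖z i‖ ^ 2) = r ^ 2 := by exact_mod_cast h2.symm.trans h1
    linarith
  set c : ℝ := (Real.sqrt (1 - r ^ 2))⁻¹ with hc
  have hpos : 0 < 1 - r ^ 2 := by linarith
  have hc2 : c ^ 2 * (1 - r ^ 2) = 1 := by
    rw [hc, inv_pow, Real.sq_sqrt hpos.le, inv_mul_cancel₀ hpos.ne']
  have hcs : c ^ 2 - (-(r * c)) ^ 2 = 1 := by linarith [hc2, (by ring : c ^ 2 * (1 - r ^ 2) = c ^ 2 - (-(r * c)) ^ 2)]
  obtain ⟨g', hg'⟩ := exists_SU_map_plane _ (boost_isometry hcs) (g • W)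
  refine ⟨g' * g, ?_⟩
  rw [mul_smul, hg', hg]
  have hmem := Submodule.mem_map_of_mem (f := boost c (-(r * c)))
    (Submodule.mem_map_of_mem (f := extend K) hzW)
  have hcz : (c : ℂ) ≠ 0 := by
    rw [hc]; exact_mod_cast inv_ne_zero (Real.sqrt_pos.2 hpos).ne'
  have e : boost c (-(r * c)) (extend K (lift z)) = ((c : ℂ)⁻¹) • eV (Sum.inr ()) := by
    have hKz' : (extend K (lift z)) = Sum.elim (Pi.single 0 (r : ℂ)) fun _ => 1 := by
      rw [← hKz]; rfl
    rw [hKz']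
    funext i
    rcases i with i | i
    · refine Fin.cases ?_ (fun i => ?_) i
      · simp [boost, eV]; ring
      · simp [boost, eV]
    · have hc2' : (c : ℂ) ^ 2 * (1 - (r : ℂ) ^ 2) = 1 := by exact_mod_cast hc2
      simp [boost, eV]
      field_simp
      linear_combination hc2'
  rw [e] at hmem
  have := Submodule.smul_mem _ (c : ℂ) hmem
  rwa [smul_smul, mul_inv_cancel₀ hcz, one_smul] at this

/-- `SU(n,1)` acts transitively on complex geodesics. -/
theorem exists_smul_eq_baseGeo {m : ℕ} (W : Geodesic (m + 1)) :
    ∃ g : SU (m + 1), g • W = baseGeo m := by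
  obtain ⟨g, hg⟩ := exists_smul_eV_mem W
  obtain ⟨w, hw, hw'⟩ : ∃ w ∈ (g • W).plane, w ∉ Submodule.span ℂ {eV (n := m + 1) (Sum.inr ())} := by
    by_contra! h
    have h1 := Submodule.finrank_mono (R := ℂ) (s := (g • W).plane)
      (t := Submodule.span ℂ {eV (n := m + 1) (Sum.inr ())}) h
    rw [(g • W).finrank_eq] at h1
    have h2 := finrank_span_le_card (R := ℂ) {eV (n := m + 1) (Sum.inr ())}
    simp only [Set.toFinset_singleton, Finset.card_singleton] at h2
    omega
  set v : Fin (m + 1) → ℂ := fun i => w (Sum.inl i) with hv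
  have hwv : w = vec v + w (Sum.inr ()) • eV (Sum.inr ()) := by
    funext i
    rcases i with i | i <;> simp [vec, eV, hv]
  have hv0 : v ≠ 0 := by
    intro h0
    apply hw'
    rw [hwv, h0]
    have : vec (0 : Fin (m + 1) → ℂ) = 0 := by funext i; rcases i with i | i <;> simp [vec]
    rw [this, zero_add]
    exact Submodule.smul_mem _ _ (Submodule.mem_span_singleton_self _)
  have hvW : vec v ∈ (g • W).plane := by
    have : vec v = w - w (Sum.inr ()) • eV (Sum.inr ()) := by
      rw [eq_sub_iff_add_eq]; exact hwv.symm
    rw [this]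
    exact Submodule.sub_mem _ hw (Submodule.smul_mem _ _ hg)
  obtain ⟨K, r, hK, hKi, hKv⟩ := exists_unitary v
  obtain ⟨g', hg'⟩ := exists_SU_map_plane _ (extend_isometry hK) (g • W)
  refine ⟨g' * g, ?_⟩
  rw [mul_smul]
  have hr : (r : ℂ) ≠ 0 := by
    intro h
    rw [h, Pi.single_zero] at hKv
    exact hv0 (hKi (by rw [hKv, map_zero]))
  apply Geodesic.ext
  symm
  apply Submodule.eq_of_le_of_finrank_eq
  · show Submodule.span ℂ (Set.range (baseFrame m)) ≤ _
    rw [Submodule.span_le, hg']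
    rintro _ ⟨i, rfl⟩
    fin_cases i
    · refine ⟨_, hg, ?_⟩
      funext i
      rcases i with i | i
      · have : (fun i => eV (n := m + 1) (Sum.inr ()) (Sum.inl i)) = 0 := by funext i; simp [eV]
        show K (fun i => eV (n := m + 1) (Sum.inr ()) (Sum.inl i)) i = _
        rw [this, map_zero]
        simp [baseFrame, eV]
      · simp [extend, baseFrame, eV]
    · have h1 := Submodule.mem_map_of_mem (f := extend K) hvW
      have e : extend K (vec v) = (r : ℂ) • eV (Sum.inl 0) := by
        have : extend K (vec v) = Sum.elim (K v) fun _ => 0 := rfl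
        rw [this, hKv]
        funext i
        rcases i with i | i <;> simp [eV, Pi.single_apply]
      rw [e] at h1
      have := Submodule.smul_mem _ (r : ℂ)⁻¹ h1
      rwa [smul_smul, inv_mul_cancel₀ hr, one_smul] at this
  · rw [Geodesic.finrank_eq, Geodesic.finrank_eq]

end CHyp

namespace CHyp

/-! ### The invariant form on the space of complex geodesics -/

/-- A basis of the plane of a complex geodesic. -/
noncomputable def geoBasis {n : ℕ} (W : Geodesic n) : Module.Basis (Fin 2) ℂ W.plane :=
  Module.finBasisOfFinrankEq ℂ W.plane W.finrank_eq

/-- The vectors of `geoBasis`. -/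
noncomputable def geoFrame {n : ℕ} (W : Geodesic n) : Fin 2 → V n := fun i => (geoBasis W i : V n)

lemma exists_section {n : ℕ} (W : Geodesic n) :
    ∃ s : (V n ⧸ W.plane) →ₗ[ℂ] V n, W.plane.mkQ ∘ₗ s = LinearMap.id :=
  LinearMap.exists_rightInverse_of_surjective _ (Submodule.range_mkQ _)

/-- The values of a tangent vector on `geoFrame`, lifted to `ℂ^{n+1}`. -/
noncomputable def liftTan {n : ℕ} (W : Geodesic n) : TanGeo W →ₗ[ℂ] (Fin 2 → V n) :=
  LinearMap.pi fun i => (exists_section W).choose ∘ₗ LinearMap.applyₗ (geoBasis W i)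

lemma mkQ_liftTan {n : ℕ} (W : Geodesic n) (A : TanGeo W) (i : Fin 2) :
    W.plane.mkQ (liftTan W A i) = A (geoBasis W i) :=
  LinearMap.congr_fun (exists_section W).choose_spec (A (geoBasis W i))

/-- The invariant indefinite Kähler form on the space of complex geodesics: the pullback of
the Fubini–Study form of bivectors. -/
noncomputable def geoOmega (n : ℕ) : GeoForm n := fun W =>
  (fs (plucker (geoFrame W))).compLinearMap
    ((dplucker (geoFrame W) ∘ₗ liftTan W).restrictScalars ℝ)

lemma det_ne_zero_of_comb {n : ℕ} {g : Fin 2 → Fin 2 → ℂ} {f : Fin 2 → V n}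
    (hf : LinearIndependent ℂ (comb g f)) : g 0 0 * g 1 1 - g 0 1 * g 1 0 ≠ 0 := by
  intro h
  have h0 : comb g f = ![comb g f 0, comb g f 1] := by funext i; fin_cases i <;> rfl
  rw [h0, LinearIndependent.pair_iff] at hf
  have e1 : g 1 1 • comb g f 0 + (-g 0 1) • comb g f 1 = 0 := by
    funext x
    simp only [comb, Fin.sum_univ_two, Pi.add_apply, Pi.smul_apply, smul_eq_mul, Pi.zero_apply]
    linear_combination (f 0 x) * h
  have e2 : g 1 0 • comb g f 0 + (-g 0 0) • comb g f 1 = 0 := by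
    funext x
    simp only [comb, Fin.sum_univ_two, Pi.add_apply, Pi.smul_apply, smul_eq_mul, Pi.zero_apply]
    linear_combination (-f 1 x) * h
  obtain ⟨a, b⟩ := hf _ _ e1
  obtain ⟨c, d⟩ := hf _ _ e2
  have : comb g f 0 = 0 := by
    simp only [comb, Fin.sum_univ_two]
    rw [neg_eq_zero.1 b, neg_eq_zero.1 d]
    simp
  have := (hf 1 0 (by simp [this])).1
  exact one_ne_zero this

/-- Vectors of a plane are combinations of any frame of it. -/
lemma exists_comb {n : ℕ} {f f' : Fin 2 → V n}
    (h : ∀ i, f' i ∈ Submodule.span ℂ (Set.range f)) : ∃ g, f' = comb g f := by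
  choose g hg using fun i => (Submodule.mem_span_range_iff_exists_fun ℂ).1 (h i)
  exact ⟨g, funext fun i => (hg i).symm⟩

lemma span_geoFrame {n : ℕ} (W : Geodesic n) :
    Submodule.span ℂ (Set.range (geoFrame W)) = W.plane := by
  have h := (geoBasis W).span_eq
  have h2 := congrArg (Submodule.map W.plane.subtype) h
  rw [Submodule.map_span, Submodule.map_top, Submodule.range_subtype, ← Set.range_comp] at h2
  exact h2

lemma geoFrame_mem {n : ℕ} (W : Geodesic n) : geoFrame W ∈ frames n := by
  refine ⟨(geoBasis W).linearIndependent.map' W.plane.subtype (Submodule.ker_subtype _), ?_⟩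
  rw [span_geoFrame]
  exact W.exists_neg

lemma exists_dplucker_eq {n : ℕ} (W : Geodesic n) (g : Fin 2 → Fin 2 → ℂ) (A : TanGeo W)
    (u : Fin 2 → V n) (hmem : ∀ i, comb g (geoFrame W) i ∈ W.plane)
    (hu : ∀ i, W.plane.mkQ (u i) = A ⟨comb g (geoFrame W) i, hmem i⟩) :
    ∃ s : ℂ, dplucker (comb g (geoFrame W)) u =
      (g 0 0 * g 1 1 - g 0 1 * g 1 0) • dplucker (geoFrame W) (liftTan W A) +
        s • plucker (geoFrame W) := by
  have h1 : ∀ i, (u - comb g (liftTan W A)) i ∈ Submodule.span ℂ (Set.range (geoFrame W)) := by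
    intro i
    rw [span_geoFrame, ← Submodule.Quotient.mk_eq_zero]
    show W.plane.mkQ ((u - comb g (liftTan W A)) i) = 0
    rw [Pi.sub_apply, map_sub, hu, sub_eq_zero]
    have : (⟨comb g (geoFrame W) i, hmem i⟩ : W.plane) = ∑ j, g i j • geoBasis W j := by
      apply Subtype.ext
      simp [comb, geoFrame]
    rw [this, map_sum]
    simp only [comb, map_sum, map_smul, mkQ_liftTan]
  obtain ⟨c, hc⟩ := exists_comb h1
  have : u = comb g (liftTan W A) + comb c (geoFrame W) := by rw [← hc]; abel
  rw [this, dplucker_comb]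
  exact ⟨_, rfl⟩

/-- The form can be computed with any frame. -/
lemma geoOmega_eq {n : ℕ} (W : Geodesic n) (f : Fin 2 → V n) (hf : LinearIndependent ℂ f)
    (hmem : ∀ i, f i ∈ W.plane) (A B : TanGeo W) (u w : Fin 2 → V n)
    (hu : ∀ i, W.plane.mkQ (u i) = A ⟨f i, hmem i⟩)
    (hw : ∀ i, W.plane.mkQ (w i) = B ⟨f i, hmem i⟩) :
    geoOmega n W ![A, B] = fs (plucker f) ![dplucker f u, dplucker f w] := by
  obtain ⟨g, rfl⟩ := exists_comb (f := geoFrame W) (f' := f) fun i => by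
    rw [span_geoFrame]; exact hmem i
  obtain ⟨s, hs⟩ := exists_dplucker_eq W g A u hmem hu
  obtain ⟨t, ht⟩ := exists_dplucker_eq W g B w hmem hw
  have hd := det_ne_zero_of_comb hf
  rw [hs, ht, plucker_comb, fs_apply]
  simp only [Matrix.cons_val_zero, Matrix.cons_val_one]
  rw [fsK_rescale _ _ _ hd]
  simp [geoOmega, fs_apply]

lemma linearIndependent_lin {n : ℕ} (g : SU n) {f : Fin 2 → V n} (hf : LinearIndependent ℂ f) :
    LinearIndependent ℂ fun i => lin g (f i) :=
  hf.map' (lin g : V n →ₗ[ℂ] V n) (LinearEquiv.ker _)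

lemma dgeo_apply {n : ℕ} (g : SU n) (W : Geodesic n) (A : TanGeo W) (x : V n) (hx : x ∈ W.plane)
    (hgx : lin g x ∈ (g • W).plane) (u : V n) (hu : W.plane.mkQ u = A ⟨x, hx⟩) :
    dgeo g W A ⟨lin g x, hgx⟩ = (g • W).plane.mkQ (lin g u) := by
  have h1 : ((lin g).submoduleMap W.plane).symm ⟨lin g x, hgx⟩ = ⟨x, hx⟩ := by
    rw [LinearEquiv.symm_apply_eq]
    rfl
  have h2 : dgeo g W A ⟨lin g x, hgx⟩ = Submodule.Quotient.equiv W.plane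
      (W.plane.map (lin g : V n →ₗ[ℂ] V n)) (lin g) rfl
      (A (((lin g).submoduleMap W.plane).symm ⟨lin g x, hgx⟩)) := rfl
  rw [h2, h1, ← hu]
  rfl

lemma geoOmega_invariant (n : ℕ) : (geoOmega n).Invariant := by
  intro g W A B
  have hm : ∀ i, lin g (geoFrame W i) ∈ (g • W).plane := fun i =>
    Submodule.mem_map_of_mem (geoBasis W i).2
  rw [geoOmega_eq (g • W) (fun i => lin g (geoFrame W i))
    (linearIndependent_lin g (geoFrame_mem W).1) hm _ _
    (fun i => lin g (liftTan W A i)) (fun i => lin g (liftTan W B i))]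
  · rw [fs_apply]
    simp only [Matrix.cons_val_zero, Matrix.cons_val_one]
    rw [fsK_lin]
    rfl
  · intro i
    rw [dgeo_apply g W A (geoFrame W i) (geoBasis W i).2 (hm i) _ (mkQ_liftTan W A i)]
  · intro i
    rw [dgeo_apply g W B (geoFrame W i) (geoBasis W i).2 (hm i) _ (mkQ_liftTan W B i)]

lemma dspan_apply {n : ℕ} (f : Fin 2 → V n) (hf : f ∈ frames n) (u : Fin 2 → V n) (i : Fin 2)
    (h : f i ∈ (spanGeo f hf).plane) :
    dspan f hf u ⟨f i, h⟩ = (spanGeo f hf).plane.mkQ (u i) := by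
  have e : (⟨f i, h⟩ : (spanGeo f hf).plane) = Module.Basis.span hf.1 i :=
    (Module.Basis.span_apply hf.1 i).symm
  rw [e]
  exact Module.Basis.constr_basis (Module.Basis.span hf.1) ℂ _ i

lemma pull_apply {n : ℕ} (ω : GeoForm n) {f : Fin 2 → V n} (hf : f ∈ frames n)
    (m : Fin 2 → Fin 2 → V n) :
    ω.pull f m = ω (spanGeo f hf) ![dspan f hf (m 0), dspan f hf (m 1)] := by
  rw [GeoForm.pull, dif_pos hf]
  show (ω (spanGeo f hf)) (fun i => dspan f hf (m i)) = _
  congr 1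
  funext i; fin_cases i <;> rfl

lemma pull_geoOmega {n : ℕ} {f : Fin 2 → V n} (hf : f ∈ frames n) (m : Fin 2 → Fin 2 → V n) :
    (geoOmega n).pull f m = fs (plucker f) ![dplucker f (m 0), dplucker f (m 1)] := by
  rw [pull_apply _ hf]
  have hm : ∀ i, f i ∈ (spanGeo f hf).plane := fun i => Submodule.subset_span ⟨i, rfl⟩
  exact geoOmega_eq _ f hf.1 hm _ _ _ _ (fun i => (dspan_apply f hf _ i _).symm)
    (fun i => (dspan_apply f hf _ i _).symm)

lemma geoOmega_type {n : ℕ} (W : Geodesic n) (A B : TanGeo W) :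
    geoOmega n W ![Complex.I • A, Complex.I • B] = geoOmega n W ![A, B] := by
  have h := fs_I (plucker (geoFrame W)) (dplucker (geoFrame W) (liftTan W A))
    (dplucker (geoFrame W) (liftTan W B))
  rw [fs_apply, fs_apply] at h
  simpa [geoOmega, fs_apply] using h

/-! ### Non-isotropy of the Plücker vector -/

lemma exists_lin_baseFrame {m : ℕ} {f : Fin 2 → V (m + 1)} (hf : f ∈ frames (m + 1)) :
    ∃ (g : SU (m + 1)) (c : Fin 2 → Fin 2 → ℂ), f = comb c fun i => lin g (baseFrame m i) := by
  obtain ⟨g, hg⟩ := exists_smul_eq_baseGeo (spanGeo f hf)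
  have hg' : spanGeo f hf = g⁻¹ • baseGeo m := by rw [← hg, inv_smul_smul]
  refine ⟨g⁻¹, exists_comb fun i => ?_⟩
  have h1 : f i ∈ (spanGeo f hf).plane := Submodule.subset_span ⟨i, rfl⟩
  rw [hg', smul_plane] at h1
  have h2 : (baseGeo m).plane = Submodule.span ℂ (Set.range (baseFrame m)) := rfl
  rw [h2, Submodule.map_span, ← Set.range_comp] at h1
  exact h1

lemma hf_eV {n : ℕ} (i j : Fin n ⊕ Unit) : hf (eV i) (eV j) = if i = j then sgn i else 0 := by
  simp only [hf, eV, Pi.single_apply]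
  split_ifs with h
  · subst h; simp
  · refine Finset.sum_eq_zero fun k _ => ?_
    by_cases h1 : k = i
    · subst h1; simp [h]
    · simp [h1]

/-- The bivector of a complex geodesic is negative. -/
lemma hh_plucker_neg {m : ℕ} {f : Fin 2 → V (m + 1)} (hf : f ∈ frames (m + 1)) :
    ∃ r : ℝ, 0 < r ∧ hh (plucker f) (plucker f) = -(r : ℂ) := by
  obtain ⟨g, c, rfl⟩ := exists_lin_baseFrame hf
  have hd := det_ne_zero_of_comb hf.1
  rw [plucker_comb, hh_smul_left, hh_smul_right]
  have h1 : hh (plucker fun i => lin g (baseFrame m i)) (plucker fun i => lin g (baseFrame m i))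
      = -2 := by
    simp only [plucker]
    rw [hh_plucker_lin, hh_wdg]
    simp [baseFrame, hf_eV]
  refine ⟨2 * ‖c 0 0 * c 1 1 - c 0 1 * c 1 0‖ ^ 2, by have := norm_pos_iff.2 hd; positivity, ?_⟩
  rw [h1, ← mul_assoc, Complex.mul_conj']
  push_cast
  ring

lemma hh_plucker_ne_zero {m : ℕ} {f : Fin 2 → V (m + 1)} (hf : f ∈ frames (m + 1)) :
    hh (plucker f) (plucker f) ≠ 0 := by
  obtain ⟨r, hr, h⟩ := hh_plucker_neg hf
  rw [h, neg_ne_zero]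
  exact_mod_cast hr.ne'

end CHyp

namespace CHyp

/-! ### Smoothness and closedness -/

lemma contDiffOn_alternating {E F : Type*} [NormedAddCommGroup E] [NormedSpace ℝ E]
    [FiniteDimensional ℝ E] [NormedAddCommGroup F] [NormedSpace ℝ F] {k : ℕ} {N : WithTop ℕ∞}
    {Φ : F → E [⋀^Fin k]→L[ℝ] ℝ} {s : Set F}
    (h : ∀ m : Fin k → E, ContDiffOn ℝ N (fun x => Φ x m) s) : ContDiffOn ℝ N Φ s := by
  let b := Module.finBasis ℝ E
  let ev : (E [⋀^Fin k]→L[ℝ] ℝ) →ₗ[ℝ] ((Fin k → Fin (Module.finrank ℝ E)) → ℝ) :=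
    { toFun := fun a r => a fun i => b (r i)
      map_add' := fun _ _ => rfl
      map_smul' := fun _ _ => rfl }
  have hinj : Function.Injective ev := by
    intro a a' haa
    apply ContinuousAlternatingMap.toAlternatingMap_injective
    refine AlternatingMap.coe_multilinearMap_injective
      (Module.Basis.ext_multilinear (fun _ => b) fun r => ?_)
    exact congrFun haa r
  have : FiniteDimensional ℝ (E [⋀^Fin k]→L[ℝ] ℝ) := FiniteDimensional.of_injective ev hinj
  obtain ⟨l, hl⟩ := LinearMap.exists_leftInverse_of_injective ev (LinearMap.ker_eq_bot.2 hinj)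
  have e : Φ = fun x => LinearMap.toContinuousLinearMap l (ev (Φ x)) := by
    funext x
    exact (LinearMap.congr_fun hl (Φ x)).symm
  rw [e]
  refine (LinearMap.toContinuousLinearMap l).contDiff.comp_contDiffOn ?_
  rw [contDiffOn_pi]
  exact fun r => h _

lemma contDiffOn_hh {F : Type*} [NormedAddCommGroup F] [NormedSpace ℝ F] {n : ℕ}
    {N : WithTop ℕ∞} {s : Set F} {a b : F → Biv n} (ha : ContDiffOn ℝ N a s)
    (hb : ContDiffOn ℝ N b s) : ContDiffOn ℝ N (fun x => hh (a x) (b x)) s := by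
  simp only [hh]
  refine ContDiffOn.sum fun i _ => ?_
  refine contDiffOn_const.mul (ContDiffOn.mul (contDiffOn_pi.1 ha i) ?_)
  exact Complex.conjCLE.contDiff.comp_contDiffOn (contDiffOn_pi.1 hb i)

lemma contDiffOn_complex_div {F : Type*} [NormedAddCommGroup F] [NormedSpace ℝ F]
    {N : WithTop ℕ∞} {s : Set F} {a b : F → ℂ} (ha : ContDiffOn ℝ N a s)
    (hb : ContDiffOn ℝ N b s) (h0 : ∀ x ∈ s, b x ≠ 0) :
    ContDiffOn ℝ N (fun x => a x / b x) s := by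
  simp only [div_eq_mul_inv]
  exact ha.mul (hb.inv h0)

lemma contDiffOn_fsK {F : Type*} [NormedAddCommGroup F] [NormedSpace ℝ F] {n : ℕ}
    {N : WithTop ℕ∞} {s : Set F} {p a b : F → Biv n} (hp : ContDiffOn ℝ N p s)
    (ha : ContDiffOn ℝ N a s) (hb : ContDiffOn ℝ N b s) (h0 : ∀ x ∈ s, hh (p x) (p x) ≠ 0) :
    ContDiffOn ℝ N (fun x => (fsK (p x) (a x) (b x)).im) s := by
  have h : ContDiffOn ℝ N (fun x => fsK (p x) (a x) (b x)) s := by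
    simp only [fsK]
    refine contDiffOn_complex_div ?_ ((contDiffOn_hh hp hp).pow 2) fun x hx => pow_ne_zero 2 (h0 x hx)
    exact ((contDiffOn_hh ha hb).mul (contDiffOn_hh hp hp)).sub
      ((contDiffOn_hh ha hp).mul (contDiffOn_hh hp hb))
  exact Complex.imCLM.contDiff.comp_contDiffOn h

lemma contDiff_wdg {F : Type*} [NormedAddCommGroup F] [NormedSpace ℝ F] {n : ℕ}
    {N : WithTop ℕ∞} {a b : F → V n} (ha : ContDiff ℝ N a) (hb : ContDiff ℝ N b) :
    ContDiff ℝ N fun x => wdg (a x) (b x) := by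
  rw [contDiff_pi]
  intro i
  simp only [wdg]
  rw [contDiff_pi] at ha hb
  exact ((ha i.1).mul (hb i.2)).sub ((ha i.2).mul (hb i.1))

lemma geoOmega_smooth (m : ℕ) : (geoOmega (m + 1)).Smooth := by
  refine contDiffOn_alternating fun v => ?_
  have h0 : ∀ i, ContDiff ℝ ((⊤ : ℕ∞) : WithTop ℕ∞) fun f : Fin 2 → V (m + 1) => f i :=
    fun i => contDiff_apply ℝ _ i
  have h : ContDiffOn ℝ ((⊤ : ℕ∞) : WithTop ℕ∞) (fun f : Fin 2 → V (m + 1) =>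
      (fsK (plucker f) (dplucker f (v 0)) (dplucker f (v 1))).im) (frames (m + 1)) := by
    refine contDiffOn_fsK ?_ ?_ ?_ fun f hf => hh_plucker_ne_zero hf
    · exact (contDiff_wdg (h0 0) (h0 1)).contDiffOn
    · exact ((contDiff_wdg contDiff_const (h0 1)).add
        (contDiff_wdg (h0 0) contDiff_const)).contDiffOn
    · exact ((contDiff_wdg contDiff_const (h0 1)).add
        (contDiff_wdg (h0 0) contDiff_const)).contDiffOn
  exact h.congr fun f hf => pull_geoOmega hf v

/-- A primitive of the Fubini–Study form. -/
noncomputable def fsPrim {n : ℕ} (p : Biv n) : (Biv n) [⋀^Fin 1]→L[ℝ] ℝ :=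
  ContinuousAlternatingMap.ofSubsingleton ℝ (Biv n) ℝ (0 : Fin 1) <|
    LinearMap.toContinuousLinearMap
    { toFun := fun x => (hh x p / hh p p).im
      map_add' := fun x y => by rw [hh_add_left, add_div, Complex.add_im]
      map_smul' := fun c x => by
        rw [show c • x = (c : ℂ) • x from (Complex.coe_smul c x).symm, hh_smul_left, mul_div_assoc,
          Complex.im_ofReal_mul]; rfl }

lemma fsPrim_apply {n : ℕ} (p : Biv n) (v : Fin 1 → Biv n) :
    fsPrim p v = (hh (v 0) p / hh p p).im := rfl

lemma isOpen_hh_ne_zero (n : ℕ) : IsOpen {p : Biv n | hh p p ≠ 0} := by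
  refine isOpen_ne_fun ?_ continuous_const
  have := contDiffOn_hh (N := 0) (s := Set.univ) (n := n) contDiffOn_id contDiffOn_id
  exact (contDiffOn_univ.1 this).continuous

lemma contDiffOn_fsPrim (n : ℕ) (N : WithTop ℕ∞) :
    ContDiffOn ℝ N (fsPrim (n := n)) {p | hh p p ≠ 0} := by
  refine contDiffOn_alternating fun v => ?_
  simp only [fsPrim_apply]
  have h : ContDiffOn ℝ N (fun p : Biv n => hh (v 0) p / hh p p) {p | hh p p ≠ 0} :=
    contDiffOn_complex_div (contDiffOn_hh contDiffOn_const contDiffOn_id)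
      (contDiffOn_hh contDiffOn_id contDiffOn_id) fun p hp => hp
  exact Complex.imCLM.contDiff.comp_contDiffOn h

lemma fderiv_fsPrim {n : ℕ} {p : Biv n} (hp : hh p p ≠ 0) (x y : Biv n) :
    fderiv ℝ (fun p => (hh y p / hh p p).im) p x =
      ((hh y x * hh p p - hh y p * (hh x p + hh p x)) / hh p p ^ 2).im := by
  have hd : DifferentiableAt ℝ (fun p : Biv n => (hh y p / hh p p).im) p := by
    have := (contDiffOn_fsPrim n 1).differentiableOn one_ne_zero
    have h2 := (this p hp).differentiableAt ((isOpen_hh_ne_zero n).mem_nhds hp)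
    have h3 := h2.continuousAlternatingMap_apply_const (fun _ => y)
    exact h3
  rw [← hd.lineDeriv_eq_fderiv]
  have e : ∀ t : ℝ, hh y (p + t • x) / hh (p + t • x) (p + t • x) =
      (hh y p + t * hh y x) / (hh p p + t * (hh x p + hh p x) + t * t * hh x x) := by
    intro t
    rw [show t • x = (t : ℂ) • x from (Complex.coe_smul t x).symm]
    simp only [hh_add_left, hh_add_right, hh_smul_left, hh_smul_right, Complex.conj_ofReal]
    ring
  have ht : HasDerivAt (fun t : ℝ => (t : ℂ)) 1 0 := Complex.ofRealCLM.hasDerivAt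
  have h1 : HasDerivAt (fun t : ℝ => hh y p + t * hh y x) (1 * hh y x) 0 :=
    (ht.mul_const _).const_add _
  have h2 : HasDerivAt (fun t : ℝ => hh p p + t * (hh x p + hh p x) + t * t * hh x x)
      (1 * (hh x p + hh p x) + (1 * ((0 : ℝ) : ℂ) + ((0 : ℝ) : ℂ) * 1) * hh x x) 0 :=
    ((ht.mul_const _).const_add _).add ((ht.mul ht).mul_const _)
  have h3 := h1.div h2 (by simpa using hp)
  have h4 : HasDerivAt (fun t : ℝ => (hh y (p + t • x) / hh (p + t • x) (p + t • x)).im)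
      ((hh y x * hh p p - hh y p * (hh x p + hh p x)) / hh p p ^ 2).im 0 := by
    have := Complex.imCLM.hasFDerivAt.comp_hasDerivAt (0 : ℝ) h3
    refine (this.congr_of_eventuallyEq (Filter.Eventually.of_forall fun t =>
      congrArg Complex.im (e t))).congr_deriv ?_
    simp
  exact h4.deriv

lemma extDeriv_fsPrim {n : ℕ} {p : Biv n} (hp : hh p p ≠ 0) (v : Fin 2 → Biv n) :
    extDeriv fsPrim p v = -2 * fs p v := by
  have hd : DifferentiableAt ℝ (fsPrim (n := n)) p :=
    ((contDiffOn_fsPrim n 1).differentiableOn one_ne_zero p hp).differentiableAt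
      ((isOpen_hh_ne_zero n).mem_nhds hp)
  rw [extDeriv_apply hd]
  refine (Fin.sum_univ_two _).trans ?_
  simp only [fsPrim_apply, Fin.removeNth]
  have e0 : (Fin.succAbove (0 : Fin 2) 0) = 1 := rfl
  have e1 : (Fin.succAbove (1 : Fin 2) 0) = 0 := rfl
  rw [e0, e1, fderiv_fsPrim hp, fderiv_fsPrim hp, fs_apply]
  have hc : ∀ x y, (fsK p x y).im = - (fsK p y x).im := by
    intro x y
    rw [← conj_fsK, Complex.conj_im]
  have hX : (hh (v 1) (v 0) * hh p p - hh (v 1) p * (hh (v 0) p + hh p (v 0))) / hh p p ^ 2 =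
      fsK p (v 1) (v 0) - hh (v 1) p * hh (v 0) p / hh p p ^ 2 := by rw [fsK]; ring
  have hY : (hh (v 0) (v 1) * hh p p - hh (v 0) p * (hh (v 1) p + hh p (v 1))) / hh p p ^ 2 =
      fsK p (v 0) (v 1) - hh (v 1) p * hh (v 0) p / hh p p ^ 2 := by rw [fsK]; ring
  rw [hX, hY, Complex.sub_im, Complex.sub_im, hc (v 1) (v 0)]
  simp
  ring

lemma hasFDerivAt_plucker {n : ℕ} (f : Fin 2 → V n) :
    HasFDerivAt plucker (LinearMap.toContinuousLinearMap ((dplucker f))) f := by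
  rw [hasFDerivAt_pi']
  intro x
  have h : ∀ i j, HasFDerivAt (fun f : Fin 2 → V n => f i j)
      ((ContinuousLinearMap.proj j).comp (ContinuousLinearMap.proj (R := ℂ) (φ := fun _ => V n) i))
      f := fun i j =>
    (ContinuousLinearMap.hasFDerivAt ((ContinuousLinearMap.proj (R := ℂ) j).comp
      (ContinuousLinearMap.proj (R := ℂ) (φ := fun _ => V n) i)))
  have := ((h 0 x.1).mul (h 1 x.2)).sub ((h 0 x.2).mul (h 1 x.1))
  refine this.congr_fderiv ?_
  ext u
  simp [dplucker_apply, wdg]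
  ring

lemma isOpen_frames (n : ℕ) : IsOpen (frames n) := by
  have h1 : IsOpen {f : Fin 2 → V n | LinearIndependent ℂ f} := isOpen_setOfPred_linearIndependent
  have h2 : {f : Fin 2 → V n | ∃ v ∈ Submodule.span ℂ (Set.range f), q v < 0} =
      ⋃ c : Fin 2 → ℂ, {f | q (∑ i, c i • f i) < 0} := by
    ext f
    simp only [Set.mem_ofPred_eq, Submodule.mem_span_range_iff_exists_fun, Set.mem_iUnion]
    constructor
    · rintro ⟨v, ⟨c, rfl⟩, h⟩
      exact ⟨c, h⟩
    · rintro ⟨c, h⟩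
      exact ⟨_, ⟨c, rfl⟩, h⟩
  have h3 : frames n = {f | LinearIndependent ℂ f} ∩
      {f | ∃ v ∈ Submodule.span ℂ (Set.range f), q v < 0} := rfl
  rw [h3, h2]
  refine h1.inter (isOpen_iUnion fun c => isOpen_lt ?_ continuous_const)
  simp only [q]
  fun_prop

lemma geoOmega_closed (m : ℕ) : (geoOmega (m + 1)).Closed := by
  intro f hf
  have hR : ∀ f : Fin 2 → V (m + 1), HasFDerivAt plucker
      ((LinearMap.toContinuousLinearMap (dplucker f)).restrictScalars ℝ) f :=
    fun f => (hasFDerivAt_plucker f).restrictScalars ℝ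
  have h0 : ∀ i, ContDiff ℝ ((⊤ : ℕ∞) : WithTop ℕ∞) fun f : Fin 2 → V (m + 1) => f i :=
    fun i => contDiff_apply ℝ _ i
  have hcd : ContDiff ℝ ((⊤ : ℕ∞) : WithTop ℕ∞) (plucker (n := m + 1)) :=
    contDiff_wdg (h0 0) (h0 1)
  have hmin : minSmoothness ℝ 2 ≤ ((⊤ : ℕ∞) : WithTop ℕ∞) := by
    rw [minSmoothness_of_isRCLikeNormedField]; exact WithTop.coe_le_coe.2 le_top
  have hO := isOpen_hh_ne_zero (m + 1)
  set η : (Fin 2 → V (m + 1)) → (Fin 2 → V (m + 1)) [⋀^Fin 1]→L[ℝ] ℝ := fun f =>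
    (fsPrim (plucker f)).compContinuousLinearMap (fderiv ℝ plucker f) with hη
  have hηs : ContDiffOn ℝ ((⊤ : ℕ∞) : WithTop ℕ∞) η (frames (m + 1)) := by
    refine contDiffOn_alternating fun v => ?_
    have e : ∀ f, η f v = (hh (dplucker f (v 0)) (plucker f) / hh (plucker f) (plucker f)).im := by
      intro f
      rw [hη]
      simp only [ContinuousAlternatingMap.compContinuousLinearMap_apply, fsPrim_apply,
        (hR f).fderiv]
      rfl
    simp only [e]
    have h1 : ContDiffOn ℝ ((⊤ : ℕ∞) : WithTop ℕ∞) (fun f =>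
        hh (dplucker f (v 0)) (plucker f) / hh (plucker f) (plucker f)) (frames (m + 1)) :=
      contDiffOn_complex_div (contDiffOn_hh ((contDiff_wdg contDiff_const (h0 1)).add
        (contDiff_wdg (h0 0) contDiff_const)).contDiffOn hcd.contDiffOn)
        (contDiffOn_hh hcd.contDiffOn hcd.contDiffOn) fun f hf => hh_plucker_ne_zero hf
    exact Complex.imCLM.contDiff.comp_contDiffOn h1
  have key : (geoOmega (m + 1)).pull =ᶠ[nhds f] (-1 / 2 : ℝ) • extDeriv η := by
    filter_upwards [(isOpen_frames (m + 1)).mem_nhds hf] with f hf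
    have hd : DifferentiableAt ℝ (fsPrim (n := m + 1)) (plucker f) :=
      ((contDiffOn_fsPrim (m + 1) 1).differentiableOn one_ne_zero _
        (hh_plucker_ne_zero hf)).differentiableAt (hO.mem_nhds (hh_plucker_ne_zero hf))
    rw [Pi.smul_apply, hη, extDeriv_pullback hd hcd.contDiffAt hmin]
    ext v
    rw [pull_geoOmega hf, (hR f).fderiv]
    simp only [ContinuousAlternatingMap.compContinuousLinearMap_apply,
      ContinuousAlternatingMap.smul_apply, extDeriv_fsPrim (hh_plucker_ne_zero hf), fs_apply]
    simp
    ring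
  rw [key.extDeriv_eq, extDeriv_smul, extDeriv_extDeriv_apply
    (hηs.contDiffAt ((isOpen_frames (m + 1)).mem_nhds hf)) hmin, smul_zero]

end CHyp

namespace CHyp

/-! ### Invariant forms at the base point -/

lemma GeoForm.Invariant.apply_eq {n : ℕ} {ω : GeoForm n} (hω : ω.Invariant) (g : SU n)
    (W W' : Geodesic n) (hW : g • W = W') (A B : TanGeo W) (A' B' : TanGeo W')
    (hA : ∀ x (hx : x ∈ W.plane) (hx' : lin g x ∈ W'.plane) u, W.plane.mkQ u = A ⟨x, hx⟩ →
      A' ⟨lin g x, hx'⟩ = W'.plane.mkQ (lin g u))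
    (hB : ∀ x (hx : x ∈ W.plane) (hx' : lin g x ∈ W'.plane) u, W.plane.mkQ u = B ⟨x, hx⟩ →
      B' ⟨lin g x, hx'⟩ = W'.plane.mkQ (lin g u)) :
    ω W' ![A', B'] = ω W ![A, B] := by
  subst hW
  have key : ∀ (A : TanGeo W) (A' : TanGeo (g • W)), (∀ x (hx : x ∈ W.plane)
      (hx' : lin g x ∈ (g • W).plane) u, W.plane.mkQ u = A ⟨x, hx⟩ →
      A' ⟨lin g x, hx'⟩ = (g • W).plane.mkQ (lin g u)) → A' = dgeo g W A := by
    intro A A' h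
    ext ⟨y, hy⟩
    obtain ⟨x, hx, rfl⟩ := hy
    obtain ⟨u, hu⟩ := Submodule.mkQ_surjective W.plane (A ⟨x, hx⟩)
    have hgx : lin g x ∈ (g • W).plane := Submodule.mem_map_of_mem hx
    exact (h x hx hgx u hu).trans (dgeo_apply g W A x hx hgx u hu).symm
  rw [key A A' hA, key B B' hB, hω]

/-- Tangent vectors at the base point, in coordinates. -/
def emb {m : ℕ} : (Fin 2 → Fin m → ℂ) →ₗ[ℂ] (Fin 2 → V (m + 1)) where
  toFun x a := vec (Fin.cons 0 (x a))
  map_add' x y := by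
    funext a i
    rcases i with i | i
    · refine Fin.cases ?_ (fun i => ?_) i <;> simp [vec]
    · simp [vec]
  map_smul' c x := by
    funext a i
    rcases i with i | i
    · refine Fin.cases ?_ (fun i => ?_) i <;> simp [vec]
    · simp [vec]

@[simp] lemma emb_inr {m : ℕ} (x : Fin 2 → Fin m → ℂ) (a : Fin 2) (i : Unit) :
    emb x a (Sum.inr i) = 0 := rfl

@[simp] lemma emb_zero {m : ℕ} (x : Fin 2 → Fin m → ℂ) (a : Fin 2) :
    emb x a (Sum.inl 0) = 0 := rfl

@[simp] lemma emb_succ {m : ℕ} (x : Fin 2 → Fin m → ℂ) (a : Fin 2) (j : Fin m) :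
    emb x a (Sum.inl j.succ) = x a j := rfl

/-- The tangent space at the base point, in coordinates. -/
noncomputable def baseTan (m : ℕ) : (Fin 2 → Fin m → ℂ) →ₗ[ℂ] TanGeo (baseGeo m) :=
  dspan (baseFrame m) (baseFrame_mem m) ∘ₗ emb

lemma baseFrame_mem_plane {m : ℕ} (i : Fin 2) : baseFrame m i ∈ (baseGeo m).plane :=
  Submodule.subset_span ⟨i, rfl⟩

lemma baseTan_apply {m : ℕ} (x : Fin 2 → Fin m → ℂ) (i : Fin 2) :
    baseTan m x ⟨baseFrame m i, baseFrame_mem_plane i⟩ = (baseGeo m).plane.mkQ (emb x i) :=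
  dspan_apply _ _ _ _ _

lemma tanGeo_ext {n : ℕ} {f : Fin 2 → V n} {hf : f ∈ frames n} {A B : TanGeo (spanGeo f hf)}
    (h : ∀ i (hi : f i ∈ (spanGeo f hf).plane), A ⟨f i, hi⟩ = B ⟨f i, hi⟩) : A = B := by
  apply (Module.Basis.span hf.1).ext
  intro i
  rw [Module.Basis.span_apply]
  exact h i _

lemma mkQ_eq_mkQ_base {m : ℕ} {u v : V (m + 1)} (h : ∀ j : Fin m, u (Sum.inl j.succ) =
    v (Sum.inl j.succ)) : (baseGeo m).plane.mkQ u = (baseGeo m).plane.mkQ v := by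
  rw [← sub_eq_zero, ← map_sub]
  show Submodule.Quotient.mk (u - v) = (0 : V (m + 1) ⧸ (baseGeo m).plane)
  rw [Submodule.Quotient.mk_eq_zero]
  have e : u - v = (u - v) (Sum.inr ()) • baseFrame m 0 + (u - v) (Sum.inl 0) • baseFrame m 1 := by
    funext i
    rcases i with i | i
    · refine Fin.cases ?_ (fun i => ?_) i
      · simp [baseFrame, eV]
      · simp [baseFrame, eV, h]
    · simp [baseFrame, eV]
  rw [e]
  exact Submodule.add_mem _ (Submodule.smul_mem _ _ (baseFrame_mem_plane 0))
    (Submodule.smul_mem _ _ (baseFrame_mem_plane 1))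

lemma baseTan_surjective (m : ℕ) : Function.Surjective (baseTan m) := by
  intro A
  choose u hu using fun i => Submodule.mkQ_surjective (baseGeo m).plane
    (A ⟨baseFrame m i, baseFrame_mem_plane i⟩)
  refine ⟨fun a j => u a (Sum.inl j.succ), tanGeo_ext fun i hi => ?_⟩
  refine (baseTan_apply _ i).trans (Eq.trans ?_ (hu i))
  exact mkQ_eq_mkQ_base fun j => rfl

/-- The value of a 2-form at the base point, in coordinates. -/
noncomputable def baseForm {m : ℕ} (ω : GeoForm (m + 1)) : (Fin 2 → Fin m → ℂ) [⋀^Fin 2]→ₗ[ℝ] ℝ :=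
  (ω (baseGeo m)).compLinearMap ((baseTan m).restrictScalars ℝ)

lemma baseForm_apply {m : ℕ} (ω : GeoForm (m + 1)) (x y : Fin 2 → Fin m → ℂ) :
    baseForm ω ![x, y] = ω (baseGeo m) ![baseTan m x, baseTan m y] := by
  show ω (baseGeo m) _ = _
  congr 1
  funext i; fin_cases i <;> rfl

lemma baseForm_invariant {m : ℕ} {ω : GeoForm (m + 1)} (hω : ω.Invariant)
    (T : V (m + 1) →ₗ[ℂ] V (m + 1)) (hT : ∀ v w, hf (T v) (T w) = hf v w)
    (c : Fin 2 → Fin 2 → ℂ) (hc : ∀ i, T (baseFrame m i) = comb c (baseFrame m) i)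
    (x y x' y' : Fin 2 → Fin m → ℂ)
    (hx : ∀ i (j : Fin m), ∑ k, c i k * x' k j = T (emb x i) (Sum.inl j.succ))
    (hy : ∀ i (j : Fin m), ∑ k, c i k * y' k j = T (emb y i) (Sum.inl j.succ)) :
    baseForm ω ![x', y'] = baseForm ω ![x, y] := by
  obtain ⟨g, ζ, hζ, hg⟩ := exists_SU_of_isometry T hT
  have hbase : ∀ i, comb c (baseFrame m) i ∈ (baseGeo m).plane := fun i =>
    Submodule.sum_mem _ fun j _ => Submodule.smul_mem _ _ (baseFrame_mem_plane j)
  have hW : g • baseGeo m = baseGeo m := by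
    apply Geodesic.ext
    apply Submodule.eq_of_le_of_finrank_eq
    · rw [smul_plane, Submodule.map_le_iff_le_comap]
      show Submodule.span ℂ (Set.range (baseFrame m)) ≤ _
      rw [Submodule.span_le]
      rintro _ ⟨i, rfl⟩
      show lin g (baseFrame m i) ∈ (baseGeo m).plane
      rw [hg, hc]
      exact Submodule.smul_mem _ _ (hbase i)
    · rw [Geodesic.finrank_eq, Geodesic.finrank_eq]
  have key : ∀ x x' : Fin 2 → Fin m → ℂ,
      (∀ i (j : Fin m), ∑ k, c i k * x' k j = T (emb x i) (Sum.inl j.succ)) →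
      ∀ v (hv : v ∈ (baseGeo m).plane) (hv' : lin g v ∈ (baseGeo m).plane) u,
      (baseGeo m).plane.mkQ u = baseTan m x ⟨v, hv⟩ →
      baseTan m x' ⟨lin g v, hv'⟩ = (baseGeo m).plane.mkQ (lin g u) := by
    intro x x' hx v hv hv' u hu
    obtain ⟨d, rfl⟩ := (Submodule.mem_span_range_iff_exists_fun ℂ).1
      (show v ∈ Submodule.span ℂ (Set.range (baseFrame m)) from hv)
    have e1 : (⟨∑ i, d i • baseFrame m i, hv⟩ : (baseGeo m).plane) =
        ∑ i, d i • ⟨baseFrame m i, baseFrame_mem_plane i⟩ := by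
      apply Subtype.ext; simp
    have e2 : (⟨lin g (∑ i, d i • baseFrame m i), hv'⟩ : (baseGeo m).plane) =
        ∑ i, d i • ζ • ∑ k, c i k • ⟨baseFrame m k, baseFrame_mem_plane k⟩ := by
      apply Subtype.ext
      funext k
      simp [hg, hc, comb]
      ring
    rw [e1, map_sum] at hu
    simp only [map_smul, baseTan_apply] at hu
    rw [e2]
    simp only [map_sum, map_smul, baseTan_apply]
    simp only [← map_smul, ← map_sum] at hu ⊢
    have h1 : u - ∑ i, d i • emb x i ∈ (baseGeo m).plane := by
      rw [← Submodule.Quotient.mk_eq_zero]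
      show (baseGeo m).plane.mkQ _ = 0
      rw [map_sub, hu, sub_self]
    have h2 : (baseGeo m).plane.mkQ (lin g u) = (baseGeo m).plane.mkQ (lin g (∑ i, d i • emb x i)) := by
      rw [← sub_eq_zero, ← map_sub, ← map_sub]
      show Submodule.Quotient.mk (lin g (u - ∑ i, d i • emb x i)) =
        (0 : V (m + 1) ⧸ (baseGeo m).plane)
      rw [Submodule.Quotient.mk_eq_zero]
      have h3 : lin g (u - ∑ i, d i • emb x i) ∈ (g • baseGeo m).plane :=
        Submodule.mem_map_of_mem h1
      rwa [hW] at h3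
    rw [h2]
    apply mkQ_eq_mkQ_base
    intro j
    rw [hg]
    simp only [map_sum, map_smul, Finset.sum_apply, Pi.smul_apply, smul_eq_mul, emb_succ,
      ← hx, Finset.mul_sum]
    exact Finset.sum_congr rfl fun i _ => Finset.sum_congr rfl fun k _ => by ring
  rw [baseForm_apply, baseForm_apply]
  exact hω.apply_eq g _ _ hW _ _ _ _ (key x x' hx) (key y y' hy)

/-- A coordinate vector. -/
def sng {m : ℕ} (a : Fin 2) (j : Fin m) (z : ℂ) : Fin 2 → Fin m → ℂ := Pi.single a (Pi.single j z)

/-- The diagonal isometries. -/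
def diagIso {n : ℕ} (t : Fin n ⊕ Unit → ℂ) : V n →ₗ[ℂ] V n :=
  LinearMap.pi fun i => t i • LinearMap.proj i

lemma diagIso_apply {n : ℕ} (t : Fin n ⊕ Unit → ℂ) (v : V n) (i) : diagIso t v i = t i * v i := rfl

lemma diagIso_isometry {n : ℕ} {t : Fin n ⊕ Unit → ℂ} (ht : ∀ i, t i * starRingEnd ℂ (t i) = 1)
    (v w : V n) : hf (diagIso t v) (diagIso t w) = hf v w := by
  simp only [hf, diagIso_apply, map_mul]
  exact Finset.sum_congr rfl fun i _ => by linear_combination (sgn i * v i * starRingEnd ℂ (w i)) * ht i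

lemma baseForm_diag {m : ℕ} {ω : GeoForm (m + 1)} (hω : ω.Invariant) (σ : Fin m → ℂ)
    (τ : Fin 2 → ℂ) (hσ : ∀ j, σ j = 1 ∨ σ j = -1) (hτ : ∀ j, τ j = 1 ∨ τ j = -1)
    (x y : Fin 2 → Fin m → ℂ) :
    baseForm ω ![fun a j => τ a * σ j * x a j, fun a j => τ a * σ j * y a j] =
      baseForm ω ![x, y] := by
  have hττ : ∀ a, τ a * τ a = 1 := fun a => by rcases hτ a with h | h <;> simp [h]
  refine baseForm_invariant hω (diagIso (Sum.elim (Fin.cons (τ 1) σ) fun _ => τ 0))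
    (diagIso_isometry ?_) (fun i j => if i = j then τ i else 0) ?_ x y _ _ ?_ ?_
  · intro i
    rcases i with i | i
    · refine Fin.cases ?_ (fun i => ?_) i
      · rcases hτ 1 with h | h <;> simp [h]
      · rcases hσ i with h | h <;> simp [h]
    · rcases hτ 0 with h | h <;> simp [h]
  · intro i
    funext k
    rw [diagIso_apply]
    fin_cases i
    · rcases k with k | k <;> simp [comb, baseFrame, eV]
    · rcases k with k | k
      · refine Fin.cases ?_ (fun k => ?_) k <;> simp [comb, baseFrame, eV]
      · simp [comb, baseFrame, eV]
  · intro i j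
    simp only [ite_mul, zero_mul, Finset.sum_ite_eq, Finset.mem_univ, if_true, diagIso_apply,
      Sum.elim_inl, Fin.cons_succ, emb_succ]
    linear_combination (σ j * x i j) * hττ i
  · intro i j
    simp only [ite_mul, zero_mul, Finset.sum_ite_eq, Finset.mem_univ, if_true, diagIso_apply,
      Sum.elim_inl, Fin.cons_succ, emb_succ]
    linear_combination (σ j * y i j) * hττ i

lemma baseForm_perm {m : ℕ} {ω : GeoForm (m + 1)} (hω : ω.Invariant) (π : Equiv.Perm (Fin m))
    (x y : Fin 2 → Fin m → ℂ) :
    baseForm ω ![fun a j => x a (π j), fun a j => y a (π j)] = baseForm ω ![x, y] := by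
  let T : V (m + 1) →ₗ[ℂ] V (m + 1) :=
    extend (LinearMap.pi (Fin.cons (LinearMap.proj 0) fun j => LinearMap.proj (π j).succ))
  have hT0 : ∀ v, T v (Sum.inl 0) = v (Sum.inl 0) := fun v => rfl
  have hT1 : ∀ v (j : Fin m), T v (Sum.inl j.succ) = v (Sum.inl (π j).succ) := fun v j => rfl
  have hT2 : ∀ v i, T v (Sum.inr i) = v (Sum.inr i) := fun v i => rfl
  refine baseForm_invariant hω T (extend_isometry fun v w => ?_)
    (fun i j => if i = j then 1 else 0) ?_ x y _ _ ?_ ?_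
  · simp only [herm, Fin.sum_univ_succ]
    congr 1
    exact Equiv.sum_comp π fun j => v j.succ * starRingEnd ℂ (w j.succ)
  · intro i
    funext k
    fin_cases i
    · rcases k with k | k
      · refine Fin.cases ?_ (fun k => ?_) k
        · rw [hT0]; simp [comb, baseFrame, eV]
        · rw [hT1]; simp [comb, baseFrame, eV]
      · rw [hT2]; simp [comb, baseFrame, eV]
    · rcases k with k | k
      · refine Fin.cases ?_ (fun k => ?_) k
        · rw [hT0]; simp [comb, baseFrame, eV]
        · rw [hT1]; simp [comb, baseFrame, eV]
      · rw [hT2]; simp [comb, baseFrame, eV]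
  · intro i j
    rw [hT1]; simp
  · intro i j
    rw [hT1]; simp

lemma baseForm_boost {m : ℕ} {ω : GeoForm (m + 1)} (hω : ω.Invariant) {c s : ℝ}
    (h : c ^ 2 - s ^ 2 = 1) (x y : Fin 2 → Fin m → ℂ) :
    baseForm ω ![![(c : ℂ) • x 0 - (s : ℂ) • x 1, (c : ℂ) • x 1 - (s : ℂ) • x 0],
      ![(c : ℂ) • y 0 - (s : ℂ) • y 1, (c : ℂ) • y 1 - (s : ℂ) • y 0]] =
      baseForm ω ![x, y] := by
  have h' : (c : ℂ) ^ 2 - (s : ℂ) ^ 2 = 1 := by exact_mod_cast h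
  refine baseForm_invariant hω (boost c s) (boost_isometry h) ![![(c : ℂ), s], ![(s : ℂ), c]] ?_ x y
    _ _ ?_ ?_
  · intro i
    funext k
    fin_cases i
    · rcases k with k | k
      · refine Fin.cases ?_ (fun k => ?_) k <;> simp [comb, baseFrame, eV, boost]
      · simp [comb, baseFrame, eV, boost]
    · rcases k with k | k
      · refine Fin.cases ?_ (fun k => ?_) k <;> simp [comb, baseFrame, eV, boost]
      · simp [comb, baseFrame, eV, boost]
  all_goals
    intro i j
    fin_cases i <;> simp [boost]
  · linear_combination (x 0 j) * h'
  · linear_combination (x 1 j) * h'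
  · linear_combination (y 0 j) * h'
  · linear_combination (y 1 j) * h'

lemma sng_mul {m : ℕ} (a : Fin 2) (j : Fin m) (z : ℂ) (t : Fin 2 → Fin m → ℂ) :
    (fun a' j' => t a' j' * sng a j z a' j') = sng a j (t a j * z) := by
  funext a' j'
  by_cases ha : a' = a
  · subst ha
    by_cases hj : j' = j
    · subst hj; simp [sng]
    · simp [sng, hj]
  · simp [sng, ha]

lemma sum_sng {m : ℕ} (x : Fin 2 → Fin m → ℂ) : x = ∑ i : Fin 2 × Fin m, sng i.1 i.2 (x i.1 i.2) := by
  funext a j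
  simp only [Finset.sum_apply, Fintype.sum_prod_type, sng]
  rw [Finset.sum_eq_single a, Finset.sum_eq_single j]
  · simp
  · intro b _ hb; simp [hb.symm]
  · simp
  · intro b _ hb; simp [hb.symm]
  · simp

/-- Bilinearity of an alternating 2-form. -/
lemma alt_add_left {E : Type*} [AddCommGroup E] [Module ℝ E] (α : E [⋀^Fin 2]→ₗ[ℝ] ℝ) (x y z : E) :
    α ![x + y, z] = α ![x, z] + α ![y, z] := by
  have e : ∀ y, Function.update ![x, z] 0 y = ![y, z] := fun y => by
    funext i; fin_cases i <;> simp
  have := α.map_update_add ![x, z] 0 x y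
  rwa [e, e, e] at this

lemma alt_smul_left {E : Type*} [AddCommGroup E] [Module ℝ E] (α : E [⋀^Fin 2]→ₗ[ℝ] ℝ) (c : ℝ)
    (x z : E) : α ![c • x, z] = c * α ![x, z] := by
  have e : ∀ y, Function.update ![x, z] 0 y = ![y, z] := fun y => by
    funext i; fin_cases i <;> simp
  have := α.map_update_smul ![x, z] 0 c x
  rwa [e, e] at this

lemma alt_swap {E : Type*} [AddCommGroup E] [Module ℝ E] (α : E [⋀^Fin 2]→ₗ[ℝ] ℝ) (x y : E) :
    α ![x, y] = - α ![y, x] := by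
  have h := α.map_swap ![y, x] (i := 0) (j := 1) (by decide)
  rw [← h]
  congr 1
  funext i; fin_cases i <;> simp

lemma alt_self {E : Type*} [AddCommGroup E] [Module ℝ E] (α : E [⋀^Fin 2]→ₗ[ℝ] ℝ) (x : E) :
    α ![x, x] = 0 :=
  α.map_eq_zero_of_eq ![x, x] (i := 0) (j := 1) rfl (by decide)

lemma alt_add_right {E : Type*} [AddCommGroup E] [Module ℝ E] (α : E [⋀^Fin 2]→ₗ[ℝ] ℝ)
    (x y z : E) : α ![z, x + y] = α ![z, x] + α ![z, y] := by
  rw [alt_swap, alt_add_left, alt_swap α z x, alt_swap α z y]; ring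

lemma alt_smul_right {E : Type*} [AddCommGroup E] [Module ℝ E] (α : E [⋀^Fin 2]→ₗ[ℝ] ℝ) (c : ℝ)
    (x z : E) : α ![z, c • x] = c * α ![z, x] := by
  rw [alt_swap, alt_smul_left, alt_swap α z x]; ring

lemma alt_neg_right {E : Type*} [AddCommGroup E] [Module ℝ E] (α : E [⋀^Fin 2]→ₗ[ℝ] ℝ)
    (x z : E) : α ![z, -x] = - α ![z, x] := by
  have := alt_smul_right α (-1) x z
  simpa using this

lemma alt_sum_left {E ι : Type*} [AddCommGroup E] [Module ℝ E] (α : E [⋀^Fin 2]→ₗ[ℝ] ℝ)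
    (s : Finset ι) (x : ι → E) (z : E) : α ![∑ i ∈ s, x i, z] = ∑ i ∈ s, α ![x i, z] := by
  classical
  induction s using Finset.induction_on with
  | empty => simpa using alt_smul_left α 0 0 z
  | insert a s ha ih => rw [Finset.sum_insert ha, Finset.sum_insert ha, alt_add_left, ih]

lemma alt_sum_right {E ι : Type*} [AddCommGroup E] [Module ℝ E] (α : E [⋀^Fin 2]→ₗ[ℝ] ℝ)
    (s : Finset ι) (x : ι → E) (z : E) : α ![z, ∑ i ∈ s, x i] = ∑ i ∈ s, α ![z, x i] := by
  rw [alt_swap, alt_sum_left, ← Finset.sum_neg_distrib]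
  exact Finset.sum_congr rfl fun i _ => (alt_swap α _ _).symm

/-- The restriction of a real 2-form to a complex line. -/
lemma alt_complex_line {E : Type*} [AddCommGroup E] [Module ℂ E] [Module ℝ E] [IsScalarTower ℝ ℂ E]
    (α : E [⋀^Fin 2]→ₗ[ℝ] ℝ) (v : E) (z w : ℂ) :
    α ![z • v, w • v] = (z.re * w.im - z.im * w.re) * α ![v, Complex.I • v] := by
  have e : ∀ z : ℂ, z • v = z.re • v + z.im • (Complex.I • v) := by
    intro z
    conv_lhs => rw [← Complex.re_add_im z, add_smul, mul_smul]
    rw [← algebraMap_smul ℂ z.re v, ← algebraMap_smul ℂ z.im (Complex.I • v)]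
    rfl
  rw [e z, e w]
  simp only [alt_add_left, alt_add_right, alt_smul_left, alt_smul_right, alt_self]
  rw [alt_swap α (Complex.I • v) v]
  ring

lemma baseForm_sng_ne {m : ℕ} {ω : GeoForm (m + 1)} (hω : ω.Invariant) {a b : Fin 2} {j k : Fin m}
    (h : (a, j) ≠ (b, k)) (z w : ℂ) : baseForm ω ![sng a j z, sng b k w] = 0 := by
  have key : ∀ (σ : Fin m → ℂ) (τ : Fin 2 → ℂ), (∀ j, σ j = 1 ∨ σ j = -1) →
      (∀ j, τ j = 1 ∨ τ j = -1) → τ a * σ j = 1 → τ b * σ k = -1 →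
      baseForm ω ![sng a j z, sng b k w] = 0 := by
    intro σ τ hσ hτ h1 h2
    have h3 := baseForm_diag hω σ τ hσ hτ (sng a j z) (sng b k w)
    rw [sng_mul a j z fun a j => τ a * σ j, sng_mul b k w fun a j => τ a * σ j, h1, h2, one_mul,
      show sng b k (-1 * w) = - sng b k w by simp [sng, Pi.single_neg], alt_neg_right] at h3
    linarith
  by_cases hjk : j = k
  · subst hjk
    have hab : a ≠ b := fun h' => h (by rw [h'])
    refine key (fun _ => 1) (fun i => if i = b then -1 else 1) (fun _ => Or.inl rfl) (fun i => ?_)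
      (by simp [hab]) (by simp)
    by_cases hi : i = b <;> simp [hi]
  · refine key (fun i => if i = k then -1 else 1) (fun _ => 1) (fun i => ?_) (fun _ => Or.inl rfl)
      (by simp [hjk]) (by simp)
    by_cases hi : i = k <;> simp [hi]

lemma baseForm_sng_self {m : ℕ} (ω : GeoForm (m + 1)) (a : Fin 2) (j : Fin m) (z w : ℂ) :
    baseForm ω ![sng a j z, sng a j w] =
      (z.re * w.im - z.im * w.re) * baseForm ω ![sng a j 1, sng a j Complex.I] := by
  have e : ∀ z : ℂ, sng a j z = z • sng a j 1 := by
    intro z; simp [sng, ← Pi.single_smul]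
  rw [e z, e w, e Complex.I]
  exact alt_complex_line _ _ _ _

/-- An invariant 2-form at the base point is determined by one number. -/
theorem baseForm_eq {m : ℕ} {ω : GeoForm (m + 1)} (hω : ω.Invariant) (j₀ : Fin m)
    (x y : Fin 2 → Fin m → ℂ) :
    baseForm ω ![x, y] = baseForm ω ![sng 0 j₀ 1, sng 0 j₀ Complex.I] *
      ∑ j, (((x 0 j).re * (y 0 j).im - (x 0 j).im * (y 0 j).re) -
        ((x 1 j).re * (y 1 j).im - (x 1 j).im * (y 1 j).re)) := by
  set l := baseForm ω ![sng 0 j₀ 1, sng 0 j₀ Complex.I] with hl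
  have hperm : ∀ a j, baseForm ω ![sng a j 1, sng a j Complex.I] =
      baseForm ω ![sng a j₀ 1, sng a j₀ Complex.I] := by
    intro a j
    have h := baseForm_perm hω (Equiv.swap j j₀) (sng a j₀ 1) (sng a j₀ Complex.I)
    have e : ∀ z, (fun a' j' => sng a j₀ z a' (Equiv.swap j j₀ j')) = sng a j z := by
      intro z
      funext a' j'
      by_cases ha : a' = a
      · subst ha
        by_cases hj : j' = j
        · subst hj; simp [sng]
        · have : Equiv.swap j j₀ j' ≠ j₀ := by
            intro h'
            apply hj
            have := congrArg (Equiv.swap j j₀) h'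
            simpa using this
          simp [sng, hj, this]
      · simp [sng, ha]
    rw [e, e] at h
    exact h
  have hboost : baseForm ω ![sng 1 j₀ 1, sng 1 j₀ Complex.I] = -l := by
    have h := baseForm_boost hω (c := 5 / 3) (s := 4 / 3) (by norm_num) (sng 0 j₀ 1)
      (sng 0 j₀ Complex.I)
    have e : ∀ z : ℂ, (![((5 / 3 : ℝ) : ℂ) • sng 0 j₀ z 0 - ((4 / 3 : ℝ) : ℂ) • sng 0 j₀ z 1,
        ((5 / 3 : ℝ) : ℂ) • sng 0 j₀ z 1 - ((4 / 3 : ℝ) : ℂ) • sng 0 j₀ z 0] : Fin 2 → Fin m → ℂ) =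
        sng 0 j₀ (((5 / 3 : ℝ) : ℂ) * z) + sng 1 j₀ ((-(4 / 3 : ℝ) : ℝ) * z) := by
      intro z
      funext a
      fin_cases a <;> simp [sng, ← Pi.single_smul, ← Pi.single_neg]
    rw [e, e] at h
    simp only [alt_add_left, alt_add_right] at h
    rw [baseForm_sng_ne hω (a := 0) (b := 1) (by simp), baseForm_sng_ne hω (a := 1) (b := 0) (by simp),
      baseForm_sng_self, baseForm_sng_self ω 1, ← hl] at h
    norm_num at h
    linarith
  conv_lhs => rw [sum_sng x, sum_sng y]
  rw [alt_sum_left]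
  simp only [alt_sum_right]
  have h1 : ∀ i : Fin 2 × Fin m, ∑ i' : Fin 2 × Fin m, 
      baseForm ω ![sng i.1 i.2 (x i.1 i.2), sng i'.1 i'.2 (y i'.1 i'.2)] = 
      ((x i.1 i.2).re * (y i.1 i.2).im - (x i.1 i.2).im * (y i.1 i.2).re) *
        baseForm ω ![sng i.1 j₀ 1, sng i.1 j₀ Complex.I] := by
    intro i
    rw [Finset.sum_eq_single i, baseForm_sng_self, hperm]
    · intro i' _ hi
      exact baseForm_sng_ne hω (fun h => hi h.symm) _ _
    · simp
  simp only [h1, Fintype.sum_prod_type, Fin.sum_univ_two, hboost, ← hl]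
  rw [← Finset.sum_add_distrib, Finset.mul_sum]
  exact Finset.sum_congr rfl fun j _ => by ring

lemma baseForm_geoOmega {m : ℕ} (j₀ : Fin m) :
    baseForm (geoOmega (m + 1)) ![sng 0 j₀ 1, sng 0 j₀ Complex.I] = 1 := by
  rw [baseForm_apply]
  have h := pull_geoOmega (baseFrame_mem m) ![emb (sng 0 j₀ 1), emb (sng 0 j₀ Complex.I)]
  rw [pull_apply _ (baseFrame_mem m)] at h
  refine h.trans ?_
  have e : ∀ z : ℂ, dplucker (baseFrame m) (emb (sng 0 j₀ z)) =
      z • wdg (eV (Sum.inl j₀.succ)) (eV (Sum.inl 0)) := by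
    intro z
    have e0 : emb (sng 0 j₀ z) 0 = z • eV (Sum.inl j₀.succ) := by
      funext i
      rcases i with i | i
      · refine Fin.cases ?_ (fun i => ?_) i <;> simp [sng, eV, Pi.single_apply,
          (Fin.succ_ne_zero _).symm]
      · simp [eV]
    have e1 : emb (sng 0 j₀ z) 1 = 0 := by
      funext i
      rcases i with i | i
      · refine Fin.cases ?_ (fun i => ?_) i <;> simp [sng]
      · simp
    rw [dplucker_apply, e0, e1, wdg_smul_left]
    have : wdg (baseFrame m 0) 0 = 0 := by funext x; simp [wdg]
    rw [this, add_zero]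
    rfl
  rw [fs_apply]
  simp only [Matrix.cons_val_zero, Matrix.cons_val_one, e, fsK_smul_left, fsK_smul_right]
  simp [fsK, plucker, baseFrame, hh_wdg, hf_eV]
  norm_num

/-- Invariant forms are determined by their value at the base point. -/
lemma GeoForm.Invariant.ext_base {m : ℕ} {ω ω' : GeoForm (m + 1)} (hω : ω.Invariant)
    (hω' : ω'.Invariant) (h : ∀ x y, baseForm ω ![x, y] = baseForm ω' ![x, y]) : ω = ω' := by
  funext W
  obtain ⟨g, hg⟩ := exists_smul_eq_baseGeo W
  have key : ∀ W', W' = baseGeo m → ∀ A B : TanGeo W', ω W' ![A, B] = ω' W' ![A, B] := by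
    rintro _ rfl A B
    obtain ⟨x, rfl⟩ := baseTan_surjective m A
    obtain ⟨y, rfl⟩ := baseTan_surjective m B
    rw [← baseForm_apply, ← baseForm_apply, h]
  ext v
  have e : v = ![v 0, v 1] := by funext i; fin_cases i <;> rfl
  rw [e, ← hω g, ← hω' g]
  exact key _ hg _ _

lemma geoOmega_unique {m : ℕ} (j₀ : Fin m) {ω' : GeoForm (m + 1)} (hω' : ω'.Invariant)
    (hk : ω'.PseudoKahler) : ∃ c : ℝ, c ≠ 0 ∧ ω' = fun W => c • geoOmega (m + 1) W := by
  have hω := geoOmega_invariant (m + 1)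
  set c := baseForm ω' ![sng 0 j₀ 1, sng 0 j₀ Complex.I] with hc
  have heq : ω' = fun W => c • geoOmega (m + 1) W := by
    refine hω'.ext_base (fun g W A B => ?_) fun x y => ?_
    · simp only [AlternatingMap.smul_apply, hω g W A B]
    · have : baseForm (fun W => c • geoOmega (m + 1) W) ![x, y] =
          c * baseForm (geoOmega (m + 1)) ![x, y] := rfl
      rw [this, baseForm_eq hω' j₀, baseForm_eq hω j₀, baseForm_geoOmega, one_mul]
  refine ⟨c, fun h0 => ?_, heq⟩
  have h1 := hk.nondegenerate (baseGeo m) (baseTan m (sng 0 j₀ 1)) fun B => by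
    rw [heq, h0]; simp
  have h2 := baseForm_geoOmega j₀
  rw [baseForm_apply, h1] at h2
  have h3 := alt_smul_left (geoOmega (m + 1) (baseGeo m)) 0 0 (baseTan m (sng 0 j₀ Complex.I))
  rw [zero_smul, zero_mul] at h3
  linarith

lemma geoOmega_nondegenerate {m : ℕ} (j₀ : Fin m) (W : Geodesic (m + 1)) (A : TanGeo W)
    (h : ∀ B, geoOmega (m + 1) W ![A, B] = 0) : A = 0 := by
  have hω := geoOmega_invariant (m + 1)
  obtain ⟨g, hg⟩ := exists_smul_eq_baseGeo W
  have key : ∀ W', W' = baseGeo m → ∀ A : TanGeo W', (∀ B, geoOmega (m + 1) W' ![A, B] = 0) →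
      A = 0 := by
    rintro _ rfl A hA
    obtain ⟨x, rfl⟩ := baseTan_surjective m A
    have hx : x = 0 := by
      funext a j
      have h1 := hA (baseTan m (sng a j (Complex.I * x a j)))
      rw [← baseForm_apply, baseForm_eq hω j₀, baseForm_geoOmega, one_mul] at h1
      rw [Finset.sum_eq_single j] at h1
      · have h2 : (x a j).re * (x a j).re + (x a j).im * (x a j).im = 0 := by
          fin_cases a <;> simp [sng] at h1 ⊢ <;> linarith
        apply Complex.ext <;> simp <;> nlinarith [mul_self_nonneg (x a j).re,
          mul_self_nonneg (x a j).im]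
      · intro k _ hk
        fin_cases a <;> simp [sng, hk]
      · simp
    rw [hx, map_zero]
  have h2 := key _ hg (dgeo g W A) fun B => by
    obtain ⟨B, rfl⟩ := (dgeo g W).surjective B
    rw [hω g W, h]
  exact (LinearEquiv.map_eq_zero_iff _).1 h2

lemma geoOmega_indefinite {m : ℕ} (j₀ : Fin m) : (geoOmega (m + 1)).Indefinite := by
  have hω := geoOmega_invariant (m + 1)
  intro W
  obtain ⟨g, hg⟩ := exists_smul_eq_baseGeo W
  have key : ∀ W', W' = baseGeo m → ∃ A B : TanGeo W',
      0 < geoOmega (m + 1) W' ![A, Complex.I • A] ∧ geoOmega (m + 1) W' ![B, Complex.I • B] < 0 := by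
    rintro _ rfl
    refine ⟨baseTan m (sng 0 j₀ 1), baseTan m (sng 1 j₀ 1), ?_, ?_⟩
    · rw [← map_smul, ← baseForm_apply, baseForm_eq hω j₀, baseForm_geoOmega, one_mul,
        Finset.sum_eq_single j₀]
      · simp [sng]
      · intro k _ hk; simp [sng, hk]
      · simp
    · rw [← map_smul, ← baseForm_apply, baseForm_eq hω j₀, baseForm_geoOmega, one_mul,
        Finset.sum_eq_single j₀]
      · simp [sng]
      · intro k _ hk; simp [sng, hk]
      · simp
  obtain ⟨A, B, hA, hB⟩ := key _ hg
  obtain ⟨A, rfl⟩ := (dgeo g W).surjective A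
  obtain ⟨B, rfl⟩ := (dgeo g W).surjective B
  rw [← map_smul, hω g W] at hA hB
  exact ⟨⟨A, hA⟩, ⟨B, hB⟩⟩

lemma geoOmega_pseudoKahler {m : ℕ} (j₀ : Fin m) : (geoOmega (m + 1)).PseudoKahler where
  smooth := geoOmega_smooth m
  closed := geoOmega_closed m
  type_one_one := geoOmega_type
  nondegenerate := geoOmega_nondegenerate j₀

end CHyp

namespace CHyp

/-! ### Wedge products of 2-forms -/

lemma wedge_comp {E F : Type*} [AddCommGroup E] [Module ℝ E] [AddCommGroup F] [Module ℝ F] {k : ℕ}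
    (α : Fin k → F [⋀^Fin 2]→ₗ[ℝ] ℝ) (T : E →ₗ[ℝ] F) (v : Fin k × Fin 2 → E) :
    wedge (fun i => (α i).compLinearMap T) v = wedge α fun j => T (v j) := by
  simp only [wedge, AlternatingMap.compLinearMap_apply]
  congr 1
  refine Finset.sum_congr rfl fun σ _ => ?_
  congr 1
  refine Finset.prod_congr rfl fun i _ => ?_
  congr 1
  funext b; fin_cases b <;> rfl

/-- The product of 2-forms, as a multilinear map. -/
def prodMul {E : Type*} [AddCommGroup E] [Module ℝ E] {k : ℕ} (α : Fin k → E [⋀^Fin 2]→ₗ[ℝ] ℝ) :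
    MultilinearMap ℝ (fun _ : Fin k × Fin 2 => E) ℝ where
  toFun v := ∏ i, α i ![v (i, 0), v (i, 1)]
  map_update_add' := by
    intro _ v j x y
    have hd := Subsingleton.elim (‹DecidableEq (Fin k × Fin 2)›) instDecidableEqProd
    subst hd
    obtain ⟨i, b⟩ := j
    have h : ∀ z, ∏ i', α i' ![Function.update v (i, b) z (i', 0), Function.update v (i, b) z (i', 1)]
        = α i ![Function.update v (i, b) z (i, 0), Function.update v (i, b) z (i, 1)] *
          ∏ i' ∈ Finset.univ.erase i, α i' ![v (i', 0), v (i', 1)] := by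
      intro z
      rw [← Finset.mul_prod_erase _ _ (Finset.mem_univ i)]
      congr 1
      refine Finset.prod_congr rfl fun i' hi' => ?_
      have hne : i' ≠ i := Finset.ne_of_mem_erase hi'
      rw [Function.update_of_ne (by simp [hne]), Function.update_of_ne (by simp [hne])]
    rw [h, h, h, ← add_mul]
    congr 1
    fin_cases b <;> simp [alt_add_left, alt_add_right]
  map_update_smul' := by
    intro _ v j c x
    have hd := Subsingleton.elim (‹DecidableEq (Fin k × Fin 2)›) instDecidableEqProd
    subst hd
    obtain ⟨i, b⟩ := j
    have h : ∀ z, ∏ i', α i' ![Function.update v (i, b) z (i', 0), Function.update v (i, b) z (i', 1)]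
        = α i ![Function.update v (i, b) z (i, 0), Function.update v (i, b) z (i, 1)] *
          ∏ i' ∈ Finset.univ.erase i, α i' ![v (i', 0), v (i', 1)] := by
      intro z
      rw [← Finset.mul_prod_erase _ _ (Finset.mem_univ i)]
      congr 1
      refine Finset.prod_congr rfl fun i' hi' => ?_
      have hne : i' ≠ i := Finset.ne_of_mem_erase hi'
      rw [Function.update_of_ne (by simp [hne]), Function.update_of_ne (by simp [hne])]
    rw [h, h, smul_eq_mul, ← mul_assoc]
    congr 1
    fin_cases b <;> simp [alt_smul_left, alt_smul_right]

lemma wedge_eq_alternatization {E : Type*} [AddCommGroup E] [Module ℝ E] {k : ℕ}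
    (α : Fin k → E [⋀^Fin 2]→ₗ[ℝ] ℝ) (v : Fin k × Fin 2 → E) :
    wedge α v = (1 / 2 ^ k) * MultilinearMap.alternatization (prodMul α) v := by
  rw [MultilinearMap.alternatization_apply, wedge]
  congr 1
  refine Finset.sum_congr rfl fun σ _ => ?_
  rw [Units.smul_def, zsmul_eq_mul]
  rfl

/-- `realBasis`, as a basis. -/
noncomputable def realBasisB (k : ℕ) : Module.Basis (Fin k × Fin 2) ℝ (Fin k → ℂ) :=
  (Pi.basis fun _ : Fin k => Complex.basisOneI).reindex (Equiv.sigmaEquivProd _ _)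

lemma realBasisB_apply (k : ℕ) (j : Fin k × Fin 2) : realBasisB k j = realBasis k j := by
  obtain ⟨i, b⟩ := j
  simp only [realBasisB, Module.Basis.reindex_apply, realBasis]
  rw [show (Equiv.sigmaEquivProd (Fin k) (Fin 2)).symm (i, b) = ⟨i, b⟩ from rfl, Pi.basis_apply]
  congr 1
  fin_cases b <;> simp

/-- A form of top degree is multiplied by the determinant under a linear map. -/
lemma wedge_det {k : ℕ} (α : Fin k → (Fin k → ℂ) [⋀^Fin 2]→ₗ[ℝ] ℝ)
    (T : (Fin k → ℂ) →ₗ[ℝ] (Fin k → ℂ)) :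
    wedge α (fun j => T (realBasis k j)) = LinearMap.det T * wedge α (realBasis k) := by
  have h := (MultilinearMap.alternatization (prodMul α)).eq_smul_basis_det (realBasisB k)
  have e : ⇑(realBasisB k) = realBasis k := funext (realBasisB_apply k)
  rw [wedge_eq_alternatization, wedge_eq_alternatization, h]
  simp only [AlternatingMap.smul_apply, smul_eq_mul]
  rw [← e]
  have h2 := (realBasisB k).det_comp T (realBasisB k)
  simp only [Module.Basis.det_self, mul_one, Function.comp_def] at h2
  rw [h2, Module.Basis.det_self]
  ring

/-- The permutations of `Fin k × Fin 2` that preserve pairs. -/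
def pairPerm {k : ℕ} (x : Equiv.Perm (Fin k) × (Fin k → Equiv.Perm (Fin 2))) :
    Equiv.Perm (Fin k × Fin 2) :=
  (Equiv.prodCongrRight x.2).trans (Equiv.prodCongrLeft fun _ => x.1)

lemma pairPerm_apply {k : ℕ} (x : Equiv.Perm (Fin k) × (Fin k → Equiv.Perm (Fin 2)))
    (i : Fin k) (b : Fin 2) : pairPerm x (i, b) = (x.1 i, x.2 i b) := rfl

lemma pairPerm_injective (k : ℕ) : Function.Injective (pairPerm (k := k)) := by
  rintro ⟨τ, s⟩ ⟨τ', s'⟩ h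
  have h1 : ∀ i b, (τ i, s i b) = (τ' i, s' i b) := fun i b => by
    have := congrArg (fun σ : Equiv.Perm (Fin k × Fin 2) => σ (i, b)) h
    exact this
  refine Prod.ext (Equiv.ext fun i => ?_) (funext fun i => Equiv.ext fun b => ?_)
  · exact congrArg Prod.fst (h1 i 0)
  · exact congrArg Prod.snd (h1 i b)

lemma sign_pairPerm {k : ℕ} (x : Equiv.Perm (Fin k) × (Fin k → Equiv.Perm (Fin 2))) :
    Equiv.Perm.sign (pairPerm x) = ∏ i, Equiv.Perm.sign (x.2 i) := by
  rw [pairPerm, Equiv.Perm.sign_trans, Equiv.Perm.sign_prodCongrLeft,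
    Equiv.Perm.sign_prodCongrRight]
  simp

lemma fin_two_pigeonhole (a b c : Fin 2) (h1 : a ≠ b) (h2 : a ≠ c) (h3 : b ≠ c) : False := by
  omega

lemma fiber_pigeonhole {k : ℕ} {σ : Equiv.Perm (Fin k × Fin 2)} {x y z : Fin k × Fin 2}
    (h1 : x ≠ y) (h2 : x ≠ z) (h3 : y ≠ z) (e1 : (σ x).1 = (σ y).1) (e2 : (σ x).1 = (σ z).1) :
    False := by
  refine fin_two_pigeonhole (σ x).2 (σ y).2 (σ z).2 (fun h => h1 ?_) (fun h => h2 ?_) fun h => h3 ?_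
  · exact σ.injective (Prod.ext e1 h)
  · exact σ.injective (Prod.ext e2 h)
  · exact σ.injective (Prod.ext (e1.symm.trans e2) h)

lemma mem_range_pairPerm {k : ℕ} {σ : Equiv.Perm (Fin k × Fin 2)}
    (h : ∀ i, (σ (i, 0)).1 = (σ (i, 1)).1) : σ ∈ Set.range (pairPerm (k := k)) := by
  have hτ : Function.Injective fun i => (σ (i, 0)).1 := by
    intro i j hij
    by_contra hne
    exact fiber_pigeonhole (σ := σ) (x := (i, 0)) (y := (i, 1)) (z := (j, 0)) (by simp)
      (by simp [hne]) (by simp) (h i) hij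
  have hs : ∀ i, Function.Injective fun b => (σ (i, b)).2 := by
    intro i b c hbc
    have hb : ∀ b, (σ (i, b)).1 = (σ (i, 0)).1 := by
      intro b; fin_cases b
      · rfl
      · exact (h i).symm
    have := σ.injective (Prod.ext ((hb b).trans (hb c).symm) hbc)
    exact congrArg Prod.snd this
  refine ⟨⟨Equiv.ofBijective _ (Finite.injective_iff_bijective.1 hτ),
    fun i => Equiv.ofBijective _ (Finite.injective_iff_bijective.1 (hs i))⟩, ?_⟩
  ext1 ⟨i, b⟩
  rw [pairPerm_apply]
  refine Prod.ext ?_ rfl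
  fin_cases b
  · rfl
  · exact h i

lemma pairs_of_pairs_ne {k : ℕ} {σ : Equiv.Perm (Fin k × Fin 2)} (i₀ : Fin k)
    (h : ∀ i, i ≠ i₀ → (σ (i, 0)).1 = (σ (i, 1)).1) (i : Fin k) : (σ (i, 0)).1 = (σ (i, 1)).1 := by
  by_cases hi : i = i₀
  · subst hi
    by_contra hne
    obtain ⟨⟨j, c⟩, hj⟩ := σ.surjective ((σ (i, 0)).1, 1 - (σ (i, 0)).2)
    have hj1 : (σ (j, c)).1 = (σ (i, 0)).1 := by rw [hj]
    have hj2 : (σ (j, c)).2 ≠ (σ (i, 0)).2 := by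
      rw [hj]
      show 1 - (σ (i, 0)).2 ≠ (σ (i, 0)).2
      generalize (σ (i, 0)).2 = t
      fin_cases t <;> decide
    by_cases hji : j = i
    · subst hji
      fin_cases c
      · exact hj2 rfl
      · exact hne hj1.symm
    · have h1 := h j hji
      have h0 : ∀ c, (σ (j, c)).1 = (σ (i, 0)).1 := by
        intro c'
        rw [← hj1]
        fin_cases c <;> fin_cases c'
        · rfl
        · exact h1.symm
        · exact h1
        · rfl
      exact fiber_pigeonhole (σ := σ) (x := (i, 0)) (y := (j, 0)) (z := (j, 1))
        (by simp [Ne.symm hji]) (by simp) (by simp) (h0 0).symm (h0 1).symm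
  · exact h i hi

/-- The wedge product of 2-forms all of which but one are diagonal. -/
theorem wedge_diag {E : Type*} [AddCommGroup E] [Module ℝ E] {k : ℕ}
    (α : Fin k → E [⋀^Fin 2]→ₗ[ℝ] ℝ) (v : Fin k × Fin 2 → E) (i₀ : Fin k)
    (h : ∀ i, i ≠ i₀ → ∀ a b : Fin k × Fin 2, a.1 ≠ b.1 → α i ![v a, v b] = 0) :
    wedge α v = ∑ τ : Equiv.Perm (Fin k), ∏ i, α i ![v (τ i, 0), v (τ i, 1)] := by
  have h1 := Fintype.sum_of_injective (pairPerm (k := k)) (pairPerm_injective k)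
    (fun x => ∏ i, α i ![v (x.1 i, 0), v (x.1 i, 1)])
    (fun σ => ((Equiv.Perm.sign σ : ℤ) : ℝ) * ∏ i, α i ![v (σ (i, 0)), v (σ (i, 1))]) ?_ ?_
  · rw [wedge, ← h1, Fintype.sum_prod_type]
    simp only [Finset.sum_const, Finset.card_univ, Fintype.card_pi, Fintype.card_perm,
      Fintype.card_fin, Finset.prod_const, nsmul_eq_mul]
    rw [← Finset.mul_sum, ← mul_assoc]
    simp [Nat.factorial]
  · intro σ hσ
    rw [mul_eq_zero]
    right
    by_contra hne
    replace hne := Finset.prod_ne_zero_iff.1 hne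
    refine hσ (mem_range_pairPerm (pairs_of_pairs_ne i₀ fun i hi => ?_))
    by_contra hp
    exact hne i (Finset.mem_univ i) (h i hi _ _ hp)
  · rintro ⟨τ, s⟩
    simp only [sign_pairPerm, pairPerm_apply]
    push_cast
    rw [← Finset.prod_mul_distrib]
    refine Finset.prod_congr rfl fun i _ => ?_
    have h2 := (α i).map_perm ![v (τ i, 0), v (τ i, 1)] (s i)
    have e : (![v (τ i, 0), v (τ i, 1)] : Fin 2 → E) ∘ (s i) =
        ![v (τ i, s i 0), v (τ i, s i 1)] := by
      have e0 : ∀ b : Fin 2, (![v (τ i, 0), v (τ i, 1)] : Fin 2 → E) b = v (τ i, b) := by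
        intro b; fin_cases b <;> rfl
      funext b
      fin_cases b
      · exact e0 _
      · exact e0 _
    rw [e, Units.smul_def, zsmul_eq_mul] at h2
    rw [h2, ← mul_assoc]
    rcases Int.units_eq_one_or (Equiv.Perm.sign (s i)) with hs | hs <;> simp [hs]

/-! ### Real determinants of complex linear maps, top powers of Hermitian forms -/

lemma det_real_of_complex {k : ℕ} (T : (Fin k → ℂ) →ₗ[ℂ] (Fin k → ℂ)) :
    LinearMap.det (T.restrictScalars ℝ) = ‖LinearMap.det T‖ ^ 2 := by
  rw [LinearMap.det_restrictScalars, Algebra.norm_complex_apply, Complex.normSq_eq_norm_sq]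

lemma realBasis_apply_smul {k : ℕ} (j : Fin k × Fin 2) (i : Fin k) (h : i ≠ j.1) :
    realBasis k j i = 0 := by
  simp [realBasis, h]

/-- The top exterior power of the imaginary part of a Hermitian form. -/
theorem wedge_hermitian {N : ℕ} (H : Matrix (Fin N) (Fin N) ℂ) (hH : H.IsHermitian)
    (α : (Fin N → ℂ) [⋀^Fin 2]→ₗ[ℝ] ℝ)
    (hα : ∀ x y, α ![x, y] = (x ⬝ᵥ H.mulVec (star y)).im) :
    |wedge (fun _ : Fin N => α) (realBasis N)| = N.factorial * ‖H.det‖ := by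
  rcases Nat.eq_zero_or_pos N with rfl | hN
  · simp [wedge]
  set U : Matrix (Fin N) (Fin N) ℂ := (hH.eigenvectorUnitary : Matrix (Fin N) (Fin N) ℂ) with hU
  set l := hH.eigenvalues with hl
  have hUU : U * star U = 1 := Unitary.coe_mul_star_self _
  have hdec : H = U * Matrix.diagonal (fun i => (l i : ℂ)) * star U := by
    have := hH.spectral_theorem
    rw [Unitary.conjStarAlgAut_apply] at this
    exact this
  let B : (Fin N → ℂ) →ₗ[ℝ] (Fin N → ℂ) →ₗ[ℝ] ℝ := LinearMap.mk₂ ℝ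
    (fun x y => ∑ i, l i * (x i * starRingEnd ℂ (y i)).im)
    (fun x y z => by simp only [Pi.add_apply, add_mul, Complex.add_im, mul_add, Finset.sum_add_distrib])
    (fun c x y => by
      simp only [Pi.smul_apply, Complex.real_smul, mul_assoc, Complex.im_ofReal_mul, smul_eq_mul,
        Finset.mul_sum]
      exact Finset.sum_congr rfl fun i _ => by ring)
    (fun x y z => by
      simp only [Pi.add_apply, map_add, mul_add, Complex.add_im, Finset.sum_add_distrib])
    (fun c x y => by
      simp only [Pi.smul_apply, Complex.real_smul, map_mul, Complex.conj_ofReal, mul_left_comm _ (c : ℂ),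
        Complex.im_ofReal_mul, smul_eq_mul, Finset.mul_sum]
      exact Finset.sum_congr rfl fun i _ => by ring)
  have hB : ∀ x, B x x = 0 := fun x => by
    show ∑ i, l i * (x i * starRingEnd ℂ (x i)).im = 0
    exact Finset.sum_eq_zero fun i _ => by rw [Complex.mul_conj]; simp
  let δ := altOfBilin B hB
  have hδ : ∀ x y, δ ![x, y] = ∑ i, l i * (x i * starRingEnd ℂ (y i)).im := fun x y => rfl
  let T : (Fin N → ℂ) →ₗ[ℂ] (Fin N → ℂ) := Matrix.toLin' U.transpose
  have hαδ : α = δ.compLinearMap (T.restrictScalars ℝ) := by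
    ext m
    have em : m = ![m 0, m 1] := by funext i; fin_cases i <;> rfl
    rw [em, hα]
    have e2 : δ.compLinearMap (T.restrictScalars ℝ) ![m 0, m 1] = δ ![T (m 0), T (m 1)] := by
      rw [AlternatingMap.compLinearMap_apply]
      congr 1
      funext i; fin_cases i <;> rfl
    rw [e2, hδ]
    have e3 : m 0 ⬝ᵥ H.mulVec (star (m 1)) = ∑ i, (l i : ℂ) * (T (m 0) i * starRingEnd ℂ (T (m 1) i)) := by
      have eT : ∀ x, T x = Matrix.vecMul x U := fun x => by
        simp only [T, Matrix.toLin'_apply, Matrix.mulVec_transpose]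
      have es : (star U).mulVec (star (m 1)) = star (Matrix.vecMul (m 1) U) := by
        rw [Matrix.star_vecMul]; rfl
      rw [hdec, ← Matrix.mulVec_mulVec, ← Matrix.mulVec_mulVec, Matrix.dotProduct_mulVec, es, eT, eT]
      simp only [dotProduct, Matrix.mulVec_diagonal, Pi.star_apply]
      exact Finset.sum_congr rfl fun i _ => by
        show _ = (l i : ℂ) * (_ * star _)
        ring
    rw [e3, Complex.im_sum]
    simp only [Complex.im_ofReal_mul]
  have hdetT : LinearMap.det (T.restrictScalars ℝ) = 1 := by
    rw [det_real_of_complex, LinearMap.det_toLin', Matrix.det_transpose]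
    have h1 := congrArg Matrix.det hUU
    rw [Matrix.det_mul, Matrix.star_eq_conjTranspose, Matrix.det_conjTranspose, Matrix.det_one] at h1
    have h2 := congrArg norm h1
    rw [norm_mul, norm_star, norm_one] at h2
    rw [sq, h2]
  have hdetH : H.det = ∏ i, (l i : ℂ) := hH.det_eq_prod_eigenvalues
  rw [hαδ, wedge_comp (fun _ => δ)]
  have h1 := wedge_det (fun _ : Fin N => δ) (T.restrictScalars ℝ)
  rw [h1, hdetT, one_mul, wedge_diag (fun _ => δ) (realBasis N) ⟨0, hN⟩]
  · have e : ∀ i, δ ![realBasis N (i, 0), realBasis N (i, 1)] = - l i := by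
      intro i
      rw [hδ, Finset.sum_eq_single i]
      · simp [realBasis]
      · intro j _ hj
        simp [realBasis, hj]
      · simp
    simp only [e]
    have e2 : ∀ τ : Equiv.Perm (Fin N), ∏ i, -l (τ i) = ∏ i, - l i := fun τ =>
      Equiv.prod_comp τ fun i => - l i
    simp only [e2, Finset.sum_const, Finset.card_univ, Fintype.card_perm, Fintype.card_fin,
      nsmul_eq_mul]
    rw [abs_mul, Finset.abs_prod, hdetH, norm_prod]
    simp
  · intro i _ a b hab
    rw [hδ]
    refine Finset.sum_eq_zero fun j _ => ?_
    by_cases hj : j = a.1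
    · rw [realBasis_apply_smul b j (by rw [hj]; exact hab)]; simp
    · rw [realBasis_apply_smul a j hj]; simp

/-- The coefficient of `β ∧ ω^{k-1}`, where `ω` is `c` times the standard Kähler form. -/
theorem wedge_std {k : ℕ} (i₀ : Fin (k + 1)) (β α : (Fin (k + 1) → ℂ) [⋀^Fin 2]→ₗ[ℝ] ℝ) (c : ℝ)
    (hα : ∀ x y, α ![x, y] = -c * (herm x y).im) :
    wedge (fun i : Fin (k + 1) => if i = i₀ then β else α) (realBasis (k + 1)) =
      k.factorial * c ^ k * ∑ j, β ![Pi.single j 1, Pi.single j Complex.I] := by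
  rw [wedge_diag _ (realBasis (k + 1)) i₀]
  · have e : ∀ τ : Equiv.Perm (Fin (k + 1)), ∏ i, (if i = i₀ then β else α)
        ![realBasis (k + 1) (τ i, 0), realBasis (k + 1) (τ i, 1)] =
        c ^ k * β ![Pi.single (τ i₀) 1, Pi.single (τ i₀) Complex.I] := by
      intro τ
      rw [← Finset.mul_prod_erase _ _ (Finset.mem_univ i₀), mul_comm]
      congr 1
      · have : ∀ i ∈ Finset.univ.erase i₀, (if i = i₀ then β else α)
            ![realBasis (k + 1) (τ i, 0), realBasis (k + 1) (τ i, 1)] = c := by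
          intro i hi
          rw [if_neg (Finset.ne_of_mem_erase hi), hα]
          simp only [herm]
          rw [Finset.sum_eq_single (τ i)]
          · simp [realBasis]
          · intro j _ hj
            simp [realBasis, hj]
          · simp
        rw [Finset.prod_congr rfl this]
        simp
      · simp [realBasis]
    simp only [e]
    rw [← Finset.mul_sum]
    have h2 : ∑ τ : Equiv.Perm (Fin (k + 1)), β ![Pi.single (τ i₀) 1, Pi.single (τ i₀) Complex.I] =
        k.factorial * ∑ j, β ![Pi.single j 1, Pi.single j Complex.I] := by
      rw [← Equiv.sum_comp (Equiv.mulRight (Equiv.swap 0 i₀))]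
      simp only [Equiv.coe_mulRight, Equiv.Perm.coe_mul, Function.comp_apply, Equiv.swap_apply_right]
      rw [← Equiv.sum_comp Equiv.Perm.decomposeFin.symm, Fintype.sum_prod_type]
      simp only [Equiv.Perm.decomposeFin_symm_apply_zero, Finset.sum_const, Finset.card_univ,
        Fintype.card_perm, Fintype.card_fin, nsmul_eq_mul]
      rw [← Finset.mul_sum]
    rw [h2]
    ring
  · intro i hi a b hab
    rw [if_neg hi, hα]
    simp only [herm]
    rw [Finset.sum_eq_zero]
    · simp
    · intro j _
      by_cases hj : j = a.1
      · rw [realBasis_apply_smul b j (by rw [hj]; exact hab)]; simp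
      · rw [realBasis_apply_smul a j hj]; simp

end CHyp

namespace CHyp

/-! ### Affine charts of the space of complex geodesics -/

/-- The parameter space of charts. -/
abbrev Par (m : ℕ) : Type := Fin (2 * (m + 1) - 2) → ℂ

/-- The parameters of a chart form two vectors of `ℂ^m`. -/
def parEquiv (m : ℕ) : Fin (2 * (m + 1) - 2) ≃ Fin 2 × Fin m :=
  (finCongr (by omega)).trans finProdFinEquiv.symm

/-- The components of a parameter. -/
noncomputable def parComp {m : ℕ} (a : Fin 2) : Par m →L[ℂ] (Fin m → ℂ) :=
  ContinuousLinearMap.pi fun j => ContinuousLinearMap.proj ((parEquiv m).symm (a, j))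

lemma parComp_apply {m : ℕ} (a : Fin 2) (u : Par m) (j : Fin m) :
    parComp a u j = u ((parEquiv m).symm (a, j)) := rfl

lemma par_ext {m : ℕ} {u w : Par m} (h : ∀ a, parComp a u = parComp a w) : u = w := by
  funext i
  have := congrFun (h (parEquiv m i).1) (parEquiv m i).2
  simpa [parComp_apply] using this

/-- The parameter with given components. -/
def parMk {m : ℕ} (x : Fin 2 → Fin m → ℂ) : Par m := fun i => x (parEquiv m i).1 (parEquiv m i).2

@[simp] lemma parComp_parMk {m : ℕ} (x : Fin 2 → Fin m → ℂ) (a : Fin 2) :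
    parComp a (parMk x) = x a := by
  funext j; simp [parComp_apply, parMk]

/-- The vector with `k`-th coordinate `c` and the other coordinates `x`. -/
def ins {m : ℕ} (k : Fin (m + 1)) (c : ℂ) (x : Fin m → ℂ) : Fin (m + 1) → ℂ :=
  Fin.insertNth k c x

@[simp] lemma ins_same {m : ℕ} (k : Fin (m + 1)) (c : ℂ) (x : Fin m → ℂ) : ins k c x k = c := by
  simp [ins]

@[simp] lemma ins_succAbove {m : ℕ} (k : Fin (m + 1)) (c : ℂ) (x : Fin m → ℂ) (j : Fin m) :
    ins k c x (k.succAbove j) = x j := by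
  simp [ins]

lemma eq_ins {m : ℕ} {k : Fin (m + 1)} {c : ℂ} {x : Fin m → ℂ} {y : Fin (m + 1) → ℂ} (h : y k = c)
    (hj : ∀ j, y (k.succAbove j) = x j) : y = ins k c x := by
  funext i
  rcases Fin.eq_self_or_eq_succAbove k i with rfl | ⟨j, rfl⟩
  · simp [h]
  · simp [hj]

/-- The frame of the chart of complex lines whose direction has non-zero `k`-th coordinate. -/
noncomputable def chartFrame {m : ℕ} (k : Fin (m + 1)) (u : Par m) : Fin 2 → V (m + 1) :=
  ![lift (ins k 0 (parComp 0 u)), vec (ins k 1 (parComp 1 u))]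

/-- The coordinates in the `k`-th chart of the plane spanned by a frame, from its bivector. -/
noncomputable def bivCoord {m : ℕ} (k : Fin (m + 1)) (p : Biv (m + 1)) : Par m :=
  parMk ![fun j => p (Sum.inl (k.succAbove j), Sum.inl k) / p (Sum.inr (), Sum.inl k),
    fun j => p (Sum.inr (), Sum.inl (k.succAbove j)) / p (Sum.inr (), Sum.inl k)]

lemma plucker_chartFrame_pivot {m : ℕ} (k : Fin (m + 1)) (u : Par m) :
    plucker (chartFrame k u) (Sum.inr (), Sum.inl k) = 1 := by
  simp [plucker, chartFrame, wdg, lift, vec]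

lemma bivCoord_chartFrame {m : ℕ} (k : Fin (m + 1)) (u : Par m) :
    bivCoord k (plucker (chartFrame k u)) = u := by
  refine par_ext fun a => ?_
  rw [bivCoord, parComp_parMk, plucker_chartFrame_pivot]
  funext j
  fin_cases a <;> simp [plucker, chartFrame, wdg, lift, vec]

lemma bivCoord_smul {m : ℕ} (k : Fin (m + 1)) {c : ℂ} (hc : c ≠ 0) (p : Biv (m + 1)) :
    bivCoord k (c • p) = bivCoord k p := by
  simp only [bivCoord, Pi.smul_apply, smul_eq_mul, mul_div_mul_left _ _ hc]

lemma chartFrame_bivCoord {m : ℕ} (k : Fin (m + 1)) (f : Fin 2 → V (m + 1))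
    (h : plucker f (Sum.inr (), Sum.inl k) ≠ 0) :
    chartFrame k (bivCoord k (plucker f)) =
      comb (fun i j => ![![f 1 (Sum.inl k), -f 0 (Sum.inl k)],
        ![-f 1 (Sum.inr ()), f 0 (Sum.inr ())]] i j / plucker f (Sum.inr (), Sum.inl k)) f := by
  have hp : ∀ x y, plucker f (x, y) = f 0 x * f 1 y - f 0 y * f 1 x := fun x y => rfl
  funext a i
  rw [chartFrame, bivCoord]
  simp only [parComp_parMk]
  fin_cases a
  · rcases i with i | i
    · rcases Fin.eq_self_or_eq_succAbove k i with rfl | ⟨j, rfl⟩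
      · simp [lift, comb]; ring
      · simp [lift, comb, hp]; ring
    · simp [lift, comb]
      field_simp
      rw [hp]; ring
  · rcases i with i | i
    · rcases Fin.eq_self_or_eq_succAbove k i with rfl | ⟨j, rfl⟩
      · simp [vec, comb]
        field_simp
        rw [hp]; ring
      · simp [vec, comb, hp]; ring
    · simp [vec, comb]; ring

lemma plucker_chartFrame_bivCoord {m : ℕ} (k : Fin (m + 1)) (f : Fin 2 → V (m + 1))
    (h : plucker f (Sum.inr (), Sum.inl k) ≠ 0) :
    plucker f = plucker f (Sum.inr (), Sum.inl k) •
      plucker (chartFrame k (bivCoord k (plucker f))) := by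
  rw [chartFrame_bivCoord k f h, plucker_comb, smul_smul]
  have hp : plucker f (Sum.inr (), Sum.inl k) =
    f 0 (Sum.inr ()) * f 1 (Sum.inl k) - f 0 (Sum.inl k) * f 1 (Sum.inr ()) := rfl
  have : plucker f (Sum.inr (), Sum.inl k) * ((f 1 (Sum.inl k) / plucker f (Sum.inr (), Sum.inl k)) *
      (f 0 (Sum.inr ()) / plucker f (Sum.inr (), Sum.inl k)) -
      (-f 0 (Sum.inl k) / plucker f (Sum.inr (), Sum.inl k)) *
      (-f 1 (Sum.inr ()) / plucker f (Sum.inr (), Sum.inl k))) = 1 := by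
    field_simp
    rw [hp]; ring
  conv_lhs => rw [← one_smul ℂ (plucker f), ← this]
  rfl

lemma linearIndependent_of_plucker {n : ℕ} {f : Fin 2 → V n} (h : plucker f ≠ 0) :
    LinearIndependent ℂ f := by
  have h0 : f = ![f 0, f 1] := by funext i; fin_cases i <;> rfl
  rw [h0, LinearIndependent.pair_iff]
  intro s t hst
  have e1 : s • plucker f = 0 := by
    have : wdg (s • f 0 + t • f 1) (f 1) = s • plucker f := by
      rw [wdg_add_left, wdg_smul_left, wdg_smul_left, wdg_self, smul_zero, add_zero]; rfl
    rw [← this, hst]; funext x; simp [wdg]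
  have e2 : t • plucker f = 0 := by
    have : wdg (f 0) (s • f 0 + t • f 1) = t • plucker f := by
      rw [wdg_add_right, wdg_smul_right, wdg_smul_right, wdg_self, smul_zero, zero_add]; rfl
    rw [← this, hst]; funext x; simp [wdg]
  exact ⟨(smul_eq_zero.1 e1).resolve_right h, (smul_eq_zero.1 e2).resolve_right h⟩

lemma span_comb_le {n : ℕ} (g : Fin 2 → Fin 2 → ℂ) (f : Fin 2 → V n) :
    Submodule.span ℂ (Set.range (comb g f)) ≤ Submodule.span ℂ (Set.range f) := by
  rw [Submodule.span_le]
  rintro _ ⟨i, rfl⟩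
  exact Submodule.sum_mem _ fun j _ => Submodule.smul_mem _ _ (Submodule.subset_span ⟨j, rfl⟩)

lemma span_eq_of_le {n : ℕ} {f f' : Fin 2 → V n} (hf : LinearIndependent ℂ f)
    (hf' : LinearIndependent ℂ f')
    (h : Submodule.span ℂ (Set.range f') ≤ Submodule.span ℂ (Set.range f)) :
    Submodule.span ℂ (Set.range f') = Submodule.span ℂ (Set.range f) := by
  apply Submodule.eq_of_le_of_finrank_eq h
  rw [finrank_span_eq_card hf, finrank_span_eq_card hf']

lemma linearIndependent_chartFrame {m : ℕ} (k : Fin (m + 1)) (u : Par m) :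
    LinearIndependent ℂ (chartFrame k u) := by
  apply linearIndependent_of_plucker
  intro h
  have := plucker_chartFrame_pivot k u
  rw [h] at this
  simp at this

lemma span_chartFrame_bivCoord {m : ℕ} (k : Fin (m + 1)) {f : Fin 2 → V (m + 1)}
    (h : plucker f (Sum.inr (), Sum.inl k) ≠ 0) :
    Submodule.span ℂ (Set.range (chartFrame k (bivCoord k (plucker f)))) =
      Submodule.span ℂ (Set.range f) := by
  refine span_eq_of_le (linearIndependent_of_plucker fun h0 => h (by rw [h0]; rfl))
    (linearIndependent_chartFrame k _) ?_
  rw [chartFrame_bivCoord k f h]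
  exact span_comb_le _ _

/-- Bivectors of frames of the same plane are proportional. -/
lemma exists_plucker_smul {n : ℕ} {f f' : Fin 2 → V n} (hf' : LinearIndependent ℂ f')
    (h : Submodule.span ℂ (Set.range f') ≤ Submodule.span ℂ (Set.range f)) :
    ∃ c : ℂ, c ≠ 0 ∧ plucker f' = c • plucker f := by
  obtain ⟨g, rfl⟩ := exists_comb (f := f) (f' := f') fun i => h (Submodule.subset_span ⟨i, rfl⟩)
  exact ⟨_, det_ne_zero_of_comb hf', plucker_comb g f⟩

/-- The differential of `chartFrame`. -/
noncomputable def dchart {m : ℕ} (k : Fin (m + 1)) (x : Par m) : Fin 2 → V (m + 1) :=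
  fun a => vec (ins k 0 (parComp a x))

lemma hasFDerivAt_chartFrame {m : ℕ} (k : Fin (m + 1)) (u : Par m) :
    ∃ L : Par m →L[ℂ] (Fin 2 → V (m + 1)), (∀ x, L x = dchart k x) ∧
      HasFDerivAt (chartFrame k) L u := by
  have hL : IsLinearMap ℂ (dchart (m := m) k) := by
    constructor
    · intro x y
      funext a i
      rcases i with i | i
      · rcases Fin.eq_self_or_eq_succAbove k i with rfl | ⟨j, rfl⟩ <;> simp [dchart, vec]
      · simp [dchart, vec]
    · intro c x
      funext a i
      rcases i with i | i
      · rcases Fin.eq_self_or_eq_succAbove k i with rfl | ⟨j, rfl⟩ <;> simp [dchart, vec]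
      · simp [dchart, vec]
  let L := LinearMap.toContinuousLinearMap (hL.mk' _)
  refine ⟨L, fun x => rfl, ?_⟩
  have e : chartFrame k = fun u => chartFrame k 0 + L u := by
    funext u a i
    have hL' : L u = dchart k u := rfl
    rw [hL']
    fin_cases a
    · rcases i with i | i
      · rcases Fin.eq_self_or_eq_succAbove k i with rfl | ⟨j, rfl⟩ <;> simp [chartFrame, dchart, vec, lift]
      · simp [chartFrame, dchart, vec, lift]
    · rcases i with i | i
      · rcases Fin.eq_self_or_eq_succAbove k i with rfl | ⟨j, rfl⟩ <;> simp [chartFrame, dchart, vec]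
      · simp [chartFrame, dchart, vec]
  rw [e]
  exact L.hasFDerivAt.const_add _

lemma differentiable_chartFrame {m : ℕ} (k : Fin (m + 1)) : Differentiable ℂ (chartFrame (m := m) k) :=
  fun u => by obtain ⟨L, -, h⟩ := hasFDerivAt_chartFrame k u; exact h.differentiableAt

lemma fderiv_chartFrame {m : ℕ} (k : Fin (m + 1)) (u x : Par m) :
    fderiv ℂ (chartFrame k) u x = dchart k x := by
  obtain ⟨L, hL, h⟩ := hasFDerivAt_chartFrame k u
  rw [h.fderiv, hL]

/-- The affine charts of the space of complex geodesics. -/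
noncomputable def chart {m : ℕ} (k : Fin (m + 1)) : GeoChart (m + 1) where
  dom := {u | chartFrame k u ∈ frames (m + 1)}
  isOpen_dom := (isOpen_frames (m + 1)).preimage (differentiable_chartFrame k).continuous
  frame := chartFrame k
  holomorphic := (differentiable_chartFrame k).differentiableOn
  mem_frames := fun u hu => hu
  injective := by
    intro u hu u' hu' h
    have h1 : Submodule.span ℂ (Set.range (chartFrame k u)) =
      Submodule.span ℂ (Set.range (chartFrame k u')) := congrArg Geodesic.plane h
    obtain ⟨c, hc, hp⟩ := exists_plucker_smul hu.1 h1.le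
    rw [← bivCoord_chartFrame k u, hp, bivCoord_smul k hc, bivCoord_chartFrame]
  immersive := by
    intro u hu
    have hlin : (fun x => dspan (chartFrame k u) hu (fderiv ℂ (chartFrame k) u x)) =
      (dspan (chartFrame k u) hu ∘ₗ (fderiv ℂ (chartFrame k) u).toLinearMap) := rfl
    rw [hlin, ← LinearMap.ker_eq_bot, LinearMap.ker_eq_bot']
    intro x hx
    have h1 : ∀ a, vec (ins k 0 (parComp a x)) ∈ Submodule.span ℂ (Set.range (chartFrame k u)) := by
      intro a
      have ha : chartFrame k u a ∈ (spanGeo (chartFrame k u) hu).plane :=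
        Submodule.subset_span ⟨a, rfl⟩
      have h2 := dspan_apply (chartFrame k u) hu (dchart k x) a ha
      have h3 : dspan (chartFrame k u) hu (dchart k x) = 0 := by
        rw [← fderiv_chartFrame k u x]; exact hx
      rw [h3] at h2
      exact (Submodule.Quotient.mk_eq_zero _).1 h2.symm
    refine par_ext fun a => ?_
    obtain ⟨d, hd⟩ := (Submodule.mem_span_range_iff_exists_fun ℂ).1 (h1 a)
    have d0 : d 0 = 0 := by simpa [chartFrame, vec, lift] using congrFun hd (Sum.inr ())
    have d1 : d 1 = 0 := by simpa [chartFrame, vec, lift, d0] using congrFun hd (Sum.inl k)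
    funext j
    simpa [chartFrame, vec, lift, d0, d1] using (congrFun hd (Sum.inl (k.succAbove j))).symm

/-! ### The density of the invariant volume form in the affine charts -/

/-- The Gram matrix of a frame. -/
noncomputable def gram {n : ℕ} (f : Fin 2 → V n) : Matrix (Fin 2) (Fin 2) ℂ :=
  Matrix.of fun a b => hf (f a) (f b)

lemma hh_plucker {n : ℕ} (f : Fin 2 → V n) : hh (plucker f) (plucker f) = 2 * (gram f).det := by
  rw [Matrix.det_fin_two, plucker, hh_wdg]
  rfl

/-- The form induced by `h` on the quotient by the plane of a frame. -/
noncomputable def quotForm {n : ℕ} (f : Fin 2 → V n) (u w : V n) : ℂ :=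
  hf u w - (hf u (f 0) * hf (f 1) (f 1) * hf (f 0) w - hf u (f 0) * hf (f 0) (f 1) * hf (f 1) w
    - hf u (f 1) * hf (f 1) (f 0) * hf (f 0) w + hf u (f 1) * hf (f 0) (f 0) * hf (f 1) w) /
    (gram f).det

lemma fsK_plucker {n : ℕ} (f u w : Fin 2 → V n) (h : (gram f).det ≠ 0) :
    fsK (plucker f) (dplucker f u) (dplucker f w) =
      (hf (f 1) (f 1) * quotForm f (u 0) (w 0) - hf (f 1) (f 0) * quotForm f (u 0) (w 1)
        - hf (f 0) (f 1) * quotForm f (u 1) (w 0) + hf (f 0) (f 0) * quotForm f (u 1) (w 1)) /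
      (gram f).det := by
  have hd : (gram f).det = hf (f 0) (f 0) * hf (f 1) (f 1) - hf (f 0) (f 1) * hf (f 1) (f 0) := by
    rw [Matrix.det_fin_two]; rfl
  rw [fsK, hh_plucker]
  simp only [dplucker_apply, plucker, quotForm, hh_add_left, hh_add_right, hh_wdg]
  rw [div_eq_div_iff (pow_ne_zero 2 (mul_ne_zero two_ne_zero h)) h]
  field_simp
  rw [hd]
  ring

lemma hf_vec_ins {m : ℕ} (k : Fin (m + 1)) (x : Fin m → ℂ) (w : V (m + 1)) :
    hf (vec (ins k 0 x)) w = ∑ j, x j * starRingEnd ℂ (w (Sum.inl (k.succAbove j))) := by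
  simp [hf, vec, Fintype.sum_sum_type, Fin.sum_univ_succAbove _ k]

lemma hf_vec_ins_right {m : ℕ} (k : Fin (m + 1)) (x : Fin m → ℂ) (w : V (m + 1)) :
    hf w (vec (ins k 0 x)) = ∑ j, w (Sum.inl (k.succAbove j)) * starRingEnd ℂ (x j) := by
  simp [hf, vec, Fintype.sum_sum_type, Fin.sum_univ_succAbove _ k]

/-- The Gram matrix of a chart frame with the remaining basis vectors. -/
noncomputable def crossGram {m : ℕ} (k : Fin (m + 1)) (f : Fin 2 → V (m + 1)) :
    Matrix (Fin m) (Fin 2) ℂ :=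
  Matrix.of fun j a => starRingEnd ℂ (f a (Sum.inl (k.succAbove j)))

/-- The matrix of `quotForm` for a chart frame. -/
noncomputable def quotMatrix {m : ℕ} (k : Fin (m + 1)) (f : Fin 2 → V (m + 1)) :
    Matrix (Fin m) (Fin m) ℂ :=
  1 - crossGram k f * (gram f)⁻¹ * (crossGram k f).conjTranspose

lemma inv_gram {n : ℕ} (f : Fin 2 → V n) : (gram f)⁻¹ = ((gram f).det)⁻¹ •
    Matrix.of ![![hf (f 1) (f 1), -hf (f 0) (f 1)], ![-hf (f 1) (f 0), hf (f 0) (f 0)]] := by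
  rw [Matrix.inv_def, Ring.inverse_eq_inv', Matrix.adjugate_fin_two]
  rfl

lemma inv_gram_apply {n : ℕ} (f : Fin 2 → V n) :
    (gram f)⁻¹ 0 0 = hf (f 1) (f 1) / (gram f).det ∧
    (gram f)⁻¹ 0 1 = -hf (f 0) (f 1) / (gram f).det ∧
    (gram f)⁻¹ 1 0 = -hf (f 1) (f 0) / (gram f).det ∧
    (gram f)⁻¹ 1 1 = hf (f 0) (f 0) / (gram f).det := by
  rw [inv_gram]
  refine ⟨?_, ?_, ?_, ?_⟩ <;> simp [div_eq_inv_mul]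

lemma quotForm_vec_ins {m : ℕ} (k : Fin (m + 1)) (f : Fin 2 → V (m + 1)) (x y : Fin m → ℂ) :
    quotForm f (vec (ins k 0 x)) (vec (ins k 0 y)) = x ⬝ᵥ (quotMatrix k f).mulVec (star y) := by
  have h1 : ∀ c, hf (vec (ins k 0 x)) (f c) = Matrix.vecMul x (crossGram k f) c := fun c => by
    rw [hf_vec_ins]; rfl
  have h2 : ∀ c, hf (f c) (vec (ins k 0 y)) =
      (crossGram k f).conjTranspose.mulVec (star y) c := fun c => by
    rw [hf_vec_ins_right]
    simp [Matrix.mulVec, dotProduct, crossGram]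
  have h3 : hf (vec (ins k 0 x)) (vec (ins k 0 y)) = x ⬝ᵥ star y := by
    rw [hf_vec_ins]
    simp [vec, dotProduct]
  rw [quotMatrix, Matrix.sub_mulVec, Matrix.one_mulVec, dotProduct_sub, ← Matrix.mulVec_mulVec,
    ← Matrix.mulVec_mulVec, Matrix.dotProduct_mulVec, quotForm, h3, h1, h1, h2, h2]
  congr 1
  obtain ⟨g00, g01, g10, g11⟩ := inv_gram_apply f
  simp only [dotProduct, Matrix.mulVec, Fin.sum_univ_two, g00, g01, g10, g11]
  ring

lemma isHermitian_gram {n : ℕ} (f : Fin 2 → V n) : (gram f).IsHermitian := by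
  ext a b
  show star (hf (f b) (f a)) = hf (f a) (f b)
  exact conj_hf _ _

lemma isHermitian_quotMatrix {m : ℕ} (k : Fin (m + 1)) (f : Fin 2 → V (m + 1)) :
    (quotMatrix k f).IsHermitian := by
  have h := (isHermitian_gram f).inv
  refine Matrix.isHermitian_one.sub ?_
  exact Matrix.isHermitian_mul_mul_conjTranspose _ h

lemma det_quotMatrix {m : ℕ} (k : Fin (m + 1)) (u : Par m)
    (h : (gram (chartFrame k u)).det ≠ 0) :
    (quotMatrix k (chartFrame k u)).det = - ((gram (chartFrame k u)).det)⁻¹ := by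
  set f := chartFrame k u with hf'
  set E := crossGram k f with hE
  have hu : IsUnit (gram f).det := isUnit_iff_ne_zero.2 h
  rw [quotMatrix, Matrix.mul_assoc, Matrix.det_one_sub_mul_comm, Matrix.mul_assoc]
  have e1 : 1 - (gram f)⁻¹ * (E.conjTranspose * E) =
      (gram f)⁻¹ * (gram f - E.conjTranspose * E) := by
    rw [Matrix.mul_sub, Matrix.nonsing_inv_mul _ hu]
  have e2 : gram f - E.conjTranspose * E = Matrix.of ![![-1, 0], ![0, 1]] := by
    have e3 : ∀ a b, (gram f - E.conjTranspose * E) a b =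
        f a (Sum.inl k) * starRingEnd ℂ (f b (Sum.inl k)) -
          f a (Sum.inr ()) * starRingEnd ℂ (f b (Sum.inr ())) := by
      intro a b
      rw [Matrix.sub_apply, Matrix.mul_apply]
      simp only [gram, hf, Matrix.of_apply, Fintype.sum_sum_type, Fin.sum_univ_succAbove _ k, hE,
        crossGram, Matrix.conjTranspose_apply, sgn_inl, sgn_inr, Finset.univ_unique,
        Finset.sum_singleton, RCLike.star_def, Complex.conj_conj]
      simp
      ring
    ext a b
    rw [e3]
    fin_cases a <;> fin_cases b <;> simp [hf', chartFrame, lift, vec]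
  rw [← hE, e1, Matrix.det_mul, e2, Matrix.det_nonsing_inv, Matrix.det_fin_two]
  simp

/-- The density of the invariant volume form in an affine chart. -/
theorem abs_density_chart {m : ℕ} (k : Fin (m + 1)) (u : Par m)
    (hu : chartFrame k u ∈ frames (m + 1)) :
    |(chart k).density (geoOmega (m + 1)) u| =
      (2 * (m + 1) - 2).factorial * (‖(gram (chartFrame k u)).det‖⁻¹) ^ (m + 2) := by
  set f := chartFrame k u with hf'
  have hdet : (gram f).det ≠ 0 := by
    have := hh_plucker_ne_zero hu
    rw [hh_plucker] at this
    exact right_ne_zero_of_mul this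
  set H : Matrix (Fin (2 * (m + 1) - 2)) (Fin (2 * (m + 1) - 2)) ℂ :=
    (Matrix.kroneckerMap (· * ·) ((gram f)⁻¹).transpose (quotMatrix k f)).submatrix
      (parEquiv m) (parEquiv m) with hH
  have hHerm : H.IsHermitian := by
    refine Matrix.IsHermitian.submatrix ?_ _
    have h1 := Matrix.conjTranspose_kronecker ((gram f)⁻¹).transpose (quotMatrix k f)
    have h2 : ((gram f)⁻¹).transpose.IsHermitian := (isHermitian_gram f).inv.transpose
    rw [Matrix.IsHermitian, h1, h2.eq, (isHermitian_quotMatrix k f).eq]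
  have hdetH : ‖H.det‖ = (‖(gram f).det‖⁻¹) ^ (m + 2) := by
    rw [hH, Matrix.det_submatrix_equiv_self]
    have := Matrix.det_kronecker ((gram f)⁻¹).transpose (quotMatrix k f)
    have hq : (quotMatrix k f).det = - ((gram f).det)⁻¹ := det_quotMatrix k u hdet
    rw [this, Matrix.det_transpose, hq, Matrix.det_nonsing_inv,
      Ring.inverse_eq_inv']
    simp [pow_add]
  rw [← hdetH]
  refine wedge_hermitian H hHerm _ fun x y => ?_
  have e1 : ((geoOmega (m + 1)).pull ((chart k).frame u)).toAlternatingMap.compLinearMap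
      ((fderiv ℂ (chart k).frame u).restrictScalars ℝ).toLinearMap ![x, y] =
      (geoOmega (m + 1)).pull f ![dchart k x, dchart k y] := by
    rw [← fderiv_chartFrame k u x, ← fderiv_chartFrame k u y]
    show (geoOmega (m + 1)).pull f _ = _
    congr 1
    funext i; fin_cases i <;> rfl
  rw [e1, pull_geoOmega hu, fs_apply]
  simp only [Matrix.cons_val_zero, Matrix.cons_val_one]
  rw [fsK_plucker f _ _ hdet]
  simp only [dchart, quotForm_vec_ins]
  congr 1
  have e2 : x ⬝ᵥ H.mulVec (star y) = ∑ a, ∑ b, (gram f)⁻¹ b a *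
      (parComp a x ⬝ᵥ (quotMatrix k f).mulVec (star (parComp b y))) := by
    simp only [dotProduct, Matrix.mulVec, Finset.mul_sum]
    rw [← Equiv.sum_comp (parEquiv m).symm, Fintype.sum_prod_type]
    refine Finset.sum_congr rfl fun a _ => ?_
    conv_rhs => rw [Finset.sum_comm]
    refine Finset.sum_congr rfl fun j _ => ?_
    rw [← Equiv.sum_comp (parEquiv m).symm, Fintype.sum_prod_type]
    refine Finset.sum_congr rfl fun b _ => ?_
    refine Finset.sum_congr rfl fun l _ => ?_
    simp [hH, parComp_apply]
    ring
  obtain ⟨g00, g01, g10, g11⟩ := inv_gram_apply f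
  simp only [e2, Fin.sum_univ_two, g00, g01, g10, g11]
  ring

end CHyp

namespace CHyp

/-! ### Change of charts -/

lemma plucker_frame_hasFDerivAt {m : ℕ} (c : GeoChart (m + 1)) {u : Par m} (hu : u ∈ c.dom) :
    HasFDerivAt (fun u => plucker (c.frame u))
      ((LinearMap.toContinuousLinearMap (dplucker (c.frame u))).comp (fderiv ℂ c.frame u)) u :=
  (hasFDerivAt_plucker (c.frame u)).comp u
    ((c.holomorphic u hu).differentiableAt (c.isOpen_dom.mem_nhds hu)).hasFDerivAt

/-- The form `ω^{2n-2}` in a chart, in terms of bivectors. -/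
lemma chart_form_apply {m : ℕ} (c : GeoChart (m + 1)) {u : Par m} (hu : u ∈ c.dom)
    (v : Fin 2 → Par m) :
    ((geoOmega (m + 1)).pull (c.frame u)).toAlternatingMap.compLinearMap
      ((fderiv ℂ c.frame u).restrictScalars ℝ).toLinearMap v =
    (fsK (plucker (c.frame u)) (fderiv ℂ (fun u => plucker (c.frame u)) u (v 0))
      (fderiv ℂ (fun u => plucker (c.frame u)) u (v 1))).im := by
  rw [(plucker_frame_hasFDerivAt c hu).fderiv]
  exact pull_geoOmega (c.mem_frames u hu) _

/-- The coordinates of a chart in the `k`-th affine chart. -/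
noncomputable def trans {m : ℕ} (c : GeoChart (m + 1)) (k : Fin (m + 1)) (u : Par m) : Par m :=
  bivCoord k (plucker (c.frame u))

lemma differentiableAt_bivCoord {m : ℕ} (k : Fin (m + 1)) {p : Biv (m + 1)}
    (hp : p (Sum.inr (), Sum.inl k) ≠ 0) : DifferentiableAt ℂ (bivCoord k) p := by
  rw [differentiableAt_pi]
  intro i
  have h : ∀ x, DifferentiableAt ℂ (fun p : Biv (m + 1) => p x) p := fun x =>
    differentiableAt_apply x p
  have e : ∀ q : Biv (m + 1), bivCoord k q i = (if (parEquiv m i).1 = 0 then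
      q (Sum.inl (k.succAbove (parEquiv m i).2), Sum.inl k)
      else q (Sum.inr (), Sum.inl (k.succAbove (parEquiv m i).2))) *
      (q (Sum.inr (), Sum.inl k))⁻¹ := by
    intro q
    simp only [bivCoord, parMk]
    generalize parEquiv m i = x
    obtain ⟨a, j⟩ := x
    fin_cases a <;> simp [div_eq_mul_inv]
  simp only [e]
  refine DifferentiableAt.fun_mul ?_ ((h _).fun_inv hp)
  split_ifs <;> exact h _

lemma differentiableAt_trans {m : ℕ} (c : GeoChart (m + 1)) (k : Fin (m + 1)) {u : Par m}
    (hu : u ∈ c.dom) (hp : plucker (c.frame u) (Sum.inr (), Sum.inl k) ≠ 0) :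
    DifferentiableAt ℂ (trans c k) u :=
  (differentiableAt_bivCoord k hp).comp u (plucker_frame_hasFDerivAt c hu).differentiableAt

lemma span_trans {m : ℕ} (c : GeoChart (m + 1)) (k : Fin (m + 1)) {u : Par m}
    (hp : plucker (c.frame u) (Sum.inr (), Sum.inl k) ≠ 0) :
    Submodule.span ℂ (Set.range (chartFrame k (trans c k u))) =
      Submodule.span ℂ (Set.range (c.frame u)) :=
  span_chartFrame_bivCoord k hp

lemma trans_mem {m : ℕ} (c : GeoChart (m + 1)) (k : Fin (m + 1)) {u : Par m} (hu : u ∈ c.dom)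
    (hp : plucker (c.frame u) (Sum.inr (), Sum.inl k) ≠ 0) :
    chartFrame k (trans c k u) ∈ frames (m + 1) :=
  ⟨linearIndependent_chartFrame _ _, by rw [span_trans c k hp]; exact (c.mem_frames u hu).2⟩

lemma trans_injOn {m : ℕ} (c : GeoChart (m + 1)) (k : Fin (m + 1)) :
    Set.InjOn (trans c k) {u | u ∈ c.dom ∧ plucker (c.frame u) (Sum.inr (), Sum.inl k) ≠ 0} := by
  rintro u ⟨hu, hp⟩ u' ⟨hu', hp'⟩ h
  refine c.injective u hu u' hu' (Geodesic.ext ?_)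
  show Submodule.span ℂ (Set.range (c.frame u)) = Submodule.span ℂ (Set.range (c.frame u'))
  rw [← span_trans c k hp, ← span_trans c k hp', h]

lemma density_trans {m : ℕ} (c : GeoChart (m + 1)) (k : Fin (m + 1)) {u : Par m} (hu : u ∈ c.dom)
    (hp : plucker (c.frame u) (Sum.inr (), Sum.inl k) ≠ 0) :
    c.density (geoOmega (m + 1)) u = LinearMap.det ((fderiv ℂ (trans c k) u).restrictScalars ℝ :
      Par m →ₗ[ℝ] Par m) * (chart k).density (geoOmega (m + 1)) (trans c k u) := by
  set φ := trans c k with hφ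
  set Φ : Par m → Biv (m + 1) := fun u => plucker (c.frame u) with hΦ
  set Ψ : Par m → Biv (m + 1) := fun u => plucker (chartFrame k u) with hΨ
  have hΦ' := (plucker_frame_hasFDerivAt c hu).differentiableAt.hasFDerivAt
  have hφ' := (differentiableAt_trans c k hu hp).hasFDerivAt
  have hw : φ u ∈ (chart k).dom := trans_mem c k hu hp
  have hΨ' := (plucker_frame_hasFDerivAt (chart k) hw).differentiableAt.hasFDerivAt
  have hl : HasFDerivAt (fun u => Φ u (Sum.inr (), Sum.inl k)) _ u := hasFDerivAt_pi'.1 hΦ' _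
  have hcomp := hl.smul (hΨ'.comp u hφ')
  have hev : Φ =ᶠ[nhds u] fun u => Φ u (Sum.inr (), Sum.inl k) • (Ψ ∘ φ) u := by
    have hc : ContinuousAt (fun u => Φ u (Sum.inr (), Sum.inl k)) u := hl.continuousAt
    filter_upwards [hc.eventually_ne hp] with u hu
    exact plucker_chartFrame_bivCoord k (c.frame u) hu
  have hder := hΦ'.unique (hcomp.congr_of_eventuallyEq hev)
  have hform : ((geoOmega (m + 1)).pull (c.frame u)).toAlternatingMap.compLinearMap
      ((fderiv ℂ c.frame u).restrictScalars ℝ).toLinearMap =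
      (((geoOmega (m + 1)).pull ((chart k).frame (φ u))).toAlternatingMap.compLinearMap
      ((fderiv ℂ (chart k).frame (φ u)).restrictScalars ℝ).toLinearMap).compLinearMap
      ((fderiv ℂ φ u).restrictScalars ℝ : Par m →ₗ[ℝ] Par m) := by
    ext v
    rw [chart_form_apply c hu, AlternatingMap.compLinearMap_apply, chart_form_apply (chart k) hw]
    congr 1
    have e0 : Φ u = Φ u (Sum.inr (), Sum.inl k) • Ψ (φ u) := hev.self_of_nhds
    have e1 : ∀ x, fderiv ℂ Φ u x = Φ u (Sum.inr (), Sum.inl k) • fderiv ℂ Ψ (φ u) (fderiv ℂ φ u x) +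
        (fderiv ℂ Φ u x (Sum.inr (), Sum.inl k)) • Ψ (φ u) := by
      intro x
      conv_lhs => rw [hder]
      rfl
    show fsK (Φ u) (fderiv ℂ Φ u (v 0)) (fderiv ℂ Φ u (v 1)) =
      fsK (Ψ (φ u)) (fderiv ℂ Ψ (φ u) (fderiv ℂ φ u (v 0))) (fderiv ℂ Ψ (φ u) (fderiv ℂ φ u (v 1)))
    rw [e1 (v 0), e1 (v 1)]
    conv_lhs => rw [e0]
    have e2 : (Φ u (Sum.inr (), Sum.inl k) • Ψ (φ u)) (Sum.inr (), Sum.inl k) =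
        Φ u (Sum.inr (), Sum.inl k) := by rw [← e0]
    rw [e2]
    exact fsK_rescale _ _ _ hp _ _
  rw [GeoChart.density, hform, wedge_comp (fun _ => _), wedge_det]
  rfl

end CHyp

namespace CHyp

open MeasureTheory Topology

/-! ### The topology of the space of complex geodesics -/

lemma continuous_spanGeo (n : ℕ) : Continuous fun f : frames n => spanGeo f.1 f.2 :=
  continuous_coinduced_rng

lemma isOpen_geodesic_iff {n : ℕ} {S : Set (Geodesic n)} :
    IsOpen S ↔ IsOpen {f : Fin 2 → V n | ∃ hf : f ∈ frames n, spanGeo f hf ∈ S} := by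
  have h : {f : Fin 2 → V n | ∃ hf : f ∈ frames n, spanGeo f hf ∈ S} =
      Subtype.val '' ((fun f : frames n => spanGeo f.1 f.2) ⁻¹' S) := by
    ext f
    simp
  rw [h, ← (isOpen_frames n).isOpenEmbedding_subtypeVal.isOpen_iff_image_isOpen]
  exact isOpen_coinduced

lemma continuous_lin {n : ℕ} (g : SU n) : Continuous (lin g) :=
  LinearMap.continuous_of_finiteDimensional (lin g : V n →ₗ[ℂ] V n)

lemma lin_mem_frames {n : ℕ} (g : SU n) {f : Fin 2 → V n} (hf : f ∈ frames n) :
    (fun i => lin g (f i)) ∈ frames n := by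
  refine ⟨linearIndependent_lin g hf.1, ?_⟩
  obtain ⟨v, hv, h⟩ := hf.2
  refine ⟨lin g v, ?_, by rwa [q_lin]⟩
  have : Set.range (fun i => lin g (f i)) = (lin g : V n →ₗ[ℂ] V n) '' Set.range f := by
    rw [← Set.range_comp]; rfl
  rw [this, ← Submodule.map_span]
  exact Submodule.mem_map_of_mem hv

lemma span_lin {n : ℕ} (g : SU n) (f : Fin 2 → V n) :
    Submodule.span ℂ (Set.range fun i => lin g (f i)) =
      (Submodule.span ℂ (Set.range f)).map (lin g : V n →ₗ[ℂ] V n) := by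
  have : Set.range (fun i => lin g (f i)) = (lin g : V n →ₗ[ℂ] V n) '' Set.range f := by
    rw [← Set.range_comp]; rfl
  rw [this, ← Submodule.map_span]

lemma smul_spanGeo {n : ℕ} (g : SU n) {f : Fin 2 → V n} (hf : f ∈ frames n) :
    g • spanGeo f hf = spanGeo (fun i => lin g (f i)) (lin_mem_frames g hf) :=
  Geodesic.ext (span_lin g f).symm

instance (n : ℕ) : ContinuousConstSMul (SU n) (Geodesic n) where
  continuous_const_smul g := by
    refine continuous_coinduced_dom.2 ?_
    have h : (fun W : Geodesic n => g • W) ∘ (fun f : frames n => spanGeo f.1 f.2) =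
        (fun f : frames n => spanGeo f.1 f.2) ∘
          fun f : frames n => ⟨fun i => lin g (f.1 i), lin_mem_frames g f.2⟩ := by
      funext f
      exact smul_spanGeo g f.2
    rw [h]
    refine (continuous_spanGeo n).comp (Continuous.subtype_mk ?_ _)
    exact continuous_pi fun i => (continuous_lin g).comp
      ((continuous_apply i).comp continuous_subtype_val)

lemma continuous_plucker (n : ℕ) : Continuous (plucker (n := n)) :=
  continuous_iff_continuousAt.2 fun f => (hasFDerivAt_plucker f).continuousAt

/-- The affine charts as maps to the space of complex geodesics. -/
noncomputable def chartMap {m : ℕ} (k : Fin (m + 1)) (u : (chart (m := m) k).dom) :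
    Geodesic (m + 1) :=
  spanGeo (chartFrame k u.1) u.2

lemma pivot_ne_zero_of_span {m : ℕ} {k : Fin (m + 1)} {f : Fin 2 → V (m + 1)} {u : Par m}
    (h : Submodule.span ℂ (Set.range (chartFrame k u)) = Submodule.span ℂ (Set.range f)) :
    plucker f (Sum.inr (), Sum.inl k) ≠ 0 ∧ bivCoord k (plucker f) = u := by
  obtain ⟨c, hc, e⟩ := exists_plucker_smul (f := f) (linearIndependent_chartFrame k u) h.le
  have h1 := plucker_chartFrame_pivot k u
  refine ⟨fun h0 => ?_, ?_⟩
  · rw [e] at h1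
    simp [h0] at h1
  · rw [← bivCoord_smul k hc, ← e, bivCoord_chartFrame]

lemma continuous_chartMap {m : ℕ} (k : Fin (m + 1)) : Continuous (chartMap (m := m) k) := by
  let F : (chart (m := m) k).dom → frames (m + 1) := fun u => ⟨chartFrame k u.1, u.2⟩
  have h : Continuous F := by
    refine continuous_induced_rng.2 ?_
    exact (differentiable_chartFrame k).continuous.comp continuous_subtype_val
  exact Continuous.comp (g := fun f : frames (m + 1) => spanGeo f.1 f.2) (f := F)
    (continuous_spanGeo (m + 1)) h

lemma isOpenEmbedding_chartMap {m : ℕ} (k : Fin (m + 1)) : IsOpenEmbedding (chartMap (m := m) k) := by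
  refine IsOpenEmbedding.of_continuous_injective_isOpenMap ?_ ?_ ?_
  · exact continuous_chartMap k
  · rintro u u' h
    exact Subtype.ext ((chart k).injective u.1 u.2 u'.1 u'.2 h)
  · intro O hO
    rw [isOpen_geodesic_iff]
    obtain ⟨O', hO', rfl⟩ := isOpen_induced_iff.1 hO
    have : {f : Fin 2 → V (m + 1) | ∃ hf : f ∈ frames (m + 1), spanGeo f hf ∈
        chartMap k '' (Subtype.val ⁻¹' O')} = frames (m + 1) ∩
          ({f | plucker f (Sum.inr (), Sum.inl k) ≠ 0} ∩
          (fun f => bivCoord k (plucker f)) ⁻¹' O') := by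
      ext f
      constructor
      · rintro ⟨hf, u, hu, e⟩
        obtain ⟨h1, h2⟩ := pivot_ne_zero_of_span (congrArg Geodesic.plane e)
        exact ⟨hf, h1, by rw [Set.mem_preimage, h2]; exact hu⟩
      · rintro ⟨hf, h1, h2⟩
        refine ⟨hf, ⟨bivCoord k (plucker f), linearIndependent_chartFrame k _, ?_⟩, h2,
          Geodesic.ext (span_chartFrame_bivCoord k h1)⟩
        rw [span_chartFrame_bivCoord k h1]
        exact hf.2
    rw [this]
    have hpiv : IsOpen {f : Fin 2 → V (m + 1) | plucker f (Sum.inr (), Sum.inl k) ≠ 0} :=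
      isOpen_ne_fun ((continuous_apply _).comp (continuous_plucker _)) continuous_const
    refine (isOpen_frames _).inter (ContinuousOn.isOpen_inter_preimage ?_ hpiv hO')
    intro f hf
    exact ((differentiableAt_bivCoord k hf).continuousAt.comp
      (continuous_plucker _).continuousAt).continuousWithinAt

/-- Every complex geodesic is in the image of an affine chart. -/
lemma exists_pivot_ne_zero {m : ℕ} {f : Fin 2 → V (m + 1)} (hf : f ∈ frames (m + 1)) :
    ∃ k, plucker f (Sum.inr (), Sum.inl k) ≠ 0 := by
  by_contra! h
  obtain ⟨v, hv, hq⟩ := hf.2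
  have hp : ∀ x y, plucker f (x, y) = f 0 x * f 1 y - f 0 y * f 1 x := fun x y => rfl
  simp only [hp] at h
  have hv0 := last_ne_zero hq
  have h01 : f 0 (Sum.inr ()) ≠ 0 ∨ f 1 (Sum.inr ()) ≠ 0 := by
    by_contra! h'
    apply hv0
    obtain ⟨c, rfl⟩ := (Submodule.mem_span_range_iff_exists_fun ℂ).1 hv
    simp [h']
  have h2 := hf.1
  rw [show f = ![f 0, f 1] by funext i; fin_cases i <;> rfl, LinearIndependent.pair_iff] at h2
  have := h2 (-f 1 (Sum.inr ())) (f 0 (Sum.inr ())) (by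
    funext i
    rcases i with i | i
    · have := h i
      simp only [Pi.add_apply, Pi.smul_apply, smul_eq_mul, Pi.zero_apply]
      linear_combination this
    · simp only [Pi.add_apply, Pi.smul_apply, smul_eq_mul, Pi.zero_apply]
      ring)
  simp at this
  tauto

/-! ### The invariant measure on the space of complex geodesics -/

/-- The density of the invariant measure in the affine charts. -/
noncomputable def rho {m : ℕ} (k : Fin (m + 1)) (u : Par m) : ℝ :=
  (2 * (m + 1) - 2).factorial * (‖(gram (chartFrame k u)).det‖⁻¹) ^ (m + 2)

/-- The measure with density `a |ω^{2n-2}|`. -/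
noncomputable def geoVol (m : ℕ) (a : ℝ) : Measure (Geodesic (m + 1)) :=
  Measure.map (chartMap 0) (Measure.comap Subtype.val
    ((volume : Measure (Par m)).withDensity fun u => ENNReal.ofReal (a * rho 0 u)))

lemma geoVol_apply {m : ℕ} (a : ℝ) (S : Set (Geodesic (m + 1))) :
    geoVol m a S = ((volume : Measure (Par m)).withDensity fun u => ENNReal.ofReal (a * rho 0 u))
      (Subtype.val '' (chartMap 0 ⁻¹' S)) := by
  rw [geoVol, (isOpenEmbedding_chartMap 0).measurableEmbedding.map_apply,
    ((chart 0).isOpen_dom.isOpenEmbedding_subtypeVal).measurableEmbedding.comap_apply]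

lemma measurableSet_pivot {m : ℕ} (c : GeoChart (m + 1)) (k : Fin (m + 1)) {A : Set (Par m)}
    (hA : MeasurableSet A) (hAc : A ⊆ c.dom) :
    MeasurableSet (A ∩ {u | plucker (c.frame u) (Sum.inr (), Sum.inl k) ≠ 0}) := by
  have hc : ContinuousOn (fun u => plucker (c.frame u) (Sum.inr (), Sum.inl k)) c.dom :=
    fun u hu => ((continuous_apply _).continuousAt.comp
      (plucker_frame_hasFDerivAt c hu).continuousAt).continuousWithinAt
  have := hc.isOpen_inter_preimage c.isOpen_dom (isOpen_ne (x := (0 : ℂ)))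
  have e : A ∩ {u | plucker (c.frame u) (Sum.inr (), Sum.inl k) ≠ 0} = A ∩ (c.dom ∩
      (fun u => plucker (c.frame u) (Sum.inr (), Sum.inl k)) ⁻¹' {y | y ≠ 0}) := by
    ext u
    constructor
    · rintro ⟨h, h'⟩
      exact ⟨h, hAc h, h'⟩
    · rintro ⟨h, -, h'⟩
      exact ⟨h, h'⟩
  rw [e]
  exact hA.inter this.measurableSet

lemma lintegral_trans {m : ℕ} (a : ℝ) (c : GeoChart (m + 1)) (k : Fin (m + 1)) {A : Set (Par m)}
    (hA : MeasurableSet A) (hAc : A ⊆ c.dom)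
    (hp : ∀ u ∈ A, plucker (c.frame u) (Sum.inr (), Sum.inl k) ≠ 0) :
    ∫⁻ u in A, ENNReal.ofReal |a * c.density (geoOmega (m + 1)) u| =
      ∫⁻ u in trans c k '' A, ENNReal.ofReal (|a| * rho k u) := by
  rw [lintegral_image_eq_lintegral_abs_det_fderiv_mul volume hA
    (f' := fun u => (fderiv ℂ (trans c k) u).restrictScalars ℝ)
    (fun u hu => ((differentiableAt_trans c k (hAc hu) (hp u hu)).hasFDerivAt.restrictScalars
      ℝ).hasFDerivWithinAt)
    ((trans_injOn c k).mono fun u hu => show _ ∧ _ from ⟨hAc hu, hp u hu⟩)]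
  refine setLIntegral_congr_fun hA fun u hu => ?_
  show ENNReal.ofReal |a * c.density (geoOmega (m + 1)) u| = _
  rw [density_trans c k (hAc hu) (hp u hu), abs_mul, abs_mul,
    abs_density_chart k _ (trans_mem c k (hAc hu) (hp u hu)), ← ENNReal.ofReal_mul (abs_nonneg _)]
  congr 1
  rw [rho]
  show _ = |LinearMap.det _| * _
  ring

lemma isVolumeMeasure_geoVol (m : ℕ) {a : ℝ} (ha : 0 < a) :
    IsVolumeMeasure (geoOmega (m + 1)) a (geoVol m a) := by
  intro c A hA hAc
  set P : Fin (m + 1) → Set (Par m) :=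
    fun k => {u | plucker (c.frame u) (Sum.inr (), Sum.inl k) ≠ 0} with hP
  have hPm : ∀ k, MeasurableSet (A ∩ P k) := fun k => measurableSet_pivot c k hA hAc
  have himg : Subtype.val '' (chartMap 0 ⁻¹'
      {W : Geodesic (m + 1) | ∃ u ∈ A, W.plane = Submodule.span ℂ (Set.range (c.frame u))}) =
      trans c 0 '' (A ∩ P 0) := by
    ext w
    constructor
    · rintro ⟨w, ⟨u, hu, e⟩, rfl⟩
      obtain ⟨h1, h2⟩ := pivot_ne_zero_of_span e
      exact ⟨u, ⟨hu, h1⟩, h2⟩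
    · rintro ⟨u, ⟨hu, h1⟩, rfl⟩
      exact ⟨⟨trans c 0 u, trans_mem c 0 (hAc hu) h1⟩, ⟨u, hu, span_trans c 0 h1⟩, rfl⟩
  have hmeas : MeasurableSet (trans c 0 '' (A ∩ P 0)) :=
    measurable_image_of_fderivWithin (hPm 0)
      (f' := fun u => (fderiv ℂ (trans c 0) u).restrictScalars ℝ)
      (fun u hu => ((differentiableAt_trans c 0 (hAc hu.1) hu.2).hasFDerivAt.restrictScalars
        ℝ).hasFDerivWithinAt)
      ((trans_injOn c 0).mono fun u hu => show _ ∧ _ from ⟨hAc hu.1, hu.2⟩)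
  rw [geoVol_apply, himg, withDensity_apply _ hmeas]
  have h0 := lintegral_trans a c 0 (hPm 0) (fun u hu => hAc hu.1) fun u hu => hu.2
  rw [abs_of_pos ha] at h0
  rw [← h0, ← lintegral_inter_add_sdiff _ A (hPm 0), Set.inter_eq_self_of_subset_right
    Set.inter_subset_left]
  suffices h : ∫⁻ u in A \ (A ∩ P 0), ENNReal.ofReal |a * c.density (geoOmega (m + 1)) u| = 0 by
    rw [h, add_zero]
  have hcov : A \ (A ∩ P 0) ⊆ ⋃ k, ((A ∩ P k) \ (A ∩ P 0)) := by
    rintro u ⟨hu, hu'⟩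
    obtain ⟨k, hk⟩ := exists_pivot_ne_zero (c.mem_frames u (hAc hu))
    exact Set.mem_iUnion.2 ⟨k, ⟨hu, hk⟩, hu'⟩
  refine le_antisymm ((lintegral_mono_set hcov).trans ?_) zero_le
  refine (lintegral_iUnion_le _ _).trans ?_
  rw [ENNReal.tsum_eq_zero.2]
  intro k
  rw [lintegral_trans a c k ((hPm k).diff (hPm 0)) (fun u hu => hAc hu.1.1) fun u hu => hu.1.2]
  refine setLIntegral_measure_zero _ _ ?_
  rcases eq_or_ne k 0 with rfl | hk
  · simp
  obtain ⟨j, hj⟩ := Fin.exists_succAbove_eq hk.symm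
  refine measure_mono_null (t := {u : Par m | u ((parEquiv m).symm (1, j)) = 0}) ?_
    (Measure.pi_hyperplane _ _ _)
  rintro _ ⟨u, ⟨⟨hu, h1⟩, h2⟩, rfl⟩
  have h3 : plucker (c.frame u) (Sum.inr (), Sum.inl 0) = 0 := by
    by_contra h; exact h2 ⟨hu, h⟩
  show trans c k u ((parEquiv m).symm (1, j)) = 0
  simp [trans, bivCoord, parMk, hj, h3]

lemma dspan_eq_zero_iff {n : ℕ} {f : Fin 2 → V n} (hf : f ∈ frames n) (u : Fin 2 → V n) :
    dspan f hf u = 0 ↔ ∀ i, u i ∈ Submodule.span ℂ (Set.range f) := by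
  have hm : ∀ i, f i ∈ (spanGeo f hf).plane := fun i => Submodule.subset_span ⟨i, rfl⟩
  constructor
  · intro h i
    have h2 := dspan_apply f hf u i (hm i)
    rw [h] at h2
    exact (Submodule.Quotient.mk_eq_zero _).1 h2.symm
  · intro h
    refine (Module.Basis.span hf.1).ext fun i => ?_
    have e : Module.Basis.span hf.1 i = (⟨f i, hm i⟩ : (spanGeo f hf).plane) :=
      Module.Basis.span_apply hf.1 i
    have h2 := dspan_apply f hf u i (hm i)
    rw [(Submodule.Quotient.mk_eq_zero (spanGeo f hf).plane).2 (h i) |> fun h =>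
      show (spanGeo f hf).plane.mkQ (u i) = 0 from h] at h2
    exact (congrArg (dspan f hf u) e).trans h2

/-- The action of a group element on frames. -/
noncomputable def linFrame {n : ℕ} (g : SU n) : (Fin 2 → V n) →L[ℂ] (Fin 2 → V n) :=
  LinearMap.toContinuousLinearMap (LinearMap.pi fun i : Fin 2 =>
    (lin g : V n →ₗ[ℂ] V n) ∘ₗ LinearMap.proj i)

lemma linFrame_mem {n : ℕ} (g : SU n) {f : Fin 2 → V n} (hf : f ∈ frames n) :
    linFrame g f ∈ frames n :=
  lin_mem_frames g hf

lemma fderiv_linFrame_comp {m : ℕ} (c : GeoChart (m + 1)) (g : SU (m + 1)) {u : Par m}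
    (hu : u ∈ c.dom) : fderiv ℂ (fun u => linFrame g (c.frame u)) u =
      (linFrame g).comp (fderiv ℂ c.frame u) :=
  ((linFrame g).hasFDerivAt.comp u
    ((c.holomorphic u hu).differentiableAt (c.isOpen_dom.mem_nhds hu)).hasFDerivAt).fderiv

/-- The chart moved by an element of the group. -/
noncomputable def GeoChart.translate {m : ℕ} (c : GeoChart (m + 1)) (g : SU (m + 1)) :
    GeoChart (m + 1) where
  dom := c.dom
  isOpen_dom := c.isOpen_dom
  frame u := linFrame g (c.frame u)
  holomorphic := (linFrame g).differentiable.comp_differentiableOn c.holomorphic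
  mem_frames u hu := linFrame_mem g (c.mem_frames u hu)
  injective u hu u' hu' h := by
    refine c.injective u hu u' hu' (smul_left_cancel g ?_)
    exact (smul_spanGeo g (c.mem_frames u hu)).trans
      (h.trans (smul_spanGeo g (c.mem_frames u' hu')).symm)
  immersive u hu := by
    have h1 := c.immersive u hu
    have hlin : (fun x => dspan (linFrame g (c.frame u)) (linFrame_mem g (c.mem_frames u hu))
        (fderiv ℂ (fun u => linFrame g (c.frame u)) u x)) =
      (dspan (linFrame g (c.frame u)) (linFrame_mem g (c.mem_frames u hu)) ∘ₗ
        (fderiv ℂ (fun u => linFrame g (c.frame u)) u).toLinearMap) := rfl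
    refine (congrArg Function.Injective hlin).mpr ?_
    rw [← LinearMap.ker_eq_bot, LinearMap.ker_eq_bot']
    intro x hx
    have hx' : dspan (linFrame g (c.frame u)) (linFrame_mem g (c.mem_frames u hu))
        (linFrame g (fderiv ℂ c.frame u x)) = 0 := by
      rw [← hx]
      exact congrArg (dspan _ _) (congrArg (fun L => L x) (fderiv_linFrame_comp c g hu)).symm
    rw [dspan_eq_zero_iff] at hx'
    have h2 : dspan (c.frame u) (c.mem_frames u hu) (fderiv ℂ c.frame u x) = 0 := by
      rw [dspan_eq_zero_iff]
      intro i
      have h3 : lin g (fderiv ℂ c.frame u x i) ∈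
        Submodule.span ℂ (Set.range fun i => lin g (c.frame u i)) := hx' i
      rw [span_lin] at h3
      obtain ⟨y, hy, e⟩ := h3
      rwa [← (lin g).injective e]
    exact h1 (h2.trans (by simp))

lemma density_translate {m : ℕ} (c : GeoChart (m + 1)) (g : SU (m + 1)) {u : Par m}
    (hu : u ∈ c.dom) :
    (c.translate g).density (geoOmega (m + 1)) u = c.density (geoOmega (m + 1)) u := by
  have hform : ((geoOmega (m + 1)).pull ((c.translate g).frame u)).toAlternatingMap.compLinearMap
      ((fderiv ℂ (c.translate g).frame u).restrictScalars ℝ).toLinearMap =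
      ((geoOmega (m + 1)).pull (c.frame u)).toAlternatingMap.compLinearMap
      ((fderiv ℂ c.frame u).restrictScalars ℝ).toLinearMap := by
    ext v
    have e : fderiv ℂ (c.translate g).frame u = (linFrame g).comp (fderiv ℂ c.frame u) :=
      fderiv_linFrame_comp c g hu
    rw [e]
    have h1 := pull_geoOmega (linFrame_mem g (c.mem_frames u hu))
      fun i => linFrame g (fderiv ℂ c.frame u (v i))
    have h2 := pull_geoOmega (c.mem_frames u hu) fun i => fderiv ℂ c.frame u (v i)
    have h3 := congrArg Complex.im (fsK_lin g (c.frame u) (fderiv ℂ c.frame u (v 0))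
      (fderiv ℂ c.frame u (v 1)))
    rw [fs_apply] at h1 h2
    exact h1.trans (h3.trans h2.symm)
  rw [GeoChart.density, hform]
  rfl

lemma geoVol_image {m : ℕ} {a : ℝ} (ha : 0 < a) (g : SU (m + 1)) {S : Set (Geodesic (m + 1))}
    (hS : MeasurableSet S) : geoVol m a ((fun W => g • W) '' S) = geoVol m a S := by
  have key : ∀ (g : SU (m + 1)) (S : Set (Geodesic (m + 1))), MeasurableSet S →
      geoVol m a S ≤ geoVol m a ((fun W => g • W) '' S) := by
    intro g S hS
    set A : Set (Par m) := Subtype.val '' (chartMap 0 ⁻¹' S) with hA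
    have hAm : MeasurableSet A :=
      ((chart 0).isOpen_dom.isOpenEmbedding_subtypeVal).measurableEmbedding.measurableSet_image.2
        ((continuous_chartMap 0).measurable hS)
    have hAd : A ⊆ (chart 0).dom := by rintro _ ⟨u, -, rfl⟩; exact u.2
    have h1 := isVolumeMeasure_geoVol m ha ((chart 0).translate g) A hAm hAd
    have h2 : ∫⁻ u in A, ENNReal.ofReal |a * ((chart 0).translate g).density (geoOmega (m + 1)) u| =
        geoVol m a S := by
      rw [geoVol_apply, withDensity_apply _ hAm]
      refine setLIntegral_congr_fun hAm fun u hu => ?_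
      show ENNReal.ofReal |a * ((chart 0).translate g).density (geoOmega (m + 1)) u| = _
      rw [density_translate _ g (hAd hu), abs_mul, abs_density_chart 0 u (hAd hu), abs_of_pos ha, rho]
    rw [h2] at h1
    rw [← h1]
    refine measure_mono ?_
    rintro W ⟨_, ⟨u, hu, rfl⟩, e⟩
    exact ⟨chartMap 0 u, hu, (smul_spanGeo g u.2).trans (Geodesic.ext e.symm)⟩
  refine le_antisymm ?_ (key g S hS)
  have hS' : MeasurableSet ((fun W => g • W) '' S) :=
    ((Homeomorph.smul g).measurableEmbedding.measurableSet_image).2 hS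
  refine (key g⁻¹ _ hS').trans (le_of_eq ?_)
  rw [Set.image_image]
  simp

lemma map_geoVol {m : ℕ} {a : ℝ} (ha : 0 < a) (g : SU (m + 1)) :
    (geoVol m a).map (fun W => g • W) = geoVol m a := by
  ext S hS
  rw [Measure.map_apply (continuous_const_smul g).measurable hS, ← geoVol_image ha g⁻¹ hS]
  congr 1
  ext W
  constructor
  · intro h
    exact ⟨g • W, h, inv_smul_smul g W⟩
  · rintro ⟨W', h, rfl⟩
    simpa using h

/-- The chart parameters of the base geodesic. -/
lemma baseGeo_eq_chartMap (m : ℕ) : ∃ u, baseGeo m = chartMap 0 u := by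
  have h : plucker (baseFrame m) (Sum.inr (), Sum.inl 0) ≠ 0 := by
    simp [plucker, wdg, baseFrame, eV]
  have hs := span_chartFrame_bivCoord 0 h
  refine ⟨⟨bivCoord 0 (plucker (baseFrame m)), linearIndependent_chartFrame 0 _, ?_⟩, ?_⟩
  · rw [hs]; exact (baseFrame_mem m).2
  · exact Geodesic.ext hs.symm

lemma continuous_det_gram_chartFrame {m : ℕ} (k : Fin (m + 1)) :
    Continuous fun u : Par m => (gram (chartFrame k u)).det := by
  have h : (fun u : Par m => (gram (chartFrame k u)).det) = fun u =>
      hh (plucker (chartFrame k u)) (plucker (chartFrame k u)) / 2 := by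
    funext u; rw [hh_plucker]; ring
  have hp : Continuous fun u : Par m => plucker (chartFrame k u) :=
    (continuous_plucker _).comp (differentiable_chartFrame k).continuous
  rw [h]
  simp only [hh]
  fun_prop

lemma continuousOn_rho {m : ℕ} (k : Fin (m + 1)) : ContinuousOn (rho (m := m) k) (chart k).dom := by
  refine continuousOn_const.mul (ContinuousOn.pow ((continuous_det_gram_chartFrame k).norm.continuousOn.inv₀ ?_) _)
  intro u hu
  have h := hh_plucker_ne_zero (show chartFrame k u ∈ frames (m + 1) from hu)
  rw [hh_plucker] at h
  simpa using h

lemma geoVol_singleton {m : ℕ} (hm : 0 < m) {a : ℝ} (ha : 0 < a) (W : Geodesic (m + 1)) :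
    geoVol m a {W} = 0 := by
  obtain ⟨g, hg⟩ := exists_smul_eq_baseGeo W
  obtain ⟨u, hu⟩ := baseGeo_eq_chartMap m
  have h1 : MeasurableSet ({baseGeo m} : Set (Geodesic (m + 1))) := by
    rw [hu, ← Set.image_singleton]
    exact (isOpenEmbedding_chartMap 0).measurableEmbedding.measurableSet_image.2
      (MeasurableSet.singleton u)
  have h2 : ({W} : Set (Geodesic (m + 1))) = (fun W => g⁻¹ • W) '' {baseGeo m} := by
    rw [Set.image_singleton, ← hg, inv_smul_smul]
  have h3 : chartMap 0 ⁻¹' {baseGeo m} = {u} := by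
    rw [hu]
    ext u'
    exact (isOpenEmbedding_chartMap 0).injective.eq_iff
  rw [h2, geoVol_image ha _ h1, geoVol_apply, h3, Set.image_singleton]
  refine withDensity_absolutelyContinuous _ _ ?_
  have : Nonempty (Fin (2 * (m + 1) - 2)) := ⟨⟨0, by omega⟩⟩
  exact measure_singleton _

lemma finiteAt_geoVol {m : ℕ} {a : ℝ} (ha : 0 < a) (W : Geodesic (m + 1)) :
    (geoVol m a).FiniteAtFilter (nhds W) := by
  obtain ⟨g, hg⟩ := exists_smul_eq_baseGeo W
  obtain ⟨u, hu⟩ := baseGeo_eq_chartMap m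
  obtain ⟨K, hK, huK, hKd⟩ := exists_compact_subset (chart (m := m) 0).isOpen_dom u.2
  set O : Set (Geodesic (m + 1)) := chartMap 0 '' (Subtype.val ⁻¹' interior K) with hO
  have hOo : IsOpen O := (isOpenEmbedding_chartMap 0).isOpenMap _
    (isOpen_interior.preimage continuous_subtype_val)
  refine ⟨(fun W => g⁻¹ • W) '' O, ?_, ?_⟩
  · refine ((Homeomorph.smul g⁻¹).isOpenMap _ hOo).mem_nhds ⟨baseGeo m, ?_, ?_⟩
    · rw [hu]; exact ⟨u, huK, rfl⟩
    · show g⁻¹ • baseGeo m = W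
      rw [← hg, inv_smul_smul]
  · rw [geoVol_image ha _ hOo.measurableSet, geoVol_apply, hO,
      Set.preimage_image_eq _ (isOpenEmbedding_chartMap 0).injective]
    refine (measure_mono ((Set.image_preimage_subset _ _).trans interior_subset)).trans_lt ?_
    rw [withDensity_apply _ hK.measurableSet]
    obtain ⟨C, hC⟩ := hK.bddAbove_image (continuousOn_const (c := a) |>.mul
      ((continuousOn_rho 0).mono hKd))
    refine (setLIntegral_mono' (g := fun _ => ENNReal.ofReal C) hK.measurableSet
      fun x hx => ENNReal.ofReal_le_ofReal (hC ⟨x, hx, rfl⟩)).trans_lt ?_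
    rw [setLIntegral_const]
    exact ENNReal.mul_lt_top ENNReal.ofReal_lt_top hK.measure_lt_top

end CHyp

namespace CHyp

open MeasureTheory Topology

/-! ### The topology of the projective space and of the projectivized tangent bundle -/

/-- Nonzero vectors. -/
abbrev NZ (n : ℕ) : Type := {v : Fin n → ℂ // v ≠ 0}

/-- The line of a nonzero vector. -/
noncomputable def toProj {n : ℕ} (v : NZ n) : ℙ ℂ (Fin n → ℂ) := Projectivization.mk ℂ v.1 v.2

lemma continuous_toProj (n : ℕ) : Continuous (toProj (n := n)) := continuous_coinduced_rng

lemma surjective_toProj (n : ℕ) : Function.Surjective (toProj (n := n)) := fun l =>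
  ⟨⟨l.rep, l.rep_nonzero⟩, l.mk_rep⟩

lemma toProj_eq_iff {n : ℕ} {v w : NZ n} : toProj v = toProj w ↔ ∃ a : ℂˣ, a • w.1 = v.1 :=
  Projectivization.mk_eq_mk_iff ℂ _ _ v.2 w.2

lemma isOpenMap_toProj (n : ℕ) : IsOpenMap (toProj (n := n)) := by
  intro O hO
  refine isOpen_coinduced.2 ?_
  have h : (fun v : NZ n => Projectivization.mk ℂ v.1 v.2) ⁻¹' (toProj '' O) =
      ⋃ a : ℂˣ, (fun v : NZ n => (⟨a • v.1, (smul_ne_zero_iff_ne a).2 v.2⟩ : NZ n)) ⁻¹' O := by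
    ext v
    simp only [Set.mem_preimage, Set.mem_image, Set.mem_iUnion]
    constructor
    · rintro ⟨w, hw, e⟩
      obtain ⟨a, ha⟩ := toProj_eq_iff.1 (e : toProj w = toProj v)
      exact ⟨a, by convert hw⟩
    · rintro ⟨a, ha⟩
      exact ⟨_, ha, toProj_eq_iff.2 ⟨a, rfl⟩⟩
  rw [h]
  refine isOpen_iUnion fun a => hO.preimage ?_
  exact Continuous.subtype_mk (continuous_subtype_val.const_smul a) _

/-- The orthogonal projection to a line, as a matrix. -/
noncomputable def projMatrix {n : ℕ} (l : ℙ ℂ (Fin n → ℂ)) : Matrix (Fin n) (Fin n) ℂ :=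
  Projectivization.lift (fun v : NZ n => Matrix.of fun i j =>
    v.1 i * starRingEnd ℂ (v.1 j) / ∑ k, v.1 k * starRingEnd ℂ (v.1 k)) (by
      rintro ⟨v, hv⟩ ⟨w, hw⟩ t (rfl : v = t • w)
      have ht : t ≠ 0 := by rintro rfl; simp at hv
      ext i j
      have ht' : starRingEnd ℂ t ≠ 0 := by simpa using ht
      simp only [Matrix.of_apply, Pi.smul_apply, smul_eq_mul, map_mul]
      rw [show ∑ k, t * w k * (starRingEnd ℂ t * starRingEnd ℂ (w k)) =
        (t * starRingEnd ℂ t) * ∑ k, w k * starRingEnd ℂ (w k) by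
          rw [Finset.mul_sum]; exact Finset.sum_congr rfl fun k _ => by ring,
        show t * w i * (starRingEnd ℂ t * starRingEnd ℂ (w j)) =
          (t * starRingEnd ℂ t) * (w i * starRingEnd ℂ (w j)) by ring,
        mul_div_mul_left _ _ (mul_ne_zero ht ht')]) l

lemma sum_mul_conj_ne_zero {n : ℕ} {v : Fin n → ℂ} (hv : v ≠ 0) :
    ∑ k, v k * starRingEnd ℂ (v k) ≠ 0 := by
  simp_rw [Complex.mul_conj]
  rw [← Complex.ofReal_sum]
  norm_cast
  rw [Finset.sum_eq_zero_iff_of_nonneg fun i _ => Complex.normSq_nonneg _]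
  intro h
  exact hv (funext fun i => by simpa using h i (Finset.mem_univ _))

lemma continuous_projMatrix (n : ℕ) : Continuous (projMatrix (n := n)) := by
  refine continuous_coinduced_dom.2 ?_
  refine continuous_matrix fun i j => ?_
  have h : (fun v : NZ n => projMatrix (toProj v) i j) = fun v : NZ n =>
    v.1 i * starRingEnd ℂ (v.1 j) / ∑ k, v.1 k * starRingEnd ℂ (v.1 k) := rfl
  refine (congrArg Continuous h).mpr ?_
  refine Continuous.div ?_ ?_ fun v => sum_mul_conj_ne_zero v.2
  · exact ((continuous_apply i).comp continuous_subtype_val).mul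
      (Complex.continuous_conj.comp ((continuous_apply j).comp continuous_subtype_val))
  · exact continuous_finsetSum _ fun k _ => ((continuous_apply k).comp continuous_subtype_val).mul
      (Complex.continuous_conj.comp ((continuous_apply k).comp continuous_subtype_val))

lemma injective_projMatrix (n : ℕ) : Function.Injective (projMatrix (n := n)) := by
  intro l l' h
  obtain ⟨v, rfl⟩ := surjective_toProj n l
  obtain ⟨w, rfl⟩ := surjective_toProj n l'
  have h' : ∀ i j, v.1 i * starRingEnd ℂ (v.1 j) / ∑ k, v.1 k * starRingEnd ℂ (v.1 k) =
    w.1 i * starRingEnd ℂ (w.1 j) / ∑ k, w.1 k * starRingEnd ℂ (w.1 k) := fun i j =>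
      congrFun (congrFun h i) j
  have hV := sum_mul_conj_ne_zero v.2
  have hW := sum_mul_conj_ne_zero w.2
  set A := ∑ k, v.1 k * starRingEnd ℂ (v.1 k)
  set B := ∑ k, w.1 k * starRingEnd ℂ (w.1 k)
  obtain ⟨j, hj⟩ : ∃ j, w.1 j ≠ 0 := by
    by_contra! h0
    exact w.2 (funext h0)
  have hjv : v.1 j ≠ 0 := by
    intro h0
    have := h' j j
    rw [h0, zero_mul, zero_div] at this
    refine div_ne_zero (mul_ne_zero hj ?_) hW this.symm
    simpa using hj
  have hjv' : starRingEnd ℂ (v.1 j) ≠ 0 := by simpa using hjv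
  have hj' : starRingEnd ℂ (w.1 j) ≠ 0 := by simpa using hj
  have ha : A * starRingEnd ℂ (w.1 j) / (B * starRingEnd ℂ (v.1 j)) ≠ 0 :=
    div_ne_zero (mul_ne_zero hV hj') (mul_ne_zero hW hjv')
  refine toProj_eq_iff.2 ⟨Units.mk0 _ ha, ?_⟩
  funext i
  have := h' i j
  rw [div_eq_div_iff hV hW] at this
  rw [Pi.smul_apply, Units.smul_mk0, smul_eq_mul, div_mul_eq_mul_div,
    div_eq_iff (mul_ne_zero hW hjv')]
  linear_combination -this

instance (n : ℕ) : CompactSpace (ℙ ℂ (Fin n → ℂ)) := by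
  have hne : ∀ v : Metric.sphere (0 : Fin n → ℂ) 1, v.1 ≠ 0 := fun v =>
    norm_ne_zero_iff.1 (by rw [mem_sphere_zero_iff_norm.1 v.2]; norm_num)
  have hc : Continuous fun v : Metric.sphere (0 : Fin n → ℂ) 1 => toProj ⟨v.1, hne v⟩ :=
    (continuous_toProj n).comp (Continuous.subtype_mk continuous_subtype_val _)
  refine ⟨?_⟩
  have hs : Function.Surjective
      fun v : Metric.sphere (0 : Fin n → ℂ) 1 => toProj ⟨v.1, hne v⟩ := by
    intro l
    obtain ⟨v, rfl⟩ := surjective_toProj n l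
    have hv : ‖v.1‖ ≠ 0 := norm_ne_zero_iff.2 v.2
    have hv' : ((‖v.1‖⁻¹ : ℝ) : ℂ) ≠ 0 := by
      rw [Complex.ofReal_ne_zero]; exact inv_ne_zero hv
    refine ⟨⟨((‖v.1‖⁻¹ : ℝ) : ℂ) • v.1, ?_⟩, toProj_eq_iff.2 ⟨Units.mk0 _ hv', rfl⟩⟩
    rw [mem_sphere_zero_iff_norm, norm_smul, Complex.norm_real, norm_inv, norm_norm,
      inv_mul_cancel₀ hv]
  rw [← hs.range_eq]
  exact isCompact_range hc

lemma isClosedEmbedding_projMatrix (n : ℕ) : IsClosedEmbedding (projMatrix (n := n)) :=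
  (continuous_projMatrix n).isClosedEmbedding (injective_projMatrix n)

instance (n : ℕ) : T2Space (ℙ ℂ (Fin n → ℂ)) :=
  (isClosedEmbedding_projMatrix n).isEmbedding.t2Space

instance (n : ℕ) : SecondCountableTopology (ℙ ℂ (Fin n → ℂ)) := by
  have : SecondCountableTopology (Matrix (Fin n) (Fin n) ℂ) :=
    inferInstanceAs (SecondCountableTopology (Fin n → Fin n → ℂ))
  exact (isClosedEmbedding_projMatrix n).isEmbedding.secondCountableTopology

/-- The projectivized tangent bundle is a product. -/
noncomputable def pthHomeo (n : ℕ) : PTH n ≃ₜ Hn n × ℙ ℂ (Fin n → ℂ) where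
  toFun p := (p.pt, p.dir)
  invFun x := ⟨x.1, x.2⟩
  left_inv _ := rfl
  right_inv _ := rfl
  continuous_toFun := continuous_induced_dom
  continuous_invFun := continuous_induced_rng.2 continuous_id

lemma continuous_pt (n : ℕ) : Continuous (PTH.pt (n := n)) :=
  continuous_fst.comp (pthHomeo n).continuous

instance (n : ℕ) : LocallyCompactSpace (Hn n) := (isOpen_ball n).locallyCompactSpace

instance (n : ℕ) : T2Space (PTH n) := (pthHomeo n).symm.t2Space

instance (n : ℕ) : LocallyCompactSpace (PTH n) :=
  (pthHomeo n).isClosedEmbedding.locallyCompactSpace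

instance (n : ℕ) : SecondCountableTopology (PTH n) := (pthHomeo n).secondCountableTopology

noncomputable instance (n : ℕ) : MeasurableSpace (PTH n) := borel _

instance (n : ℕ) : BorelSpace (PTH n) := ⟨rfl⟩

/-- The tangent line of a nonzero tangent vector. -/
noncomputable def tanLine {n : ℕ} (x : Hn n × NZ n) : PTH n := ⟨x.1, toProj x.2⟩

lemma isOpenQuotientMap_tanLine (n : ℕ) : IsOpenQuotientMap (tanLine (n := n)) := by
  have h : IsOpenQuotientMap (toProj (n := n)) :=
    ⟨surjective_toProj n, continuous_toProj n, isOpenMap_toProj n⟩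
  exact (pthHomeo n).symm.isOpenQuotientMap.comp (IsOpenQuotientMap.id.prodMap h)

/-! ### The action on tangent vectors -/

lemma lin_lift_add {n : ℕ} (g : SU n) (z v : Fin n → ℂ) (t : ℂ) :
    lin g (lift (z + t • v)) = lin g (lift z) + t • lin g (vec v) := by
  rw [← map_smul, ← map_add]
  congr 1
  funext i
  rcases i with i | i <;> simp [lift, vec]

lemma fderiv_mob_apply {n : ℕ} (g : SU n) {z : Fin n → ℂ} (hz : z ∈ ball n) (v : Fin n → ℂ) :
    fderiv ℂ (mob g) z v = fun i => (lin g (vec v) (Sum.inl i) * lin g (lift z) (Sum.inr ()) -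
      lin g (lift z) (Sum.inl i) * lin g (vec v) (Sum.inr ())) / lin g (lift z) (Sum.inr ()) ^ 2 := by
  have hd := den_ne_zero g hz
  have h1 : HasDerivAt (fun t : ℂ => mob g (z + t • v)) (fderiv ℂ (mob g) z v) 0 := by
    have h := (differentiableAt_mob g hz).hasFDerivAt
    have h2 : HasDerivAt (fun t : ℂ => z + t • v) v 0 := by
      simpa using ((hasDerivAt_id (0 : ℂ)).smul_const v).const_add z
    have h3 : HasFDerivAt (mob g) (fderiv ℂ (mob g) z) (z + (0 : ℂ) • v) := by simpa using h
    exact h3.comp_hasDerivAt (0 : ℂ) h2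
  funext i
  have h4 := hasDerivAt_pi.1 h1 i
  have h5 : ∀ k, HasDerivAt (fun t : ℂ => lin g (lift (z + t • v)) k) (lin g (vec v) k) 0 := by
    intro k
    simp only [lin_lift_add, Pi.add_apply, Pi.smul_apply, smul_eq_mul]
    simpa using ((hasDerivAt_id (0 : ℂ)).mul_const (lin g (vec v) k)).const_add (lin g (lift z) k)
  have h6 := (h5 (Sum.inl i)).div (h5 (Sum.inr ())) (by simpa using hd)
  have := h4.unique h6
  simpa using this

lemma vec_fderiv_mob {n : ℕ} (g : SU n) {z : Fin n → ℂ} (hz : z ∈ ball n) (v : Fin n → ℂ) :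
    vec (fderiv ℂ (mob g) z v) = (lin g (lift z) (Sum.inr ()))⁻¹ • lin g (vec v) -
      (lin g (vec v) (Sum.inr ()) / lin g (lift z) (Sum.inr ()) ^ 2) • lin g (lift z) := by
  have hd := den_ne_zero g hz
  rw [fderiv_mob_apply g hz]
  funext i
  rcases i with i | i
  · simp only [vec, Sum.elim_inl, Pi.sub_apply, Pi.smul_apply, smul_eq_mul]
    field_simp
  · simp only [vec, Sum.elim_inr, Pi.sub_apply, Pi.smul_apply, smul_eq_mul]
    field_simp
    ring

instance (n : ℕ) : ContinuousConstSMul (SU n) (Hn n) where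
  continuous_const_smul g := by
    refine continuous_induced_rng.2 ?_
    refine continuous_iff_continuousAt.2 fun z => ?_
    exact (differentiableAt_mob g z.2).continuousAt.comp continuous_subtype_val.continuousAt

lemma continuous_lift (n : ℕ) : Continuous (lift (n := n)) :=
  continuous_pi fun i => by
    rcases i with i | i
    · exact continuous_apply i
    · exact continuous_const

lemma continuous_vec (n : ℕ) : Continuous (vec (n := n)) :=
  continuous_pi fun i => by
    rcases i with i | i
    · exact continuous_apply i
    · exact continuous_const

lemma continuous_fderiv_mob {n : ℕ} (g : SU n) :
    Continuous fun x : Hn n × (Fin n → ℂ) => fderiv ℂ (mob g) x.1.1 x.2 := by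
  have h : (fun x : Hn n × (Fin n → ℂ) => fderiv ℂ (mob g) x.1.1 x.2) = fun x i =>
      (lin g (vec x.2) (Sum.inl i) * lin g (lift x.1.1) (Sum.inr ()) -
      lin g (lift x.1.1) (Sum.inl i) * lin g (vec x.2) (Sum.inr ())) /
        lin g (lift x.1.1) (Sum.inr ()) ^ 2 := by
    funext x
    exact fderiv_mob_apply g x.1.2 x.2
  have hl : ∀ i, Continuous fun x : Hn n × (Fin n → ℂ) => lin g (lift x.1.1) i := fun i =>
    (continuous_apply i).comp ((continuous_lin g).comp ((continuous_lift n).comp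
      (continuous_subtype_val.comp continuous_fst)))
  have hv : ∀ i, Continuous fun x : Hn n × (Fin n → ℂ) => lin g (vec x.2) i := fun i =>
    (continuous_apply i).comp ((continuous_lin g).comp ((continuous_vec n).comp continuous_snd))
  rw [h]
  refine continuous_pi fun i => Continuous.div ?_ ((hl _).pow 2)
    fun x => pow_ne_zero 2 (den_ne_zero g x.1.2)
  exact ((hv _).mul (hl _)).sub ((hl _).mul (hv _))

lemma fderiv_mob_ne_zero {n : ℕ} (g : SU n) {z v : Fin n → ℂ} (hz : z ∈ ball n) (hv : v ≠ 0) :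
    fderiv ℂ (mob g) z v ≠ 0 := fun h =>
  hv (fderiv_mob_injective g hz (h.trans (map_zero (fderiv ℂ (mob g) z)).symm))

lemma smul_tanLine {n : ℕ} (g : SU n) (x : Hn n × NZ n) :
    g • tanLine x = tanLine (g • x.1, ⟨fderiv ℂ (mob g) x.1.1 x.2.1,
      fderiv_mob_ne_zero g x.1.2 x.2.2⟩) := rfl

instance (n : ℕ) : ContinuousConstSMul (SU n) (PTH n) where
  continuous_const_smul g := by
    rw [(isOpenQuotientMap_tanLine n).isQuotientMap.continuous_iff]
    have h : Continuous fun x : Hn n × NZ n => (x.1, x.2.1) :=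
      continuous_fst.prodMk (continuous_subtype_val.comp continuous_snd)
    have h1 : Continuous fun x : Hn n × NZ n => (⟨fderiv ℂ (mob g) x.1.1 x.2.1,
        fderiv_mob_ne_zero g x.1.2 x.2.2⟩ : NZ n) :=
      continuous_induced_rng.2 ((continuous_fderiv_mob g).comp h)
    have h2 : Continuous fun x : Hn n × NZ n => g • x.1 :=
      (continuous_const_smul g).comp continuous_fst
    exact (isOpenQuotientMap_tanLine n).continuous.comp (h2.prodMk h1)

/-! ### The map to the space of complex geodesics -/

lemma toGeodesic_tanLine {n : ℕ} (x : Hn n × NZ n) :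
    toGeodesic (tanLine x) = spanGeo ![lift x.1.1, vec x.2.1]
      (mem_frames_of_tangent x.1.2 x.2.2) := by
  apply Geodesic.ext
  obtain ⟨a, ha⟩ := (Projectivization.exists_smul_eq_mk_rep ℂ x.2.1 x.2.2)
  have ha' : a • x.2.1 = (tanLine x).dir.rep := ha
  refine span_eq_of_le (mem_frames_of_tangent x.1.2 x.2.2).1
    (mem_frames_of_tangent (tanLine x).pt.2 (tanLine x).dir.rep_nonzero).1 ?_
  rw [Submodule.span_le]
  rintro _ ⟨i, rfl⟩
  fin_cases i
  · exact Submodule.subset_span ⟨0, rfl⟩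
  · have : vec (tanLine x).dir.rep = (a : ℂ) • vec x.2.1 := by
      rw [← ha']
      funext i
      rcases i with i | i <;> simp [vec, Units.smul_def]
    show vec (tanLine x).dir.rep ∈ _
    rw [this]
    exact Submodule.smul_mem _ _ (Submodule.subset_span ⟨1, rfl⟩)

lemma continuous_toGeodesic (n : ℕ) : Continuous (toGeodesic (n := n)) := by
  rw [(isOpenQuotientMap_tanLine n).isQuotientMap.continuous_iff]
  let F : Hn n × NZ n → frames n := fun x => ⟨![lift x.1.1, vec x.2.1],
    mem_frames_of_tangent x.1.2 x.2.2⟩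
  have hF : Continuous F := by
    refine continuous_induced_rng.2 (continuous_pi fun i => ?_)
    fin_cases i
    · exact (continuous_lift n).comp (continuous_subtype_val.comp continuous_fst)
    · exact (continuous_vec n).comp (continuous_subtype_val.comp continuous_snd)
  have : toGeodesic ∘ tanLine = (fun f : frames n => spanGeo f.1 f.2) ∘ F :=
    funext toGeodesic_tanLine
  rw [this]
  exact (continuous_spanGeo n).comp hF

lemma smul_toGeodesic {n : ℕ} (g : SU n) (p : PTH n) : g • toGeodesic p = toGeodesic (g • p) := by
  obtain ⟨x, rfl⟩ := (isOpenQuotientMap_tanLine n).surjective p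
  rw [smul_tanLine, toGeodesic_tanLine, toGeodesic_tanLine, smul_spanGeo]
  refine Geodesic.ext (span_eq_of_le (lin_mem_frames g (mem_frames_of_tangent x.1.2 x.2.2)).1
    (mem_frames_of_tangent (g • x.1).2 (fderiv_mob_ne_zero g x.1.2 x.2.2)).1 ?_).symm
  have h0 : lin g (lift x.1.1) ∈
      Submodule.span ℂ (Set.range fun i => lin g ((![lift x.1.1, vec x.2.1] : Fin 2 → V n) i)) :=
    Submodule.subset_span ⟨0, rfl⟩
  have h1 : lin g (vec x.2.1) ∈
      Submodule.span ℂ (Set.range fun i => lin g ((![lift x.1.1, vec x.2.1] : Fin 2 → V n) i)) :=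
    Submodule.subset_span ⟨1, rfl⟩
  rw [Submodule.span_le]
  rintro _ ⟨i, rfl⟩
  fin_cases i
  · show lift (mob g x.1.1) ∈ _
    rw [lift_mob g x.1.2]
    exact Submodule.smul_mem _ _ h0
  · show vec (fderiv ℂ (mob g) x.1.1 x.2.1) ∈ _
    rw [vec_fderiv_mob g x.1.2]
    exact Submodule.sub_mem _ (Submodule.smul_mem _ _ h1) (Submodule.smul_mem _ _ h0)

end CHyp

namespace CHyp

open MeasureTheory Topology

/-! ### Discrete subgroups act properly discontinuously -/

lemma hf_eV_inr {n : ℕ} (v : V n) : hf v (eV (Sum.inr ())) = -v (Sum.inr ()) := by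
  simp [hf, eV, Pi.single_apply]

lemma lin_inv_apply {n : ℕ} (g : SU n) (v : V n) : lin g (lin g⁻¹ v) = v := by
  rw [← lin_mul, mul_inv_cancel, lin_one]

lemma lin_apply_inr {n : ℕ} (g : SU n) (v : V n) :
    lin g v (Sum.inr ()) = -hf v (lin g⁻¹ (eV (Sum.inr ()))) := by
  rw [← hf_lin v _ g, lin_inv_apply, hf_eV_inr, neg_neg]

/-- The entries of `g` are bounded in terms of `z` and `g z`. -/
lemma norm_entry_le {n : ℕ} {δ : ℝ} (hδ : 0 < δ) (hδ1 : δ ≤ 1) : ∃ B : ℝ, ∀ (g : SU n)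
    (z : Fin n → ℂ), ∑ i, ‖z i‖ ^ 2 ≤ 1 - δ → ∑ i, ‖mob g z i‖ ^ 2 ≤ 1 - δ → ∀ i j,
    ‖(g : Matrix.SpecialLinearGroup (Fin n ⊕ Unit) ℂ).1 i j‖ ≤ B := by
  set σ := √(1 - δ) with hσ
  have hσ2 : σ ^ 2 = 1 - δ := Real.sq_sqrt (by linarith)
  have hσ0 : 0 ≤ σ := Real.sqrt_nonneg _
  have hσ1 : σ < 1 := by nlinarith
  set C := (√δ * (1 - σ))⁻¹ with hC
  have hsd : 0 < √δ := Real.sqrt_pos.2 hδ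
  have hsd2 : √δ ^ 2 = δ := Real.sq_sqrt hδ.le
  refine ⟨√(1 + C ^ 2), fun g z hz hgz i j => ?_⟩
  have hzb : z ∈ ball n := lt_of_le_of_lt hz (by linarith)
  set x := lin g⁻¹ (eV (n := n) (Sum.inr ())) with hx
  set d := lin g (lift z) (Sum.inr ()) with hd
  have hqx : q x = -1 := by rw [hx, q_lin, q_eV_inr]
  have hsum : ∑ i, ‖x (Sum.inl i)‖ ^ 2 = ‖x (Sum.inr ())‖ ^ 2 - 1 := by
    rw [q] at hqx; linarith
  have hdn : ‖d‖ ^ 2 * δ ≤ 1 := by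
    have h1 : q (lin g (lift z)) = ‖d‖ ^ 2 * q (lift (mob g z)) := by
      rw [lift_mob g hzb, q_smul, ← hd, norm_inv, inv_pow, mul_inv_cancel_left₀]
      exact pow_ne_zero 2 (norm_ne_zero_iff.2 (den_ne_zero g hzb))
    rw [q_lin, q_lift, q_lift] at h1
    have h2 : 0 ≤ ∑ i, ‖z i‖ ^ 2 := Finset.sum_nonneg fun i _ => by positivity
    have h3 : ‖d‖ ^ 2 * δ ≤ ‖d‖ ^ 2 * (1 - ∑ i, ‖mob g z i‖ ^ 2) :=
      mul_le_mul_of_nonneg_left (by linarith) (by positivity)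
    nlinarith
  have hd1 : √δ * ‖d‖ ≤ 1 := by
    have : (√δ * ‖d‖) ^ 2 ≤ 1 := by rw [mul_pow, hsd2]; linarith
    exact (sq_le_one_iff₀ (by positivity)).1 this
  have hdx : d = -(∑ i, z i * starRingEnd ℂ (x (Sum.inl i))) + starRingEnd ℂ (x (Sum.inr ())) := by
    rw [hd, lin_apply_inr]
    simp [hf, Fintype.sum_sum_type, lift, hx, add_comm]
  have hcs : ‖∑ i, z i * starRingEnd ℂ (x (Sum.inl i))‖ ≤ σ * ‖x (Sum.inr ())‖ := by
    refine (norm_sum_le _ _).trans ?_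
    simp only [norm_mul, RCLike.norm_conj]
    refine (pow_le_pow_iff_left₀ (Finset.sum_nonneg fun i _ => by positivity) (by positivity)
      two_ne_zero).1 ?_
    refine (Finset.sum_mul_sq_le_sq_mul_sq _ _ _).trans ?_
    rw [mul_pow, hσ2, hsum]
    exact mul_le_mul hz (by linarith) (by rw [← hsum]; exact Finset.sum_nonneg fun i _ => by positivity)
      (by linarith)
  have hx0 : ‖x (Sum.inr ())‖ ≤ C := by
    have h1 : ‖x (Sum.inr ())‖ ≤ ‖d‖ + σ * ‖x (Sum.inr ())‖ := by
      calc ‖x (Sum.inr ())‖ = ‖starRingEnd ℂ (x (Sum.inr ()))‖ := (RCLike.norm_conj _).symm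
        _ = ‖d + ∑ i, z i * starRingEnd ℂ (x (Sum.inl i))‖ := by rw [hdx]; ring_nf
        _ ≤ _ := (norm_add_le _ _).trans (by linarith)
    rw [hC, ← one_div, le_div_iff₀ (by nlinarith)]
    calc ‖x (Sum.inr ())‖ * (√δ * (1 - σ)) = √δ * (‖x (Sum.inr ())‖ - σ * ‖x (Sum.inr ())‖) := by ring
      _ ≤ √δ * ‖d‖ := mul_le_mul_of_nonneg_left (by linarith) hsd.le
      _ ≤ 1 := hd1
  have hxj : ∀ j, ‖x j‖ ^ 2 ≤ ‖x (Sum.inr ())‖ ^ 2 := by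
    rintro (j | j)
    · have := Finset.single_le_sum (f := fun i => ‖x (Sum.inl i)‖ ^ 2) (fun i _ => by positivity)
        (Finset.mem_univ j)
      linarith
    · exact le_rfl
  have hgij : ∀ k, (g : Matrix.SpecialLinearGroup (Fin n ⊕ Unit) ℂ).1 k j = lin g (eV j) k := by
    intro k
    simp [lin_apply, eV, Matrix.mulVec_single]
  have hlast : ‖lin g (eV j) (Sum.inr ())‖ ^ 2 ≤ C ^ 2 := by
    have h1 : ‖lin g (eV j) (Sum.inr ())‖ = ‖x j‖ := by
      rw [lin_apply_inr, norm_neg]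
      rcases j with j | j <;> simp [hf, eV, Pi.single_apply, hx]
    rw [h1]
    exact (hxj j).trans (pow_le_pow_left₀ (norm_nonneg _) hx0 2)
  have hq : q (lin g (eV j)) ≤ 1 := by
    rw [q_lin]
    rcases j with j | j <;> simp [q, eV, Pi.single_apply, apply_ite]
  rw [hgij]
  refine Real.le_sqrt_of_sq_le ?_
  rcases i with i | i
  · have := Finset.single_le_sum (f := fun i => ‖lin g (eV j) (Sum.inl i)‖ ^ 2)
      (fun i _ => by positivity) (Finset.mem_univ i)
    rw [q] at hq
    linarith
  · linarith

lemma isClosed_SU (n : ℕ) : IsClosed (SU n : Set (Matrix.SpecialLinearGroup (Fin n ⊕ Unit) ℂ)) := by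
  have : Continuous fun M : Matrix.SpecialLinearGroup (Fin n ⊕ Unit) ℂ =>
      (M : Matrix _ _ ℂ).conjTranspose * formMatrix n * (M : Matrix _ _ ℂ) := by
    have h : Continuous fun M : Matrix.SpecialLinearGroup (Fin n ⊕ Unit) ℂ => M.1 :=
      continuous_subtype_val
    exact (h.matrix_conjTranspose.matrix_mul continuous_const).matrix_mul h
  exact isClosed_eq this continuous_const

lemma isClosedEmbedding_entries (n : ℕ) :
    IsClosedEmbedding fun g : SU n => (g : Matrix.SpecialLinearGroup (Fin n ⊕ Unit) ℂ).1 := by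
  have h0 : IsClosedEmbedding fun M : Matrix.SpecialLinearGroup (Fin n ⊕ Unit) ℂ => M.1 :=
    Matrix.SpecialLinearGroup.isClosedEmbedding_val
  have h1 : IsClosedEmbedding fun g : SU n => (g : Matrix.SpecialLinearGroup (Fin n ⊕ Unit) ℂ) :=
    (isClosed_SU n).isClosedEmbedding_subtypeVal
  exact h0.comp h1

lemma exists_norm_sq_le {n : ℕ} {K : Set (Hn n)} (hK : IsCompact K) :
    ∃ δ : ℝ, 0 < δ ∧ ∀ z ∈ K, ∑ i, ‖z.1 i‖ ^ 2 ≤ 1 - δ := by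
  have hc : Continuous fun z : Hn n => ∑ i, ‖z.1 i‖ ^ 2 :=
    continuous_finsetSum _ fun i _ => (((continuous_apply i).comp continuous_subtype_val).norm).pow 2
  rcases K.eq_empty_or_nonempty with rfl | hne
  · exact ⟨1, one_pos, by simp⟩
  obtain ⟨z, -, hz⟩ := hK.exists_isMaxOn hne hc.continuousOn
  refine ⟨1 - ∑ i, ‖z.1 i‖ ^ 2, ?_, fun w hw => ?_⟩
  · have : ∑ i, ‖z.1 i‖ ^ 2 < 1 := z.2
    linarith
  · have := hz hw
    simp only [Set.mem_ofPred_eq] at this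
    linarith

lemma projX_eq_iff {n : ℕ} {Γ : Subgroup (SU n)} {z w : Hn n} :
    projX Γ z = projX Γ w ↔ ∃ γ : Γ, γ • w = z :=
  Quotient.eq (r := MulAction.orbitRel Γ (Hn n))

lemma projPT_eq_iff {n : ℕ} {Γ : Subgroup (SU n)} {p p' : PTH n} :
    projPT Γ p = projPT Γ p' ↔ ∃ γ : Γ, γ • p' = p :=
  Quotient.eq (r := MulAction.orbitRel Γ (PTH n))

instance {n : ℕ} (Γ : Subgroup (SU n)) : ContinuousConstSMul Γ (Hn n) :=
  ⟨fun γ => continuous_const_smul γ.1⟩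

instance {n : ℕ} (Γ : Subgroup (SU n)) : ContinuousConstSMul Γ (PTH n) :=
  ⟨fun γ => continuous_const_smul γ.1⟩

section Discrete

variable {n : ℕ} (Γ : Subgroup (SU n)) [DiscreteTopology Γ]

instance : ProperlyDiscontinuousSMul Γ (Hn n) where
  finite_disjoint_inter_image {K L} hK hL := by
    obtain ⟨δ, hδ, h1⟩ := exists_norm_sq_le (hK.union hL)
    obtain ⟨B, hB⟩ := norm_entry_le (n := n) (lt_min hδ one_pos) (min_le_right δ 1)
    set S : Set (Matrix (Fin n ⊕ Unit) (Fin n ⊕ Unit) ℂ) := {M | ∀ i j, ‖M i j‖ ≤ B} with hS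
    have hSc : IsCompact S := by
      have : S = Set.univ.pi fun _ => Set.univ.pi fun _ => Metric.closedBall (0 : ℂ) B := by
        ext M
        exact ⟨fun h i _ j _ => mem_closedBall_zero_iff.2 (h i j),
          fun h i j => mem_closedBall_zero_iff.1 (h i trivial j trivial)⟩
      rw [this]
      exact isCompact_univ_pi fun _ => isCompact_univ_pi fun _ => isCompact_closedBall _ _
    have hcpt := (isClosedEmbedding_entries n).isCompact_preimage hSc
    have ht := Subgroup.tendsto_coe_cofinite_of_discrete Γ
      (isDiscrete_iff_discreteTopology.2 inferInstance)
    have hfin := ht hcpt.compl_mem_cocompact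
    rw [Filter.mem_map, Filter.mem_cofinite] at hfin
    refine hfin.subset ?_
    rintro γ ⟨_, ⟨z, hz, rfl⟩, hw⟩
    simp only [Set.mem_compl_iff, Set.mem_preimage, not_not, hS, Set.mem_ofPred_eq]
    refine hB γ.1 z.1 ((h1 z (Or.inl hz)).trans ?_) ((h1 _ (Or.inr hw)).trans ?_) <;>
    · have := min_le_left δ 1
      linarith

instance : ProperlyDiscontinuousSMul Γ (PTH n) where
  finite_disjoint_inter_image {K L} hK hL := by
    refine (finite_disjoint_inter_image (Γ := Γ) (hK.image (continuous_pt n))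
      (hL.image (continuous_pt n))).subset ?_
    rintro γ ⟨_, ⟨p, hp, rfl⟩, hw⟩
    exact ⟨γ • p.pt, ⟨p.pt, ⟨p, hp, rfl⟩, rfl⟩, ⟨_, hw, rfl⟩⟩

instance : Countable Γ := by
  have : SecondCountableTopology (Matrix (Fin n ⊕ Unit) (Fin n ⊕ Unit) ℂ) :=
    inferInstanceAs (SecondCountableTopology (Fin n ⊕ Unit → Fin n ⊕ Unit → ℂ))
  have hemb :=
    (isClosedEmbedding_entries n).isEmbedding.comp (IsEmbedding.subtypeVal (p := (· ∈ Γ)))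
  have := hemb.secondCountableTopology
  exact countable_of_Lindelof_of_discrete

variable {Γ}

lemma eq_one_of_smul_eq (hΓ : TorsionFree Γ) {γ : Γ} {z : Hn n} (h : γ • z = z) : γ = 1 := by
  have hfin := ProperlyDiscontinuousSMul.finite_stabilizer (Γ := Γ) z
  have : Finite (MulAction.stabilizer Γ z) := hfin
  have h1 := isOfFinOrder_of_finite (⟨γ, h⟩ : MulAction.stabilizer Γ z)
  have h2 : IsOfFinOrder γ.1 := by
    have h3 := (Subgroup.subtype _).isOfFinOrder h1
    exact Γ.subtype.isOfFinOrder h3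
  exact Subtype.ext (hΓ γ.1 γ.2 h2)

lemma exists_open_disjoint (hΓ : TorsionFree Γ) (z : Hn n) :
    ∃ U, IsOpen U ∧ z ∈ U ∧ ∀ γ : Γ, ∀ w ∈ U, γ • w ∈ U → γ = 1 := by
  obtain ⟨U, hU, h⟩ := ProperlyDiscontinuousSMul.exists_nhds_image_smul_eq_self Γ z
  refine ⟨interior U, isOpen_interior, mem_interior_iff_mem_nhds.2 hU, fun γ w hw hw' => ?_⟩
  exact eq_one_of_smul_eq hΓ (h γ ⟨γ • w, ⟨w, interior_subset hw, rfl⟩, interior_subset hw'⟩)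

end Discrete

end CHyp

namespace CHyp

open MeasureTheory Topology

/-! ### Leaves in the affine charts -/

section Leaf

variable {m : ℕ} (k : Fin (m + 1))

/-- The direction of the complex geodesic with given chart parameters. -/
noncomputable def leafDir (u : Par m) : Fin (m + 1) → ℂ := ins k 1 (parComp 1 u)

lemma leafDir_ne_zero (u : Par m) : leafDir k u ≠ 0 := fun h => by
  have := congrFun h k
  simp [leafDir] at this

/-- The parametrization of the leaves by the `k`-th coordinate. -/
noncomputable def leafPt (u : Par m) (t : ℂ) : Fin (m + 1) → ℂ :=
  ins k 0 (parComp 0 u) + t • leafDir k u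

@[simp] lemma leafPt_apply_self (u : Par m) (t : ℂ) : leafPt k u t k = t := by
  simp [leafPt, leafDir]

lemma lift_leafPt (u : Par m) (t : ℂ) :
    lift (leafPt k u t) = chartFrame k u 0 + t • chartFrame k u 1 := by
  funext i
  rcases i with i | i <;> simp [lift, leafPt, leafDir, chartFrame, vec]

lemma vec_leafDir (u : Par m) : vec (leafDir k u) = chartFrame k u 1 := rfl

variable {k} in
lemma mem_dom_of_leafPt_mem {u : Par m} {t : ℂ} (h : leafPt k u t ∈ ball (m + 1)) :
    u ∈ (chart k).dom := by
  refine ⟨linearIndependent_chartFrame k u, lift (leafPt k u t), ?_, q_lift_neg h⟩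
  rw [lift_leafPt]
  exact Submodule.add_mem _ (Submodule.subset_span ⟨0, rfl⟩)
    (Submodule.smul_mem _ _ (Submodule.subset_span ⟨1, rfl⟩))

/-- The point of `PT_{H^n}` with given chart parameters. -/
noncomputable def leafLine (x : {x : Par m × ℂ // leafPt k x.1 x.2 ∈ ball (m + 1)}) : PTH (m + 1) :=
  tanLine (⟨leafPt k x.1.1 x.1.2, x.2⟩, ⟨leafDir k x.1.1, leafDir_ne_zero k x.1.1⟩)

lemma toGeodesic_leafLine (x : {x : Par m × ℂ // leafPt k x.1 x.2 ∈ ball (m + 1)}) :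
    toGeodesic (leafLine k x) = chartMap k ⟨x.1.1, mem_dom_of_leafPt_mem x.2⟩ := by
  rw [leafLine, toGeodesic_tanLine]
  refine Geodesic.ext (span_eq_of_le (linearIndependent_chartFrame k x.1.1)
    (mem_frames_of_tangent x.2 (leafDir_ne_zero k x.1.1)).1 ?_)
  rw [Submodule.span_le]
  rintro _ ⟨i, rfl⟩
  fin_cases i
  · show lift (leafPt k x.1.1 x.1.2) ∈ _
    rw [lift_leafPt]
    exact Submodule.add_mem _ (Submodule.subset_span ⟨0, rfl⟩)
      (Submodule.smul_mem _ _ (Submodule.subset_span ⟨1, rfl⟩))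
  · exact Submodule.subset_span ⟨1, rfl⟩

variable {k} in
lemma eq_of_toGeodesic_eq {p : PTH (m + 1)} {u : (chart (m := m) k).dom}
    (h : toGeodesic p = chartMap k u) :
    p.pt.1 = leafPt k u.1 (p.pt.1 k) ∧ ∃ c : ℂ, c ≠ 0 ∧ p.dir.rep = c • leafDir k u.1 := by
  have hp : Submodule.span ℂ (Set.range ![lift p.pt.1, vec p.dir.rep]) =
    Submodule.span ℂ (Set.range (chartFrame k u.1)) := congrArg Geodesic.plane h
  have h0 : lift p.pt.1 ∈ Submodule.span ℂ (Set.range (chartFrame k u.1)) := by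
    rw [← hp]; exact Submodule.subset_span ⟨0, rfl⟩
  have h1 : vec p.dir.rep ∈ Submodule.span ℂ (Set.range (chartFrame k u.1)) := by
    rw [← hp]; exact Submodule.subset_span ⟨1, rfl⟩
  obtain ⟨a, ha⟩ := (Submodule.mem_span_range_iff_exists_fun ℂ).1 h0
  obtain ⟨b, hb⟩ := (Submodule.mem_span_range_iff_exists_fun ℂ).1 h1
  rw [Fin.sum_univ_two] at ha hb
  have a0 : a 0 = 1 := by simpa [chartFrame, lift, vec] using congrFun ha (Sum.inr ())
  have a1 : a 1 = p.pt.1 k := by simpa [chartFrame, lift, vec] using congrFun ha (Sum.inl k)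
  have b0 : b 0 = 0 := by simpa [chartFrame, lift, vec] using congrFun hb (Sum.inr ())
  refine ⟨?_, b 1, ?_, ?_⟩
  · funext i
    rw [a0, a1, one_smul, ← lift_leafPt] at ha
    exact (congrFun ha (Sum.inl i)).symm
  · intro hb1
    refine p.dir.rep_nonzero (funext fun i => ?_)
    have := congrFun hb (Sum.inl i)
    simpa [b0, hb1, vec] using this.symm
  · funext i
    have := congrFun hb (Sum.inl i)
    rw [b0, zero_smul, zero_add, ← vec_leafDir] at this
    exact this.symm

variable {k} in
lemma eq_leafLine {p : PTH (m + 1)} {u : (chart (m := m) k).dom} (h : toGeodesic p = chartMap k u) :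
    ∃ hx : leafPt k u.1 (p.pt.1 k) ∈ ball (m + 1), p = leafLine k ⟨(u.1, p.pt.1 k), hx⟩ := by
  obtain ⟨h1, c, hc, h2⟩ := eq_of_toGeodesic_eq h
  have hx : leafPt k u.1 (p.pt.1 k) ∈ ball (m + 1) := by rw [← h1]; exact p.pt.2
  refine ⟨hx, ?_⟩
  obtain ⟨z, l⟩ := p
  refine congrArg₂ PTH.mk (Subtype.ext h1) ?_
  have : l = toProj ⟨l.rep, l.rep_nonzero⟩ := l.mk_rep.symm
  rw [this]
  exact toProj_eq_iff.2 ⟨Units.mk0 c hc, h2.symm⟩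

lemma continuous_ins : Continuous fun x : ℂ × (Fin m → ℂ) => ins k x.1 x.2 :=
  Continuous.finInsertNth k continuous_fst continuous_snd

lemma continuous_leafDir : Continuous (leafDir (m := m) k) :=
  (continuous_ins k).comp (continuous_const.prodMk (parComp 1).continuous)

lemma continuous_leafPt : Continuous fun x : Par m × ℂ => leafPt k x.1 x.2 := by
  have h0 : Continuous fun x : Par m × ℂ => ins k 0 (parComp 0 x.1) :=
    (continuous_ins k).comp (continuous_const.prodMk ((parComp 0).continuous.comp continuous_fst))
  exact h0.add (continuous_snd.smul ((continuous_leafDir k).comp continuous_fst))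

lemma continuous_leafLine : Continuous (leafLine (m := m) k) := by
  have h1 : Continuous fun x : {x : Par m × ℂ // leafPt k x.1 x.2 ∈ ball (m + 1)} =>
      (⟨leafPt k x.1.1 x.1.2, x.2⟩ : Hn (m + 1)) :=
    continuous_induced_rng.2 ((continuous_leafPt k).comp continuous_subtype_val)
  have h2 : Continuous fun x : {x : Par m × ℂ // leafPt k x.1 x.2 ∈ ball (m + 1)} =>
      (⟨leafDir k x.1.1, leafDir_ne_zero k x.1.1⟩ : NZ (m + 1)) :=
    continuous_induced_rng.2 ((continuous_leafDir k).comp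
      (continuous_fst.comp continuous_subtype_val))
  exact (isOpenQuotientMap_tanLine _).continuous.comp (h1.prodMk h2)

end Leaf

/-- Every point of `PT_{H^n}` has a basis of neighborhoods on which the foliation is a product. -/
lemma exists_box {m : ℕ} (p₀ : PTH (m + 1)) {S : Set (PTH (m + 1))} (hS : IsOpen S) (hp₀ : p₀ ∈ S) :
    ∃ C : Set (PTH (m + 1)), IsOpen C ∧ p₀ ∈ C ∧ C ⊆ S ∧ IsOpen (toGeodesic '' C) ∧
      ∃ e : C ≃ₜ Metric.ball (0 : ℂ) 1 × (toGeodesic '' C),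
        ∀ p : C, ((e p).2 : Geodesic (m + 1)) = toGeodesic p.1 := by
  obtain ⟨⟨k, u₀⟩, h₀⟩ : ∃ x : Σ k : Fin (m + 1), (chart (m := m) k).dom,
      toGeodesic p₀ = chartMap x.1 x.2 := by
    have hf := mem_frames_of_tangent p₀.pt.2 p₀.dir.rep_nonzero
    obtain ⟨k, hk⟩ := exists_pivot_ne_zero hf
    have hs := span_chartFrame_bivCoord k hk
    refine ⟨⟨k, ⟨bivCoord k (plucker ![lift p₀.pt.1, vec p₀.dir.rep]),
      linearIndependent_chartFrame k _, ?_⟩⟩, Geodesic.ext hs.symm⟩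
    rw [hs]
    exact hf.2
  dsimp only at h₀
  obtain ⟨hx₀, e₀⟩ := eq_leafLine h₀
  set t₀ := p₀.pt.1 k with ht₀
  have hE : IsOpen {x : Par m × ℂ | leafPt k x.1 x.2 ∈ ball (m + 1)} :=
    (isOpen_ball _).preimage (continuous_leafPt k)
  have hE' := hE.isOpenMap_subtype_val _ (hS.preimage (continuous_leafLine k))
  have hmem : (u₀.1, t₀) ∈ Subtype.val '' (leafLine k ⁻¹' S) :=
    ⟨⟨(u₀.1, t₀), hx₀⟩, by rw [Set.mem_preimage, ← e₀]; exact hp₀, rfl⟩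
  obtain ⟨O, T, hO, hT, hu₀, ht₀', hOT⟩ := isOpen_prod_iff.1 hE' _ _ hmem
  obtain ⟨ε, hε, hεT⟩ := Metric.isOpen_iff.1 hT t₀ ht₀'
  have hbox : ∀ u ∈ O, ∀ t ∈ Metric.ball t₀ ε, ∃ hx : leafPt k u t ∈ ball (m + 1),
      leafLine k ⟨(u, t), hx⟩ ∈ S := by
    intro u hu t ht
    obtain ⟨⟨x, hx⟩, hx', rfl⟩ := hOT (Set.mk_mem_prod hu (hεT ht))
    exact ⟨hx, hx'⟩
  have hOd : ∀ u ∈ O, u ∈ (chart k).dom := fun u hu =>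
    mem_dom_of_leafPt_mem (hbox u hu t₀ (Metric.mem_ball_self hε)).1
  let b : O → Geodesic (m + 1) := fun u => chartMap k ⟨u.1, hOd u.1 u.2⟩
  have hb : IsEmbedding b := (isOpenEmbedding_chartMap k).isEmbedding.comp (IsEmbedding.inclusion hOd)
  have hbr : IsOpen (Set.range b) := by
    have : Set.range b = chartMap k '' (Subtype.val ⁻¹' O) := by
      ext W
      constructor
      · rintro ⟨u, rfl⟩
        exact ⟨⟨u.1, hOd u.1 u.2⟩, u.2, rfl⟩
      · rintro ⟨u, hu, rfl⟩
        exact ⟨⟨u.1, hu⟩, rfl⟩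
    rw [this]
    exact (isOpenEmbedding_chartMap k).isOpenMap _ (hO.preimage continuous_subtype_val)
  have hs : ∀ s : Metric.ball (0 : ℂ) 1, t₀ + ε * s.1 ∈ Metric.ball t₀ ε := by
    intro s
    have := mem_ball_zero_iff.1 s.2
    rw [mem_ball_iff_norm, add_sub_cancel_left, norm_mul, Complex.norm_real, Real.norm_of_nonneg hε.le]
    nlinarith
  have hε' : (ε : ℂ) ≠ 0 := Complex.ofReal_ne_zero.2 hε.ne'
  let a : Metric.ball (0 : ℂ) 1 → ℂ := fun s => t₀ + ε * s.1
  have ha : IsEmbedding a := by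
    have h1 : IsEmbedding fun s : ℂ => t₀ + ε * s :=
      ((Homeomorph.mulLeft₀ (ε : ℂ) hε').trans (Homeomorph.addLeft t₀)).isEmbedding
    exact h1.comp IsEmbedding.subtypeVal
  let F : Metric.ball (0 : ℂ) 1 × O → PTH (m + 1) := fun x =>
    leafLine k ⟨(x.2.1, a x.1), (hbox x.2.1 x.2.2 _ (hs x.1)).1⟩
  let g : PTH (m + 1) → ℂ × Geodesic (m + 1) := fun p => (p.pt.1 k, toGeodesic p)
  have hg : Continuous g := ((continuous_apply k).comp
    (continuous_subtype_val.comp (continuous_pt _))).prodMk (continuous_toGeodesic _)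
  have hgF : ∀ x, g (F x) = (a x.1, b x.2) := by
    intro x
    refine Prod.ext ?_ (toGeodesic_leafLine k _)
    exact leafPt_apply_self k _ _
  have hFc : Continuous F := by
    refine (continuous_leafLine k).comp (continuous_induced_rng.2 ?_)
    exact (continuous_subtype_val.comp continuous_snd).prodMk (ha.continuous.comp continuous_fst)
  have hF : IsEmbedding F := by
    refine IsEmbedding.of_comp hFc hg ?_
    have : g ∘ F = Prod.map a b := funext hgF
    rw [this]
    exact ha.prodMap hb
  have hrange : Set.range F = g ⁻¹' (Metric.ball t₀ ε ×ˢ Set.range b) := by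
    ext p
    constructor
    · rintro ⟨x, rfl⟩
      rw [Set.mem_preimage, hgF]
      exact ⟨hs x.1, x.2, rfl⟩
    · rintro ⟨h1, u, hu⟩
      obtain ⟨hx, e⟩ := eq_leafLine (u := ⟨u.1, hOd u.1 u.2⟩) hu.symm
      have h1' : ‖p.pt.1 k - t₀‖ < ε := mem_ball_iff_norm.1 h1
      refine ⟨(⟨(ε : ℂ)⁻¹ * (p.pt.1 k - t₀), ?_⟩, u), ?_⟩
      · rw [mem_ball_zero_iff, norm_mul, norm_inv, Complex.norm_real, Real.norm_of_nonneg hε.le,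
          inv_mul_lt_iff₀ hε, mul_one]
        exact h1'
      · refine Eq.trans ?_ e.symm
        refine congrArg (leafLine k) (Subtype.ext (Prod.ext rfl ?_))
        show t₀ + ε * ((ε : ℂ)⁻¹ * (p.pt.1 k - t₀)) = p.pt.1 k
        rw [mul_inv_cancel_left₀ hε']
        ring
  have himg : toGeodesic '' Set.range F = Set.range b := by
    ext W
    constructor
    · rintro ⟨_, ⟨x, rfl⟩, rfl⟩
      exact ⟨x.2, (congrArg Prod.snd (hgF x)).symm⟩
    · rintro ⟨u, rfl⟩
      exact ⟨F (⟨0, Metric.mem_ball_self one_pos⟩, u), ⟨_, rfl⟩, congrArg Prod.snd (hgF _)⟩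
  refine ⟨Set.range F, ?_, ?_, ?_, by rwa [himg], ?_⟩
  · rw [hrange]
    exact (Metric.isOpen_ball.prod hbr).preimage hg
  · rw [hrange]
    exact ⟨Metric.mem_ball_self hε, ⟨u₀.1, hu₀⟩, h₀.symm⟩
  · rintro _ ⟨x, rfl⟩
    exact (hbox x.2.1 x.2.2 _ (hs x.1)).2
  · refine ⟨hF.toHomeomorph.symm.trans ((Homeomorph.refl _).prodCongr
      (hb.toHomeomorph.trans (Homeomorph.setCongr himg.symm))), ?_⟩
    intro p
    obtain ⟨x, rfl⟩ := hF.toHomeomorph.surjective p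
    simp only [Homeomorph.trans_apply, Homeomorph.symm_apply_apply]
    exact (congrArg Prod.snd (hgF x)).symm

lemma isOpenMap_toGeodesic (m : ℕ) : IsOpenMap (toGeodesic (n := m + 1)) := by
  intro S hS
  rw [isOpen_iff_mem_nhds]
  rintro _ ⟨p, hp, rfl⟩
  obtain ⟨C, -, hpC, hCS, hC, -⟩ := exists_box p hS hp
  exact Filter.mem_of_superset (hC.mem_nhds ⟨p, hpC, rfl⟩) (Set.image_mono hCS)

/-! ### Existence of partitions of unity -/

lemma exists_partition_quotient {T G : Type*} [TopologicalSpace T] [T2Space T]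
    [LocallyCompactSpace T] [SecondCountableTopology T] [Group G] [MulAction G T]
    [ContinuousConstSMul G T] [ProperlyDiscontinuousSMul G T] {ι : Type*}
    (U : ι → Set (MulAction.orbitRel.Quotient G T)) (hU : ∀ i, IsOpen (U i))
    (hcov : ∀ x, ∃ i, x ∈ U i) :
    ∃ χ : PartitionOfUnity ι (MulAction.orbitRel.Quotient G T) Set.univ, χ.IsSubordinate U := by
  have hT2 : T2Space (MulAction.orbitRel.Quotient G T) :=
    t2Space_of_properlyDiscontinuousSMul_of_t2Space
  have h2 : SecondCountableTopology (MulAction.orbitRel.Quotient G T) :=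
    ContinuousConstSMul.secondCountableTopology
  have hq : IsOpenQuotientMap (Quotient.mk (MulAction.orbitRel G T)) :=
    MulAction.isOpenQuotientMap_quotientMk
  have hlc : WeaklyLocallyCompactSpace (MulAction.orbitRel.Quotient G T) := by
    refine ⟨fun x => ?_⟩
    obtain ⟨t, rfl⟩ := hq.surjective x
    obtain ⟨K, hK, hKt⟩ := exists_compact_mem_nhds t
    exact ⟨_, hK.image hq.continuous, hq.isOpenMap.image_mem_nhds hKt⟩
  have : LocallyCompactSpace (MulAction.orbitRel.Quotient G T) := inferInstance
  exact PartitionOfUnity.exists_isSubordinate isClosed_univ U hU fun x _ => by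
    obtain ⟨i, hi⟩ := hcov x
    exact Set.mem_iUnion.2 ⟨i, hi⟩

section Discrete

variable {n : ℕ} {Γ : Subgroup (SU n)} [DiscreteTopology Γ]

lemma isOpenQuotientMap_projX (Γ : Subgroup (SU n)) : IsOpenQuotientMap (projX Γ) :=
  MulAction.isOpenQuotientMap_quotientMk

lemma isOpenQuotientMap_projPT (Γ : Subgroup (SU n)) : IsOpenQuotientMap (projPT Γ) :=
  MulAction.isOpenQuotientMap_quotientMk

lemma nonempty_XPartition (hΓ : TorsionFree Γ) : Nonempty (XPartition Γ) := by
  choose U hU hzU h using exists_open_disjoint hΓ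
  obtain ⟨χ, hχ⟩ := exists_partition_quotient (G := Γ) (T := Hn n) (fun z => projX Γ '' U z)
    (fun z => (isOpenQuotientMap_projX Γ).isOpenMap _ (hU z)) (fun x => by
      obtain ⟨z, rfl⟩ := (isOpenQuotientMap_projX Γ).surjective x
      exact ⟨z, z, hzU z, rfl⟩)
  refine ⟨⟨Hn n, U, hU, fun i z hz w hw e => ?_, χ, hχ⟩⟩
  obtain ⟨γ, rfl⟩ := projX_eq_iff.1 e
  rw [h i γ w hw hz, one_smul]

end Discrete

lemma nonempty_PTPartition {m : ℕ} {Γ : Subgroup (SU (m + 1))} [DiscreteTopology Γ]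
    (hΓ : TorsionFree Γ) : Nonempty (PTPartition Γ) := by
  choose U hU hzU h using exists_open_disjoint hΓ
  choose C hC hpC hCS hCo e he using fun p : PTH (m + 1) =>
    exists_box p ((hU p.pt).preimage (continuous_pt _)) (hzU p.pt)
  obtain ⟨χ, hχ⟩ := exists_partition_quotient (G := Γ) (T := PTH (m + 1)) (fun p => projPT Γ '' C p)
    (fun z => (isOpenQuotientMap_projPT Γ).isOpenMap _ (hC z)) (fun x => by
      obtain ⟨z, rfl⟩ := (isOpenQuotientMap_projPT Γ).surjective x
      exact ⟨z, z, hpC z, rfl⟩)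
  refine ⟨⟨PTH (m + 1), fun p => ⟨C p, hC p, fun x hx y hy exy => ?_, e p, he p⟩, χ, hχ⟩⟩
  obtain ⟨γ, rfl⟩ := projPT_eq_iff.1 exy
  rw [h p.pt γ y.pt (hCS p hy) (hCS p hx), one_smul]

/-! ### The transverse measure -/

lemma isInvariantTransverseMeasure_geoVol {m : ℕ} {a : ℝ} (ha : 0 < a) (Γ : Subgroup (SU (m + 1))) :
    IsInvariantTransverseMeasure Γ (transverse Γ (geoVol m a)) := by
  have hopen : ∀ U : RegularOpen Γ, IsOpen U.plaques := fun U =>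
    isOpenMap_toGeodesic m _ U.isOpen_carrier
  refine ⟨fun U => ?_, fun U K hKU hK => ?_, fun U U' γ hγ A hA hAU => ?_⟩
  · rw [transverse, Measure.restrict_apply (hopen U).measurableSet.compl, Set.compl_inter_self,
      measure_empty]
  · refine (Measure.restrict_apply_le _ _).trans_lt ?_
    exact hK.measure_lt_top_of_nhdsWithin fun W _ =>
      (finiteAt_geoVol ha W).filter_mono nhdsWithin_le_nhds
  · have h1 : A ⊆ U.plaques := fun W hW => by
      obtain ⟨p, hp, rfl⟩ := hAU hW
      exact ⟨p, hp.1, rfl⟩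
    have h2 : (fun W => γ • W) '' A ⊆ U'.plaques := by
      rintro _ ⟨W, hW, rfl⟩
      obtain ⟨p, hp, rfl⟩ := hAU hW
      exact ⟨γ • p, hp.2, (smul_toGeodesic γ p).symm⟩
    rw [transverse, transverse, Measure.restrict_eq_self _ h1, Measure.restrict_eq_self _ h2,
      geoVol_image ha γ hA]

end CHyp

namespace CHyp

open MeasureTheory Topology

/-! ### The Bergman metric of the ball -/

section Metric

variable {n : ℕ}

/-- The square of the Euclidean norm. -/
noncomputable def nsq (v : Fin n → ℂ) : ℝ := ∑ i, ‖v i‖ ^ 2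

lemma nsq_nonneg (v : Fin n → ℂ) : 0 ≤ nsq v := Finset.sum_nonneg fun _ _ => by positivity

lemma herm_self (v : Fin n → ℂ) : herm v v = nsq v := by
  simp [herm, nsq, Complex.mul_conj']

lemma herm_smul_left (c : ℂ) (u v : Fin n → ℂ) : herm (c • u) v = c * herm u v := by
  simp [herm, Finset.mul_sum, mul_assoc]

lemma herm_smul_right (c : ℂ) (u v : Fin n → ℂ) : herm u (c • v) = starRingEnd ℂ c * herm u v := by
  simp [herm, Finset.mul_sum, mul_left_comm]

lemma conj_herm (u v : Fin n → ℂ) : starRingEnd ℂ (herm u v) = herm v u := by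
  simp [herm, mul_comm]

lemma nsq_smul (c : ℂ) (v : Fin n → ℂ) : nsq (c • v) = ‖c‖ ^ 2 * nsq v := by
  simp [nsq, mul_pow, Finset.mul_sum]

lemma nsq_pos {v : Fin n → ℂ} (hv : v ≠ 0) : 0 < nsq v := by
  refine lt_of_le_of_ne (nsq_nonneg v) fun h => hv ?_
  funext i
  have := (Finset.sum_eq_zero_iff_of_nonneg fun i _ => by positivity).1 h.symm i (Finset.mem_univ i)
  simpa using this

lemma mem_ball_iff {z : Fin n → ℂ} : z ∈ ball n ↔ nsq z < 1 := Iff.rfl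

lemma continuous_nsq : Continuous (nsq (n := n)) :=
  continuous_finsetSum _ fun i _ => ((continuous_apply i).norm).pow 2

lemma continuous_herm : Continuous fun x : (Fin n → ℂ) × (Fin n → ℂ) => herm x.1 x.2 :=
  continuous_finsetSum _ fun i _ => ((continuous_apply i).comp continuous_fst).mul
    (Complex.continuous_conj.comp ((continuous_apply i).comp continuous_snd))

/-- The opposite of the Gram determinant of `(z, 1)` and `(v, 0)`. -/
noncomputable def gramD (z v : Fin n → ℂ) : ℝ := (1 - nsq z) * nsq v + ‖herm v z‖ ^ 2

/-- The square of the length of a tangent vector, up to a factor 4. -/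
noncomputable def metricN (z v : Fin n → ℂ) : ℝ := gramD z v / (1 - nsq z) ^ 2

lemma hf_lift_lift (z : Fin n → ℂ) : hf (lift z) (lift z) = (nsq z : ℂ) - 1 := by
  rw [hf_self, q_lift]; simp [nsq]

lemma hf_vec_vec (u v : Fin n → ℂ) : hf (vec u) (vec v) = herm u v := by
  simp [hf, vec, herm, Fintype.sum_sum_type]

lemma hf_vec_lift (u v : Fin n → ℂ) : hf (vec u) (lift v) = herm u v := by
  simp [hf, vec, lift, herm, Fintype.sum_sum_type]

lemma hf_lift_vec (u v : Fin n → ℂ) : hf (lift u) (vec v) = herm u v := by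
  simp [hf, vec, lift, herm, Fintype.sum_sum_type]

lemma det_gram_tangent (z v : Fin n → ℂ) : (gram ![lift z, vec v]).det = -(gramD z v : ℂ) := by
  rw [Matrix.det_fin_two]
  show hf (lift z) (lift z) * hf (vec v) (vec v) - hf (lift z) (vec v) * hf (vec v) (lift z) = _
  rw [hf_lift_lift, hf_vec_vec, hf_lift_vec, hf_vec_lift, herm_self, gramD, ← conj_herm v z,
    mul_comm (starRingEnd ℂ _), Complex.mul_conj']
  push_cast
  ring

lemma gramD_smul (z v : Fin n → ℂ) (c : ℂ) : gramD z (c • v) = ‖c‖ ^ 2 * gramD z v := by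
  rw [gramD, gramD, nsq_smul, herm_smul_left, norm_mul]; ring

lemma metricN_smul (z v : Fin n → ℂ) (c : ℂ) : metricN z (c • v) = ‖c‖ ^ 2 * metricN z v := by
  rw [metricN, metricN, gramD_smul]; ring

lemma one_sub_nsq_pos {z : Fin n → ℂ} (hz : z ∈ ball n) : 0 < 1 - nsq z := by
  have := mem_ball_iff.1 hz; linarith

lemma gramD_pos {z v : Fin n → ℂ} (hz : z ∈ ball n) (hv : v ≠ 0) : 0 < gramD z v := by
  have h1 := one_sub_nsq_pos hz
  have h2 := nsq_pos hv
  rw [gramD]; positivity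

lemma metricN_pos {z v : Fin n → ℂ} (hz : z ∈ ball n) (hv : v ≠ 0) : 0 < metricN z v := by
  have h1 := one_sub_nsq_pos hz
  have h2 := gramD_pos hz hv
  rw [metricN]; positivity

lemma continuous_gramD : Continuous fun x : (Fin n → ℂ) × (Fin n → ℂ) => gramD x.1 x.2 :=
  ((continuous_const.sub (continuous_nsq.comp continuous_fst)).mul
    (continuous_nsq.comp continuous_snd)).add
    ((continuous_herm.comp (continuous_snd.prodMk continuous_fst)).norm.pow 2)

lemma one_sub_nsq_mob (g : SU n) {z : Fin n → ℂ} (hz : z ∈ ball n) :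
    1 - nsq (mob g z) = (‖lin g (lift z) (Sum.inr ())‖⁻¹) ^ 2 * (1 - nsq z) := by
  have h : q (lift (mob g z)) = ‖(lin g (lift z) (Sum.inr ()))⁻¹‖ ^ 2 * q (lift z) := by
    rw [lift_mob g hz, q_smul, q_lin]
  rw [q_lift, q_lift, norm_inv] at h
  rw [nsq, nsq]
  linarith

lemma gramD_mob (g : SU n) {z : Fin n → ℂ} (hz : z ∈ ball n) (v : Fin n → ℂ) :
    gramD (mob g z) (fderiv ℂ (mob g) z v) =
      (‖lin g (lift z) (Sum.inr ())‖⁻¹) ^ 4 * gramD z v := by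
  set d := lin g (lift z) (Sum.inr ()) with hd
  set c := lin g (vec v) (Sum.inr ()) / d ^ 2 with hc
  have hframe : (![lift (mob g z), vec (fderiv ℂ (mob g) z v)] : Fin 2 → V n) =
      comb ![![d⁻¹, 0], ![-c, d⁻¹]] fun i => lin g ((![lift z, vec v] : Fin 2 → V n) i) := by
    funext i
    fin_cases i
    · simp [comb, lift_mob g hz, ← hd]
    · simp [comb, vec_fderiv_mob g hz, ← hd, ← hc]
      abel
  have h1 := hh_plucker (![lift (mob g z), vec (fderiv ℂ (mob g) z v)] : Fin 2 → V n)
  have h3 : hh (plucker fun i => lin g ((![lift z, vec v] : Fin 2 → V n) i))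
      (plucker fun i => lin g ((![lift z, vec v] : Fin 2 → V n) i)) =
      hh (plucker ![lift z, vec v]) (plucker ![lift z, vec v]) := hh_plucker_lin _ _ _ _ _
  rw [hframe, plucker_comb, hh_smul_left, hh_smul_right, h3, hh_plucker, ← hframe,
    det_gram_tangent, det_gram_tangent] at h1
  simp only [Matrix.cons_val_zero, Matrix.cons_val_one, zero_mul, sub_zero] at h1
  rw [← mul_assoc, Complex.mul_conj'] at h1
  have h2 : ((gramD (mob g z) (fderiv ℂ (mob g) z v) : ℝ) : ℂ) =
      (((‖d‖⁻¹) ^ 4 * gramD z v : ℝ) : ℂ) := by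
    rw [norm_mul, norm_inv] at h1
    push_cast at h1 ⊢
    linear_combination (1 / 2 : ℂ) * h1
  exact_mod_cast h2

lemma metricN_mob (g : SU n) {z : Fin n → ℂ} (hz : z ∈ ball n) (v : Fin n → ℂ) :
    metricN (mob g z) (fderiv ℂ (mob g) z v) = metricN z v := by
  have hd : ‖lin g (lift z) (Sum.inr ())‖ ≠ 0 := norm_ne_zero_iff.2 (den_ne_zero g hz)
  have h1 := one_sub_nsq_pos hz
  rw [metricN, metricN, gramD_mob g hz, one_sub_nsq_mob g hz]
  field_simp

/-- A square root of the metric. -/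
noncomputable def rootT (z : Fin n → ℂ) : (Fin n → ℂ) →ₗ[ℂ] (Fin n → ℂ) :=
  Matrix.toLin' ((((1 - nsq z : ℝ) : ℂ)⁻¹ * (√(1 - nsq z) : ℝ)) •
    (1 + Matrix.replicateCol Unit z * Matrix.replicateRow Unit
      (((√(1 - nsq z) * (1 + √(1 - nsq z)) : ℝ) : ℂ)⁻¹ • star z)))

lemma rootT_apply {z : Fin n → ℂ} (hz : z ∈ ball n) (v : Fin n → ℂ) :
    rootT z v = ((1 - nsq z : ℝ) : ℂ)⁻¹ • (((√(1 - nsq z) : ℝ) : ℂ) • v +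
      (((1 + √(1 - nsq z) : ℝ) : ℂ)⁻¹ * herm v z) • z) := by
  have hs : 0 < √(1 - nsq z) := Real.sqrt_pos.2 (one_sub_nsq_pos hz)
  have hs' : ((√(1 - nsq z) : ℝ) : ℂ) ≠ 0 := Complex.ofReal_ne_zero.2 hs.ne'
  rw [rootT, Matrix.toLin'_apply, Matrix.smul_mulVec, Matrix.add_mulVec, Matrix.one_mulVec,
    ← Matrix.mulVec_mulVec]
  have h1 : (Matrix.replicateRow Unit
      (((√(1 - nsq z) * (1 + √(1 - nsq z)) : ℝ) : ℂ)⁻¹ • star z)).mulVec v = fun _ => ((√(1 - nsq z) * (1 + √(1 - nsq z)) : ℝ) : ℂ)⁻¹ * herm v z := by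
    funext i
    simp [Matrix.mulVec, dotProduct, herm, Finset.mul_sum]
    exact Finset.sum_congr rfl fun j _ => by ring
  rw [h1]
  funext i
  simp [Matrix.mulVec, dotProduct]
  field_simp

lemma herm_rootT {z : Fin n → ℂ} (hz : z ∈ ball n) (u v : Fin n → ℂ) :
    herm (rootT z u) (rootT z v) =
      ((1 - herm z z) * herm u v + herm u z * herm z v) / (1 - herm z z) ^ 2 := by
  have h0 := one_sub_nsq_pos hz
  have hs : 0 < √(1 - nsq z) := Real.sqrt_pos.2 h0
  have hs2 : √(1 - nsq z) ^ 2 = 1 - nsq z := Real.sq_sqrt h0.le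
  rw [rootT_apply hz, rootT_apply hz, herm_self]
  set s := √(1 - nsq z) with hsdef
  have hn : (nsq z : ℂ) = 1 - (s : ℂ) ^ 2 := by
    rw [← Complex.ofReal_pow, hs2]; push_cast; ring
  have hs' : (s : ℂ) ≠ 0 := Complex.ofReal_ne_zero.2 hs.ne'
  have hs1 : (1 + s : ℂ) ≠ 0 := by
    rw [← Complex.ofReal_one, ← Complex.ofReal_add, Complex.ofReal_ne_zero]; linarith
  simp only [herm_smul_left, herm_smul_right, herm_add_left, herm_add_right, map_inv₀,
    Complex.conj_ofReal, map_mul, conj_herm, herm_self]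
  push_cast
  rw [hn]
  field_simp
  ring

lemma metricN_eq_nsq {z : Fin n → ℂ} (hz : z ∈ ball n) (v : Fin n → ℂ) :
    metricN z v = nsq (rootT z v) := by
  have h : ((nsq (rootT z v) : ℝ) : ℂ) = (metricN z v : ℂ) := by
    rw [← herm_self, herm_rootT hz, metricN, gramD, herm_self, herm_self, ← conj_herm v z,
      Complex.mul_conj']
    push_cast
    ring
  exact_mod_cast h.symm

lemma kahler_eq {z : Fin n → ℂ} (hz : z ∈ ball n) (x : Fin 2 → Fin n → ℂ) :
    kahler z x = -4 * (herm (rootT z (x 0)) (rootT z (x 1))).im := by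
  rw [herm_rootT hz]; rfl

/-- The Jacobian of `rootT`. -/
noncomputable def jacT (z : Fin n → ℂ) : ℝ := ((1 - nsq z)⁻¹) ^ (n + 1)

lemma jacT_pos {z : Fin n → ℂ} (hz : z ∈ ball n) : 0 < jacT z := by
  have := one_sub_nsq_pos hz
  rw [jacT]; positivity

lemma norm_det_rootT {z : Fin n → ℂ} (hz : z ∈ ball n) : ‖LinearMap.det (rootT z)‖ ^ 2 = jacT z := by
  have h0 := one_sub_nsq_pos hz
  have hs : 0 < √(1 - nsq z) := Real.sqrt_pos.2 h0
  have hs2 : √(1 - nsq z) ^ 2 = 1 - nsq z := Real.sq_sqrt h0.le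
  rw [rootT, LinearMap.det_toLin', Matrix.det_smul, Matrix.det_one_add_replicateCol_mul_replicateRow]
  set s := √(1 - nsq z) with hsdef
  have hn : (nsq z : ℂ) = 1 - (s : ℂ) ^ 2 := by
    rw [← Complex.ofReal_pow, hs2]; push_cast; ring
  have hs' : (s : ℂ) ≠ 0 := Complex.ofReal_ne_zero.2 hs.ne'
  have hs1 : (1 + s : ℂ) ≠ 0 := by
    rw [← Complex.ofReal_one, ← Complex.ofReal_add, Complex.ofReal_ne_zero]; linarith
  have h1 : 1 + (((s * (1 + s) : ℝ) : ℂ)⁻¹ • star z) ⬝ᵥ z = (s : ℂ)⁻¹ := by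
    have : star z ⬝ᵥ z = (nsq z : ℂ) := by
      rw [← herm_self]; simp [herm, dotProduct, mul_comm]
    rw [smul_dotProduct, this, hn, smul_eq_mul]
    push_cast
    field_simp
    ring
  rw [h1, jacT, ← hs2, Fintype.card_fin]
  rw [norm_mul, norm_pow, norm_mul, norm_inv, norm_inv, Complex.norm_real, Complex.norm_real,
    Real.norm_of_nonneg hs.le, Real.norm_of_nonneg (by positivity)]
  have h2 : (s ^ 2)⁻¹ * s = s⁻¹ := by field_simp
  rw [h2]
  ring

end Metric

end CHyp

namespace CHyp

open MeasureTheory Topology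

/-! ### The invariant measure on the projectivized tangent bundle -/

section Volume

variable {n : ℕ}

lemma nsq_eq_zero {v : Fin n → ℂ} (h : nsq v = 0) : v = 0 := by
  by_contra hv
  exact (nsq_pos hv).ne' h

/-- A linear change of variables. -/
lemma lintegral_comp_linear (A : (Fin n → ℂ) →ₗ[ℂ] (Fin n → ℂ)) (hA : LinearMap.det A ≠ 0)
    (H : (Fin n → ℂ) → ENNReal) :
    ∫⁻ v, ENNReal.ofReal (‖LinearMap.det A‖ ^ 2) * H (A v) = ∫⁻ v, H v := by
  set B : (Fin n → ℂ) →L[ℝ] (Fin n → ℂ) := LinearMap.toContinuousLinearMap (A.restrictScalars ℝ)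
  have hdet : B.det = ‖LinearMap.det A‖ ^ 2 := det_real_of_complex A
  have hbij : Function.Bijective A := by
    exact (LinearMap.equivOfDetNeZero A hA).bijective
  have h := lintegral_image_eq_lintegral_abs_det_fderiv_mul volume MeasurableSet.univ
    (f := B) (f' := fun _ => B) (fun x _ => B.hasFDerivAt.hasFDerivWithinAt)
    (hbij.injective.injOn) H
  have h' : B '' Set.univ = Set.univ := by
    rw [Set.image_univ]; exact hbij.surjective.range_eq
  rw [h', hdet, abs_of_nonneg (by positivity), setLIntegral_univ, setLIntegral_univ] at h
  exact h.symm

lemma integral_comp_linear {E : Type*} [NormedAddCommGroup E] [NormedSpace ℝ E]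
    (A : (Fin n → ℂ) →ₗ[ℂ] (Fin n → ℂ)) (hA : LinearMap.det A ≠ 0)
    (H : (Fin n → ℂ) → E) :
    ∫ v, (‖LinearMap.det A‖ ^ 2) • H (A v) = ∫ v, H v := by
  set B : (Fin n → ℂ) →L[ℝ] (Fin n → ℂ) := LinearMap.toContinuousLinearMap (A.restrictScalars ℝ)
  have hdet : B.det = ‖LinearMap.det A‖ ^ 2 := det_real_of_complex A
  have hbij : Function.Bijective A := (LinearMap.equivOfDetNeZero A hA).bijective
  have h := integral_image_eq_integral_abs_det_fderiv_smul volume MeasurableSet.univ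
    (f := B) (f' := fun _ => B) (fun x _ => B.hasFDerivAt.hasFDerivWithinAt)
    (hbij.injective.injOn) H
  have h' : B '' Set.univ = Set.univ := by
    rw [Set.image_univ]; exact hbij.surjective.range_eq
  rw [h', hdet, abs_of_nonneg (by positivity), setIntegral_univ, setIntegral_univ] at h
  exact h.symm

lemma norm_det_eq_of_nsq_eq {A B : (Fin n → ℂ) →ₗ[ℂ] (Fin n → ℂ)} (hB : LinearMap.det B ≠ 0)
    (h : ∀ v, nsq (A v) = nsq (B v)) : ‖LinearMap.det A‖ ^ 2 = ‖LinearMap.det B‖ ^ 2 := by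
  have hA : LinearMap.det A ≠ 0 := by
    have hinj : Function.Injective A := by
      rw [← LinearMap.ker_eq_bot, LinearMap.ker_eq_bot']
      intro v hv
      have h1 : nsq (B v) = 0 := by rw [← h, hv]; simp [nsq]
      have h2 : B v = 0 := nsq_eq_zero h1
      exact (LinearMap.equivOfDetNeZero B hB).injective (h2.trans (map_zero B).symm)
    have hu : IsUnit A := (LinearMap.isUnit_iff_ker_eq_bot A).2 (LinearMap.ker_eq_bot.2 hinj)
    exact (LinearMap.isUnit_iff_isUnit_det A).1 hu |>.ne_zero
  have hvol0 : volume (ball n) ≠ 0 :=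
    ((isOpen_ball n).measure_pos volume ⟨0, by simp [ball]⟩).ne'
  have hvol : volume (ball n) ≠ ⊤ := by
    refine ((Metric.isBounded_closedBall (x := (0 : Fin n → ℂ)) (r := 1)).subset ?_).measure_lt_top.ne
    intro z hz
    rw [mem_closedBall_zero_iff, pi_norm_le_iff_of_nonneg zero_le_one]
    intro i
    have := Finset.single_le_sum (f := fun i => ‖z i‖ ^ 2) (fun i _ => by positivity)
      (Finset.mem_univ i)
    have h2 : ∑ i, ‖z i‖ ^ 2 < 1 := hz
    exact (sq_le_one_iff₀ (norm_nonneg _)).1 (this.trans h2.le)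
  have e : (A.restrictScalars ℝ) ⁻¹' ball n = (B.restrictScalars ℝ) ⁻¹' ball n := by
    ext v
    show nsq (A v) < 1 ↔ nsq (B v) < 1
    rw [h]
  have hA' : LinearMap.det (A.restrictScalars ℝ) ≠ 0 := by
    rw [det_real_of_complex]; exact pow_ne_zero 2 (norm_ne_zero_iff.2 hA)
  have hB' : LinearMap.det (B.restrictScalars ℝ) ≠ 0 := by
    rw [det_real_of_complex]; exact pow_ne_zero 2 (norm_ne_zero_iff.2 hB)
  have h1 := Measure.addHaar_preimage_linearMap volume hA' (ball n)
  rw [e, Measure.addHaar_preimage_linearMap volume hB', ENNReal.mul_left_inj hvol0 hvol,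
    det_real_of_complex, det_real_of_complex, ENNReal.ofReal_eq_ofReal_iff (abs_nonneg _)
    (abs_nonneg _), abs_of_nonneg (by positivity), abs_of_nonneg (by positivity), inv_inj] at h1
  exact h1.symm

lemma det_rootT_ne_zero {z : Fin n → ℂ} (hz : z ∈ ball n) : LinearMap.det (rootT z) ≠ 0 := by
  intro h
  have := norm_det_rootT hz
  rw [h] at this
  have h2 := jacT_pos hz
  simp at this
  linarith

lemma jacT_mob (g : SU n) {z : Fin n → ℂ} (hz : z ∈ ball n) :
    jacT z = jacT (mob g z) *
      ‖LinearMap.det (fderiv ℂ (mob g) z : (Fin n → ℂ) →ₗ[ℂ] (Fin n → ℂ))‖ ^ 2 := by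
  have h := norm_det_eq_of_nsq_eq
    (A := rootT (mob g z) ∘ₗ (fderiv ℂ (mob g) z : (Fin n → ℂ) →ₗ[ℂ] (Fin n → ℂ)))
    (det_rootT_ne_zero hz) fun v => by
      rw [← metricN_eq_nsq hz, ← metricN_mob g hz, metricN_eq_nsq (mob_mem g hz)]
      rfl
  rw [LinearMap.det_comp, norm_mul, mul_pow, norm_det_rootT hz, norm_det_rootT (mob_mem g hz)] at h
  exact h.symm

lemma det_fderiv_mob_ne_zero (g : SU n) {z : Fin n → ℂ} (hz : z ∈ ball n) :
    LinearMap.det (fderiv ℂ (mob g) z : (Fin n → ℂ) →ₗ[ℂ] (Fin n → ℂ)) ≠ 0 := by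
  intro h
  have h1 := jacT_mob g hz
  have h2 := jacT_pos hz
  rw [h] at h1
  simp at h1
  linarith

/-- Nonzero tangent vectors of the ball. -/
def tanSet (n : ℕ) : Set ((Fin n → ℂ) × (Fin n → ℂ)) := {x | x.1 ∈ ball n ∧ x.2 ≠ 0}

lemma isOpen_tanSet (n : ℕ) : IsOpen (tanSet n) :=
  ((isOpen_ball n).preimage continuous_fst).inter
    (isOpen_ne_fun continuous_snd continuous_const)

/-- The tangent line of a nonzero tangent vector. -/
noncomputable def tanMap (x : tanSet n) : PTH n := tanLine (⟨x.1.1, x.2.1⟩, ⟨x.1.2, x.2.2⟩)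

lemma continuous_tanMap : Continuous (tanMap (n := n)) := by
  refine (isOpenQuotientMap_tanLine n).continuous.comp (Continuous.prodMk ?_ ?_)
  · exact continuous_induced_rng.2 (continuous_fst.comp continuous_subtype_val)
  · exact continuous_induced_rng.2 (continuous_snd.comp continuous_subtype_val)

open Classical in
/-- A function on `PT_{H^n}` as a function of tangent vectors, extended by zero. -/
noncomputable def tanExt {E : Type*} [Zero E] (f : PTH n → E) (x : (Fin n → ℂ) × (Fin n → ℂ)) : E :=
  if h : x ∈ tanSet n then f (tanMap ⟨x, h⟩) else 0

lemma tanExt_of_mem {E : Type*} [Zero E] (f : PTH n → E) (x : tanSet n) :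
    tanExt f x.1 = f (tanMap x) := dif_pos x.2

lemma tanExt_of_notMem {E : Type*} [Zero E] (f : PTH n → E) {x : (Fin n → ℂ) × (Fin n → ℂ)}
    (hx : x ∉ tanSet n) : tanExt f x = 0 := dif_neg hx

lemma measurable_tanExt {E : Type*} [Zero E] [MeasurableSpace E] {f : PTH n → E} (hf : Measurable f) :
    Measurable (tanExt f) := by
  refine measurable_of_restrict_of_restrict_compl (isOpen_tanSet n).measurableSet ?_ ?_
  · have : (tanSet n).domRestrict (tanExt f) = f ∘ tanMap := funext fun x => tanExt_of_mem f x
    rw [this]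
    exact hf.comp continuous_tanMap.measurable
  · have : (tanSet n)ᶜ.domRestrict (tanExt f) = fun _ => 0 :=
      funext fun x => tanExt_of_notMem f x.2
    rw [this]
    exact measurable_const

/-- The density of the invariant measure on tangent vectors. -/
noncomputable def tanDens (x : (Fin n → ℂ) × (Fin n → ℂ)) : ℝ :=
  Real.exp (-metricN x.1 x.2) * jacT x.1 ^ 2

lemma measurable_metricN : Measurable fun x : (Fin n → ℂ) × (Fin n → ℂ) => metricN x.1 x.2 :=
  continuous_gramD.measurable.div
    ((continuous_const.sub (continuous_nsq.comp continuous_fst)).measurable.pow_const 2)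

lemma measurable_jacT : Measurable (jacT (n := n)) :=
  (continuous_const.sub continuous_nsq).measurable.inv.pow_const _

lemma measurable_tanDens : Measurable (tanDens (n := n)) :=
  (Real.measurable_exp.comp measurable_metricN.neg).mul
    ((measurable_jacT.comp measurable_fst).pow_const 2)

/-- The invariant measure on `PT_{H^n}`. -/
noncomputable def volPT (n : ℕ) : Measure (PTH n) :=
  Measure.map tanMap (Measure.comap Subtype.val
    ((volume : Measure ((Fin n → ℂ) × (Fin n → ℂ))).withDensity fun x => ENNReal.ofReal (tanDens x)))

lemma lintegral_volPT {f : PTH n → ENNReal} (hf : Measurable f) :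
    ∫⁻ p, f p ∂(volPT n) = ∫⁻ z, ∫⁻ v, ENNReal.ofReal (tanDens (z, v)) * tanExt f (z, v) := by
  have hm : Measurable fun x => ENNReal.ofReal (tanDens (n := n) x) :=
    measurable_tanDens.ennreal_ofReal
  rw [volPT, lintegral_map hf continuous_tanMap.measurable]
  simp only [← tanExt_of_mem f]
  rw [lintegral_subtype_comap (isOpen_tanSet n).measurableSet, setLIntegral_withDensity_eq_setLIntegral_mul
    _ hm (measurable_tanExt hf) (isOpen_tanSet n).measurableSet, ← lintegral_indicator
    (isOpen_tanSet n).measurableSet]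
  have : (tanSet n).indicator ((fun x => ENNReal.ofReal (tanDens x)) * tanExt f) =
      fun x => ENNReal.ofReal (tanDens x) * tanExt f x := by
    funext x
    by_cases hx : x ∈ tanSet n
    · rw [Set.indicator_of_mem hx]; rfl
    · rw [Set.indicator_of_notMem hx, tanExt_of_notMem f hx, mul_zero]
  rw [this]
  exact lintegral_prod _ (hm.mul (measurable_tanExt hf)).aemeasurable

lemma tanExt_comp_smul {E : Type*} [Zero E] (f : PTH n → E) (g : SU n) {z : Fin n → ℂ}
    (hz : z ∈ ball n) (v : Fin n → ℂ) :
    tanExt (fun p => f (g • p)) (z, v) = tanExt f (mob g z, fderiv ℂ (mob g) z v) := by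
  by_cases hv : v = 0
  · have h1 : (z, v) ∉ tanSet n := fun h => h.2 hv
    have h2 : (mob g z, fderiv ℂ (mob g) z v) ∉ tanSet n := fun h => h.2 (by simp [hv])
    exact (tanExt_of_notMem (fun p => f (g • p)) h1).trans (tanExt_of_notMem f h2).symm
  · have h1 : (z, v) ∈ tanSet n := ⟨hz, hv⟩
    have h2 : (mob g z, fderiv ℂ (mob g) z v) ∈ tanSet n :=
      ⟨mob_mem g hz, fderiv_mob_ne_zero g hz hv⟩
    exact (tanExt_of_mem (fun p => f (g • p)) ⟨_, h1⟩).trans (tanExt_of_mem f ⟨_, h2⟩).symm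

lemma mob_image_ball (g : SU n) : mob g '' ball n = ball n := by
  refine Set.Subset.antisymm (Set.image_subset_iff.2 fun z hz => mob_mem g hz) fun z hz => ?_
  refine ⟨mob g⁻¹ z, mob_mem _ hz, ?_⟩
  rw [← mob_mul g g⁻¹ hz, mul_inv_cancel, mob_one]

lemma mob_injOn (g : SU n) : Set.InjOn (mob g) (ball n) := by
  intro z hz w hw h
  have := congrArg (mob g⁻¹) h
  rwa [← mob_mul g⁻¹ g hz, ← mob_mul g⁻¹ g hw, inv_mul_cancel, mob_one, mob_one] at this

lemma lintegral_mob (g : SU n) (H : (Fin n → ℂ) → ENNReal) :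
    ∫⁻ z in ball n, ENNReal.ofReal
      (‖LinearMap.det (fderiv ℂ (mob g) z : (Fin n → ℂ) →ₗ[ℂ] (Fin n → ℂ))‖ ^ 2) * H (mob g z) =
    ∫⁻ z in ball n, H z := by
  have h := lintegral_image_eq_lintegral_abs_det_fderiv_mul volume (isOpen_ball n).measurableSet
    (f := mob g) (f' := fun z => (fderiv ℂ (mob g) z).restrictScalars ℝ)
    (fun z hz => ((differentiableAt_mob g hz).hasFDerivAt.restrictScalars ℝ).hasFDerivWithinAt)
    (mob_injOn g) H
  rw [mob_image_ball] at h
  rw [h]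
  refine lintegral_congr fun z => ?_
  have e : ((fderiv ℂ (mob g) z).restrictScalars ℝ).det =
    ‖LinearMap.det (fderiv ℂ (mob g) z : (Fin n → ℂ) →ₗ[ℂ] (Fin n → ℂ))‖ ^ 2 :=
    det_real_of_complex _
  rw [e, abs_of_nonneg (by positivity)]

lemma lintegral_volPT_smul (g : SU n) {f : PTH n → ENNReal} (hf : Measurable f) :
    ∫⁻ p, f (g • p) ∂(volPT n) = ∫⁻ p, f p ∂(volPT n) := by
  have hg : Measurable fun p : PTH n => g • p := (continuous_const_smul g).measurable
  have hball : ∀ f : PTH n → ENNReal,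
      ∫⁻ z, ∫⁻ v, ENNReal.ofReal (tanDens (z, v)) * tanExt f (z, v) =
      ∫⁻ z in ball n, ∫⁻ v, ENNReal.ofReal (tanDens (z, v)) * tanExt f (z, v) := by
    intro f
    rw [← lintegral_indicator (isOpen_ball n).measurableSet]
    refine lintegral_congr fun z => ?_
    by_cases hz : z ∈ ball n
    · rw [Set.indicator_of_mem hz]
    · rw [Set.indicator_of_notMem hz]
      have h : ∀ v, (z, v) ∉ tanSet n := fun v h => hz h.1
      simp only [tanExt_of_notMem f (h _), mul_zero, lintegral_zero]
  have hfg : Measurable fun p : PTH n => f (g • p) := hf.comp hg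
  rw [lintegral_volPT hfg, lintegral_volPT hf, hball, hball, ← lintegral_mob g (fun z => ∫⁻ v, ENNReal.ofReal
    (tanDens (z, v)) * tanExt f (z, v))]
  refine setLIntegral_congr_fun (isOpen_ball n).measurableSet fun z hz => ?_
  set J := ‖LinearMap.det (fderiv ℂ (mob g) z : (Fin n → ℂ) →ₗ[ℂ] (Fin n → ℂ))‖ ^ 2 with hJ
  have hJ0 : 0 ≤ J := by positivity
  show ∫⁻ v, ENNReal.ofReal (tanDens (z, v)) * tanExt (fun p => f (g • p)) (z, v) =
    ENNReal.ofReal J * ∫⁻ v, ENNReal.ofReal (tanDens (mob g z, v)) * tanExt f (mob g z, v)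
  rw [← lintegral_comp_linear (fderiv ℂ (mob g) z : (Fin n → ℂ) →ₗ[ℂ] (Fin n → ℂ))
    (det_fderiv_mob_ne_zero g hz) (fun v => ENNReal.ofReal (tanDens (mob g z, v)) *
    tanExt f (mob g z, v)), ← lintegral_const_mul' _ _ ENNReal.ofReal_ne_top]
  refine lintegral_congr fun v => ?_
  rw [tanExt_comp_smul f g hz, ← mul_assoc, ← mul_assoc, ← hJ, ← ENNReal.ofReal_mul hJ0,
    ← ENNReal.ofReal_mul (by positivity)]
  congr 2
  have h1 : metricN (mob g z) (fderiv ℂ (mob g) z v) = metricN z v := metricN_mob g hz v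
  simp only [tanDens]
  rw [jacT_mob g hz]
  show _ = J * J * (Real.exp (-metricN (mob g z) (fderiv ℂ (mob g) z v)) * _)
  rw [h1]
  ring

instance (Γ : Subgroup (SU n)) : SMulInvariantMeasure Γ (PTH n) (volPT n) where
  measure_preimage_smul γ s hs := by
    have h := lintegral_volPT_smul γ.1 (f := s.indicator 1) (measurable_one.indicator hs)
    rw [lintegral_indicator_one hs] at h
    rw [← h]
    have h2 : MeasurableSet ((fun p : PTH n => γ • p) ⁻¹' s) :=
      (continuous_const_smul γ).measurable hs
    rw [← lintegral_indicator_one h2]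
    rfl

end Volume

end CHyp

namespace CHyp

open MeasureTheory Topology

/-! ### Gaussian integrals and integration along the fibers -/

lemma integrable_gauss_moment (k : ℕ) :
    Integrable (fun s : ℂ => ‖s‖ ^ (2 * k) * Real.exp (-‖s‖ ^ 2)) ∧
      0 < ∫ s : ℂ, ‖s‖ ^ (2 * k) * Real.exp (-‖s‖ ^ 2) := by
  have h := Complex.integral_rpow_mul_exp_neg_rpow (p := 2) (q := (2 * k : ℕ)) one_le_two
    (by have : (0 : ℝ) ≤ (2 * k : ℕ) := by positivity
        linarith)
  have e : ∀ s : ℂ, ‖s‖ ^ ((2 * k : ℕ) : ℝ) * Real.exp (-‖s‖ ^ (2 : ℝ)) =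
      ‖s‖ ^ (2 * k) * Real.exp (-‖s‖ ^ 2) := by
    intro s
    rw [Real.rpow_natCast, Real.rpow_two]
  simp only [e] at h
  have hpos : 0 < ∫ s : ℂ, ‖s‖ ^ (2 * k) * Real.exp (-‖s‖ ^ 2) := by
    rw [h]
    have := Real.Gamma_pos_of_pos (s := (((2 * k : ℕ) : ℝ) + 2) / 2) (by positivity)
    positivity
  refine ⟨?_, hpos⟩
  by_contra hni
  rw [integral_undef hni] at hpos
  exact lt_irrefl _ hpos

lemma exp_neg_nsq {n : ℕ} (x : Fin n → ℂ) : Real.exp (-nsq x) = ∏ i, Real.exp (-‖x i‖ ^ 2) := by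
  rw [← Real.exp_sum, nsq, Finset.sum_neg_distrib]

lemma integrable_gauss (n : ℕ) : Integrable fun x : Fin n → ℂ => Real.exp (-nsq x) := by
  simp only [exp_neg_nsq]
  refine Integrable.fintype_prod (f := fun (_ : Fin n) (s : ℂ) => Real.exp (-‖s‖ ^ 2)) fun i => ?_
  simpa using (integrable_gauss_moment 0).1

lemma integral_gauss_pos (n : ℕ) : 0 < ∫ x : Fin n → ℂ, Real.exp (-nsq x) := by
  simp only [exp_neg_nsq]
  rw [integral_fintype_prod_volume_eq_prod (fun (_ : Fin n) (s : ℂ) => Real.exp (-‖s‖ ^ 2))]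
  refine Finset.prod_pos fun i _ => ?_
  simpa using (integrable_gauss_moment 0).2

section Gauss

variable {n : ℕ}

/-- The weight of the Gaussian averages of quadratic functions. -/
noncomputable def gaussW (x : Fin n → ℂ) : ℝ := Real.exp (-nsq x) / nsq x

lemma norm_sq_le_nsq (x : Fin n → ℂ) (j : Fin n) : ‖x j‖ ^ 2 ≤ nsq x :=
  Finset.single_le_sum (f := fun i => ‖x i‖ ^ 2) (fun i _ => by positivity) (Finset.mem_univ j)

lemma measurable_gaussW : Measurable (gaussW (n := n)) :=
  (Real.measurable_exp.comp continuous_nsq.neg.measurable).div continuous_nsq.measurable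

lemma integrable_gaussW_mul {f : (Fin n → ℂ) → ℝ} (hf : Measurable f) {C : ℝ} (hC : 0 ≤ C)
    (h : ∀ x, |f x| ≤ C * nsq x) : Integrable fun x => gaussW x * f x := by
  refine ((integrable_gauss n).const_mul C).mono' (measurable_gaussW.mul hf).aestronglyMeasurable
    (Filter.Eventually.of_forall fun x => ?_)
  rw [norm_mul, gaussW, norm_div, Real.norm_eq_abs, Real.norm_eq_abs, Real.norm_eq_abs, Real.abs_exp,
    abs_of_nonneg (nsq_nonneg x)]
  rcases (nsq_nonneg x).eq_or_lt with h0 | h0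
  · rw [← h0]
    simpa using hC
  · rw [div_mul_eq_mul_div, div_le_iff₀ h0]
    nlinarith [h x, Real.exp_pos (-nsq x), mul_le_mul_of_nonneg_left (h x) (Real.exp_pos (-nsq x)).le]

/-- The Gaussian average of the square of a coordinate. -/
noncomputable def gaussK (n : ℕ) (j : Fin n) : ℝ := ∫ x : Fin n → ℂ, gaussW x * ‖x j‖ ^ 2

lemma integrable_coord (j : Fin n) : Integrable fun x : Fin n → ℂ => gaussW x * ‖x j‖ ^ 2 :=
  integrable_gaussW_mul (C := 1) ((measurable_pi_apply j).norm.pow_const 2) zero_le_one fun x => by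
    rw [abs_of_nonneg (by positivity), one_mul]; exact norm_sq_le_nsq x j

/-- Multiplication of a coordinate by `-1`. -/
noncomputable def flip (j : Fin n) : (Fin n → ℂ) →ₗ[ℂ] (Fin n → ℂ) :=
  Matrix.toLin' (Matrix.diagonal fun i => if i = j then -1 else 1)

lemma flip_apply (j : Fin n) (x : Fin n → ℂ) (i : Fin n) :
    flip j x i = if i = j then -x i else x i := by
  rw [flip, Matrix.toLin'_apply, Matrix.mulVec_diagonal]
  split_ifs <;> simp

lemma norm_det_flip (j : Fin n) : ‖LinearMap.det (flip j)‖ = 1 := by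
  rw [flip, LinearMap.det_toLin', Matrix.det_diagonal, norm_prod]
  refine Finset.prod_eq_one fun i _ => ?_
  split_ifs <;> simp

lemma nsq_flip (j : Fin n) (x : Fin n → ℂ) : nsq (flip j x) = nsq x := by
  refine Finset.sum_congr rfl fun i _ => ?_
  rw [flip_apply]
  split_ifs <;> simp

lemma integral_flip (j : Fin n) (f : (Fin n → ℂ) → ℝ) :
    ∫ x, gaussW x * f (flip j x) = ∫ x, gaussW x * f x := by
  have h := integral_comp_linear (flip j)
    (norm_ne_zero_iff.1 (by rw [norm_det_flip]; exact one_ne_zero)) fun x => gaussW x * f x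
  rw [← h]
  refine integral_congr_ae (Filter.Eventually.of_forall fun x => ?_)
  simp only [norm_det_flip, gaussW, nsq_flip]
  simp

lemma gaussK_eq (i j : Fin n) : gaussK n i = gaussK n j := by
  have hmp : MeasurePreserving (MeasurableEquiv.piCongrLeft (fun _ : Fin n => ℂ) (Equiv.swap i j)) :=
    volume_measurePreserving_piCongrLeft (fun _ : Fin n => ℂ) (Equiv.swap i j)
  have happ : ∀ (x : Fin n → ℂ) (l : Fin n),
      MeasurableEquiv.piCongrLeft (fun _ : Fin n => ℂ) (Equiv.swap i j) x l = x (Equiv.swap i j l) := by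
    intro x l
    have h := Equiv.piCongrLeft_apply_apply (fun _ : Fin n => ℂ) (Equiv.swap i j) x (Equiv.swap i j l)
    rw [Equiv.swap_apply_self] at h
    exact h
  rw [gaussK, ← hmp.integral_comp (MeasurableEquiv.measurableEmbedding _)]
  refine integral_congr_ae (Filter.Eventually.of_forall fun x => ?_)
  have h1 : nsq (MeasurableEquiv.piCongrLeft (fun _ : Fin n => ℂ) (Equiv.swap i j) x) = nsq x := by
    simp only [nsq, happ]
    exact Equiv.sum_comp (Equiv.swap i j) fun l => ‖x l‖ ^ 2
  simp only [gaussW, h1, happ, Equiv.swap_apply_left]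

lemma sum_gaussK : ∑ j, gaussK n j = ∫ x : Fin n → ℂ, gaussW x * nsq x := by
  simp only [gaussK]
  rw [← integral_finsetSum _ fun j _ => integrable_coord j]
  simp only [nsq, Finset.mul_sum]

lemma gaussK_pos (j : Fin n) : 0 < gaussK n j := by
  have h : ∫ x : Fin n → ℂ, gaussW x * nsq x = ∫ x : Fin n → ℂ, Real.exp (-nsq x) := by
    refine integral_congr_ae ?_
    have : Nonempty (Fin n) := ⟨j⟩
    have h0 : ∀ᵐ x : Fin n → ℂ, x ≠ 0 := by
      rw [ae_iff]
      simp only [ne_eq, not_not]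
      exact measure_singleton _
    filter_upwards [h0] with x hx
    rw [gaussW, div_mul_cancel₀ _ (nsq_pos hx).ne']
  have h1 := integral_gauss_pos n
  rw [← h, ← sum_gaussK, Finset.sum_congr rfl fun i _ => gaussK_eq i j, Finset.sum_const,
    nsmul_eq_mul] at h1
  exact (pos_iff_pos_of_mul_pos h1).1 (by
    rw [Finset.card_univ, Fintype.card_fin]; exact_mod_cast j.pos)

/-- The Gaussian average of the quadratic function `β(x, ix)`. -/
lemma integral_gaussW_form (β : (Fin n → ℂ) [⋀^Fin 2]→L[ℝ] ℝ) (j₀ : Fin n) :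
    ∫ x, gaussW x * β ![x, Complex.I • x] =
      gaussK n j₀ * ∑ j, β ![Pi.single j 1, Pi.single j Complex.I] := by
  set α : (Fin n → ℂ) [⋀^Fin 2]→ₗ[ℝ] ℝ := β.toAlternatingMap with hα
  let t : Fin n → Fin n → (Fin n → ℂ) → ℝ := fun j k x =>
    β ![x j • Pi.single j (1 : ℂ), (Complex.I * x k) • Pi.single k (1 : ℂ)]
  have hexp : ∀ x : Fin n → ℂ, β ![x, Complex.I • x] = ∑ j, ∑ k, t j k x := by
    intro x
    have h1 : x = ∑ j, x j • Pi.single j (1 : ℂ) := by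
      funext i; simp [Finset.sum_apply, Pi.single_apply]
    have h2 : Complex.I • x = ∑ k, (Complex.I * x k) • Pi.single k (1 : ℂ) := by
      funext i; simp [Finset.sum_apply, Pi.single_apply]
    have h3 : β ![x, Complex.I • x] = α ![∑ j, x j • Pi.single j (1 : ℂ),
        ∑ k, (Complex.I * x k) • Pi.single k (1 : ℂ)] := by
      rw [← h1, ← h2]; rfl
    rw [h3, alt_sum_left]
    refine Finset.sum_congr rfl fun j _ => ?_
    rw [alt_sum_right]
    rfl
  have htm : ∀ j k, Measurable (t j k) := by
    intro j k
    refine (β.cont.comp (continuous_pi fun i => ?_)).measurable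
    fin_cases i
    · exact (continuous_apply j).smul continuous_const
    · exact (continuous_const.mul (continuous_apply k)).smul continuous_const
  have htb : ∀ j k x, |t j k x| ≤ ‖β‖ * nsq x := by
    intro j k x
    refine (β.le_opNorm _).trans ?_
    refine mul_le_mul_of_nonneg_left ?_ (norm_nonneg _)
    rw [Fin.prod_univ_two]
    simp only [Matrix.cons_val_zero, Matrix.cons_val_one, norm_smul, norm_mul, Complex.norm_I, one_mul]
    have hs : ∀ j : Fin n, ‖(Pi.single j (1 : ℂ) : Fin n → ℂ)‖ = 1 := by
      intro j; simp [Pi.norm_single]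
    rw [hs, hs, mul_one, mul_one]
    nlinarith [norm_sq_le_nsq x j, norm_sq_le_nsq x k, sq_nonneg (‖x j‖ - ‖x k‖)]
  have hti : ∀ j k, Integrable fun x => gaussW x * t j k x := fun j k =>
    integrable_gaussW_mul (htm j k) (norm_nonneg β) (htb j k)
  have hoff : ∀ j k, j ≠ k → ∫ x, gaussW x * t j k x = 0 := by
    intro j k hjk
    have h1 := integral_flip j (t j k)
    have h2 : ∀ x, t j k (flip j x) = -t j k x := by
      intro x
      simp only [t, flip_apply, if_true, if_neg hjk.symm]
      have : -x j • Pi.single j (1 : ℂ) = (-1 : ℝ) • (x j • Pi.single j (1 : ℂ)) := by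
        simp
      have h4 : α ![-x j • Pi.single j (1 : ℂ), (Complex.I * x k) • Pi.single k (1 : ℂ)] =
          -α ![x j • Pi.single j (1 : ℂ), (Complex.I * x k) • Pi.single k (1 : ℂ)] := by
        rw [this, alt_smul_left]; simp
      exact h4
    simp only [h2, mul_neg, integral_neg] at h1
    linarith
  have hdiag : ∀ j, ∫ x, gaussW x * t j j x =
      gaussK n j₀ * β ![Pi.single j 1, Pi.single j Complex.I] := by
    intro j
    rw [← gaussK_eq j j₀, gaussK, ← integral_mul_const]
    refine integral_congr_ae (Filter.Eventually.of_forall fun x => ?_)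
    have h1 : t j j x = ‖x j‖ ^ 2 * β ![Pi.single j 1, Pi.single j Complex.I] := by
      have h2 := alt_complex_line α (Pi.single j (1 : ℂ)) (x j) (Complex.I * x j)
      have h3 : Complex.I • (Pi.single j (1 : ℂ) : Fin n → ℂ) = Pi.single j Complex.I := by
        rw [← Pi.single_smul]; simp
      rw [h3] at h2
      refine h2.trans ?_
      rw [← Complex.normSq_eq_norm_sq, Complex.normSq_apply]
      simp
      left; rfl
    simp only [h1]
    ring
  simp only [hexp, Finset.mul_sum]
  rw [integral_finsetSum _ fun j _ => integrable_finsetSum _ fun k _ => hti j k]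
  refine Finset.sum_congr rfl fun j _ => ?_
  rw [integral_finsetSum _ fun k _ => hti j k, Finset.sum_eq_single j (fun k _ hk => hoff j k hk.symm)
    (fun h => absurd (Finset.mem_univ j) h), hdiag]

/-- Integration along the fibers of `PT_{H^n}`. -/
lemma integral_tanDens_form {m : ℕ} {z : Fin (m + 1) → ℂ} (hz : z ∈ ball (m + 1))
    (β : (Fin (m + 1) → ℂ) [⋀^Fin 2]→L[ℝ] ℝ) :
    ∫ v, tanDens (z, v) * (β ![v, Complex.I • v] / metricN z v) =
      gaussK (m + 1) 0 / (m.factorial * 4 ^ m) * wedge (fun i : Fin (m + 1) =>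
        if (i : ℕ) = 0 then β.toAlternatingMap else kahler z) (realBasis (m + 1)) := by
  set T := rootT z with hT
  have hdet := det_rootT_ne_zero hz
  set e := LinearMap.equivOfDetNeZero T hdet with he
  have heT : ∀ v, e v = T v := fun v => rfl
  set S : (Fin (m + 1) → ℂ) →L[ℝ] (Fin (m + 1) → ℂ) :=
    LinearMap.toContinuousLinearMap ((e.symm : _ →ₗ[ℂ] _).restrictScalars ℝ) with hS
  have hST : ∀ v, S (T v) = v := fun v => e.symm_apply_apply v
  have hSI : ∀ v, S (Complex.I • v) = Complex.I • S v := fun v => map_smul e.symm Complex.I v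
  set β' := β.compContinuousLinearMap S with hβ'
  have hβ'a : ∀ x y, β' ![x, y] = β ![S x, S y] := by
    intro x y
    rw [hβ', ContinuousAlternatingMap.compContinuousLinearMap_apply]
    congr 1
    funext i; fin_cases i <;> rfl
  have hββ : ∀ x y, β ![x, y] = β' ![T x, T y] := by
    intro x y
    rw [hβ'a, hST, hST]
  have h1 := integral_comp_linear T hdet fun x => gaussW x * β' ![x, Complex.I • x]
  rw [integral_gaussW_form β' 0, hT, norm_det_rootT hz, ← hT] at h1
  have hLHS : ∫ v, tanDens (z, v) * (β ![v, Complex.I • v] / metricN z v) =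
      jacT z * (gaussK (m + 1) 0 * ∑ j, β' ![Pi.single j 1, Pi.single j Complex.I]) := by
    rw [← h1, ← integral_const_mul]
    refine integral_congr_ae (Filter.Eventually.of_forall fun v => ?_)
    simp only [tanDens, gaussW, metricN_eq_nsq hz, ← hT, hββ v, map_smul, smul_eq_mul]
    ring
  have hform : (fun i : Fin (m + 1) => if (i : ℕ) = 0 then β.toAlternatingMap else kahler z) =
      fun i => (if i = 0 then β'.toAlternatingMap else kahler 0).compLinearMap
        (T.restrictScalars ℝ) := by
    funext i
    have hi : (i : ℕ) = 0 ↔ i = 0 := Fin.val_eq_zero_iff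
    by_cases h : i = 0
    · rw [if_pos (hi.2 h), if_pos h]
      ext x
      have hx : x = ![x 0, x 1] := by funext i; fin_cases i <;> rfl
      have := hββ (x 0) (x 1)
      rw [← hx] at this
      refine this.trans ?_
      show β' _ = β' _
      congr 1
      funext i; fin_cases i <;> rfl
    · rw [if_neg fun h' => h (hi.1 h'), if_neg h]
      ext x
      rw [kahler_eq hz, AlternatingMap.compLinearMap_apply, kahler_eq (by simp [ball])]
      have h0 : ∀ v : Fin (m + 1) → ℂ, rootT 0 v = v := by
        intro v
        rw [rootT_apply (by simp [ball])]
        simp [nsq, herm]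
      rw [h0, h0]
      rfl
  rw [hLHS, hform, wedge_comp, wedge_det, det_real_of_complex, hT, norm_det_rootT hz,
    wedge_std 0 β'.toAlternatingMap (kahler 0) 4]
  · have : (m.factorial : ℝ) ≠ 0 := by positivity
    field_simp
    rfl
  · intro x y
    rw [kahler_eq (by simp [ball])]
    have h0 : ∀ v : Fin (m + 1) → ℂ, rootT 0 v = v := by
      intro v
      rw [rootT_apply (by simp [ball])]
      simp [nsq, herm]
    simp [h0]

lemma continuousOn_jacT : ContinuousOn (jacT (n := n)) (ball n) :=
  ((continuous_const.sub continuous_nsq).continuousOn.inv₀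
    fun _ hz => (one_sub_nsq_pos hz).ne').pow _

lemma volPT_preimage_lt_top {K : Set (Hn n)} (hK : IsCompact K) :
    volPT n (PTH.pt ⁻¹' K) < ⊤ := by
  have hKm : MeasurableSet (PTH.pt (n := n) ⁻¹' K) :=
    (hK.isClosed.preimage (continuous_pt n)).measurableSet
  have hK' : IsCompact (Subtype.val '' K) := hK.image continuous_subtype_val
  have hKb : Subtype.val '' K ⊆ ball n := by rintro _ ⟨z, -, rfl⟩; exact z.2
  rw [← lintegral_indicator_one hKm, lintegral_volPT (measurable_one.indicator hKm)]
  obtain ⟨C, hC⟩ := hK'.bddAbove_image (continuousOn_jacT.mono hKb)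
  have hG : ∫⁻ x : Fin n → ℂ, ENNReal.ofReal (Real.exp (-nsq x)) < ⊤ := by
    rw [← ofReal_integral_eq_lintegral_ofReal (integrable_gauss n)
      (Filter.Eventually.of_forall fun x => (Real.exp_pos _).le)]
    exact ENNReal.ofReal_lt_top
  have hle : ∀ z, ∫⁻ v, ENNReal.ofReal (tanDens (z, v)) *
      tanExt ((PTH.pt ⁻¹' K).indicator (1 : PTH n → ENNReal)) (z, v) ≤
      (Subtype.val '' K).indicator (fun _ => ENNReal.ofReal C *
        ∫⁻ x : Fin n → ℂ, ENNReal.ofReal (Real.exp (-nsq x))) z := by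
    intro z
    by_cases hz : z ∈ Subtype.val '' K
    · have hzb := hKb hz
      rw [Set.indicator_of_mem hz]
      calc _ ≤ ∫⁻ v, ENNReal.ofReal (tanDens (z, v)) := by
            refine lintegral_mono fun v => mul_le_of_le_one_right zero_le ?_
            rw [tanExt]
            split_ifs with h
            · exact Set.indicator_le_self' (fun _ _ => zero_le) _
            · exact zero_le
        _ = ENNReal.ofReal (jacT z) * ∫⁻ x : Fin n → ℂ, ENNReal.ofReal (Real.exp (-nsq x)) := by
            rw [← lintegral_comp_linear (rootT z) (det_rootT_ne_zero hzb) (fun x =>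
              ENNReal.ofReal (Real.exp (-nsq x))), ← lintegral_const_mul' _ _ ENNReal.ofReal_ne_top]
            refine lintegral_congr fun v => ?_
            rw [norm_det_rootT hzb, ← ENNReal.ofReal_mul (jacT_pos hzb).le,
              ← ENNReal.ofReal_mul (jacT_pos hzb).le, tanDens, metricN_eq_nsq hzb]
            congr 1
            ring
        _ ≤ _ := by
            gcongr
            exact hC ⟨z, hz, rfl⟩
    · rw [Set.indicator_of_notMem hz]
      refine le_of_eq ?_
      rw [lintegral_eq_zero_of_ae_eq_zero]
      refine Filter.Eventually.of_forall fun v => ?_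
      have : tanExt ((PTH.pt ⁻¹' K).indicator (1 : PTH n → ENNReal)) (z, v) = 0 := by
        rw [tanExt]
        split_ifs with h
        · exact Set.indicator_of_notMem (s := PTH.pt ⁻¹' K) (a := tanMap ⟨(z, v), h⟩)
            (fun h' => hz ⟨(tanMap ⟨(z, v), h⟩).pt, h', rfl⟩) _
        · rfl
      simp [this]
  refine (lintegral_mono hle).trans_lt ?_
  rw [lintegral_indicator hK'.measurableSet, setLIntegral_const]
  exact ENNReal.mul_lt_top (ENNReal.mul_lt_top ENNReal.ofReal_lt_top hG) hK'.measure_lt_top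

end Gauss

end CHyp

namespace CHyp

open MeasureTheory Topology

/-! ### Disintegration along the leaves -/

/-- Integration of a function on the image of a parametrization. -/
lemma integral_parametrized {A Y : Type*} [MeasurableSpace A] [MeasurableSpace Y] {μ : Measure A}
    {S : Set A} (hS : MeasurableSet S) {φ : S → Y} (hφ : Measurable φ) {d : A → ℝ}
    (hd : Measurable d) (hd0 : ∀ x ∈ S, 0 ≤ d x) {F : Y → ℝ} (hF : Measurable F) {F' : A → ℝ}
    (hF' : ∀ x : S, F' x.1 = F (φ x)) (hF0 : ∀ x ∉ S, F' x = 0)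
    (hi : Integrable F (Measure.map φ (Measure.comap Subtype.val
      (μ.withDensity fun x => ENNReal.ofReal (d x))))) :
    Integrable (fun x => d x * F' x) μ ∧
      ∫ y, F y ∂(Measure.map φ (Measure.comap Subtype.val
        (μ.withDensity fun x => ENNReal.ofReal (d x)))) = ∫ x, d x * F' x ∂μ := by
  set ν := μ.withDensity fun x => ENNReal.ofReal (d x) with hν
  have hemb := MeasurableEmbedding.subtype_coe hS
  have hm : Measurable fun x => ENNReal.ofReal (d x) := hd.ennreal_ofReal
  rw [integrable_map_measure hF.aestronglyMeasurable hφ.aemeasurable] at hi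
  rw [integral_map hφ.aemeasurable hF.aestronglyMeasurable]
  have e : F ∘ φ = F' ∘ Subtype.val := funext fun x => (hF' x).symm
  have e' : ∀ x, F (φ x) = F' x.1 := fun x => (hF' x).symm
  have hrestr : Measure.map Subtype.val (Measure.comap (Subtype.val : S → A) ν) =
      (μ.restrict S).withDensity fun x => ENNReal.ofReal (d x) := by
    rw [map_comap_subtype_coe hS, hν, restrict_withDensity hS]
  rw [e, ← hemb.integrable_map_iff, hrestr, integrable_withDensity_iff_integrable_smul' hm
    (Filter.Eventually.of_forall fun x => ENNReal.ofReal_lt_top)] at hi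
  have hcongr : ∀ x ∈ S, (ENNReal.ofReal (d x)).toReal • F' x = d x * F' x := by
    intro x hx
    rw [ENNReal.toReal_ofReal (hd0 x hx), smul_eq_mul]
  have hsupp : ∀ x ∉ S, d x * F' x = 0 := fun x hx => by rw [hF0 x hx, mul_zero]
  have hi' : IntegrableOn (fun x => d x * F' x) S μ :=
    (integrableOn_congr_fun hcongr hS).1 hi
  refine ⟨(integrableOn_iff_integrable_of_support_subset fun x hx => ?_).1 hi', ?_⟩
  · by_contra h
    exact hx (hsupp x h)
  · simp only [e']
    rw [← hemb.integral_map, hrestr, integral_withDensity_eq_integral_toReal_smul hm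
      (Filter.Eventually.of_forall fun x => ENNReal.ofReal_lt_top),
      setIntegral_congr_fun hS hcongr, setIntegral_eq_integral_of_forall_compl_eq_zero hsupp]

lemma integral_volPT {n : ℕ} {F : PTH n → ℝ} (hF : Measurable F) (hi : Integrable F (volPT n)) :
    Integrable (fun x => tanDens x * tanExt F x) ∧
      ∫ p, F p ∂(volPT n) = ∫ x, tanDens x * tanExt F x :=
  integral_parametrized (isOpen_tanSet n).measurableSet continuous_tanMap.measurable
    measurable_tanDens (fun x _ => by rw [tanDens]; positivity) hF (fun x => tanExt_of_mem F x)
    (fun x hx => tanExt_of_notMem F hx) hi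

section Ins

variable {m : ℕ} (k : Fin (m + 1))

lemma lintegral_ins {H : (Fin (m + 1) → ℂ) → ENNReal} (hH : Measurable H) :
    ∫⁻ v, H v = ∫⁻ s : ℂ, ∫⁻ x : Fin m → ℂ, H (ins k s x) := by
  have h := (volume_preserving_piFinSuccAbove (fun _ : Fin (m + 1) => ℂ) k).symm
  rw [← h.lintegral_comp hH, Measure.volume_eq_prod, lintegral_prod]
  · rfl
  · exact (hH.comp (MeasurableEquiv.measurable _)).aemeasurable

lemma smul_ins_one (s : ℂ) (y : Fin m → ℂ) : s • ins k 1 y = ins k s (s • y) := by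
  refine eq_ins (by simp) fun j => by simp

lemma lintegral_ins_smul {H : (Fin (m + 1) → ℂ) → ENNReal} (hH : Measurable H) :
    ∫⁻ v, H v = ∫⁻ y : Fin m → ℂ, ∫⁻ s : ℂ,
      ENNReal.ofReal (‖s‖ ^ (2 * m)) * H (s • ins k 1 y) := by
  rw [lintegral_ins k hH]
  refine Eq.trans ?_ (lintegral_lintegral_swap (f := fun (y : Fin m → ℂ) (s : ℂ) =>
    ENNReal.ofReal (‖s‖ ^ (2 * m)) * H (s • ins k 1 y)) ?_).symm
  · refine lintegral_congr_ae ?_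
    have h0 : ∀ᵐ s : ℂ, s ≠ 0 := by
      rw [ae_iff]; simp
    filter_upwards [h0] with s hs
    have hdet : LinearMap.det (s • (LinearMap.id : (Fin m → ℂ) →ₗ[ℂ] (Fin m → ℂ))) = s ^ m := by
      simp
    rw [← lintegral_comp_linear (s • (LinearMap.id : (Fin m → ℂ) →ₗ[ℂ] (Fin m → ℂ)))
      (by rw [hdet]; exact pow_ne_zero _ hs)]
    refine lintegral_congr fun y => ?_
    rw [hdet, norm_pow, ← pow_mul, mul_comm m 2, smul_ins_one]
    rfl
  · have h1 : Measurable fun x : (Fin m → ℂ) × ℂ => H (x.2 • ins k 1 x.1) :=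
      hH.comp (continuous_snd.smul ((continuous_ins k).comp
        (continuous_const.prodMk continuous_fst))).measurable
    exact ((measurable_snd.norm.pow_const _).ennreal_ofReal.mul h1).aemeasurable

end Ins

/-- The constant of the disintegration. -/
noncomputable def leafC (m : ℕ) : ℝ := ∫ s : ℂ, ‖s‖ ^ (2 * m) * Real.exp (-‖s‖ ^ 2)

lemma leafC_pos (m : ℕ) : 0 < leafC m := (integrable_gauss_moment m).2

lemma lintegral_gauss_scaled (m : ℕ) {N : ℝ} (hN : 0 < N) :
    ∫⁻ s : ℂ, ENNReal.ofReal (‖s‖ ^ (2 * m) * Real.exp (-(‖s‖ ^ 2 * N))) =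
      ENNReal.ofReal (leafC m * (N⁻¹) ^ (m + 1)) := by
  have hr : √N ≠ 0 := (Real.sqrt_pos.2 hN).ne'
  have hr2 : √N ^ 2 = N := Real.sq_sqrt hN.le
  set g : ℂ → ℝ := fun s => ‖s‖ ^ (2 * m) * Real.exp (-‖s‖ ^ 2) with hg
  have e : ∀ s : ℂ, ‖s‖ ^ (2 * m) * Real.exp (-(‖s‖ ^ 2 * N)) = (N⁻¹) ^ m * g (√N • s) := by
    intro s
    simp only [hg, norm_smul, Real.norm_of_nonneg (Real.sqrt_nonneg N), mul_pow, pow_mul, hr2]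
    rw [show N * ‖s‖ ^ 2 = ‖s‖ ^ 2 * N by ring, inv_pow]
    field_simp
  have hi : Integrable fun s : ℂ => (N⁻¹) ^ m * g (√N • s) :=
    ((integrable_gauss_moment m).1.comp_smul hr).const_mul _
  simp only [e]
  rw [← ofReal_integral_eq_lintegral_ofReal hi (Filter.Eventually.of_forall fun s => by
    simp only [hg]; positivity), integral_const_mul, Measure.integral_comp_smul]
  congr 1
  rw [Complex.finrank_real_complex, hr2, abs_of_pos (by positivity), smul_eq_mul]
  show (N⁻¹) ^ m * (N⁻¹ * leafC m) = _
  ring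

lemma tanExt_smul {n : ℕ} {E : Type*} [Zero E] (f : PTH n → E) (z v : Fin n → ℂ) {s : ℂ} (hs : s ≠ 0) :
    tanExt f (z, s • v) = tanExt f (z, v) := by
  by_cases h : (z, v) ∈ tanSet n
  · have h' : (z, s • v) ∈ tanSet n := ⟨h.1, smul_ne_zero hs h.2⟩
    refine (tanExt_of_mem f ⟨_, h'⟩).trans (Eq.trans ?_ (tanExt_of_mem f ⟨_, h⟩).symm)
    refine congrArg f (congrArg (PTH.mk _) ?_)
    exact toProj_eq_iff.2 ⟨Units.mk0 s hs, rfl⟩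
  · have h' : (z, s • v) ∉ tanSet n := fun h' => h ⟨h'.1, fun h0 => h'.2 (by
      show s • v = 0
      rw [show v = 0 from h0, smul_zero])⟩
    exact (tanExt_of_notMem f h').trans (tanExt_of_notMem f h).symm

/-- Integration over the lines in a tangent space. -/
lemma lintegral_tangent {m : ℕ} (k : Fin (m + 1)) {f : PTH (m + 1) → ENNReal} (hf : Measurable f)
    (z : Fin (m + 1) → ℂ) :
    ∫⁻ v, ENNReal.ofReal (tanDens (z, v)) * tanExt f (z, v) = ∫⁻ y : Fin m → ℂ,
      ENNReal.ofReal (leafC m * ((metricN z (ins k 1 y))⁻¹) ^ (m + 1) * jacT z ^ 2) *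
        tanExt f (z, ins k 1 y) := by
  have hmeas : Measurable fun v => ENNReal.ofReal (tanDens (z, v)) * tanExt f (z, v) :=
    ((measurable_tanDens.ennreal_ofReal).mul (measurable_tanExt hf)).comp measurable_prodMk_left
  rw [lintegral_ins_smul k hmeas]
  refine lintegral_congr fun y => ?_
  set w := ins k 1 y with hw
  have hw0 : w ≠ 0 := fun h => by
    have := congrFun h k
    simp [hw] at this
  by_cases hz : z ∈ ball (m + 1)
  · have hN := metricN_pos hz hw0
    have h1 : ∫⁻ s : ℂ, ENNReal.ofReal (‖s‖ ^ (2 * m)) *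
        (ENNReal.ofReal (tanDens (z, s • w)) * tanExt f (z, s • w)) =
        ∫⁻ s : ℂ, ENNReal.ofReal (‖s‖ ^ (2 * m) * Real.exp (-(‖s‖ ^ 2 * metricN z w))) *
          (ENNReal.ofReal (jacT z ^ 2) * tanExt f (z, w)) := by
      refine lintegral_congr_ae ?_
      have h0 : ∀ᵐ s : ℂ, s ≠ 0 := by
        rw [ae_iff]; simp
      filter_upwards [h0] with s hs
      rw [tanExt_smul f z w hs, tanDens, metricN_smul, ← mul_assoc, ← mul_assoc,
        ← ENNReal.ofReal_mul (by positivity), ← ENNReal.ofReal_mul (by positivity)]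
      congr 2
      ring
    rw [h1, lintegral_mul_const, lintegral_gauss_scaled m hN, ← mul_assoc,
      ← ENNReal.ofReal_mul (mul_nonneg (leafC_pos m).le (by positivity))]
    fun_prop
  · have h : ∀ v, tanExt f (z, v) = 0 := fun v => by
      have : (z, v) ∉ tanSet (m + 1) := fun h => hz h.1
      exact tanExt_of_notMem f this
    simp [h]

lemma measurePreserving_parComp (m : ℕ) :
    MeasurePreserving (fun u : Par m => (parComp 0 u, parComp 1 u)) := by
  let e : Fin (2 * (m + 1) - 2) ≃ Fin m ⊕ Fin m := (parEquiv m).trans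
    ((Equiv.prodCongr finTwoEquiv (Equiv.refl (Fin m))).trans (Equiv.boolProdEquivSum (Fin m)))
  have h1 := volume_measurePreserving_piCongrLeft (fun _ : Fin m ⊕ Fin m => ℂ) e
  have h2 := volume_measurePreserving_sumPiEquivProdPi (fun _ : Fin m ⊕ Fin m => ℂ)
  have h3 := h2.comp h1
  have h4 : ∀ (u : Par m) (i : Fin m ⊕ Fin m),
      MeasurableEquiv.piCongrLeft (fun _ : Fin m ⊕ Fin m => ℂ) e u i = u (e.symm i) := by
    intro u i
    have h := Equiv.piCongrLeft_apply_apply (fun _ : Fin m ⊕ Fin m => ℂ) e u (e.symm i)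
    rw [Equiv.apply_symm_apply] at h
    exact h
  have h5 : (MeasurableEquiv.sumPiEquivProdPi fun _ : Fin m ⊕ Fin m => ℂ) ∘
      (MeasurableEquiv.piCongrLeft (fun _ : Fin m ⊕ Fin m => ℂ) e) =
      fun u : Par m => (parComp 0 u, parComp 1 u) := by
    funext u
    refine Prod.ext (funext fun j => ?_) (funext fun j => ?_)
    · exact h4 u (Sum.inl j)
    · exact h4 u (Sum.inr j)
  rw [h5] at h3
  exact h3

lemma leafPt_eq_ins {m : ℕ} (k : Fin (m + 1)) (u : Par m) (t : ℂ) :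
    leafPt k u t = ins k t (parComp 0 u + t • parComp 1 u) := by
  refine eq_ins (leafPt_apply_self k u t) fun j => ?_
  simp [leafPt, leafDir]

/-- The density of the disintegration. -/
noncomputable def leafDens {m : ℕ} (x : Par m × ℂ) : ℝ :=
  metricN (leafPt 0 x.1 x.2) (leafDir 0 x.1) * (‖(gram (chartFrame 0 x.1)).det‖⁻¹) ^ (m + 2)

lemma norm_det_gram_chartFrame {m : ℕ} {u : Par m} {t : ℂ} (h : leafPt 0 u t ∈ ball (m + 1)) :
    ‖(gram (chartFrame 0 u)).det‖ = gramD (leafPt 0 u t) (leafDir 0 u) := by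
  have h1 := hh_plucker (chartFrame 0 u)
  have h2 := hh_plucker (![lift (leafPt 0 u t), vec (leafDir 0 u)] : Fin 2 → V (m + 1))
  have h3 : plucker (![lift (leafPt 0 u t), vec (leafDir 0 u)] : Fin 2 → V (m + 1)) =
      plucker (chartFrame 0 u) := by
    have : (![lift (leafPt 0 u t), vec (leafDir 0 u)] : Fin 2 → V (m + 1)) =
        comb ![![1, t], ![0, 1]] (chartFrame 0 u) := by
      funext i
      fin_cases i
      · simp [comb, lift_leafPt]
      · simp [comb, vec_leafDir]
    rw [this, plucker_comb]
    simp
  rw [h3, h1, det_gram_tangent] at h2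
  have h4 : (gram (chartFrame 0 u)).det = -(gramD (leafPt 0 u t) (leafDir 0 u) : ℂ) :=
    mul_left_cancel₀ two_ne_zero h2
  rw [h4, norm_neg, Complex.norm_real, Real.norm_of_nonneg (gramD_pos h (leafDir_ne_zero 0 u)).le]

lemma leafDens_eq {m : ℕ} {u : Par m} {t : ℂ} (h : leafPt 0 u t ∈ ball (m + 1)) :
    ((metricN (leafPt 0 u t) (leafDir 0 u))⁻¹) ^ (m + 1) * jacT (leafPt 0 u t) ^ 2 =
      leafDens (u, t) := by
  have h1 := one_sub_nsq_pos h
  have h2 := gramD_pos h (leafDir_ne_zero 0 u)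
  rw [leafDens, norm_det_gram_chartFrame h, metricN, jacT]
  set D := gramD (leafPt 0 u t) (leafDir 0 u)
  set c := 1 - nsq (leafPt 0 u t)
  rw [inv_div, div_pow, inv_pow, inv_pow, inv_pow, ← pow_mul, ← pow_mul]
  field_simp
  ring

lemma measurable_leafDens {m : ℕ} : Measurable (leafDens (m := m)) := by
  have hd : Continuous fun x : Par m × ℂ => leafDir 0 x.1 :=
    (continuous_leafDir 0).comp continuous_fst
  have hp := continuous_leafPt (m := m) 0
  have h1 : Measurable fun x : Par m × ℂ => metricN (leafPt 0 x.1 x.2) (leafDir 0 x.1) :=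
    measurable_metricN.comp
      (f := fun x : Par m × ℂ => (leafPt 0 x.1 x.2, leafDir 0 x.1)) (hp.prodMk hd).measurable
  have hn : Measurable fun x : Par m × ℂ => ‖(gram (chartFrame 0 x.1)).det‖ :=
    (continuous_det_gram_chartFrame (m := m) 0).norm.measurable.comp
      (g := fun u : Par m => ‖(gram (chartFrame 0 u)).det‖) measurable_fst
  have h2 : Measurable fun x : Par m × ℂ => ‖(gram (chartFrame 0 x.1)).det‖⁻¹ ^ (m + 2) :=
    hn.inv.pow_const _
  exact h1.mul h2

/-- The disintegration of the invariant measure along the leaves. -/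
lemma lintegral_volPT_leaf {m : ℕ} {f : PTH (m + 1) → ENNReal} (hf : Measurable f) :
    ∫⁻ p, f p ∂(volPT (m + 1)) = ∫⁻ x : Par m × ℂ, ENNReal.ofReal (leafC m * leafDens x) *
      tanExt f (leafPt 0 x.1 x.2, leafDir 0 x.1) := by
  set Φ : (Fin (m + 1) → ℂ) → (Fin m → ℂ) → ENNReal := fun z y =>
    ENNReal.ofReal (leafC m * ((metricN z (ins 0 1 y))⁻¹) ^ (m + 1) * jacT z ^ 2) *
        tanExt f (z, ins 0 1 y) with hΦ
  have hpair : Measurable fun x : (Fin (m + 1) → ℂ) × (Fin m → ℂ) => (x.1, ins 0 1 x.2) :=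
    (continuous_fst.prodMk ((continuous_ins 0).comp
      (continuous_const.prodMk continuous_snd))).measurable
  have hΦm : Measurable (Function.uncurry Φ) := by
    refine Measurable.mul (Measurable.ennreal_ofReal ?_) ((measurable_tanExt hf).comp hpair)
    exact (measurable_const.mul ((measurable_metricN.comp hpair).inv.pow_const _)).mul
      ((measurable_jacT.comp measurable_fst).pow_const 2)
  set Ψ : (Fin m → ℂ) → (Fin m → ℂ) → ℂ → ENNReal := fun x y t => Φ (ins 0 t (x + t • y)) y with hΨ
  have hΨm : Measurable fun x : ((Fin m → ℂ) × (Fin m → ℂ)) × ℂ => Ψ x.1.1 x.1.2 x.2 := by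
    refine hΦm.comp (g := Function.uncurry Φ)
      (f := fun x : ((Fin m → ℂ) × (Fin m → ℂ)) × ℂ => (ins 0 x.2 (x.1.1 + x.2 • x.1.2), x.1.2)) ?_
    refine Continuous.measurable (Continuous.prodMk ?_ (continuous_snd.comp continuous_fst))
    exact (continuous_ins 0).comp (continuous_snd.prodMk ((continuous_fst.comp continuous_fst).add
      (continuous_snd.smul (continuous_snd.comp continuous_fst))))
  calc ∫⁻ p, f p ∂(volPT (m + 1)) = ∫⁻ z, ∫⁻ y, Φ z y := by
        rw [lintegral_volPT hf]
        exact lintegral_congr fun z => lintegral_tangent 0 hf z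
    _ = ∫⁻ y, ∫⁻ z, Φ z y := lintegral_lintegral_swap hΦm.aemeasurable
    _ = ∫⁻ y, ∫⁻ t : ℂ, ∫⁻ x, Ψ x y t := by
        refine lintegral_congr fun y => ?_
        have hy : Measurable fun z => Φ z y := hΦm.of_uncurry_right
        rw [lintegral_ins 0 hy]
        refine lintegral_congr fun t => ?_
        exact (lintegral_add_right_eq_self (fun x => Φ (ins 0 t x) y) (t • y)).symm
    _ = ∫⁻ y, ∫⁻ x, ∫⁻ t : ℂ, Ψ x y t := by
        refine lintegral_congr fun y => lintegral_lintegral_swap ?_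
        exact (hΨm.comp ((measurable_snd.prodMk measurable_const).prodMk measurable_fst)).aemeasurable
    _ = ∫⁻ x : (Fin m → ℂ) × (Fin m → ℂ), ∫⁻ t : ℂ, Ψ x.1 x.2 t := by
        rw [Measure.volume_eq_prod, lintegral_prod_symm]
        exact (hΨm.lintegral_prod_right').aemeasurable
    _ = ∫⁻ u : Par m, ∫⁻ t : ℂ, Ψ (parComp 0 u) (parComp 1 u) t := by
        rw [← (measurePreserving_parComp m).lintegral_comp
          (f := fun x => ∫⁻ t : ℂ, Ψ x.1 x.2 t) hΨm.lintegral_prod_right']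
    _ = ∫⁻ x : Par m × ℂ, Ψ (parComp 0 x.1) (parComp 1 x.1) x.2 := by
        rw [Measure.volume_eq_prod, lintegral_prod]
        exact (hΨm.comp ((((parComp 0).continuous.comp continuous_fst).prodMk
          ((parComp 1).continuous.comp continuous_fst)).measurable.prodMk
          measurable_snd)).aemeasurable
    _ = _ := by
        refine lintegral_congr fun x => ?_
        obtain ⟨u, t⟩ := x
        simp only [hΨ, hΦ, ← leafPt_eq_ins]
        show ENNReal.ofReal (leafC m * ((metricN (leafPt 0 u t) (leafDir 0 u))⁻¹) ^ (m + 1) *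
          jacT (leafPt 0 u t) ^ 2) * tanExt f (leafPt 0 u t, leafDir 0 u) = _
        by_cases h : leafPt 0 u t ∈ ball (m + 1)
        · rw [mul_assoc, leafDens_eq h]
        · have h' : (leafPt 0 u t, leafDir 0 u) ∉ tanSet (m + 1) := fun h' => h h'.1
          rw [tanExt_of_notMem f h', mul_zero, mul_zero]

/-- The domain of the parametrization of the leaves. -/
def leafSet (m : ℕ) : Set (Par m × ℂ) := {x | leafPt 0 x.1 x.2 ∈ ball (m + 1)}

lemma isOpen_leafSet (m : ℕ) : IsOpen (leafSet m) :=
  (isOpen_ball _).preimage (continuous_leafPt 0)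

/-- The parametrization of the tangent lines by the leaves. -/
noncomputable def leafMap {m : ℕ} (x : leafSet m) : PTH (m + 1) := leafLine 0 x

lemma continuous_leafMap {m : ℕ} : Continuous (leafMap (m := m)) := continuous_leafLine 0

lemma tanExt_leaf {m : ℕ} {E : Type*} [Zero E] (f : PTH (m + 1) → E) (x : leafSet m) :
    tanExt f (leafPt 0 x.1.1 x.1.2, leafDir 0 x.1.1) = f (leafMap x) := by
  have h : (leafPt 0 x.1.1 x.1.2, leafDir 0 x.1.1) ∈ tanSet (m + 1) :=
    ⟨x.2, leafDir_ne_zero 0 x.1.1⟩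
  exact tanExt_of_mem f ⟨_, h⟩

lemma tanExt_leaf_of_notMem {m : ℕ} {E : Type*} [Zero E] (f : PTH (m + 1) → E) {x : Par m × ℂ}
    (hx : x ∉ leafSet m) : tanExt f (leafPt 0 x.1 x.2, leafDir 0 x.1) = 0 := by
  have h : (leafPt 0 x.1 x.2, leafDir 0 x.1) ∉ tanSet (m + 1) := fun h => hx h.1
  exact tanExt_of_notMem f h

lemma leafDens_nonneg {m : ℕ} (x : Par m × ℂ) (hx : x ∈ leafSet m) : 0 ≤ leafC m * leafDens x := by
  have h1 := leafC_pos m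
  have h2 := metricN_pos hx (leafDir_ne_zero 0 x.1)
  rw [leafDens]
  positivity

lemma volPT_eq_map_leafMap (m : ℕ) : volPT (m + 1) = Measure.map (leafMap (m := m))
    (Measure.comap (Subtype.val : leafSet m → Par m × ℂ)
      (volume.withDensity fun x => ENNReal.ofReal (leafC m * leafDens x))) := by
  have hm : Measurable fun x : Par m × ℂ => ENNReal.ofReal (leafC m * leafDens x) :=
    (measurable_const.mul measurable_leafDens).ennreal_ofReal
  have hl : Measurable (leafMap (m := m)) := continuous_leafMap.measurable
  have hS := (isOpen_leafSet m).measurableSet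
  ext s hs
  have hf : Measurable (s.indicator (1 : PTH (m + 1) → ENNReal)) := measurable_one.indicator hs
  have hf' : Measurable fun x : Par m × ℂ => tanExt (s.indicator (1 : PTH (m + 1) → ENNReal))
      (leafPt 0 x.1 x.2, leafDir 0 x.1) :=
    (measurable_tanExt hf).comp
      ((continuous_leafPt 0).prodMk ((continuous_leafDir 0).comp continuous_fst)).measurable
  rw [← lintegral_indicator_one hs, ← lintegral_indicator_one hs, lintegral_volPT_leaf hf,
    lintegral_map hf hl]
  have e : ∀ x : leafSet m, s.indicator (1 : PTH (m + 1) → ENNReal) (leafMap x) =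
    (fun x : Par m × ℂ => tanExt (s.indicator (1 : PTH (m + 1) → ENNReal))
      (leafPt 0 x.1 x.2, leafDir 0 x.1)) x.1 := fun x => (tanExt_leaf _ x).symm
  rw [lintegral_congr e, lintegral_subtype_comap hS (fun x : Par m × ℂ =>
    tanExt (s.indicator (1 : PTH (m + 1) → ENNReal)) (leafPt 0 x.1 x.2, leafDir 0 x.1)),
    setLIntegral_withDensity_eq_setLIntegral_mul _ hm hf' hS, ← lintegral_indicator hS]
  refine lintegral_congr fun x => ?_
  by_cases hx : x ∈ leafSet m
  · rw [Set.indicator_of_mem hx]; rfl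
  · rw [Set.indicator_of_notMem hx, tanExt_leaf_of_notMem _ hx, mul_zero]

lemma integral_volPT_leaf {m : ℕ} {F : PTH (m + 1) → ℝ} (hF : Measurable F)
    (hi : Integrable F (volPT (m + 1))) :
    Integrable (fun x : Par m × ℂ => leafC m * leafDens x *
      tanExt F (leafPt 0 x.1 x.2, leafDir 0 x.1)) ∧
    ∫ p, F p ∂(volPT (m + 1)) = ∫ x : Par m × ℂ, leafC m * leafDens x *
      tanExt F (leafPt 0 x.1 x.2, leafDir 0 x.1) := by
  rw [volPT_eq_map_leafMap] at hi ⊢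
  exact integral_parametrized (isOpen_leafSet m).measurableSet continuous_leafMap.measurable
    (measurable_const.mul measurable_leafDens) leafDens_nonneg hF (fun x => tanExt_leaf F x)
    (fun x hx => tanExt_leaf_of_notMem F hx) hi

end CHyp

namespace CHyp

open MeasureTheory Topology

/-! ### Integration on a quotient by means of partitions of unity -/

section Quotient

variable {G Y : Type*} [Group G] [MulAction G Y] [MeasurableSpace Y]

/-- A measurable set whose translates are disjoint. -/
structure Wandering (G : Type*) {Y : Type*} [Group G] [MulAction G Y] [MeasurableSpace Y]
    (A : Set Y) : Prop where
  measurableSet : MeasurableSet A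
  eq_one : ∀ g : G, ∀ y ∈ A, g • y ∈ A → g = 1

lemma Wandering.disjoint {A : Set Y} (hA : Wandering G A) :
    Pairwise (Function.onFun Disjoint fun g : G => (fun y : Y => g • y) ⁻¹' A) := by
  intro g g' h
  refine Set.disjoint_left.2 fun y hy hy' => h ?_
  have := hA.eq_one (g' * g⁻¹) (g • y) hy (by rwa [smul_smul, inv_mul_cancel_right])
  exact (mul_inv_eq_one.1 this).symm

lemma Wandering.measurableSet_preimage [MeasurableConstSMul G Y] {A : Set Y} (hA : Wandering G A) (g : G) :
    MeasurableSet ((fun y : Y => g • y) ⁻¹' A) := hA.measurableSet.preimage (measurable_const_smul g)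

/-- A partition of unity on the quotient, with summands carried by wandering sets, which can be
used to integrate `F`. -/
structure Partitions (G : Type*) {Y ι : Type*} [Group G] [MulAction G Y] [MeasurableSpace Y]
    (μ : Measure Y) (F : Y → ℝ) (A : ι → Set Y) (φ : ι → Y → ℝ) : Prop where
  wandering : ∀ i, Wandering G (A i)
  measurable : ∀ i, Measurable (φ i)
  invariant : ∀ i (g : G) y, φ i (g • y) = φ i y
  nonneg : ∀ i y, 0 ≤ φ i y
  le_one : ∀ i y, φ i y ≤ 1
  support : ∀ i y, (∀ g : G, g • y ∉ A i) → φ i y = 0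
  finite : {i | ∃ y, F y ≠ 0 ∧ φ i y ≠ 0}.Finite
  sum_eq_one : ∀ y, ∑ᶠ i, φ i y = 1
  integrableOn : ∀ i, IntegrableOn F (A i) μ

variable {μ : Measure Y} {ι κ : Type*} {F : Y → ℝ} {A : ι → Set Y} {φ : ι → Y → ℝ} {B : κ → Set Y}
  {ψ : κ → Y → ℝ}

lemma Partitions.sum_mul (h : Partitions G μ F A φ) (y : Y) :
    ∑ i ∈ h.finite.toFinset, φ i y * F y = F y := by
  by_cases hy : F y = 0
  · simp [hy]
  · rw [← Finset.sum_mul, ← finsum_eq_sum_of_support_subset, h.sum_eq_one, one_mul]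
    intro i hi
    rw [Set.Finite.coe_toFinset]
    exact ⟨y, hy, hi⟩

lemma Partitions.finsum_eq (h : Partitions G μ F A φ) :
    ∑ᶠ i, ∫ y in A i, φ i y * F y ∂μ = ∑ i ∈ h.finite.toFinset, ∫ y in A i, φ i y * F y ∂μ := by
  refine finsum_eq_sum_of_support_subset _ fun i hi => ?_
  rw [Set.Finite.coe_toFinset]
  by_contra hc
  refine hi ?_
  have : ∀ y, φ i y * F y = 0 := fun y => by
    by_contra h0
    exact hc ⟨y, right_ne_zero_of_mul h0, left_ne_zero_of_mul h0⟩
  simp [this]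

lemma Partitions.integrableOn_mul (h : Partitions G μ F A φ) (i : ι) {f : Y → ℝ}
    (hf : Measurable f) (h0 : ∀ y, 0 ≤ f y) (h1 : ∀ y, f y ≤ 1) :
    IntegrableOn (fun y => f y * F y) (A i) μ := by
  refine (h.integrableOn i).bdd_mul (c := 1) hf.aestronglyMeasurable
    (Filter.Eventually.of_forall fun y => ?_)
  rw [Real.norm_of_nonneg (h0 y)]
  exact h1 y

variable [Countable G] [MeasurableConstSMul G Y]

lemma Wandering.setIntegral_eq_tsum {A B : Set Y} (hA : Wandering G A) (hB : Wandering G B)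
    {F : Y → ℝ} (hFB : ∀ y, (∀ g : G, g • y ∉ B) → F y = 0) (hi : IntegrableOn F A μ) :
    ∫ y in A, F y ∂μ = ∑' g : G, ∫ y in A ∩ (fun y : Y => g • y) ⁻¹' B, F y ∂μ := by
  have hsub : (⋃ g : G, A ∩ (fun y : Y => g • y) ⁻¹' B) ⊆ A :=
    Set.iUnion_subset fun g => Set.inter_subset_left
  rw [← integral_iUnion (f := F) (μ := μ) (fun g => hA.measurableSet.inter (hB.measurableSet_preimage g))
    (fun g g' h => (hB.disjoint h).mono Set.inter_subset_right Set.inter_subset_right)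
    (hi.mono_set hsub)]
  refine setIntegral_eq_of_subset_of_forall_sdiff_eq_zero (f := F) hA.measurableSet hsub ?_
  rintro y ⟨hy, hy'⟩
  refine hFB y fun g hg => hy' (Set.mem_iUnion.2 ⟨g, hy, hg⟩)

variable [SMulInvariantMeasure G Y μ]

lemma Wandering.measure_inter_iUnion_le {A K : Set Y} (hA : Wandering G A) (hK : MeasurableSet K) :
    μ (A ∩ ⋃ g : G, (fun y : Y => g • y) ⁻¹' K) ≤ μ K := by
  rw [Set.inter_iUnion]
  calc μ (⋃ g : G, A ∩ (fun y : Y => g • y) ⁻¹' K)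
      ≤ ∑' g : G, μ (A ∩ (fun y : Y => g • y) ⁻¹' K) := measure_iUnion_le _
    _ = ∑' g : G, μ ((fun y : Y => g⁻¹ • y) ⁻¹' A ∩ K) := by
        refine tsum_congr fun g => ?_
        rw [← measure_preimage_smul μ g ((fun y : Y => g⁻¹ • y) ⁻¹' A ∩ K)]
        congr 1
        ext y
        simp
    _ = ∑' g : G, μ ((fun y : Y => g • y) ⁻¹' A ∩ K) :=
        (Equiv.inv G).tsum_eq fun g => μ ((fun y : Y => g • y) ⁻¹' A ∩ K)
    _ = μ (⋃ g : G, (fun y : Y => g • y) ⁻¹' A ∩ K) := by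
        refine (measure_iUnion (fun g g' h => ?_) fun g =>
          (hA.measurableSet_preimage g).inter hK).symm
        exact (hA.disjoint h).mono Set.inter_subset_left Set.inter_subset_left
    _ ≤ μ K := measure_mono (Set.iUnion_subset fun g => Set.inter_subset_right)

lemma Wandering.setIntegral_eq {A B : Set Y} (hA : Wandering G A) (hB : Wandering G B)
    {F : Y → ℝ} (hF : ∀ (g : G) y, F (g • y) = F y) (hFA : ∀ y, (∀ g : G, g • y ∉ A) → F y = 0)
    (hFB : ∀ y, (∀ g : G, g • y ∉ B) → F y = 0) (hiA : IntegrableOn F A μ)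
    (hiB : IntegrableOn F B μ) : ∫ y in A, F y ∂μ = ∫ y in B, F y ∂μ := by
  rw [hA.setIntegral_eq_tsum hB hFB hiA, hB.setIntegral_eq_tsum hA hFA hiB,
    ← (Equiv.inv G).tsum_eq]
  refine tsum_congr fun g => ?_
  have h := (measurePreserving_smul g μ).setIntegral_preimage_emb
    (measurableEmbedding_const_smul g) F (A ∩ (fun y : Y => g⁻¹ • y) ⁻¹' B)
  simp only [hF] at h
  rw [Equiv.inv_apply, ← h]
  congr 2
  ext y
  simp [and_comm]

/-- The integral over the quotient does not depend on the partition of unity. -/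
lemma Partitions.integral_eq (h : Partitions G μ F A φ) (h' : Partitions G μ F B ψ)
    (hF : ∀ (g : G) y, F (g • y) = F y) :
    ∑ᶠ i, ∫ y in A i, φ i y * F y ∂μ = ∑ᶠ j, ∫ y in B j, ψ j y * F y ∂μ := by
  have hm : ∀ i j, Measurable fun y => φ i y * ψ j y := fun i j =>
    (h.measurable i).mul (h'.measurable j)
  have h0 : ∀ i j y, 0 ≤ φ i y * ψ j y := fun i j y => mul_nonneg (h.nonneg i y) (h'.nonneg j y)
  have h1 : ∀ i j y, φ i y * ψ j y ≤ 1 := fun i j y =>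
    mul_le_one₀ (h.le_one i y) (h'.nonneg j y) (h'.le_one j y)
  have hA : ∀ i, ∫ y in A i, φ i y * F y ∂μ =
      ∑ j ∈ h'.finite.toFinset, ∫ y in A i, φ i y * ψ j y * F y ∂μ := by
    intro i
    rw [← integral_finsetSum _ fun j _ => h.integrableOn_mul i (hm i j) (h0 i j) (h1 i j)]
    refine integral_congr_ae (Filter.Eventually.of_forall fun y => ?_)
    simp only [mul_assoc, ← Finset.mul_sum, h'.sum_mul]
  have hB : ∀ j, ∫ y in B j, ψ j y * F y ∂μ =
      ∑ i ∈ h.finite.toFinset, ∫ y in B j, φ i y * ψ j y * F y ∂μ := by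
    intro j
    rw [← integral_finsetSum _ fun i _ => h'.integrableOn_mul j (hm i j) (h0 i j) (h1 i j)]
    refine integral_congr_ae (Filter.Eventually.of_forall fun y => ?_)
    simp only [mul_comm (φ _ y) (ψ j y), mul_assoc, ← Finset.mul_sum, h.sum_mul]
  rw [h.finsum_eq, h'.finsum_eq, Finset.sum_congr rfl fun i _ => hA i,
    Finset.sum_congr rfl fun j _ => hB j, Finset.sum_comm]
  refine Finset.sum_congr rfl fun j _ => Finset.sum_congr rfl fun i _ => ?_
  refine (h.wandering i).setIntegral_eq (h'.wandering j) (fun g y => ?_) (fun y hy => ?_)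
    (fun y hy => ?_) (h.integrableOn_mul i (hm i j) (h0 i j) (h1 i j))
    (h'.integrableOn_mul j (hm i j) (h0 i j) (h1 i j))
  · rw [h.invariant, h'.invariant, hF]
  · rw [h.support i y hy, zero_mul, zero_mul]
  · rw [h'.support j y hy, mul_zero, zero_mul]

end Quotient

end CHyp

namespace CHyp

open MeasureTheory Topology

/-! ### The function on `PT_X` defined by a 2-form on `X` -/

lemma alt_smul_line {E : Type*} [AddCommGroup E] [Module ℂ E] [Module ℝ E] [IsScalarTower ℝ ℂ E]
    (α : E [⋀^Fin 2]→ₗ[ℝ] ℝ) (v : E) (c : ℂ) :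
    α ![c • v, Complex.I • (c • v)] = ‖c‖ ^ 2 * α ![v, Complex.I • v] := by
  rw [smul_smul, alt_complex_line, Complex.sq_norm, Complex.normSq_apply]
  simp

section Form

variable {n : ℕ} {Γ : Subgroup (SU n)}

/-- The value of a 2-form on complex lines, relative to the Kähler metric. -/
noncomputable def XForm.onLines (β : XForm Γ) (p : PTH n) : ℝ :=
  β.toFun p.pt.1 ![p.dir.rep, Complex.I • p.dir.rep] / metricN p.pt.1 p.dir.rep

lemma XForm.onLines_tanLine (β : XForm Γ) (x : Hn n × NZ n) :
    β.onLines (tanLine x) = β.toFun x.1.1 ![x.2.1, Complex.I • x.2.1] / metricN x.1.1 x.2.1 := by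
  obtain ⟨z, v⟩ := x
  set l := toProj v with hl
  have h : toProj ⟨l.rep, l.rep_nonzero⟩ = toProj v := l.mk_rep.trans hl
  obtain ⟨a, ha⟩ := toProj_eq_iff.1 h
  have ha' : l.rep = (a : ℂ) • v.1 := ha.symm
  show β.toFun z.1 ![l.rep, Complex.I • l.rep] / metricN z.1 l.rep = _
  have h1 := alt_smul_line (β.toFun z.1).toAlternatingMap v.1 (a : ℂ)
  have h2 : β.toFun z.1 ![(a : ℂ) • v.1, Complex.I • ((a : ℂ) • v.1)] =
    ‖(a : ℂ)‖ ^ 2 * β.toFun z.1 ![v.1, Complex.I • v.1] := h1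
  rw [ha', h2, metricN_smul]
  have : ‖(a : ℂ)‖ ^ 2 ≠ 0 := by simp
  exact mul_div_mul_left _ _ this

lemma XForm.onLines_smul (β : XForm Γ) (γ : Γ) (p : PTH n) : β.onLines (γ • p) = β.onLines p := by
  obtain ⟨x, rfl⟩ := (isOpenQuotientMap_tanLine n).surjective p
  have h : γ • tanLine x = tanLine (γ.1 • x.1, ⟨fderiv ℂ (mob γ.1) x.1.1 x.2.1,
      fderiv_mob_ne_zero γ.1 x.1.2 x.2.2⟩) := rfl
  rw [h, onLines_tanLine, onLines_tanLine]
  have h1 : metricN (mob γ.1 x.1.1) (fderiv ℂ (mob γ.1) x.1.1 x.2.1) = metricN x.1.1 x.2.1 :=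
    metricN_mob γ.1 x.1.2 x.2.1
  have h2 := β.invariant γ.1 γ.2 x.1.1 x.1.2
  have h3 : fderiv ℝ (mob γ.1) x.1.1 = (fderiv ℂ (mob γ.1) x.1.1).restrictScalars ℝ :=
    (differentiableAt_mob γ.1 x.1.2).fderiv_restrictScalars ℝ
  have h4 : β.toFun (mob γ.1 x.1.1) ![fderiv ℂ (mob γ.1) x.1.1 x.2.1,
      Complex.I • fderiv ℂ (mob γ.1) x.1.1 x.2.1] = β.toFun x.1.1 ![x.2.1, Complex.I • x.2.1] := by
    rw [← h2, ContinuousAlternatingMap.compContinuousLinearMap_apply, h3]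
    congr 1
    funext i
    fin_cases i <;> simp
  show β.toFun (mob γ.1 x.1.1) ![fderiv ℂ (mob γ.1) x.1.1 x.2.1,
      Complex.I • fderiv ℂ (mob γ.1) x.1.1 x.2.1] /
    metricN (mob γ.1 x.1.1) (fderiv ℂ (mob γ.1) x.1.1 x.2.1) = _
  rw [h1, h4]

lemma XForm.continuous_onLines (β : XForm Γ) : Continuous β.onLines := by
  rw [(isOpenQuotientMap_tanLine n).isQuotientMap.continuous_iff]
  have e : β.onLines ∘ tanLine = fun x : Hn n × NZ n =>
      β.toFun x.1.1 ![x.2.1, Complex.I • x.2.1] / metricN x.1.1 x.2.1 :=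
    funext β.onLines_tanLine
  rw [e]
  have hβ : Continuous fun x : Hn n × NZ n => β.toFun x.1.1 :=
    (continuousOn_iff_continuous_domRestrict.1 β.smooth.continuousOn).comp continuous_fst
  have hz : Continuous fun x : Hn n × NZ n => x.1.1 := continuous_subtype_val.comp continuous_fst
  have hv : Continuous fun x : Hn n × NZ n => x.2.1 := continuous_subtype_val.comp continuous_snd
  have hvv : Continuous fun x : Hn n × NZ n => ![x.2.1, Complex.I • x.2.1] := by
    refine continuous_pi fun i => ?_
    fin_cases i
    · exact hv
    · exact hv.const_smul Complex.I
  have hev : Continuous fun x : Hn n × NZ n => β.toFun x.1.1 ![x.2.1, Complex.I • x.2.1] :=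
    hβ.eval hvv
  refine hev.div ?_ fun x => (metricN_pos x.1.2 x.2.2).ne'
  have hg : Continuous fun x : Hn n × NZ n => gramD x.1.1 x.2.1 :=
    continuous_gramD.comp (f := fun x : Hn n × NZ n => (x.1.1, x.2.1)) (hz.prodMk hv)
  have hq : Continuous fun x : Hn n × NZ n => 1 - nsq x.1.1 :=
    continuous_const.sub (continuous_nsq.comp hz)
  refine hg.div (hq.pow 2) fun x => ?_
  exact pow_ne_zero 2 (one_sub_nsq_pos x.1.2).ne'

lemma XForm.exists_compact_lift {β : XForm Γ} (h : β.CompactlySupported) :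
    ∃ K : Set (Hn n), IsCompact K ∧ ∀ z : Hn n, β.toFun z.1 ≠ 0 → ∃ γ : Γ, γ • z ∈ K := by
  choose K hK hzK using fun z : Hn n => exists_compact_mem_nhds z
  obtain ⟨t, ht⟩ := h.elim_finite_subcover (fun z => projX Γ '' interior (K z))
    (fun z => (isOpenQuotientMap_projX Γ).isOpenMap _ isOpen_interior) (fun x _ => by
      obtain ⟨z, rfl⟩ := (isOpenQuotientMap_projX Γ).surjective x
      exact Set.mem_iUnion.2 ⟨z, z, mem_interior_iff_mem_nhds.2 (hzK z), rfl⟩)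
  refine ⟨⋃ z ∈ t, K z, t.isCompact_biUnion fun z _ => hK z, fun z hz => ?_⟩
  have h1 := ht (subset_closure ⟨z, hz, rfl⟩)
  simp only [Set.mem_iUnion] at h1
  obtain ⟨w, hw, z', hz', e⟩ := h1
  obtain ⟨γ, hγ⟩ := projX_eq_iff.1 e
  exact ⟨γ, Set.mem_biUnion hw (by rw [hγ]; exact interior_subset hz')⟩

lemma isCompact_preimage_pt {K : Set (Hn n)} (hK : IsCompact K) : IsCompact (PTH.pt ⁻¹' K) := by
  have h := ((pthHomeo n).isCompact_preimage (s := K ×ˢ Set.univ)).2 (hK.prod isCompact_univ)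
  convert h using 1
  ext p
  exact ⟨fun h => ⟨h, trivial⟩, fun h => h.1⟩

lemma XForm.onLines_eq_zero {β : XForm Γ} {p : PTH n} (h : β.toFun p.pt.1 = 0) :
    β.onLines p = 0 := by
  simp [onLines, h]

lemma XForm.exists_onLines_bound {β : XForm Γ} (h : β.CompactlySupported) :
    ∃ M, ∀ p, ‖β.onLines p‖ ≤ M := by
  obtain ⟨K, hK, hβ⟩ := exists_compact_lift h
  obtain ⟨M, hM⟩ := (isCompact_preimage_pt hK).exists_bound_of_continuousOn
    β.continuous_onLines.continuousOn
  refine ⟨max M 0, fun p => ?_⟩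
  by_cases h0 : β.toFun p.pt.1 = 0
  · rw [onLines_eq_zero h0, norm_zero]; exact le_max_right _ _
  · obtain ⟨γ, hγ⟩ := hβ _ h0
    rw [← β.onLines_smul γ p]
    exact (hM _ hγ).trans (le_max_left _ _)

variable [DiscreteTopology Γ]

lemma XForm.integrableOn_onLines {β : XForm Γ} (h : β.CompactlySupported) {A : Set (PTH n)}
    (hA : Wandering Γ A) : IntegrableOn β.onLines A (volPT n) := by
  obtain ⟨K, hK, hβ⟩ := exists_compact_lift h
  obtain ⟨M, hM⟩ := exists_onLines_bound h
  have hKm : MeasurableSet (PTH.pt ⁻¹' K) := (isCompact_preimage_pt hK).isClosed.measurableSet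
  have hfin : volPT n (A ∩ ⋃ γ : Γ, (fun p : PTH n => γ • p) ⁻¹' (PTH.pt ⁻¹' K)) < ⊤ :=
    (hA.measure_inter_iUnion_le hKm).trans_lt (volPT_preimage_lt_top hK)
  refine (Measure.integrableOn_of_bounded hfin.ne
    β.continuous_onLines.measurable.aestronglyMeasurable (M := M)
    (Filter.Eventually.of_forall hM)).of_forall_sdiff_eq_zero hA.measurableSet ?_
  rintro p ⟨hp, hp'⟩
  refine onLines_eq_zero (by_contra fun h0 => hp' ⟨hp, ?_⟩)
  obtain ⟨γ, hγ⟩ := hβ _ h0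
  exact Set.mem_iUnion.2 ⟨γ, hγ⟩

lemma wandering_of_injOn (hΓ : TorsionFree Γ) {A : Set (PTH n)} (hA : IsOpen A)
    (hi : Set.InjOn (projPT Γ) A) : Wandering Γ A := by
  refine ⟨hA.measurableSet, fun γ p hp hp' => ?_⟩
  have h : γ • p = p := hi hp' hp (projPT_eq_iff.2 ⟨γ, rfl⟩)
  exact eq_one_of_smul_eq hΓ (z := p.pt) (congrArg PTH.pt h)

lemma XPartition.partitions (hΓ : TorsionFree Γ) (P : XPartition Γ) {β : XForm Γ}
    (h : β.CompactlySupported) : Partitions Γ (volPT n) β.onLines (fun i => PTH.pt ⁻¹' P.U i)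
      (fun i p => P.χ i (projX Γ p.pt)) := by
  have hw : ∀ i, Wandering Γ (PTH.pt ⁻¹' P.U i) := fun i => by
    refine ⟨((P.isOpen_U i).preimage (continuous_pt n)).measurableSet, fun γ p hp hp' => ?_⟩
    exact eq_one_of_smul_eq hΓ (z := p.pt) (P.injOn i hp' hp (projX_eq_iff.2 ⟨γ, rfl⟩))
  refine ⟨hw, fun i => ?_, fun i γ p => ?_, fun i p => P.χ.nonneg i _, fun i p => P.χ.le_one i _,
    fun i p hp => ?_, ?_, fun p => P.χ.sum_eq_one trivial, fun i => β.integrableOn_onLines h (hw i)⟩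
  · exact ((P.χ i).continuous.comp ((isOpenQuotientMap_projX Γ).continuous.comp
      (continuous_pt n))).measurable
  · exact congrArg (P.χ i) (projX_eq_iff.2 ⟨γ, rfl⟩)
  · by_contra h0
    obtain ⟨z, hz, e⟩ := P.subordinate i (subset_tsupport _ h0)
    obtain ⟨γ, hγ⟩ := projX_eq_iff.1 e
    exact hp γ (show γ • p.pt ∈ P.U i by rw [hγ]; exact hz)
  · obtain ⟨K, hK, hβ⟩ := XForm.exists_compact_lift h
    refine (P.χ.locallyFinite.finite_nonempty_inter_compact
      (hK.image (isOpenQuotientMap_projX Γ).continuous)).subset ?_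
    rintro i ⟨p, hp, hp'⟩
    obtain ⟨γ, hγ⟩ := hβ p.pt fun h0 => hp (XForm.onLines_eq_zero h0)
    exact ⟨projX Γ p.pt, hp', γ • p.pt, hγ, projX_eq_iff.2 ⟨γ, rfl⟩⟩

lemma PTPartition.partitions (hΓ : TorsionFree Γ) (P : PTPartition Γ) {β : XForm Γ}
    (h : β.CompactlySupported) : Partitions Γ (volPT n) β.onLines (fun i => (P.U i).carrier)
      (fun i p => P.χ i (projPT Γ p)) := by
  have hw : ∀ i, Wandering Γ (P.U i).carrier := fun i =>
    wandering_of_injOn hΓ (P.U i).isOpen_carrier (P.U i).injOn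
  refine ⟨hw, fun i => ?_, fun i γ p => ?_, fun i p => P.χ.nonneg i _, fun i p => P.χ.le_one i _,
    fun i p hp => ?_, ?_, fun p => P.χ.sum_eq_one trivial, fun i => β.integrableOn_onLines h (hw i)⟩
  · exact ((P.χ i).continuous.comp (isOpenQuotientMap_projPT Γ).continuous).measurable
  · exact congrArg (P.χ i) (projPT_eq_iff.2 ⟨γ, rfl⟩)
  · by_contra h0
    obtain ⟨p', hp', e⟩ := P.subordinate i (subset_tsupport _ h0)
    obtain ⟨γ, hγ⟩ := projPT_eq_iff.1 e
    exact hp γ (by rw [hγ]; exact hp')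
  · obtain ⟨K, hK, hβ⟩ := XForm.exists_compact_lift h
    refine (P.χ.locallyFinite.finite_nonempty_inter_compact
      ((isCompact_preimage_pt hK).image (isOpenQuotientMap_projPT Γ).continuous)).subset ?_
    rintro i ⟨p, hp, hp'⟩
    obtain ⟨γ, hγ⟩ := hβ p.pt fun h0 => hp (XForm.onLines_eq_zero h0)
    exact ⟨projPT Γ p, hp', γ • p, hγ, projPT_eq_iff.2 ⟨γ, rfl⟩⟩

end Form

end CHyp

namespace CHyp

open MeasureTheory Topology

/-! ### Comparison of the integrals on `X`, on `PT_X` and along the leaves -/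

section Compare

variable {m : ℕ} {Γ : Subgroup (SU (m + 1))}

lemma tanExt_indicator_pt (U : Set (Hn (m + 1))) (χ : Hn (m + 1) → ℝ) (β : XForm Γ)
    (z : Hn (m + 1)) (v : Fin (m + 1) → ℂ) :
    tanExt ((PTH.pt ⁻¹' U).indicator fun p => χ p.pt * β.onLines p) (z.1, v) =
      U.indicator χ z * (β.toFun z.1 ![v, Complex.I • v] / metricN z.1 v) := by
  by_cases hv : v = 0
  · have h1 : (z.1, v) ∉ tanSet (m + 1) := fun h => h.2 hv
    have h2 : β.toFun z.1 ![v, Complex.I • v] = 0 := (β.toFun z.1).map_coord_zero 0 hv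
    rw [h2, zero_div, mul_zero]
    exact tanExt_of_notMem _ h1
  · have h1 : (z.1, v) ∈ tanSet (m + 1) := ⟨z.2, hv⟩
    refine (tanExt_of_mem _ ⟨_, h1⟩).trans ?_
    rw [← β.onLines_tanLine (z, ⟨v, hv⟩)]
    by_cases hz : z ∈ U
    · have h2 : tanMap ⟨(z.1, v), h1⟩ ∈ PTH.pt ⁻¹' U := hz
      rw [Set.indicator_of_mem h2, Set.indicator_of_mem hz]
      rfl
    · have h2 : tanMap ⟨(z.1, v), h1⟩ ∉ PTH.pt ⁻¹' U := hz
      rw [Set.indicator_of_notMem h2, Set.indicator_of_notMem hz, zero_mul]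

/-- Integration over the fibers of `PT_X → X`. -/
lemma setIntegral_preimage_pt {U : Set (Hn (m + 1))} (hU : MeasurableSet U) {χ : Hn (m + 1) → ℝ}
    (hχ : Measurable χ) (β : XForm Γ)
    (hi : IntegrableOn (fun p => χ p.pt * β.onLines p) (PTH.pt ⁻¹' U) (volPT (m + 1))) :
    ∫ p in PTH.pt ⁻¹' U, χ p.pt * β.onLines p ∂(volPT (m + 1)) =
      gaussK (m + 1) 0 / (m.factorial * 4 ^ m) *
        ∫ z in U, χ z * β.wedgeKahler z ∂(Measure.comap Subtype.val volume) := by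
  have hUm : MeasurableSet (PTH.pt ⁻¹' U) := hU.preimage (continuous_pt _).measurable
  have hF : Measurable ((PTH.pt ⁻¹' U).indicator fun p => χ p.pt * β.onLines p) :=
    ((hχ.comp (continuous_pt _).measurable).mul β.continuous_onLines.measurable).indicator hUm
  obtain ⟨h1, h2⟩ := integral_volPT hF (hi.integrable_indicator hUm)
  rw [← integral_indicator hUm, h2, ← integral_indicator hU, ← integral_const_mul]
  rw [Measure.volume_eq_prod] at h1 ⊢
  rw [integral_prod _ h1]
  have h3 : ∀ z ∉ ball (m + 1), ∫ v, tanDens (z, v) *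
      tanExt ((PTH.pt ⁻¹' U).indicator fun p => χ p.pt * β.onLines p) (z, v) = 0 := by
    intro z hz
    have h4 : ∀ v, (z, v) ∉ tanSet (m + 1) := fun v h => hz h.1
    simp only [tanExt_of_notMem _ (h4 _), mul_zero, integral_zero]
  rw [← setIntegral_eq_integral_of_forall_compl_eq_zero h3,
    ← integral_subtype_comap (isOpen_ball _).measurableSet (fun z => ∫ v, tanDens (z, v) *
      tanExt ((PTH.pt ⁻¹' U).indicator fun p => χ p.pt * β.onLines p) (z, v))]
  refine integral_congr_ae (Filter.Eventually.of_forall fun z => ?_)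
  simp only [tanExt_indicator_pt U χ β z]
  have h5 : ∀ v, tanDens (z.1, v) * (U.indicator χ z * (β.toFun z.1 ![v, Complex.I • v] /
      metricN z.1 v)) = U.indicator χ z * (tanDens (z.1, v) * (β.toFun z.1 ![v, Complex.I • v] /
      metricN z.1 v)) := fun v => by ring
  simp only [h5]
  rw [integral_const_mul, integral_tanDens_form z.2]
  by_cases hz : z ∈ U
  · rw [Set.indicator_of_mem hz, Set.indicator_of_mem hz, XForm.wedgeKahler]
    ring
  · rw [Set.indicator_of_notMem hz, Set.indicator_of_notMem hz]
    ring

/-- An affine change of variable in `ℂ`. -/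
lemma integral_comp_affine (t₀ c : ℂ) (hc : c ≠ 0) (f : ℂ → ℝ) :
    ∫ t, ‖c‖ ^ 2 * f (t₀ + t * c) = ∫ t, f t := by
  set B : ℂ →L[ℝ] ℂ := ContinuousLinearMap.mul ℝ ℂ c with hB
  have hdet : |B.det| = ‖c‖ ^ 2 := by
    have h : B.det = Algebra.norm ℝ c := rfl
    rw [h, Algebra.norm_complex_apply, Complex.sq_norm, abs_of_nonneg (Complex.normSq_nonneg c)]
  have h := integral_image_eq_integral_abs_det_fderiv_smul volume MeasurableSet.univ
    (f := fun t => t₀ + B t) (f' := fun _ => B)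
    (fun x _ => ((B.hasFDerivAt).const_add t₀).hasFDerivWithinAt)
    (fun x _ y _ h => mul_left_cancel₀ hc (add_left_cancel h)) f
  have h' : (fun t => t₀ + B t) '' Set.univ = Set.univ := by
    rw [Set.image_univ]
    refine Set.range_eq_univ.2 fun w => ⟨(w - t₀) / c, ?_⟩
    show t₀ + c * ((w - t₀) / c) = w
    field_simp
    ring
  rw [h', hdet, setIntegral_univ, setIntegral_univ] at h
  rw [h]
  refine integral_congr_ae (Filter.Eventually.of_forall fun t => ?_)
  show _ = ‖c‖ ^ 2 * f (t₀ + c * t)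
  rw [mul_comm c t]

/-- The value at a point of a leaf of the function to be integrated along it. -/
noncomputable def leafFun (S : Set (PTH (m + 1))) (φ : PTH (m + 1) → ℝ) (β : XForm Γ) (u : Par m)
    (t : ℂ) : ℝ :=
  metricN (leafPt 0 u t) (leafDir 0 u) *
    tanExt (S.indicator fun p => φ p * β.onLines p) (leafPt 0 u t, leafDir 0 u)

lemma leafIntegral_eq (S : Set (PTH (m + 1))) (φ : PTH (m + 1) → ℝ) (β : XForm Γ)
    {p : PTH (m + 1)} {u : (chart (m := m) 0).dom} (h : toGeodesic p = chartMap 0 u) :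
    leafIntegral S φ β.pullPT p = ∫ t, leafFun S φ β u.1 t := by
  obtain ⟨h1, c, hc, h2⟩ := eq_of_toGeodesic_eq h
  rw [← integral_comp_affine (p.pt.1 0) c hc, leafIntegral]
  refine integral_congr_ae (Filter.Eventually.of_forall fun t => ?_)
  have hpt : p.pt.1 + t • p.dir.rep = leafPt 0 u.1 (p.pt.1 0 + t * c) := by
    conv_lhs => rw [h1, h2]
    simp only [leafPt, add_smul, mul_smul, add_assoc]
  have hd := leafDir_ne_zero 0 u.1
  simp only [leafFun]
  by_cases hb : p.pt.1 + t • p.dir.rep ∈ ball (m + 1)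
  · have hb' := hb
    rw [hpt] at hb'
    have hx : (leafPt 0 u.1 (p.pt.1 0 + t * c), leafDir 0 u.1) ∈ tanSet (m + 1) := ⟨hb', hd⟩
    have hp : (⟨⟨p.pt.1 + t • p.dir.rep, hb⟩, p.dir⟩ : PTH (m + 1)) = tanMap ⟨_, hx⟩ := by
      refine congrArg₂ PTH.mk (Subtype.ext hpt) ?_
      have : p.dir = toProj ⟨p.dir.rep, p.dir.rep_nonzero⟩ := p.dir.mk_rep.symm
      rw [this]
      exact toProj_eq_iff.2 ⟨Units.mk0 c hc, h2.symm⟩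
    have hT := tanExt_of_mem (S.indicator fun p => φ p * β.onLines p) ⟨_, hx⟩
    have hα : β.pullPT ⟨⟨p.pt.1 + t • p.dir.rep, hb⟩, p.dir⟩
        ![(p.dir.rep, 0), (Complex.I • p.dir.rep, 0)] =
        ‖c‖ ^ 2 * β.toFun (leafPt 0 u.1 (p.pt.1 0 + t * c)) ![leafDir 0 u.1,
          Complex.I • leafDir 0 u.1] := by
      have h3 := alt_smul_line (β.toFun (p.pt.1 + t • p.dir.rep)).toAlternatingMap (leafDir 0 u.1) c
      rw [← h2] at h3
      rw [← hpt]
      refine Eq.trans ?_ h3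
      show β.toFun (p.pt.1 + t • p.dir.rep) _ = β.toFun (p.pt.1 + t • p.dir.rep) _
      congr 1
      funext i
      fin_cases i <;> rfl
    rw [dif_pos hb, hT, hα, hp]
    by_cases hS : tanMap ⟨_, hx⟩ ∈ S
    · rw [if_pos hS, Set.indicator_of_mem hS]
      have hN := (metricN_pos hb' hd).ne'
      have ho : β.onLines (tanMap ⟨_, hx⟩) = _ := β.onLines_tanLine (⟨_, hb'⟩, ⟨_, hd⟩)
      rw [ho]
      field_simp
    · rw [if_neg hS, Set.indicator_of_notMem hS, mul_zero, mul_zero]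
  · have hb' := hb
    rw [hpt] at hb'
    have hx : (leafPt 0 u.1 (p.pt.1 0 + t * c), leafDir 0 u.1) ∉ tanSet (m + 1) := fun h => hb' h.1
    rw [dif_neg hb, tanExt_of_notMem _ hx, mul_zero, mul_zero]

lemma leafFun_eq_zero_of_notMem_plaques (U : RegularOpen Γ) (φ : PTH (m + 1) → ℝ) (β : XForm Γ)
    {u : (chart (m := m) 0).dom} (h : chartMap 0 u ∉ U.plaques) (t : ℂ) :
    leafFun U.carrier φ β u.1 t = 0 := by
  by_cases hb : leafPt 0 u.1 t ∈ ball (m + 1)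
  · have h1 : leafMap ⟨(u.1, t), hb⟩ ∉ U.carrier := fun h1 => h ⟨_, h1, toGeodesic_leafLine 0 _⟩
    have h2 := tanExt_leaf (U.carrier.indicator fun p => φ p * β.onLines p) ⟨(u.1, t), hb⟩
    rw [Set.indicator_of_notMem h1] at h2
    rw [leafFun, h2, mul_zero]
  · have h2 := tanExt_leaf_of_notMem (U.carrier.indicator fun p => φ p * β.onLines p)
      (x := (u.1, t)) hb
    rw [leafFun, h2, mul_zero]

lemma indicator_plaqueIntegral (U : RegularOpen Γ) (φ : PTH (m + 1) → ℝ) (β : XForm Γ)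
    (u : (chart (m := m) 0).dom) :
    U.plaques.indicator (U.plaqueIntegral φ β.pullPT) (chartMap 0 u) =
      ∫ t, leafFun U.carrier φ β u.1 t := by
  by_cases h : chartMap 0 u ∈ U.plaques
  · have h' : ∃ p ∈ U.carrier, toGeodesic p = chartMap 0 u := h
    rw [Set.indicator_of_mem h, RegularOpen.plaqueIntegral, dif_pos h']
    exact leafIntegral_eq _ _ _ h'.choose_spec.2
  · rw [Set.indicator_of_notMem h]
    simp [leafFun_eq_zero_of_notMem_plaques U φ β h]

lemma integral_leafFun_of_notMem_dom (S : Set (PTH (m + 1))) (φ : PTH (m + 1) → ℝ) (β : XForm Γ)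
    {u : Par m} (h : u ∉ (chart (m := m) 0).dom) : ∫ t, leafFun S φ β u t = 0 := by
  have h1 : ∀ t, leafFun S φ β u t = 0 := fun t => by
    have h2 := tanExt_leaf_of_notMem (S.indicator fun p => φ p * β.onLines p)
      (x := (u, t)) fun hb => h (mem_dom_of_leafPt_mem hb)
    rw [leafFun, h2, mul_zero]
  simp [h1]

lemma setIntegral_carrier (U : RegularOpen Γ) {φ : PTH (m + 1) → ℝ} (hφ : Measurable φ)
    (β : XForm Γ)
    (hi : IntegrableOn (fun p => φ p * β.onLines p) U.carrier (volPT (m + 1))) :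
    ∫ p in U.carrier, φ p * β.onLines p ∂(volPT (m + 1)) =
      leafC m * ∫ u : Par m, (‖(gram (chartFrame 0 u)).det‖⁻¹) ^ (m + 2) *
        ∫ t, leafFun U.carrier φ β u t := by
  have hUm := U.isOpen_carrier.measurableSet
  have hF : Measurable (U.carrier.indicator fun p => φ p * β.onLines p) :=
    (hφ.mul β.continuous_onLines.measurable).indicator hUm
  obtain ⟨h1, h2⟩ := integral_volPT_leaf hF (hi.integrable_indicator hUm)
  rw [← integral_indicator hUm, h2, ← integral_const_mul]
  rw [Measure.volume_eq_prod] at h1 ⊢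
  rw [integral_prod _ h1]
  refine integral_congr_ae (Filter.Eventually.of_forall fun u => ?_)
  simp only
  rw [← integral_const_mul, ← integral_const_mul]
  refine integral_congr_ae (Filter.Eventually.of_forall fun t => ?_)
  simp only [leafDens, leafFun]
  ring

lemma measurable_rho : Measurable (rho (m := m) 0) := by
  have hn : Measurable fun u : Par m => ‖(gram (chartFrame 0 u)).det‖ :=
    (continuous_det_gram_chartFrame (m := m) 0).norm.measurable
  exact (hn.inv.pow_const _).const_mul _

/-- Integration over the space of plaques. -/
lemma setIntegral_plaques (U : RegularOpen Γ) {a : ℝ} (ha : 0 < a) {φ : PTH (m + 1) → ℝ}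
    (hφ : Measurable φ) (β : XForm Γ)
    (hi : IntegrableOn (fun p => φ p * β.onLines p) U.carrier (volPT (m + 1))) :
    leafC m * ∫ W in U.plaques, U.plaqueIntegral φ β.pullPT W ∂(transverse Γ (geoVol m a) U) =
      a * (2 * (m + 1) - 2).factorial *
        ∫ p in U.carrier, φ p * β.onLines p ∂(volPT (m + 1)) := by
  have hP : MeasurableSet U.plaques := (isOpenMap_toGeodesic m _ U.isOpen_carrier).measurableSet
  have hd : MeasurableSet (chart (m := m) 0).dom := (chart 0).isOpen_dom.measurableSet
  rw [setIntegral_carrier U hφ β hi, transverse, Measure.restrict_restrict hP, Set.inter_self,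
    ← integral_indicator hP, geoVol,
    (isOpenEmbedding_chartMap 0).measurableEmbedding.integral_map]
  simp only [indicator_plaqueIntegral]
  have h0 : ∀ u ∉ (chart (m := m) 0).dom, ∫ t, leafFun U.carrier φ β u t = 0 :=
    fun u hu => integral_leafFun_of_notMem_dom U.carrier φ β hu
  rw [integral_subtype_comap hd (fun u => ∫ t, leafFun U.carrier φ β u t),
    setIntegral_eq_integral_of_forall_compl_eq_zero h0,
    integral_withDensity_eq_integral_toReal_smul (measurable_rho.const_mul a).ennreal_ofReal
      (Filter.Eventually.of_forall fun u => ENNReal.ofReal_lt_top)]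
  rw [mul_left_comm (a * _) (leafC m), ← integral_const_mul (a * _)]
  refine congrArg (leafC m * ·) (integral_congr_ae ?_)
  refine Filter.Eventually.of_forall fun u => ?_
  have h0 : 0 ≤ a * rho (m := m) 0 u := mul_nonneg ha.le (by rw [rho]; positivity)
  simp only [ENNReal.toReal_ofReal h0, smul_eq_mul]
  rw [rho]
  ring

end Compare

end CHyp

namespace CHyp

open MeasureTheory Topology

section Current

variable {m : ℕ} {Γ : Subgroup (SU (m + 1))} [DiscreteTopology Γ]

/-- The integral over the projective space of a tangent space of the ratio of a 2-form and the
metric, relative to the wedge product of this form with the powers of the Kähler form. -/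
noncomputable def fiberC (m : ℕ) : ℝ := gaussK (m + 1) 0 / (m.factorial * 4 ^ m)

lemma fiberC_pos (m : ℕ) : 0 < fiberC m := by
  have := gaussK_pos (n := m + 1) 0
  rw [fiberC]
  positivity

lemma XPartition.finsum_eq (hΓ : TorsionFree Γ) (P : XPartition Γ) {β : XForm Γ}
    (h : β.CompactlySupported) :
    ∑ᶠ i, ∫ p in PTH.pt ⁻¹' P.U i, P.χ i (projX Γ p.pt) * β.onLines p ∂(volPT (m + 1)) =
      fiberC m * P.integral β.wedgeKahler := by
  have hP := P.partitions hΓ h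
  rw [XPartition.integral, ← smul_eq_mul, smul_finsum]
  refine finsum_congr fun i => ?_
  have hχ : Measurable fun z => P.χ i (projX Γ z) :=
    ((P.χ i).continuous.comp (isOpenQuotientMap_projX Γ).continuous).measurable
  exact setIntegral_preimage_pt (P.isOpen_U i).measurableSet hχ β
    (hP.integrableOn_mul i (hP.measurable i) (hP.nonneg i) (hP.le_one i))

lemma PTPartition.finsum_eq (hΓ : TorsionFree Γ) (P : PTPartition Γ) {β : XForm Γ}
    (h : β.CompactlySupported) {a : ℝ} (ha : 0 < a) :
    leafC m * P.current (transverse Γ (geoVol m a)) β.pullPT = a * (2 * (m + 1) - 2).factorial *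
      ∑ᶠ i, ∫ p in (P.U i).carrier, P.χ i (projPT Γ p) * β.onLines p ∂(volPT (m + 1)) := by
  have hP := P.partitions hΓ h
  rw [PTPartition.current, ← smul_eq_mul, smul_finsum, ← smul_eq_mul (a := a * _), smul_finsum]
  refine finsum_congr fun i => ?_
  exact setIntegral_plaques (P.U i) ha (hP.measurable i) β
    (hP.integrableOn_mul i (hP.measurable i) (hP.nonneg i) (hP.le_one i))

/-- The normalization of the invariant measure on the space of complex geodesics. -/
noncomputable def normC (m : ℕ) : ℝ :=
  leafC m / ((2 * (m + 1) - 2).factorial * fiberC m * (m + 1).factorial)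

lemma normC_pos (m : ℕ) : 0 < normC m := by
  have h1 := leafC_pos m
  have h2 := fiberC_pos m
  rw [normC]
  positivity

lemma PTPartition.current_eq (hΓ : TorsionFree Γ) (P : XPartition Γ) (Q : PTPartition Γ)
    {β : XForm Γ} (h : β.CompactlySupported) :
    Q.current (transverse Γ (geoVol m (normC m))) β.pullPT =
      1 / ((m + 1).factorial : ℝ) * P.integral β.wedgeKahler := by
  have h1 := P.finsum_eq hΓ h
  have h2 := Q.finsum_eq hΓ h (normC_pos m)
  rw [← (P.partitions hΓ h).integral_eq (Q.partitions hΓ h) β.onLines_smul, h1] at h2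
  have h3 := (leafC_pos m).ne'
  have h4 := (fiberC_pos m).ne'
  refine mul_left_cancel₀ h3 (h2.trans ?_)
  rw [normC]
  field_simp

lemma XPartition.integral_eq (hΓ : TorsionFree Γ) (P P' : XPartition Γ) {β : XForm Γ}
    (h : β.CompactlySupported) : P.integral β.wedgeKahler = P'.integral β.wedgeKahler := by
  have h1 := P.finsum_eq hΓ h
  rw [(P.partitions hΓ h).integral_eq (P'.partitions hΓ h) β.onLines_smul,
    P'.finsum_eq hΓ h] at h1
  exact (mul_left_cancel₀ (fiberC_pos m).ne' h1).symm

end Current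

end CHyp

theorem proposition3p1 (n : ℕ) (hn : 2 ≤ n) :
    ∃ ω : CHyp.GeoForm n, ω.Invariant ∧ ω.PseudoKahler ∧ ω.Indefinite ∧
      (∀ ω' : CHyp.GeoForm n, ω'.Invariant → ω'.PseudoKahler →
        ∃ c : ℝ, c ≠ 0 ∧ ω' = fun W => c • ω W) ∧
      ∃ a : ℝ, 0 < a ∧ ∃ μ : MeasureTheory.Measure (CHyp.Geodesic n),
        CHyp.IsVolumeMeasure ω a μ ∧
        (∀ g : CHyp.SU n, μ.map (fun W => g • W) = μ) ∧
        ∀ Γ : Subgroup (CHyp.SU n), DiscreteTopology Γ → CHyp.TorsionFree Γ →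
          CHyp.IsInvariantTransverseMeasure Γ (CHyp.transverse Γ μ) ∧
          (∀ (U : CHyp.RegularOpen Γ) (W : CHyp.Geodesic n), CHyp.transverse Γ μ U {W} = 0) ∧
          ∀ β : CHyp.XForm Γ, β.CompactlySupported →
            ∃ I : ℝ, CHyp.HasXIntegral Γ β.wedgeKahler I ∧
              CHyp.HasCurrent Γ (CHyp.transverse Γ μ) β.pullPT (1 / (n.factorial : ℝ) * I) := by
  obtain ⟨m, rfl⟩ : ∃ m, n = m + 1 := ⟨n - 1, by omega⟩
  have hm : 0 < m := by omega
  refine ⟨CHyp.geoOmega (m + 1), CHyp.geoOmega_invariant _, CHyp.geoOmega_pseudoKahler ⟨0, hm⟩,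
    CHyp.geoOmega_indefinite ⟨0, hm⟩, fun _ => CHyp.geoOmega_unique ⟨0, hm⟩, CHyp.normC m,
    CHyp.normC_pos m, CHyp.geoVol m (CHyp.normC m),
    CHyp.isVolumeMeasure_geoVol m (CHyp.normC_pos m), CHyp.map_geoVol (CHyp.normC_pos m), ?_⟩
  intro Γ _ hΓ
  refine ⟨CHyp.isInvariantTransverseMeasure_geoVol (CHyp.normC_pos m) Γ, fun U W => ?_,
    fun β hβ => ?_⟩
  · refine le_antisymm ((MeasureTheory.Measure.restrict_apply_le _ _).trans_eq ?_) bot_le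
    exact CHyp.geoVol_singleton hm (CHyp.normC_pos m) W
  · obtain ⟨P⟩ := CHyp.nonempty_XPartition hΓ
    exact ⟨P.integral β.wedgeKahler,
      ⟨⟨P⟩, fun P' => CHyp.XPartition.integral_eq hΓ P' P hβ⟩,
      ⟨CHyp.nonempty_PTPartition hΓ, fun Q => CHyp.PTPartition.current_eq hΓ P Q hβ⟩⟩
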